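/- Let $\Omega\subset\mathbb C$ be a domain enclosed by a Weil–Petersson curve $\Gamma=\partial\Omega$, i.e. $\Omega$ is a quasidisk (the image of the unit disk $\mathbb D$ under a quasiconformal map of $\mathbb C$) and some biholomorphic map $f_0:\mathbb D\to\Omega$ satisfies $\int_{\mathbb D}|f_0''/f_0'|^2<\infty$. A uniformization of $\Omega$ is a biholomorphic map $f:\mathbb D\to\Omega$. Let $\tau=i\nu$ be the unit tangent field of $\Gamma$, where $\nu$ is the outward normal. For $a\in\Omega$, let $u:\Omega\setminus\{a\}\to\mathbb S^1$ be the canonical harmonic map of degree $1$ with data $(\tau,a)$. This means that $u\in H^1_{loc}(\overline\Omega\setminus\{a\})$, $\deg(u,a)=1$, $u=\tau$ on $\Gamma$ in the sense of traces (after pulling back by a uniformization; $\tau\circ f\in H^{1/2}(\mathbb S^1,\mathbb S^1)$ has degree $1$), and $\langle du,iu\rangle=\star d\Phi$ with $\star dx=dy$, $\star dy=-dx$. Here $\Phi=\tilde\Phi\circ f^{-1}$ for a uniformization $f$ with $f(0)=a$, and $\tilde\Phi$ is a weak solution in $W^{1,1}(\mathbb D)$ of the Neumann problem $$\Delta\tilde\Phi=2\pi\delta_0\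 \text{ in }\mathbb D,\qquad \partial_r\tilde\Phi=\langle\partial_\theta(\tau\circ f),\,i\,(\tau\circ f)\rangle\ \text{ on }\mathbb S^1 .$$ The renormalized energy is $$W(a)=\lim_{\delta\to0}\Big(\int_{\Omega\setminus\mathbb D_\delta(a)}|\nabla u|^2-2\pi\ln\frac1\delta\Big),$$ where $\mathbb D_\delta(a)$ is the disk of radius $\delta$ centred at $a$. Then there is a real constant $W_0$ depending only on $\Omega$ such that, for every $a\in\Omega$ and every uniformization $f:\mathbb D\to\Omega$ with $f(0)=a$, the integral $\int_{\mathbb D}|f''/f'|^2$ is finite, $$W_0=\int_{\mathbb D}\Big|\frac{f''}{f'}\Big|^2+4\pi\ln|f'(0)|,$$ the canonical harmonic map with data $(\tau,a)$ exists, the limit defining $W(a)$ exists, and $$W(a)=W_0-2\pi\ln|f'(0)|.$$ -/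

import Mathlib

open MeasureTheory Filter Topology Complex
open scoped ContDiff

noncomputable section

/-- `Du` is the weak (distributional) differential of `u` on the open set `U ⊆ ℂ`:
`∫ (∂_v φ) u = - ∫ φ Du(v)` for all test functions `φ ∈ C_c^∞(U)` and all directions `v`. -/
structure HasWeakDeriv {E : Type*} [NormedAddCommGroup E] [NormedSpace ℝ E]
    (U : Set ℂ) (u : ℂ → E) (Du : ℂ → ℂ →L[ℝ] E) : Prop where
  locallyIntegrableOn : LocallyIntegrableOn u U
  locallyIntegrableOn_deriv : LocallyIntegrableOn Du U
  integral_eq : ∀ φ : ℂ → ℝ, ContDiff ℝ ∞ φ → HasCompactSupport φ → tsupport φ ⊆ U → ∀ v : ℂ,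
    ∫ z, (fderiv ℝ φ z v) • u z = - ∫ z, φ z • Du z v

/-- The squared Euclidean norm `|∂ₓu|² + |∂ᵧu|²` of the gradient at a point. -/
def gradSq {E : Type*} [NormedAddCommGroup E] [NormedSpace ℝ E] (L : ℂ →L[ℝ] E) : ℝ :=
  ‖L 1‖ ^ 2 + ‖L I‖ ^ 2

/-- `h : ℂ → ℂ` is a `K`-quasiconformal map of the plane: a homeomorphism in `H¹_loc` with
`|∂h/∂z̄| ≤ (K-1)/(K+1) |∂h/∂z|` almost everywhere. -/
def IsQuasiconformal (K : ℝ) (h : ℂ ≃ₜ ℂ) : Prop :=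
  1 ≤ K ∧ ∃ Dh : ℂ → ℂ →L[ℝ] ℂ, HasWeakDeriv Set.univ h Dh ∧
    LocallyIntegrable (fun z => gradSq (Dh z)) ∧
    ∀ᵐ z, ‖(Dh z 1 + I * Dh z I) / 2‖ ≤ (K - 1) / (K + 1) * ‖(Dh z 1 - I * Dh z I) / 2‖

/-- A quasidisk is the image of the open unit disk under a quasiconformal map of the plane;
its boundary is a quasicircle, and the quasidisk is the domain enclosed by it. -/
def IsQuasidisk (Ω : Set ℂ) : Prop :=
  ∃ (K : ℝ) (h : ℂ ≃ₜ ℂ), IsQuasiconformal K h ∧ h '' Metric.ball 0 1 = Ω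

/-- `f` restricts to a biholomorphic map from the open unit disk onto `Ω`. -/
structure IsUniformization (f : ℂ → ℂ) (Ω : Set ℂ) : Prop where
  differentiableOn : DifferentiableOn ℂ f (Metric.ball 0 1)
  bijOn : Set.BijOn f (Metric.ball 0 1) Ω

/-- The density `|f''/f'|²`. -/
def preSchwarzianSq (f : ℂ → ℂ) (z : ℂ) : ℝ := ‖deriv (deriv f) z / deriv f z‖ ^ 2

/-- `Ω` is a domain enclosed by a Weil–Petersson curve: `∂Ω` is a quasicircle and some
uniformization `f` of `Ω` satisfies `∫_𝔻 |f''/f'|² < ∞`. -/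
def IsWeilPeterssonDomain (Ω : Set ℂ) : Prop :=
  IsQuasidisk Ω ∧ ∃ f : ℂ → ℂ, IsUniformization f Ω ∧
    IntegrableOn (preSchwarzianSq f) (Metric.ball 0 1)

/-- The Euclidean inner product of `ℂ = ℝ²`. -/
def dot (z w : ℂ) : ℝ := z.re * w.re + z.im * w.im

/-- The unit vector `ν` is the outward-pointing normal of `Ω` at `x`: close to `x`, every cone
around `-ν` of half-aperture less than `π/2` lies in `Ω`, and every such cone around `ν` lies
outside `closure Ω`. In particular `x ∈ ∂Ω`, and `∂Ω` has at `x` the tangent line orthogonal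
to `ν`. -/
structure IsOutwardNormal (Ω : Set ℂ) (x ν : ℂ) : Prop where
  norm_eq : ‖ν‖ = 1
  inner_cone : ∀ c > 0, ∀ᶠ w in 𝓝[≠] (0 : ℂ), dot w ν ≤ -(c * ‖w‖) → x + w ∈ Ω
  outer_cone : ∀ c > 0, ∀ᶠ w in 𝓝[≠] (0 : ℂ), c * ‖w‖ ≤ dot w ν → x + w ∉ closure Ω

/-- The outward normal at a point is unique if it exists. -/
theorem IsOutwardNormal.unique {Ω : Set ℂ} {x ν ν' : ℂ} (h : IsOutwardNormal Ω x ν)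
    (h' : IsOutwardNormal Ω x ν') : ν = ν' := by
  by_contra hne
  have e1 : dot ν ν = 1 := by
    have := h.norm_eq
    rw [← sq_eq_sq₀ (norm_nonneg _) zero_le_one, Complex.sq_norm, Complex.normSq_apply] at this
    simpa [dot] using this
  have e2 : dot ν' ν' = 1 := by
    have := h'.norm_eq
    rw [← sq_eq_sq₀ (norm_nonneg _) zero_le_one, Complex.sq_norm, Complex.normSq_apply] at this
    simpa [dot] using this
  have hd : ν' - ν ≠ 0 := sub_ne_zero.2 (Ne.symm hne)
  have hp : 0 < ‖ν' - ν‖ := norm_pos_iff.2 hd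
  have e3 : ‖ν' - ν‖ ^ 2 = 2 - 2 * dot ν ν' := by
    rw [Complex.sq_norm, Complex.normSq_apply]
    simp only [dot, Complex.sub_re, Complex.sub_im] at *
    linarith
  have ht : Tendsto (fun t : ℝ => (t : ℂ) * (ν' - ν)) (𝓝[>] 0) (𝓝[≠] 0) := by
    refine tendsto_nhdsWithin_iff.2 ⟨?_, ?_⟩
    · have : Tendsto (fun t : ℝ => (t : ℂ) * (ν' - ν)) (𝓝 0) (𝓝 (((0 : ℝ) : ℂ) * (ν' - ν))) :=
        ((Complex.continuous_ofReal.mul continuous_const).tendsto 0)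
      simpa using this.mono_left nhdsWithin_le_nhds
    · filter_upwards [self_mem_nhdsWithin] with t ht
      exact mul_ne_zero (Complex.ofReal_ne_zero.2 (ne_of_gt ht)) hd
  have hc : 0 < ‖ν' - ν‖ / 2 := by positivity
  obtain ⟨t, ⟨h1, h2⟩, h0⟩ := ((ht.eventually ((h.inner_cone _ hc).and
    (h'.outer_cone _ hc))).and self_mem_nhdsWithin).exists
  have h0 : 0 < t := h0
  have hn : ‖(t : ℂ) * (ν' - ν)‖ = t * ‖ν' - ν‖ := by
    rw [norm_mul, Complex.norm_real, Real.norm_of_nonneg h0.le]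
  have d1 : dot ((t : ℂ) * (ν' - ν)) ν = -(‖ν' - ν‖ / 2 * ‖(t : ℂ) * (ν' - ν)‖) := by
    have : ‖ν' - ν‖ / 2 * (t * ‖ν' - ν‖) = t * (1 - dot ν ν') := by linear_combination t / 2 * e3
    rw [hn, this]
    simp only [dot, Complex.re_ofReal_mul, Complex.im_ofReal_mul, Complex.sub_re,
      Complex.sub_im] at *
    linear_combination (-t) * e1
  have d2 : dot ((t : ℂ) * (ν' - ν)) ν' = ‖ν' - ν‖ / 2 * ‖(t : ℂ) * (ν' - ν)‖ := by
    have : ‖ν' - ν‖ / 2 * (t * ‖ν' - ν‖) = t * (1 - dot ν ν') := by linear_combination t / 2 * e3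
    rw [hn, this]
    simp only [dot, Complex.re_ofReal_mul, Complex.im_ofReal_mul, Complex.sub_re,
      Complex.sub_im] at *
    linear_combination t * e2
  exact h2 d2.ge (subset_closure (h1 d1.le))

open Classical in
/-- The unit tangent field `τ` of `∂Ω` for which `(ν, τ)` is a direct frame, `ν` being the
outward normal: `τ = i ν` (and the value `0` at boundary points without normal). -/
def unitTangent (Ω : Set ℂ) (x : ℂ) : ℂ :=
  if h : ∃ ν, IsOutwardNormal Ω x ν then I * h.choose else 0

/-- The point `e^{iθ}` of the unit circle. -/
def circlePt (θ : ℝ) : ℂ := exp (θ * I)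

/-- The boundary function `θ ↦ g(f(e^{iθ}))`, where `f` is extended to the unit circle by
`f(ζ) = lim_{z → ζ, z ∈ 𝔻} f(z)`. -/
def boundaryPullback (f g : ℂ → ℂ) (θ : ℝ) : ℂ :=
  g (extendFrom (Metric.ball 0 1) f (circlePt θ))

/-- The function `e^{iθ} ↦ h θ` (for `0 < θ ≤ 2π`) belongs to `H^{1/2}` of the unit circle. -/
def MemHHalf {E : Type*} [NormedAddCommGroup E] (h : ℝ → E) : Prop :=
  MemLp h 2 (volume.restrict (Set.Ioc 0 (2 * Real.pi))) ∧
  ∫⁻ s in Set.Ioc 0 (2 * Real.pi), ∫⁻ t in Set.Ioc 0 (2 * Real.pi),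
    ENNReal.ofReal ((‖h s - h t‖ / ‖circlePt s - circlePt t‖) ^ 2) < ⊤

/-- `φ ∈ H^{1/2}(𝕊¹, ℝ)` is a phase of the circle-valued `h`, with winding `n`:
`h(e^{iθ}) = e^{inθ} e^{iφ(θ)}` almost everywhere. By definition `h` then has degree `n`. -/
def IsPhase (n : ℤ) (h : ℝ → ℂ) (φ : ℝ → ℝ) : Prop :=
  MemHHalf φ ∧ ∀ᵐ θ ∂(volume.restrict (Set.Ioc 0 (2 * Real.pi))),
    h θ = circlePt θ ^ n * exp (φ θ * I)

/-- The trace on the unit circle of the function `w` on `𝔻 \ {0}`, with weak differential `Dw`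
integrable away from `0`, is `h`: Green's formula
`∫_𝔻 (∂_v ψ) w + ψ ∂_v w = ∫_{𝕊¹} ψ ⟨v, e^{iθ}⟩ h dθ` for all smooth `ψ` vanishing near `0`. -/
def HasCircleTrace (w : ℂ → ℂ) (Dw : ℂ → ℂ →L[ℝ] ℂ) (h : ℝ → ℂ) : Prop :=
  ∀ ψ : ℂ → ℝ, ContDiff ℝ ∞ ψ → (0 : ℂ) ∉ tsupport ψ → ∀ v : ℂ,
    ∫ z in Metric.ball 0 1, ((fderiv ℝ ψ z v) • w z + ψ z • Dw z v) =
      ∫ θ in (0 : ℝ)..(2 * Real.pi), (ψ (circlePt θ) * dot v (circlePt θ)) • h θ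

/-- `Φ ∈ W^{1,1}(𝔻)`, with differential `DΦ`, is a weak solution of the Neumann problem
`ΔΦ = 2π δ₀` in `𝔻`, `∂_r Φ = ⟨∂_θ h, i h⟩ = 1 + ∂_θ φ` on `𝕊¹`, where `h = e^{iθ} e^{iφ}`:
`∫_𝔻 ∇Φ · ∇ψ = ∫_{𝕊¹} ψ dθ - ∫_{𝕊¹} φ ∂_θ ψ dθ - 2π ψ(0)` for all smooth `ψ`. -/
structure IsNeumannSolution (φ : ℝ → ℝ) (Φ : ℂ → ℝ) (DΦ : ℂ → ℂ →L[ℝ] ℝ) : Prop where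
  weakDeriv : HasWeakDeriv (Metric.ball 0 1) Φ DΦ
  integrableOn : IntegrableOn Φ (Metric.ball 0 1)
  integrableOn_deriv : IntegrableOn DΦ (Metric.ball 0 1)
  integral_eq : ∀ ψ : ℂ → ℝ, ContDiff ℝ ∞ ψ →
    ∫ z in Metric.ball 0 1, (DΦ z 1 * fderiv ℝ ψ z 1 + DΦ z I * fderiv ℝ ψ z I) =
      (∫ θ in (0 : ℝ)..(2 * Real.pi), ψ (circlePt θ))
        - (∫ θ in (0 : ℝ)..(2 * Real.pi), φ θ * deriv (fun t : ℝ => ψ (circlePt t)) θ)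
        - 2 * Real.pi * ψ 0

/-- The chain rule `D(u ∘ f)(z) v = Du(f z)(f'(z) v)` for holomorphic `f`. -/
def pullbackDeriv (f : ℂ → ℂ) (Du : ℂ → ℂ →L[ℝ] ℂ) (z : ℂ) : ℂ →L[ℝ] ℂ :=
  (Du (f z)).comp (ContinuousLinearMap.mul ℝ ℂ (deriv f z))

/-- The form `⟨du, i u⟩`, evaluated at the tangent vector whose image under `du` is `w`. -/
def angularPart (u w : ℂ) : ℝ := dot w (I * u)

/-- `u`, with weak differential `Du`, is the canonical harmonic map `Ω \ {a} → 𝕊¹` of degree `1`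
with boundary data `g ∈ H^{1/2}(∂Ω, 𝕊¹)`, `deg g = 1`. -/
structure IsCanonicalHarmonicMap (Ω : Set ℂ) (a : ℂ) (g : ℂ → ℂ)
    (u : ℂ → ℂ) (Du : ℂ → ℂ →L[ℝ] ℂ) : Prop where
  /-- `u` has values in the unit circle. -/
  norm_eq : ∀ᵐ z ∂(volume.restrict Ω), ‖u z‖ = 1
  /-- `u ∈ H¹_loc(closure Ω \ {a})` (first part: weak differentiability). -/
  weakDeriv : HasWeakDeriv (Ω \ {a}) u Du
  /-- `u ∈ H¹_loc(closure Ω \ {a})` (second part: `∇u` is square integrable up to `∂Ω`). -/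
  integrableOn_gradSq : ∀ δ > 0, IntegrableOn (fun z => gradSq (Du z)) (Ω \ Metric.ball a δ)
  /-- `deg(u, a) = 1`: the degree `(1/2π) ∫ u ∧ ∂_θ u dθ` on almost every small circle about `a`
  equals `1`. -/
  degree_eq : ∀ᵐ r : ℝ, 0 < r → Metric.closedBall a r ⊆ Ω →
    ∫ θ in (0 : ℝ)..(2 * Real.pi), angularPart (u (a + r * circlePt θ))
      (Du (a + r * circlePt θ) (I * (r * circlePt θ))) = 2 * Real.pi
  /-- For a uniformization `f` with `f(0) = a`: `g ∘ f ∈ H^{1/2}(𝕊¹, 𝕊¹)` has degree `1`,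
  `u ∘ f = g ∘ f` on `𝕊¹`, and `⟨du, i u⟩ = ⋆dΦ` with `Φ = Φ' ∘ f⁻¹`, where `Φ'` solves the
  Neumann problem with datum `⟨∂_θ (g ∘ f), i (g ∘ f)⟩`. The last identity is written on the disk,
  where `(⋆dΦ') v = dΦ'(-i v)`, since `f` is conformal. -/
  exists_uniformization : ∃ f : ℂ → ℂ, IsUniformization f Ω ∧ f 0 = a ∧
    MemHHalf (boundaryPullback f g) ∧
    HasCircleTrace (u ∘ f) (pullbackDeriv f Du) (boundaryPullback f g) ∧
    ∃ (φ : ℝ → ℝ) (Φ' : ℂ → ℝ) (DΦ' : ℂ → ℂ →L[ℝ] ℝ),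
      IsPhase 1 (boundaryPullback f g) φ ∧ IsNeumannSolution φ Φ' DΦ' ∧
      ∀ᵐ z ∂(volume.restrict (Metric.ball 0 1)), ∀ v : ℂ,
        angularPart (u (f z)) (pullbackDeriv f Du z v) = DΦ' z (-I * v)

/-- The renormalized energy `W(a)` for the boundary data `g` is well defined and equal to `W`:
the canonical harmonic map `u` with data `(g, a)` exists, and
`∫_{Ω \ 𝔻_δ(a)} |∇u|² - 2π ln (1/δ) → W` as `δ → 0`. -/
def IsRenormalizedEnergy (Ω : Set ℂ) (g : ℂ → ℂ) (a : ℂ) (W : ℝ) : Prop :=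
  (∃ u Du, IsCanonicalHarmonicMap Ω a g u Du) ∧
  ∀ u Du, IsCanonicalHarmonicMap Ω a g u Du →
    Tendsto (fun δ : ℝ => (∫ z in Ω \ Metric.ball a δ, gradSq (Du z))
      - 2 * Real.pi * Real.log (1 / δ)) (𝓝[>] 0) (𝓝 W)

end

section
open Metric Set

/-! ### Injective holomorphic functions -/

section Injective

variable {U : Set ℂ} {f : ℂ → ℂ}

/-! Write `f' = e^p` and `Q = p' = f''/f'`; the Weil–Petersson condition says `Q ∈ L²(𝔻)`, and
everything is explicit in `p`. At almost every `ζ` of the circle the extension of `f` has derivative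
`e^{p(ζ)}`, so `τ(f(ζ)) = i ζ e^{i Im p(ζ)}` and `π/2 + Im p` is a phase of the data. As `∂_θ Im p =
∂_r Re p`, the Neumann potential is `ln|z| + Re p`, and `u ∘ f = i z e^p / |z e^p|` with `|∇(u ∘ f)|
= |1/z + Q|`. The Dirichlet energy is conformally invariant. In the expansion of `|1/z + Q|²` the
cross term `2 Re(zQ)/|z|²` integrates to zero on each circle by the mean value property, so the
energy on `ρ ≤ |z| < 1` is `2π ln(1/ρ)` plus the integral of `|Q|²` there
(`integral_annulus_energy`). The preimage of `𝔻_δ(a)` is asymptotically the disk of radius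
`δ/|f'(0)|`, whence `W(a) = ∫|Q|² + 2π ln|f'(0)|` (`tendsto_sublevel_energy`).

The constant `∫|Q|² + 4π ln|f'(0)|` does not depend on `f`: uniformizations differ by a disk
automorphism `M`, under which `Q` becomes `(Q ∘ M) M' + M''/M'`. The conjugate of `M''/M'` is a
multiple of a reproducing kernel, so the new terms in the `L²` norm are evaluated exactly and cancel
against the change of `ln|f'(0)|` (`IsUniformization.weilPetersson_invariant`).

Boundary geometry rests on the fact that a holomorphic `Q ∈ L²` satisfies `(1 - |z|)|Q(z)| → 0`
uniformly. At scale `d` from a boundary point, `f` is then affine up to a small relative error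
(`norm_sub_affine_le`). Hence `f` extends continuously to the closed disk, is injective on the
circle at a uniform scale, and has a boundary derivative wherever `p` has a radial limit, which is
almost everywhere. A winding number argument makes the injectivity global
(`injOn_sphere_of_locally_ne`); the quasidisk hypothesis enters through the homeomorphism of the
plane that it provides. Normals then exist almost everywhere
(`IsDirichletConformal.isOutwardNormal`), and a Douglas-type estimate puts the boundary values of
`p` in `H^{1/2}`.

The limit has to be found for every canonical map, not only for the explicit one. The condition `|u|
= 1` makes `du` tangential, so `|∇u|` is determined by `⟨du, iu⟩ = ⋆dΦ`. Two phases differ by `2π`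
times an integer-valued `H^{1/2}` function, hence by a constant (`MemHHalf.ae_eq_const_of_int`), and
the weak Neumann problem in `W^{1,1}` determines `dΦ` because all moments of the difference of two
solutions vanish (`HasWeakDeriv.ae_eq_zero_of_neumann`). -/

theorem not_eventually_eq_of_injOn (hU : IsOpen U) (hi : InjOn f U) {z : ℂ} (hz : z ∈ U) :
    ¬ ∀ᶠ w in 𝓝 z, f w = f z := by
  intro h
  have h2 : ∀ᶠ w in 𝓝[≠] z, f w = f z ∧ w ∈ U :=
    (h.and (hU.mem_nhds hz)).filter_mono nhdsWithin_le_nhds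
  obtain ⟨w, ⟨hw, hwU⟩, hne⟩ := (h2.and self_mem_nhdsWithin).exists
  exact hne (hi hwU hz hw)

theorem nhds_le_map_of_injOn (hU : IsOpen U) (hf : DifferentiableOn ℂ f U) (hi : InjOn f U)
    {z : ℂ} (hz : z ∈ U) : 𝓝 (f z) ≤ map f (𝓝 z) :=
  ((hf.analyticOnNhd hU z hz).eventually_constant_or_nhds_le_map_nhds).resolve_left
    (not_eventually_eq_of_injOn hU hi hz)

theorem isOpen_image_of_injOn (hU : IsOpen U) (hf : DifferentiableOn ℂ f U) (hi : InjOn f U) :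
    IsOpen (f '' U) := by
  rw [isOpen_iff_mem_nhds]
  rintro _ ⟨z, hz, rfl⟩
  exact nhds_le_map_of_injOn hU hf hi hz (image_mem_map (hU.mem_nhds hz))

theorem continuousAt_invFunOn (hU : IsOpen U) (hf : DifferentiableOn ℂ f U) (hi : InjOn f U)
    {z : ℂ} (hz : z ∈ U) : ContinuousAt (Function.invFunOn f U) (f z) := by
  have hl : ∀ w ∈ U, Function.invFunOn f U (f w) = w := fun w hw => hi.leftInvOn_invFunOn hw
  rw [ContinuousAt, hl z hz]
  refine Tendsto.mono_left ?_ (nhds_le_map_of_injOn hU hf hi hz)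
  rw [tendsto_map'_iff]
  refine tendsto_id.congr' ?_
  filter_upwards [hU.mem_nhds hz] with w hw using (hl w hw).symm

theorem hasDerivAt_invFunOn_of_ne_zero (hU : IsOpen U) (hf : DifferentiableOn ℂ f U)
    (hi : InjOn f U) {z : ℂ} (hz : z ∈ U) (h0 : deriv f z ≠ 0) :
    HasDerivAt (Function.invFunOn f U) (deriv f z)⁻¹ (f z) := by
  have hl : ∀ w ∈ U, Function.invFunOn f U (f w) = w := fun w hw => hi.leftInvOn_invFunOn hw
  refine HasDerivAt.of_local_left_inverse (f := f) (continuousAt_invFunOn hU hf hi hz) ?_ h0 ?_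
  · rw [hl z hz]
    exact (hf.differentiableAt (hU.mem_nhds hz)).hasDerivAt
  · filter_upwards [(isOpen_image_of_injOn hU hf hi).mem_nhds (mem_image_of_mem f hz)]
    rintro _ ⟨w, hw, rfl⟩
    rw [hl w hw]

/-- Zeros of `f'` are isolated, so the inverse is holomorphic on a punctured neighbourhood of `f z`.
It is continuous at `f z`, so the singularity is removable, and the chain rule for the inverse
composed with `f` excludes `f'(z) = 0`. -/
theorem deriv_ne_zero_of_injOn (hU : IsOpen U) (hf : DifferentiableOn ℂ f U) (hi : InjOn f U)
    {z : ℂ} (hz : z ∈ U) : deriv f z ≠ 0 := by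
  have hl : ∀ w ∈ U, Function.invFunOn f U (f w) = w := fun w hw => hi.leftInvOn_invFunOn hw
  have ha : AnalyticAt ℂ f z := hf.analyticOnNhd hU z hz
  have hev : ∀ᶠ w in 𝓝[≠] z, deriv f w ≠ 0 := by
    refine (ha.deriv.eventually_eq_zero_or_eventually_ne_zero).resolve_left fun h => ?_
    obtain ⟨r, hr, hb⟩ := Metric.eventually_nhds_iff_ball.1 (h.and (hU.mem_nhds hz))
    refine not_eventually_eq_of_injOn hU hi hz ?_
    filter_upwards [ball_mem_nhds z hr] with w hw
    refine (convex_ball z r).is_const_of_fderivWithin_eq_zero (𝕜 := ℂ)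
      (hf.mono fun x hx => (hb x hx).2) (fun x hx => ?_) hw (mem_ball_self hr)
    rw [fderivWithin_of_isOpen isOpen_ball hx]
    ext
    simpa using (hb x hx).1
  have hg : AnalyticAt ℂ (Function.invFunOn f U) (f z) := by
    refine analyticAt_of_differentiable_on_punctured_nhds_of_continuousAt ?_
      (continuousAt_invFunOn hU hf hi hz)
    have h1 : ∀ᶠ w in 𝓝 z, w ≠ z → DifferentiableAt ℂ (Function.invFunOn f U) (f w) := by
      filter_upwards [eventually_nhdsWithin_iff.1 hev, hU.mem_nhds hz] with w hw hwU hne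
      exact (hasDerivAt_invFunOn_of_ne_zero hU hf hi hwU (hw hne)).differentiableAt
    have h2 : ∀ᶠ y in 𝓝 (f z), y ≠ f z → DifferentiableAt ℂ (Function.invFunOn f U) y := by
      refine nhds_le_map_of_injOn hU hf hi hz ?_
      rw [mem_map]
      filter_upwards [h1] with w hw hne
      exact hw fun h => hne (by rw [h])
    exact eventually_nhdsWithin_iff.2 h2
  have hc : HasDerivAt (Function.invFunOn f U ∘ f)
      (deriv (Function.invFunOn f U) (f z) * deriv f z) z :=
    hg.differentiableAt.hasDerivAt.comp z ha.differentiableAt.hasDerivAt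
  have hid : HasDerivAt (Function.invFunOn f U ∘ f) 1 z := by
    refine (hasDerivAt_id z).congr_of_eventuallyEq ?_
    filter_upwards [hU.mem_nhds hz] with w hw using hl w hw
  intro h0
  have := hc.unique hid
  simp [h0] at this

theorem hasDerivAt_invFunOn (hU : IsOpen U) (hf : DifferentiableOn ℂ f U)
    (hi : InjOn f U) {z : ℂ} (hz : z ∈ U) :
    HasDerivAt (Function.invFunOn f U) (deriv f z)⁻¹ (f z) :=
  hasDerivAt_invFunOn_of_ne_zero hU hf hi hz (deriv_ne_zero_of_injOn hU hf hi hz)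

/-- The real Jacobian determinant of multiplication by a complex number. -/
theorem det_mul_real (c : ℂ) : (ContinuousLinearMap.mul ℝ ℂ c).det = ‖c‖ ^ 2 := by
  rw [ContinuousLinearMap.det, ← LinearMap.det_toMatrix basisOneI, Matrix.det_fin_two]
  simp [LinearMap.toMatrix_apply, Complex.sq_norm, normSq_apply]

theorem hasFDerivAt_mul_real {z c : ℂ} (h : HasDerivAt f c z) :
    HasFDerivAt f (ContinuousLinearMap.mul ℝ ℂ c) z := by
  exact (h.hasFDerivAt.restrictScalars ℝ).congr_fderiv (by ext; simp [mul_comm])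

variable {S : Set ℂ} {E : Type*} [NormedAddCommGroup E] [NormedSpace ℝ E]

theorem setIntegral_image_holomorphic (hU : IsOpen U) (hf : DifferentiableOn ℂ f U)
    (hi : InjOn f U) (hS : MeasurableSet S) (hSU : S ⊆ U) (g : ℂ → E) :
    ∫ w in f '' S, g w = ∫ z in S, ‖deriv f z‖ ^ 2 • g (f z) := by
  rw [integral_image_eq_integral_abs_det_fderiv_smul volume hS
    (fun x hx => (hasFDerivAt_mul_real (hf.differentiableAt
      (hU.mem_nhds (hSU hx))).hasDerivAt).hasFDerivWithinAt) (hi.mono hSU)]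
  simp only [det_mul_real, abs_pow, abs_norm]

theorem integrableOn_image_holomorphic (hU : IsOpen U) (hf : DifferentiableOn ℂ f U)
    (hi : InjOn f U) (hS : MeasurableSet S) (hSU : S ⊆ U) (g : ℂ → E) :
    IntegrableOn g (f '' S) ↔ IntegrableOn (fun z => ‖deriv f z‖ ^ 2 • g (f z)) S := by
  rw [integrableOn_image_iff_integrableOn_abs_det_fderiv_smul volume hS
    (fun x hx => (hasFDerivAt_mul_real (hf.differentiableAt
      (hU.mem_nhds (hSU hx))).hasDerivAt).hasFDerivWithinAt) (hi.mono hSU)]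
  simp only [det_mul_real, abs_pow, abs_norm]

end Injective

/-! ### Uniformizations -/

namespace IsUniformization

variable {f : ℂ → ℂ} {Ω : Set ℂ}

/-- The inverse of a uniformization. -/
noncomputable abbrev inv (f : ℂ → ℂ) : ℂ → ℂ := Function.invFunOn f (ball 0 1)

theorem injOn (hf : IsUniformization f Ω) : InjOn f (ball 0 1) := hf.bijOn.injOn

theorem image_eq (hf : IsUniformization f Ω) : f '' ball 0 1 = Ω := hf.bijOn.image_eq

theorem mapsTo (hf : IsUniformization f Ω) {z : ℂ} (hz : z ∈ ball (0 : ℂ) 1) : f z ∈ Ω :=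
  hf.bijOn.mapsTo hz

theorem isOpen (hf : IsUniformization f Ω) : IsOpen Ω :=
  hf.image_eq ▸ isOpen_image_of_injOn isOpen_ball hf.differentiableOn hf.injOn

theorem inv_apply (hf : IsUniformization f Ω) {z : ℂ} (hz : z ∈ ball (0 : ℂ) 1) :
    inv f (f z) = z := hf.injOn.leftInvOn_invFunOn hz

theorem inv_mem (hf : IsUniformization f Ω) {w : ℂ} (hw : w ∈ Ω) : inv f w ∈ ball (0 : ℂ) 1 :=
  Function.invFunOn_mem (by simpa using hf.bijOn.surjOn hw)

theorem apply_inv (hf : IsUniformization f Ω) {w : ℂ} (hw : w ∈ Ω) : f (inv f w) = w :=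
  Function.invFunOn_eq (by simpa using hf.bijOn.surjOn hw)

theorem hasDerivAt (hf : IsUniformization f Ω) {z : ℂ} (hz : z ∈ ball (0 : ℂ) 1) :
    HasDerivAt f (deriv f z) z :=
  (hf.differentiableOn.differentiableAt (isOpen_ball.mem_nhds hz)).hasDerivAt

theorem deriv_ne_zero (hf : IsUniformization f Ω) {z : ℂ} (hz : z ∈ ball (0 : ℂ) 1) :
    deriv f z ≠ 0 := deriv_ne_zero_of_injOn isOpen_ball hf.differentiableOn hf.injOn hz

theorem hasDerivAt_inv (hf : IsUniformization f Ω) {w : ℂ} (hw : w ∈ Ω) :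
    HasDerivAt (inv f) (deriv f (inv f w))⁻¹ w := by
  have := hasDerivAt_invFunOn isOpen_ball hf.differentiableOn hf.injOn (hf.inv_mem hw)
  rwa [hf.apply_inv hw] at this

/-- A uniformization has a holomorphic logarithm of its derivative. -/
theorem exists_log_deriv (hf : IsUniformization f Ω) :
    ∃ p : ℂ → ℂ, (∀ z ∈ ball (0 : ℂ) 1, HasDerivAt p (deriv (deriv f) z / deriv f z) z) ∧
      ∀ z ∈ ball (0 : ℂ) 1, deriv f z = exp (p z) := by
  have hd : DifferentiableOn ℂ (deriv f) (ball 0 1) := hf.differentiableOn.deriv isOpen_ball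
  obtain ⟨q, hq⟩ := ((hd.deriv isOpen_ball).div hd fun z hz => hf.deriv_ne_zero hz).isExactOn_ball
  -- The primitive `q` of `f''/f'` is a logarithm of `f'` up to a multiplicative constant, since `f'
  -- e^{-q}` has zero derivative; `c` adjusts that constant at the origin.
  obtain ⟨c, hc⟩ : ∃ c, exp c = deriv f 0 / exp (q 0) :=
    ⟨_, exp_log (div_ne_zero (hf.deriv_ne_zero (mem_ball_self one_pos)) (exp_ne_zero _))⟩
  refine ⟨fun z => q z + c, fun z hz => (hq z hz).add_const c, fun z hz => ?_⟩
  have key : ∀ w ∈ ball (0 : ℂ) 1, HasDerivAt (fun w => deriv f w * exp (-q w)) 0 w := by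
    intro w hw
    have h1 := ((hd.differentiableAt (isOpen_ball.mem_nhds hw)).hasDerivAt).mul
      ((hq w hw).neg.cexp)
    refine h1.congr_deriv ?_
    have := hf.deriv_ne_zero hw
    simp only [Pi.div_apply]
    field_simp
    ring
  have hconst : deriv f z * exp (-q z) = deriv f 0 * exp (-q 0) := by
    refine (convex_ball (0 : ℂ) 1).is_const_of_fderivWithin_eq_zero (𝕜 := ℂ)
      (f := fun w => deriv f w * exp (-q w))
      (fun w hw => (key w hw).differentiableAt.differentiableWithinAt) (fun w hw => ?_) hz
      (mem_ball_self one_pos)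
    rw [fderivWithin_of_isOpen isOpen_ball hw]
    ext
    simp [(key w hw).deriv]
  rw [exp_add, hc, div_eq_mul_inv, ← exp_neg, ← hconst, mul_comm (deriv f z), ← mul_assoc,
    ← exp_add]
  simp

end IsUniformization

end

section
open Metric Set

/-! ### Polar coordinates -/

theorem continuous_circlePt : Continuous circlePt := by
  unfold circlePt; fun_prop

@[simp] theorem norm_circlePt (θ : ℝ) : ‖circlePt θ‖ = 1 := norm_exp_ofReal_mul_I θ

theorem circlePt_add (s t : ℝ) : circlePt (s + t) = circlePt s * circlePt t := by
  simp [circlePt, add_mul, exp_add]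

theorem circlePt_add_pi (s : ℝ) : circlePt (s + Real.pi) = - circlePt s := by
  rw [circlePt_add]; simp [circlePt]

theorem circlePt_add_two_pi (s : ℝ) : circlePt (s + 2 * Real.pi) = circlePt s := by
  rw [circlePt_add]; simp [circlePt]

theorem circlePt_ne_zero (θ : ℝ) : circlePt θ ≠ 0 := exp_ne_zero _

theorem hasDerivAt_circlePt (θ : ℝ) : HasDerivAt circlePt (I * circlePt θ) θ := by
  have h : HasDerivAt (fun t : ℝ => (t : ℂ) * I) (1 * I) θ :=
    (Complex.ofRealCLM.hasDerivAt (x := θ)).mul_const I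
  exact h.cexp.congr_deriv (by simp [circlePt, mul_comm])

/-- The measure `r dr` on a set of radii. -/
noncomputable def radialMeasure (A : Set ℝ) : Measure ℝ :=
  (volume.restrict A).withDensity fun r => ENNReal.ofReal r

/-- The measure `dθ` on `(0, 2π]`. -/
noncomputable def angularMeasure : Measure ℝ := volume.restrict (Ioc 0 (2 * Real.pi))

instance (A : Set ℝ) : SFinite (radialMeasure A) := by unfold radialMeasure; infer_instance

instance : IsFiniteMeasure angularMeasure := by unfold angularMeasure; infer_instance

/-- The map `(r, θ) ↦ r e^{iθ}`. -/
noncomputable def polarMap (p : ℝ × ℝ) : ℂ := p.1 * circlePt p.2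

theorem continuous_polarMap : Continuous polarMap := by
  unfold polarMap
  have := continuous_circlePt
  fun_prop

theorem lintegral_radialMeasure {A : Set ℝ} (g : ℝ → ENNReal) (hg : AEMeasurable g (volume.restrict A)) :
    ∫⁻ r, g r ∂radialMeasure A = ∫⁻ r in A, ENNReal.ofReal r * g r := by
  rw [radialMeasure, lintegral_withDensity_eq_lintegral_mul₀ (by fun_prop) hg]
  rfl

/-- The polar chart has angles in `(-π, π)`. Translating them by `π` to `(0, 2π)` amounts to `z ↦
-z`, which preserves Lebesgue measure. -/
theorem measurePreserving_polarMap {A : Set ℝ} (hA : MeasurableSet A) (hA0 : A ⊆ Ioi 0) :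
    MeasurePreserving polarMap ((radialMeasure A).prod angularMeasure)
      (volume.restrict {z : ℂ | ‖z‖ ∈ A}) := by
  refine ⟨continuous_polarMap.measurable, ?_⟩
  have hAm : MeasurableSet {z : ℂ | ‖z‖ ∈ A} := measurable_norm hA
  ext s hs
  rw [Measure.map_apply continuous_polarMap.measurable hs, Measure.restrict_apply hs]
  set T : Set ℂ := s ∩ {z : ℂ | ‖z‖ ∈ A} with hT
  have hTm : MeasurableSet T := hs.inter hAm
  have e1 : volume T = ∫⁻ z : ℂ, T.indicator 1 (-z) := by
    rw [lintegral_neg_eq_self (fun z : ℂ => T.indicator 1 z), lintegral_indicator_one hTm]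
  have hm : Measurable fun p : ℝ × ℝ => T.indicator (1 : ℂ → ENNReal) (polarMap p) :=
    (measurable_one.indicator hTm).comp continuous_polarMap.measurable
  have hm' : Measurable fun p : ℝ × ℝ => ENNReal.ofReal p.1 * T.indicator (1 : ℂ → ENNReal)
      (polarMap p) := by
    exact (ENNReal.measurable_ofReal.comp measurable_fst).mul hm
  have hadd : Measurable fun p : ℝ × ℝ => (p.1, p.2 + Real.pi) := by fun_prop
  have e2 : volume T = ∫⁻ r in Ioi (0 : ℝ), ∫⁻ θ in Ioo (-Real.pi) Real.pi,
      ENNReal.ofReal r * T.indicator 1 (polarMap (r, θ + Real.pi)) := by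
    have h := lintegral_prod (μ := volume.restrict (Ioi (0 : ℝ)))
      (ν := volume.restrict (Ioo (-Real.pi) Real.pi))
      (fun p : ℝ × ℝ => ENNReal.ofReal p.1 * T.indicator 1 (polarMap (p.1, p.2 + Real.pi)))
      (hm'.comp hadd).aemeasurable
    rw [← h, e1, ← Complex.lintegral_comp_polarCoord_symm, polarCoord_target,
      Measure.volume_eq_prod, ← Measure.prod_restrict]
    · refine lintegral_congr fun p => ?_
      rw [smul_eq_mul, Complex.polarCoord_symm_apply, polarMap, circlePt_add_pi]
      congr 3
      simp [circlePt, exp_mul_I]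
      ring
  have e3 : volume T = ∫⁻ r in Ioi (0 : ℝ), ∫⁻ θ in Ioc 0 (2 * Real.pi),
      ENNReal.ofReal r * T.indicator 1 (polarMap (r, θ)) := by
    rw [e2]
    refine lintegral_congr fun r => ?_
    rw [← restrict_Ioo_eq_restrict_Ioc]
    have := (measurePreserving_add_right volume Real.pi).setLIntegral_comp_preimage
      (measurableSet_Ioo (a := 0) (b := 2 * Real.pi))
      (f := fun θ => ENNReal.ofReal r * T.indicator 1 (polarMap (r, θ)))
      (hm'.comp measurable_prodMk_left)
    rw [← this]
    congr 2
    ext x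
    simp only [mem_Ioo, mem_preimage]
    constructor <;> rintro ⟨h1, h2⟩ <;> constructor <;> linarith
  rw [← lintegral_indicator_one (continuous_polarMap.measurable hs), lintegral_prod _ (by
    exact (measurable_one.indicator (continuous_polarMap.measurable hs)).aemeasurable),
    lintegral_radialMeasure, e3]
  · rw [← lintegral_indicator hA, ← lintegral_indicator measurableSet_Ioi]
    refine lintegral_congr fun r => ?_
    by_cases hr0 : 0 < r
    · have hpm : ∀ θ, ‖polarMap (r, θ)‖ = r := fun θ => by
        simp [polarMap, abs_of_pos hr0]
      rw [indicator_of_mem (mem_Ioi.2 hr0)]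
      by_cases hr : r ∈ A
      · rw [indicator_of_mem hr, ← lintegral_const_mul' _ _ ENNReal.ofReal_ne_top]
        refine lintegral_congr fun θ => ?_
        congr 1
        have hiff : (r, θ) ∈ polarMap ⁻¹' s ↔ polarMap (r, θ) ∈ T := by simp [hT, hpm, hr]
        by_cases h : polarMap (r, θ) ∈ T
        · rw [indicator_of_mem h, indicator_of_mem (hiff.2 h)]; rfl
        · rw [indicator_of_notMem h, indicator_of_notMem (fun h' => h (hiff.1 h'))]
      · rw [indicator_of_notMem hr]
        have : ∀ θ, T.indicator (1 : ℂ → ENNReal) (polarMap (r, θ)) = 0 := fun θ =>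
          indicator_of_notMem (fun h => hr (by simpa [hpm] using h.2)) _
        simp [this]
    · rw [indicator_of_notMem (fun h => hr0 (hA0 h)), indicator_of_notMem (show r ∉ Ioi 0 from hr0)]
  · refine Measurable.aemeasurable ?_
    exact Measurable.lintegral_prod_right' (f := fun p : ℝ × ℝ =>
      (polarMap ⁻¹' s).indicator (1 : ℝ × ℝ → ENNReal) p)
      (measurable_one.indicator (continuous_polarMap.measurable hs))

theorem lintegral_polar {A : Set ℝ} (hA : MeasurableSet A) (hA0 : A ⊆ Ioi 0) {g : ℂ → ENNReal}
    (hg : AEMeasurable g (volume.restrict {z : ℂ | ‖z‖ ∈ A})) :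
    ∫⁻ z in {z : ℂ | ‖z‖ ∈ A}, g z =
      ∫⁻ r in A, ENNReal.ofReal r * ∫⁻ θ in Ioc 0 (2 * Real.pi), g (r * circlePt θ) := by
  have hP := measurePreserving_polarMap hA hA0
  rw [← hP.map_eq] at hg ⊢
  rw [lintegral_map' hg hP.measurable.aemeasurable, lintegral_prod (fun p => g (polarMap p)) (hg.comp_measurable hP.measurable)]
  have h2 : ∀ r : ℝ, ∫⁻ θ, g (polarMap (r, θ)) ∂angularMeasure =
    ∫⁻ θ in Ioc 0 (2 * Real.pi), g (r * circlePt θ) := fun r => rfl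
  simp_rw [h2]
  have h3 : AEMeasurable (fun r : ℝ => ∫⁻ θ in Ioc 0 (2 * Real.pi), g (r * circlePt θ))
    (radialMeasure A) := (hg.comp_measurable hP.measurable).lintegral_prod_right'
  rw [radialMeasure, lintegral_withDensity_eq_lintegral_mul₀' (by fun_prop) h3]
  rfl

section
variable {E : Type*} [NormedAddCommGroup E] [NormedSpace ℝ E]

omit [NormedSpace ℝ E] in
theorem integrable_polar {A : Set ℝ} (hA : MeasurableSet A) (hA0 : A ⊆ Ioi 0) {g : ℂ → E}
    (hg : IntegrableOn g {z : ℂ | ‖z‖ ∈ A}) :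
    Integrable (fun p : ℝ × ℝ => g (p.1 * circlePt p.2))
      ((radialMeasure A).prod angularMeasure) :=
  (measurePreserving_polarMap hA hA0).integrable_comp_of_integrable hg

theorem integrableOn_radialMeasure {A : Set ℝ} (hA : MeasurableSet A) (hA0 : A ⊆ Ioi 0) {g : ℝ → E} :
    Integrable g (radialMeasure A) ↔ IntegrableOn (fun r => r • g r) A := by
  have : radialMeasure A = (volume.restrict A).withDensity fun r => (Real.toNNReal r : ENNReal) := rfl
  rw [this, integrable_withDensity_iff_integrable_smul₀ (by fun_prop)]
  refine integrable_congr ?_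
  filter_upwards [ae_restrict_mem hA] with r hr
  rw [NNReal.smul_def, Real.coe_toNNReal _ (le_of_lt (hA0 hr))]

theorem integral_radialMeasure {A : Set ℝ} (hA : MeasurableSet A) (hA0 : A ⊆ Ioi 0) (g : ℝ → E) :
    ∫ r, g r ∂radialMeasure A = ∫ r in A, r • g r := by
  have : radialMeasure A = (volume.restrict A).withDensity fun r => (Real.toNNReal r : ENNReal) := rfl
  rw [this, integral_withDensity_eq_integral_smul (by fun_prop)]
  refine integral_congr_ae ?_
  filter_upwards [ae_restrict_mem hA] with r hr
  rw [NNReal.smul_def, Real.coe_toNNReal _ (le_of_lt (hA0 hr))]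

theorem integral_polar {A : Set ℝ} (hA : MeasurableSet A) (hA0 : A ⊆ Ioi 0) {g : ℂ → E}
    (hg : IntegrableOn g {z : ℂ | ‖z‖ ∈ A}) :
    ∫ z in {z : ℂ | ‖z‖ ∈ A}, g z =
      ∫ r in A, r • ∫ θ in (0 : ℝ)..(2 * Real.pi), g (r * circlePt θ) := by
  have hP := measurePreserving_polarMap hA hA0
  have hi := integrable_polar hA hA0 hg
  have h1 : ∫ z in {z : ℂ | ‖z‖ ∈ A}, g z = ∫ p, g (polarMap p) ∂((radialMeasure A).prod angularMeasure) := by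
    rw [← hP.map_eq, integral_map hP.measurable.aemeasurable]
    rw [hP.map_eq]; exact hg.aestronglyMeasurable
  rw [h1, integral_prod (fun p => g (polarMap p)) hi, integral_radialMeasure hA hA0]
  simp_rw [intervalIntegral.integral_of_le Real.two_pi_pos.le]
  rfl

end

theorem ball_ae_eq_annulus (R : ℝ) : (ball (0 : ℂ) R) =ᵐ[volume] {z : ℂ | ‖z‖ ∈ Ioo 0 R} := by
  have : {z : ℂ | ‖z‖ ∈ Ioo 0 R} = ball (0 : ℂ) R \ {0} := by
    ext z; simp [and_comm]
  rw [this]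
  exact (sdiff_null_ae_eq_self (measure_singleton 0)).symm

theorem restrict_ball_eq (R : ℝ) :
    (volume : Measure ℂ).restrict (ball (0 : ℂ) R) = volume.restrict {z : ℂ | ‖z‖ ∈ Ioo 0 R} :=
  Measure.restrict_congr_set (ball_ae_eq_annulus R)

theorem Ioo_subset_Ioi_zero {a b : ℝ} (ha : 0 ≤ a) : Ioo a b ⊆ Ioi 0 := fun _ hx => ha.trans_lt hx.1

end

section
open Metric Set
open scoped ComplexConjugate

/-! ### Cauchy's formula on circles and disks -/

theorem one_add_mul_ne_zero {b z : ℂ} (hb : ‖b‖ < 1) (hz : ‖z‖ ≤ 1) : 1 + b * z ≠ 0 := by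
  intro h
  have h1 : ‖b * z‖ = 1 := by
    rw [← norm_neg, ← eq_neg_of_add_eq_zero_left h, norm_one]
  rw [norm_mul] at h1
  nlinarith [norm_nonneg b, norm_nonneg z]

/-- On `|z| = r` one has `z̄ = r²/z`, so `1/(1 + b z̄) = z/(z + b r²)` and `dθ = dz/(iz)` turns the
integral into Cauchy's formula at the point `-b r²`. -/
theorem integral_circle_kernel {Q : ℂ → ℂ} (hQ : DifferentiableOn ℂ Q (ball 0 1)) {b : ℂ}
    (hb : ‖b‖ < 1) {r : ℝ} (hr : r ∈ Ioo (0 : ℝ) 1) :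
    ∫ θ in (0 : ℝ)..(2 * Real.pi), Q (r * circlePt θ) / (1 + b * conj (r * circlePt θ)) =
      2 * Real.pi * Q (-(b * r ^ 2)) := by
  have hsub : closedBall (0 : ℂ) r ⊆ ball 0 1 := closedBall_subset_ball hr.2
  have hw : -(b * (r : ℂ) ^ 2) ∈ ball (0 : ℂ) r := by
    rw [mem_ball_zero_iff, norm_neg, norm_mul, norm_pow, norm_real, Real.norm_of_nonneg hr.1.le]
    nlinarith [hr.1, hr.2, norm_nonneg b, mul_pos hr.1 hr.1]
  have hC := circleIntegral_sub_inv_smul_of_differentiable_on_off_countable (s := ∅)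
    countable_empty hw (hQ.continuousOn.mono hsub) fun x hx =>
      hQ.differentiableAt (isOpen_ball.mem_nhds (hsub (ball_subset_closedBall hx.1)))
  rw [circleIntegral] at hC
  have hI : (2 * Real.pi * I : ℂ) • Q (-(b * r ^ 2)) = I * (2 * Real.pi * Q (-(b * r ^ 2))) := by
    rw [smul_eq_mul]; ring
  rw [hI] at hC
  refine mul_left_cancel₀ I_ne_zero (Eq.trans ?_ hC)
  rw [← intervalIntegral.integral_const_mul]
  refine intervalIntegral.integral_congr fun θ _ => ?_
  have hz : circleMap 0 r θ = r * circlePt θ := by simp [circleMap, circlePt]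
  have hc : conj (circlePt θ) = (circlePt θ)⁻¹ := by
    rw [inv_def, normSq_eq_norm_sq]; simp
  have h0 := circlePt_ne_zero θ
  have hr0 : (r : ℂ) ≠ 0 := by exact_mod_cast hr.1.ne'
  have h1 : 1 + b * (r * (circlePt θ)⁻¹) ≠ 0 := by
    refine one_add_mul_ne_zero hb ?_
    rw [norm_mul, norm_inv, norm_circlePt, norm_real, Real.norm_of_nonneg hr.1.le]
    linarith [hr.2]
  have h2 : (r : ℂ) * circlePt θ - -(b * r ^ 2) ≠ 0 := by
    have : (r : ℂ) * circlePt θ - -(b * r ^ 2) =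
      r * circlePt θ * (1 + b * (r * (circlePt θ)⁻¹)) := by
        field_simp
        ring
    rw [this]
    exact mul_ne_zero (mul_ne_zero hr0 h0) h1
  simp only [deriv_circleMap, hz, map_mul, conj_ofReal, hc, smul_eq_mul]
  field_simp
  rw [sub_neg_eq_add]

theorem integral_circle_mean {Q : ℂ → ℂ} (hQ : DifferentiableOn ℂ Q (ball 0 1))
    {r : ℝ} (hr : r ∈ Ioo (0 : ℝ) 1) :
    ∫ θ in (0 : ℝ)..(2 * Real.pi), Q (r * circlePt θ) = 2 * Real.pi * Q 0 := by
  simpa using integral_circle_kernel hQ (b := 0) (by simp) hr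

/-- Reproducing property of the kernel: after the circle formula, `b · 2π r Q(-b r²)` is the
`r`-derivative of `-π q(-b r²)`, and the radial integral telescopes. -/
theorem integral_disk_kernel {q Q : ℂ → ℂ} (hq : ∀ z ∈ ball (0 : ℂ) 1, HasDerivAt q (Q z) z)
    (hQ : DifferentiableOn ℂ Q (ball 0 1)) {b : ℂ} (hb : ‖b‖ < 1)
    (hi : IntegrableOn (fun z => Q z / (1 + b * conj z)) (ball 0 1)) :
    b * ∫ z in ball (0 : ℂ) 1, Q z / (1 + b * conj z) = Real.pi * (q 0 - q (-b)) := by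
  have hi' := hi
  rw [IntegrableOn, restrict_ball_eq] at hi'
  rw [restrict_ball_eq, integral_polar measurableSet_Ioo (Ioo_subset_Ioi_zero le_rfl) hi']
  have h1 : ∫ r in Ioo (0 : ℝ) 1, r • ∫ θ in (0 : ℝ)..(2 * Real.pi),
      Q (r * circlePt θ) / (1 + b * conj (r * circlePt θ)) =
      ∫ r in (0 : ℝ)..1, r • (2 * Real.pi * Q (-(b * (r : ℂ) ^ 2))) := by
    rw [intervalIntegral.integral_of_le zero_le_one, integral_Ioc_eq_integral_Ioo]
    refine setIntegral_congr_fun measurableSet_Ioo fun r hr => ?_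
    simp only [integral_circle_kernel hQ hb hr]
  have hmem : ∀ r ∈ uIcc (0 : ℝ) 1, -(b * (r : ℂ) ^ 2) ∈ ball (0 : ℂ) 1 := fun r hr => by
    rw [uIcc_of_le zero_le_one] at hr
    rw [mem_ball_zero_iff, norm_neg, norm_mul, norm_pow, norm_real, Real.norm_of_nonneg hr.1]
    nlinarith [hr.1, hr.2, norm_nonneg b, pow_le_one₀ hr.1 hr.2 (n := 2)]
  have hd : ∀ r ∈ uIcc (0 : ℝ) 1, HasDerivAt (fun r : ℝ => -Real.pi * q (-(b * (r : ℂ) ^ 2)))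
      (b * (r • (2 * Real.pi * Q (-(b * (r : ℂ) ^ 2))))) r := fun r hr => by
    have h3 : HasDerivAt (fun r : ℝ => -(b * (r : ℂ) ^ 2)) (-(b * (2 * r))) r := by
      have h4 : HasDerivAt (fun r : ℂ => -(b * r ^ 2)) (-(b * (2 * r))) (r : ℂ) := by
        exact (((hasDerivAt_pow 2 (r : ℂ)).const_mul b).neg).congr_deriv (by simp)
      exact h4.comp_ofReal
    refine (((hq _ (hmem r hr)).scomp r h3).const_mul (-(Real.pi : ℂ))).congr_deriv ?_
    simp only [smul_eq_mul, real_smul]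
    ring
  have hc : ContinuousOn (fun r : ℝ => b * (r • (2 * Real.pi * Q (-(b * (r : ℂ) ^ 2)))))
      (uIcc (0 : ℝ) 1) := by
    have : ContinuousOn (fun r : ℝ => Q (-(b * (r : ℂ) ^ 2))) (uIcc (0 : ℝ) 1) :=
      hQ.continuousOn.comp (by fun_prop) hmem
    exact continuousOn_const.mul (continuousOn_id.smul (continuousOn_const.mul this))
  rw [h1, ← intervalIntegral.integral_const_mul,
    intervalIntegral.integral_eq_sub_of_hasDerivAt hd hc.intervalIntegrable]
  simp
  ring

/-! ### Automorphisms of the disk -/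

theorem one_add_conj_mul_ne_zero {b z : ℂ} (hb : ‖b‖ < 1) (hz : ‖z‖ < 1) : 1 + conj b * z ≠ 0 :=
  one_add_mul_ne_zero (by simpa using hb) hz.le

theorem normSq_one_add_sub_normSq (b z : ℂ) :
    normSq (1 + conj b * z) - normSq (z + b) = (1 - normSq b) * (1 - normSq z) := by
  simp only [normSq_apply, add_re, add_im, mul_re, mul_im, conj_re, conj_im, one_re, one_im]
  ring

theorem normSq_lt_one_of_norm {z : ℂ} (hz : ‖z‖ < 1) : normSq z < 1 := by
  rw [normSq_eq_norm_sq]; nlinarith [norm_nonneg z]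

theorem norm_moebius_lt_one {b z : ℂ} (hb : ‖b‖ < 1) (hz : ‖z‖ < 1) :
    ‖(z + b) / (1 + conj b * z)‖ < 1 := by
  rw [norm_div, div_lt_one (norm_pos_iff.2 (one_add_conj_mul_ne_zero hb hz)),
    ← sq_lt_sq₀ (norm_nonneg _) (norm_nonneg _), ← normSq_eq_norm_sq, ← normSq_eq_norm_sq]
  nlinarith [normSq_one_add_sub_normSq b z, normSq_lt_one_of_norm hb, normSq_lt_one_of_norm hz]

theorem moebius_neg_moebius {b z : ℂ} (hb : ‖b‖ < 1) (hz : ‖z‖ < 1) :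
    ((z + b) / (1 + conj b * z) + -b) / (1 + conj (-b) * ((z + b) / (1 + conj b * z))) = z := by
  have h1 := one_add_conj_mul_ne_zero hb hz
  have h2 : (1 : ℂ) - conj b * b ≠ 0 := by
    rw [mul_comm, mul_conj]
    have := normSq_lt_one_of_norm hb
    exact_mod_cast (sub_pos.2 this).ne'
  have e1 : (z + b) / (1 + conj b * z) + -b = z * (1 - conj b * b) / (1 + conj b * z) := by
    rw [eq_div_iff h1, add_mul, div_mul_cancel₀ _ h1]; ring
  have e2 : 1 + conj (-b) * ((z + b) / (1 + conj b * z)) = (1 - conj b * b) / (1 + conj b * z) := by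
    rw [map_neg, eq_div_iff h1, add_mul, mul_assoc, div_mul_cancel₀ _ h1]; ring
  rw [e1, e2, div_div_div_cancel_right₀ h1, mul_div_cancel_right₀ _ h2]

theorem differentiableOn_moebius {b : ℂ} (hb : ‖b‖ < 1) :
    DifferentiableOn ℂ (fun z => (z + b) / (1 + conj b * z)) (ball 0 1) := by
  refine DifferentiableOn.div (by fun_prop) (by fun_prop) fun z hz => ?_
  exact one_add_conj_mul_ne_zero hb (by simpa using hz)

/-- Precomposing with an automorphism gives a map `N` that fixes the origin. The Schwarz lemma for
`N` and for its inverse forces `|N(1/2)| = 1/2`, and the equality case makes `N` a rotation. -/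
theorem IsUniformization.exists_moebius {m : ℂ → ℂ} (hm : IsUniformization m (ball 0 1)) :
    ∃ b c : ℂ, ‖b‖ < 1 ∧ ‖c‖ = 1 ∧
      ∀ z ∈ ball (0 : ℂ) 1, m z = c * ((z + b) / (1 + conj b * z)) := by
  set w := IsUniformization.inv m 0 with hw
  have h0 : (0 : ℂ) ∈ ball (0 : ℂ) 1 := mem_ball_self one_pos
  have hw1 : ‖w‖ < 1 := by simpa using hm.inv_mem h0
  have hw1' : ‖-w‖ < 1 := by simpa using hw1
  set ψ : ℂ → ℂ := fun z => (z + w) / (1 + conj w * z) with hψ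
  set σ : ℂ → ℂ := fun z => (z + -w) / (1 + conj (-w) * z) with hσ
  have hψm : MapsTo ψ (ball 0 1) (ball 0 1) := fun z hz => by
    rw [mem_ball_zero_iff] at hz ⊢
    exact norm_moebius_lt_one hw1 hz
  have hσm : MapsTo σ (ball 0 1) (ball 0 1) := fun z hz => by
    rw [mem_ball_zero_iff] at hz ⊢
    exact norm_moebius_lt_one hw1' hz
  have hψσ : ∀ z ∈ ball (0 : ℂ) 1, ψ (σ z) = z := fun z hz => by
    have := moebius_neg_moebius hw1' (z := z) (by simpa using hz)
    rwa [neg_neg] at this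
  have hσψ : ∀ z ∈ ball (0 : ℂ) 1, σ (ψ z) = z := fun z hz => by
    exact moebius_neg_moebius hw1 (z := z) (by simpa using hz)
  set N : ℂ → ℂ := m ∘ ψ with hN
  have hNd : DifferentiableOn ℂ N (ball 0 1) :=
    hm.differentiableOn.comp (differentiableOn_moebius hw1) hψm
  have hNm : MapsTo N (ball 0 1) (ball 0 1) := fun z hz => hm.mapsTo (hψm hz)
  have hN0 : N 0 = 0 := by
    have : ψ 0 = w := by simp [hψ]
    rw [hN, Function.comp_apply, this, hw, hm.apply_inv h0]
  have hm' : MapsTo (IsUniformization.inv m) (ball 0 1) (ball 0 1) := fun z hz => hm.inv_mem hz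
  have hNid : DifferentiableOn ℂ (σ ∘ IsUniformization.inv m) (ball 0 1) :=
    (differentiableOn_moebius hw1').comp
      (fun z hz => (hm.hasDerivAt_inv hz).differentiableAt.differentiableWithinAt) hm'
  have hz0 : (1 / 2 : ℂ) ∈ ball (0 : ℂ) 1 := by simp; norm_num
  have hle : ‖N (1 / 2)‖ ≤ ‖(1 / 2 : ℂ)‖ :=
    norm_le_norm_of_mapsTo_ball hNd (hNm.mono_right ball_subset_closedBall) hN0 (by simpa using hz0)
  have hge : ‖(1 / 2 : ℂ)‖ ≤ ‖N (1 / 2)‖ := by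
    have h1 := norm_le_norm_of_mapsTo_ball hNid
      ((hσm.comp hm').mono_right ball_subset_closedBall) (by simp [hσ, ← hw])
      (mem_ball_zero_iff.1 (hNm hz0))
    have h2 : (σ ∘ IsUniformization.inv m) (N (1 / 2)) = 1 / 2 := by
      simp only [Function.comp_apply, hN]
      rw [hm.inv_apply (hψm hz0), hσψ _ hz0]
    rwa [h2] at h1
  have hds : ‖dslope N 0 (1 / 2)‖ = 1 / 1 := by
    rw [dslope_of_ne _ (by norm_num), slope_def_field, hN0, sub_zero, sub_zero, norm_div,
      le_antisymm hle hge]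
    simp
  have haff := affine_of_mapsTo_ball_of_norm_dslope_eq_div hNd
    (by rw [hN0]; exact hNm.mono_right ball_subset_closedBall) hz0 hds
  refine ⟨-w, dslope N 0 (1 / 2), hw1', by simpa using hds, fun z hz => ?_⟩
  have h1 : N (σ z) = m z := by
    simp only [hN, Function.comp_apply]
    rw [hψσ z hz]
  rw [← h1, haff (hσm hz), hN0]
  simp [hσ]
  ring

/-- Two uniformizations of the same domain differ by an automorphism of the disk. -/
theorem IsUniformization.exists_eq_comp_moebius {f₀ f₁ : ℂ → ℂ} {Ω : Set ℂ}
    (h₀ : IsUniformization f₀ Ω) (h₁ : IsUniformization f₁ Ω) :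
    ∃ b c : ℂ, ‖b‖ < 1 ∧ ‖c‖ = 1 ∧
      BijOn (fun z => c * ((z + b) / (1 + conj b * z))) (ball 0 1) (ball 0 1) ∧
      ∀ z ∈ ball (0 : ℂ) 1, f₁ z = f₀ (c * ((z + b) / (1 + conj b * z))) := by
  have hm : IsUniformization (IsUniformization.inv f₀ ∘ f₁) (ball 0 1) := by
    refine ⟨fun z hz => ?_, fun z hz => h₀.inv_mem (h₁.mapsTo hz), fun z hz w hw h => ?_,
      fun y hy => ?_⟩
    · exact ((h₀.hasDerivAt_inv (h₁.mapsTo hz)).comp z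
        (h₁.hasDerivAt hz)).differentiableAt.differentiableWithinAt
    · refine h₁.injOn hz hw ?_
      rw [← h₀.apply_inv (h₁.mapsTo hz), ← h₀.apply_inv (h₁.mapsTo hw)]
      exact congrArg f₀ h
    · refine ⟨IsUniformization.inv f₁ (f₀ y), h₁.inv_mem (h₀.mapsTo hy), ?_⟩
      simp only [Function.comp_apply]
      rw [h₁.apply_inv (h₀.mapsTo hy), h₀.inv_apply hy]
  obtain ⟨b, c, hb, hc, hmz⟩ := hm.exists_moebius
  refine ⟨b, c, hb, hc, hm.bijOn.congr hmz, fun z hz => ?_⟩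
  rw [← hmz z hz, Function.comp_apply, h₀.apply_inv (h₁.mapsTo hz)]

end

section
open Metric Set
open scoped ComplexConjugate

/-! ### Conformal invariance of the constant -/

theorem integrableOn_ball_of_continuousOn_of_bound {E : Type*} [NormedAddCommGroup E]
    {g : ℂ → E} (hg : ContinuousOn g (ball 0 1)) {C : ℝ} (hC : ∀ z ∈ ball (0 : ℂ) 1, ‖g z‖ ≤ C) :
    IntegrableOn g (ball 0 1) :=
  (integrableOn_const (C := C) measure_ball_lt_top.ne).mono'
    (hg.aestronglyMeasurable measurableSet_ball)
    (by filter_upwards [ae_restrict_mem measurableSet_ball] with z hz using hC z hz)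

theorem integrableOn_of_sq {E : Type*} [NormedAddCommGroup E] {S : Set ℂ} (hS : volume S ≠ ⊤)
    {g : ℂ → E} (hg : AEStronglyMeasurable g (volume.restrict S))
    (h2 : IntegrableOn (fun z => ‖g z‖ ^ 2) S) : IntegrableOn g S := by
  have h1 : IntegrableOn (fun _ : ℂ => (1 : ℝ)) S := integrableOn_const hS
  refine (h1.add h2).mono' hg (ae_of_all _ fun z => ?_)
  simp only [Pi.add_apply]
  nlinarith [sq_nonneg (‖g z‖ - 1), sq_nonneg ‖g z‖]

theorem re_one_add_pos {b z : ℂ} (hz : ‖z‖ < 1) : 1 - ‖b‖ ≤ (1 + conj b * z).re := by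
  have h1 := abs_re_le_norm (conj b * z)
  rw [norm_mul, norm_conj] at h1
  have h2 := neg_abs_le (conj b * z).re
  rw [add_re, one_re]
  nlinarith [norm_nonneg b, norm_nonneg z]

/-- For the automorphism `M` with parameter `b`, `M''/M' = -2 b̄/(1 + b̄ z)`, whose conjugate is
`-2b` times the kernel of `integral_disk_kernel`. -/
theorem integral_moebius_cross {q Q : ℂ → ℂ} (hq : ∀ z ∈ ball (0 : ℂ) 1, HasDerivAt q (Q z) z)
    (hQ : DifferentiableOn ℂ Q (ball 0 1)) (hQi : IntegrableOn Q (ball 0 1)) {b : ℂ} (hb : ‖b‖ < 1) :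
    IntegrableOn (fun z => Q z * conj (-2 * conj b / (1 + conj b * z))) (ball 0 1) ∧
    ∫ z in ball (0 : ℂ) 1, Q z * conj (-2 * conj b / (1 + conj b * z)) =
      2 * Real.pi * (q (-b) - q 0) := by
  have e : ∀ z, Q z * conj (-2 * conj b / (1 + conj b * z)) = -2 * (b * (Q z / (1 + b * conj z))) := by
    intro z
    simp only [map_div₀, map_mul, map_add, map_one, map_neg, conj_conj, map_ofNat]
    ring
  have hne : ∀ z ∈ ball (0 : ℂ) 1, 1 + b * conj z ≠ 0 := fun z hz =>
    one_add_mul_ne_zero hb (by simpa using (mem_ball_zero_iff.1 hz).le)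
  have hi : IntegrableOn (fun z => Q z / (1 + b * conj z)) (ball 0 1) := by
    refine (hQi.norm.const_mul (1 - ‖b‖)⁻¹).mono' ?_ ?_
    · refine ContinuousOn.aestronglyMeasurable ?_ measurableSet_ball
      exact hQ.continuousOn.div (by fun_prop) hne
    · filter_upwards [ae_restrict_mem measurableSet_ball] with z hz
      rw [norm_div, div_eq_inv_mul]
      gcongr
      have h1 := re_one_add_pos (b := b) (mem_ball_zero_iff.1 hz)
      have h2 : 1 + b * conj z = conj (1 + conj b * z) := by simp
      rw [h2, norm_conj]
      exact h1.trans (re_le_norm _)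
  simp_rw [e]
  refine ⟨(hi.const_mul b).const_mul (-2), ?_⟩
  rw [integral_const_mul, integral_const_mul, integral_disk_kernel hq hQ hb hi]
  ring

/-- With `f₁ = f₀ ∘ M`, expand `|Q + γ|²`, where `Q = (p ∘ M)'` and `γ = M''/M'`. The first square
is a change of variables, the second gives `-4π ln(1 - |b|²)`, and the cross term gives `4π Re(p(0)
- p(cb))`. These compensate exactly the factors of `f₁'(0) = f₀'(cb) M'(0)`. When the centres agree,
`M` is a rotation. -/
theorem IsUniformization.weilPetersson_invariant {f₀ f₁ : ℂ → ℂ} {Ω : Set ℂ}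
    (h₀ : IsUniformization f₀ Ω) (h₁ : IsUniformization f₁ Ω)
    (hi : IntegrableOn (preSchwarzianSq f₀) (ball 0 1)) :
    IntegrableOn (preSchwarzianSq f₁) (ball 0 1) ∧
    (∫ z in ball 0 1, preSchwarzianSq f₁ z) + 4 * Real.pi * Real.log ‖deriv f₁ 0‖ =
      (∫ z in ball 0 1, preSchwarzianSq f₀ z) + 4 * Real.pi * Real.log ‖deriv f₀ 0‖ ∧
    (f₀ 0 = f₁ 0 → ‖deriv f₁ 0‖ = ‖deriv f₀ 0‖) := by
  obtain ⟨b, c, hb, hc, hbij, hf⟩ := h₀.exists_eq_comp_moebius h₁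
  set M : ℂ → ℂ := fun z => c * ((z + b) / (1 + conj b * z)) with hM
  set M' : ℂ → ℂ := fun z => c * (1 - conj b * b) / (1 + conj b * z) ^ 2 with hM'
  set γ : ℂ → ℂ := fun z => -2 * conj b / (1 + conj b * z) with hγ
  have h0 : (0 : ℂ) ∈ ball (0 : ℂ) 1 := mem_ball_self one_pos
  have hne : ∀ z ∈ ball (0 : ℂ) 1, 1 + conj b * z ≠ 0 := fun z hz =>
    one_add_conj_mul_ne_zero hb (mem_ball_zero_iff.1 hz)
  have hden : ∀ z, HasDerivAt (fun z => 1 + conj b * z) (conj b) z := fun z => by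
    simpa using ((hasDerivAt_id z).const_mul (conj b)).const_add 1
  have hMd : ∀ z ∈ ball (0 : ℂ) 1, HasDerivAt M (M' z) z := fun z hz => by
    refine ((((hasDerivAt_id z).add_const b).div (hden z) (hne z hz)).const_mul c).congr_deriv ?_
    simp only [hM', id]
    ring
  have hM'd : ∀ z ∈ ball (0 : ℂ) 1, HasDerivAt M' (M' z * γ z) z := fun z hz => by
    refine ((hasDerivAt_const z (c * (1 - conj b * b))).div ((hden z).pow 2)
      (pow_ne_zero 2 (hne z hz))).congr_deriv ?_
    simp only [hM', hγ, Pi.pow_apply]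
    have := hne z hz
    field_simp
    push_cast
    ring
  have hMb : ∀ z ∈ ball (0 : ℂ) 1, M z ∈ ball (0 : ℂ) 1 := hbij.mapsTo
  have hd1 : ∀ z ∈ ball (0 : ℂ) 1, deriv f₁ z = deriv f₀ (M z) * M' z := fun z hz => by
    refine HasDerivAt.deriv (((h₀.hasDerivAt (hMb z hz)).comp z (hMd z hz)).congr_of_eventuallyEq ?_)
    filter_upwards [isOpen_ball.mem_nhds hz] with w hw using hf w hw
  have hdd : ∀ z ∈ ball (0 : ℂ) 1, HasDerivAt (deriv f₀) (deriv (deriv f₀) z) z := fun z hz =>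
    ((h₀.differentiableOn.deriv isOpen_ball).differentiableAt (isOpen_ball.mem_nhds hz)).hasDerivAt
  have hd2 : ∀ z ∈ ball (0 : ℂ) 1, deriv (deriv f₁) z =
      deriv (deriv f₀) (M z) * M' z * M' z + deriv f₀ (M z) * (M' z * γ z) := fun z hz => by
    refine HasDerivAt.deriv ((((hdd _ (hMb z hz)).comp z (hMd z hz)).mul
      (hM'd z hz)).congr_of_eventuallyEq ?_)
    filter_upwards [isOpen_ball.mem_nhds hz] with w hw using hd1 w hw
  obtain ⟨p, hp, hpe⟩ := h₀.exists_log_deriv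
  set Q : ℂ → ℂ := fun z => deriv (deriv f₀) (M z) / deriv f₀ (M z) * M' z with hQ
  have hM'0 : ∀ z ∈ ball (0 : ℂ) 1, M' z ≠ 0 := fun z hz h => by
    apply h₁.deriv_ne_zero hz
    rw [hd1 z hz, h, mul_zero]
  have hA : ∀ z ∈ ball (0 : ℂ) 1, deriv (deriv f₁) z / deriv f₁ z = Q z + γ z := fun z hz => by
    rw [hd1 z hz, hd2 z hz]
    have h2 := hM'0 z hz
    have h3 := h₀.deriv_ne_zero (hMb z hz)
    simp only [hQ]
    field_simp
  have hMdiff : DifferentiableOn ℂ M (ball 0 1) := fun z hz =>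
    (hMd z hz).differentiableAt.differentiableWithinAt
  have hQd : DifferentiableOn ℂ Q (ball 0 1) := by
    have h4 : DifferentiableOn ℂ (deriv f₀) (ball 0 1) := h₀.differentiableOn.deriv isOpen_ball
    have h5 : DifferentiableOn ℂ (fun z => deriv (deriv f₀) z / deriv f₀ z) (ball 0 1) :=
      (h4.deriv isOpen_ball).div h4 fun z hz => h₀.deriv_ne_zero hz
    exact (h5.comp hMdiff hbij.mapsTo).mul fun z hz =>
      (hM'd z hz).differentiableAt.differentiableWithinAt
  have hq : ∀ z ∈ ball (0 : ℂ) 1, HasDerivAt (p ∘ M) (Q z) z := fun z hz =>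
    (hp _ (hMb z hz)).comp z (hMd z hz)
  have hQsq : ∀ z ∈ ball (0 : ℂ) 1, ‖deriv M z‖ ^ 2 • preSchwarzianSq f₀ (M z) = ‖Q z‖ ^ 2 :=
    fun z hz => by
      rw [(hMd z hz).deriv, hQ, smul_eq_mul, norm_mul, mul_pow, mul_comm]; rfl
  have hQi2 : IntegrableOn (fun z => ‖Q z‖ ^ 2) (ball 0 1) := by
    rw [← hbij.image_eq, integrableOn_image_holomorphic isOpen_ball hMdiff hbij.injOn
      measurableSet_ball subset_rfl] at hi
    exact hi.congr_fun hQsq measurableSet_ball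
  have hQint : ∫ z in ball 0 1, ‖Q z‖ ^ 2 = ∫ z in ball 0 1, preSchwarzianSq f₀ z := by
    have h6 := setIntegral_image_holomorphic isOpen_ball hMdiff hbij.injOn
      measurableSet_ball subset_rfl (preSchwarzianSq f₀)
    rw [hbij.image_eq] at h6
    rw [h6, setIntegral_congr_fun measurableSet_ball hQsq]
  have hQi : IntegrableOn Q (ball 0 1) := integrableOn_of_sq measure_ball_lt_top.ne
    (hQd.continuousOn.aestronglyMeasurable measurableSet_ball) hQi2
  have hγd : DifferentiableOn ℂ γ (ball 0 1) :=
    DifferentiableOn.div (by fun_prop) (by fun_prop) hne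
  have hγb : ∀ z ∈ ball (0 : ℂ) 1, ‖γ z‖ ≤ 2 * (1 - ‖b‖)⁻¹ := fun z hz => by
    have h7 := (re_one_add_pos (b := b) (mem_ball_zero_iff.1 hz)).trans (re_le_norm _)
    rw [hγ, norm_div, div_eq_mul_inv, norm_mul, norm_conj, norm_neg]
    have h8 : 0 < 1 - ‖b‖ := sub_pos.2 hb
    have : ‖(2 : ℂ)‖ * ‖b‖ ≤ 2 := by rw [RCLike.norm_ofNat]; linarith
    gcongr
  have hγi : IntegrableOn γ (ball 0 1) :=
    integrableOn_ball_of_continuousOn_of_bound hγd.continuousOn hγb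
  have hγi2 : IntegrableOn (fun z => ‖γ z‖ ^ 2) (ball 0 1) := by
    refine integrableOn_ball_of_continuousOn_of_bound (hγd.continuousOn.norm.pow 2)
      (C := (2 * (1 - ‖b‖)⁻¹) ^ 2) fun z hz => ?_
    rw [norm_pow, norm_norm]
    gcongr
    exact hγb z hz
  -- `G` is a primitive of `γ`, so the same kernel identity evaluates the norm of `γ`. The principal
  -- branch is admissible because `1 + b̄ z` has positive real part.
  set G : ℂ → ℂ := fun z => -2 * log (1 + conj b * z) with hG
  have hGd : ∀ z ∈ ball (0 : ℂ) 1, HasDerivAt G (γ z) z := fun z hz => by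
    refine (((hden z).clog (Or.inl ?_)).const_mul (-2)).congr_deriv ?_
    · exact (sub_pos.2 hb).trans_le (re_one_add_pos (mem_ball_zero_iff.1 hz))
    · simp only [hγ]; ring
  obtain ⟨c1i, c1⟩ := integral_moebius_cross hq hQd hQi hb
  obtain ⟨c2i, c2⟩ := integral_moebius_cross hGd hγd hγi hb
  have hmb : -b ∈ ball (0 : ℂ) 1 := by simpa using hb
  have hMmb : M (-b) = 0 := by simp [hM]
  have hM0 : M 0 = c * b := by simp [hM]
  have hM'0v : ‖M' 0‖ = 1 - ‖b‖ ^ 2 := by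
    simp only [hM', mul_zero, add_zero, one_pow, div_one, norm_mul, hc, one_mul]
    rw [mul_comm, mul_conj, normSq_eq_norm_sq, ← ofReal_one, ← ofReal_sub, norm_real,
      Real.norm_of_nonneg]
    nlinarith [norm_nonneg b]
  have hpos : 0 < 1 - ‖b‖ ^ 2 := by nlinarith [norm_nonneg b]
  have hsq : ∀ z, ‖Q z + γ z‖ ^ 2 = ‖Q z‖ ^ 2 + ‖γ z‖ ^ 2 + 2 * (Q z * conj (γ z)).re := fun z => by
    rw [← normSq_eq_norm_sq, ← normSq_eq_norm_sq, ← normSq_eq_norm_sq, normSq_add]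
  have hcongr : ∀ z ∈ ball (0 : ℂ) 1, ‖Q z‖ ^ 2 + ‖γ z‖ ^ 2 + 2 * (Q z * conj (γ z)).re =
      preSchwarzianSq f₁ z := fun z hz => by
    rw [← hsq, ← hA z hz]; rfl
  have hre : IntegrableOn (fun z => (Q z * conj (γ z)).re) (ball 0 1) := c1i.re
  have hsum := (hQi2.add hγi2).add (hre.const_mul 2)
  have hγint : ∫ z in ball 0 1, ‖γ z‖ ^ 2 = -(4 * Real.pi * Real.log (1 - ‖b‖ ^ 2)) := by
    have h9 : ((∫ z in ball 0 1, ‖γ z‖ ^ 2 : ℝ) : ℂ) = ∫ z in ball 0 1, γ z * conj (γ z) := by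
      rw [← integral_complex_ofReal]
      refine integral_congr_ae (ae_of_all _ fun z => ?_)
      simp only [mul_conj, normSq_eq_norm_sq]
    have h10 : G (-b) = ((-2 * Real.log (1 - ‖b‖ ^ 2) : ℝ) : ℂ) := by
      simp only [hG]
      have : 1 + conj b * -b = ((1 - ‖b‖ ^ 2 : ℝ) : ℂ) := by
        rw [mul_neg, mul_comm, mul_conj, normSq_eq_norm_sq]; push_cast; ring
      rw [this, ← ofReal_log hpos.le]
      push_cast; ring
    have h11 : G 0 = 0 := by simp [hG]
    rw [c2, h10, h11] at h9
    have h12 : (∫ z in ball (0 : ℂ) 1, ‖γ z‖ ^ 2 : ℝ) =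
      2 * Real.pi * (-2 * Real.log (1 - ‖b‖ ^ 2)) := by
      apply ofReal_injective
      rw [h9]; push_cast; ring
    rw [h12]; ring
  have hreint : ∫ z in ball 0 1, (Q z * conj (γ z)).re =
      2 * Real.pi * ((p 0).re - (p (c * b)).re) := by
    have h13 : ∫ z in ball 0 1, (Q z * conj (γ z)).re = (∫ z in ball 0 1, Q z * conj (γ z)).re :=
      integral_re c1i
    rw [h13, c1, Function.comp_apply, Function.comp_apply, hMmb, hM0]
    simp
  have hlog0 : Real.log ‖deriv f₀ 0‖ = (p 0).re := by
    rw [hpe 0 h0, norm_exp, Real.log_exp]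
  have hcb : c * b ∈ ball (0 : ℂ) 1 := by simpa [hc] using hb
  refine ⟨IntegrableOn.congr_fun (f := _) hsum hcongr measurableSet_ball, ?_, fun h => ?_⟩
  · rw [← setIntegral_congr_fun measurableSet_ball hcongr, integral_add, integral_add hQi2 hγi2,
      integral_const_mul, hQint, hγint, hreint, hlog0, hd1 0 h0, hM0, norm_mul, hM'0v,
      Real.log_mul (norm_ne_zero_iff.2 (h₀.deriv_ne_zero hcb)) hpos.ne', hpe _ hcb, norm_exp,
      Real.log_exp]
    · ring
    · exact hQi2.add hγi2
    · exact hre.const_mul 2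
  · have h14 : c * b = 0 := by
      refine (h₀.injOn h0 hcb ?_).symm
      rw [h, hf 0 h0, ← hM0]
    have h15 : b = 0 := by
      rcases mul_eq_zero.1 h14 with h | h
      · simp [h] at hc
      · exact h
    rw [hd1 0 h0, hM0, h14, norm_mul, hM'0v, h15]
    simp

end

section
open Metric Set
open scoped ComplexConjugate

/-! ### Growth of square integrable holomorphic functions -/

theorem integral_unitBall_mean {Q : ℂ → ℂ} (hQ : DifferentiableOn ℂ Q (ball 0 1))
    (hi : IntegrableOn Q (ball 0 1)) : ∫ z in ball (0 : ℂ) 1, Q z = Real.pi * Q 0 := by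
  have hi' := hi
  rw [IntegrableOn, restrict_ball_eq] at hi'
  rw [restrict_ball_eq, integral_polar measurableSet_Ioo (Ioo_subset_Ioi_zero le_rfl) hi']
  have h1 : ∫ r in Ioo (0 : ℝ) 1, r • ∫ θ in (0 : ℝ)..(2 * Real.pi), Q (r * circlePt θ) =
      ∫ r in (0 : ℝ)..1, r • (2 * Real.pi * Q 0) := by
    rw [intervalIntegral.integral_of_le zero_le_one, integral_Ioc_eq_integral_Ioo]
    refine setIntegral_congr_fun measurableSet_Ioo fun r hr => ?_
    simp only [integral_circle_mean hQ hr]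
  rw [h1, intervalIntegral.integral_smul_const, integral_id, real_smul]
  push_cast
  ring

/-- Area mean value property for the holomorphic function `Q²`, after rescaling to the unit disk. -/
theorem sq_norm_le_setIntegral_ball {Q : ℂ → ℂ} {z : ℂ} {d : ℝ} (hd : 0 < d)
    (hQ : DifferentiableOn ℂ Q (ball z d)) (hi : IntegrableOn (fun w => ‖Q w‖ ^ 2) (ball z d)) :
    Real.pi * (d * ‖Q z‖) ^ 2 ≤ ∫ w in ball z d, ‖Q w‖ ^ 2 := by
  set φ : ℂ → ℂ := fun w => z + d * w with hφ
  have hd0 : (d : ℂ) ≠ 0 := by exact_mod_cast hd.ne'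
  have hφd : ∀ w, HasDerivAt φ d w := fun w => by
    exact (((hasDerivAt_id w).const_mul (d : ℂ)).const_add z).congr_deriv (mul_one _)
  have hφi : InjOn φ (ball 0 1) := fun x _ y _ h => by
    have : (d : ℂ) * x = d * y := by simpa [hφ] using h
    exact mul_left_cancel₀ hd0 this
  have hφm : MapsTo φ (ball 0 1) (ball z d) := fun w hw => by
    rw [mem_ball_zero_iff] at hw
    rw [mem_ball_iff_norm, hφ, add_sub_cancel_left, norm_mul, norm_real, Real.norm_of_nonneg hd.le]
    nlinarith
  have himg : φ '' ball 0 1 = ball z d := by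
    refine Subset.antisymm hφm.image_subset fun w hw => ⟨(w - z) / d, ?_, ?_⟩
    · rw [mem_ball_iff_norm] at hw
      rw [mem_ball_zero_iff, norm_div, norm_real, Real.norm_of_nonneg hd.le, div_lt_one hd]
      exact hw
    · simp only [hφ]; field_simp; ring
  have hφD : DifferentiableOn ℂ φ (ball 0 1) := fun w _ =>
    (hφd w).differentiableAt.differentiableWithinAt
  have hi2 := hi
  rw [← himg, integrableOn_image_holomorphic isOpen_ball hφD hφi measurableSet_ball subset_rfl] at hi2
  have hint := setIntegral_image_holomorphic isOpen_ball hφD hφi measurableSet_ball subset_rfl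
    (fun w => ‖Q w‖ ^ 2)
  simp only [(hφd _).deriv, norm_real, smul_eq_mul, Real.norm_of_nonneg hd.le] at hi2 hint
  rw [himg, integral_const_mul] at hint
  have hi3 : IntegrableOn (fun w => ‖Q (φ w)‖ ^ 2) (ball 0 1) := by
    have := hi2.const_mul (d ^ 2)⁻¹
    refine this.congr (ae_of_all _ fun w => ?_)
    simp only
    field_simp
  have hQφ : DifferentiableOn ℂ (fun w => Q (φ w) ^ 2) (ball 0 1) := (hQ.comp hφD hφm).pow 2
  have hi4 : IntegrableOn (fun w => Q (φ w) ^ 2) (ball 0 1) :=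
    hi3.mono' (hQφ.continuousOn.aestronglyMeasurable measurableSet_ball)
      (ae_of_all _ fun w => by rw [norm_pow])
  have hm := integral_unitBall_mean hQφ hi4
  have h5 : Real.pi * ‖Q z‖ ^ 2 ≤ ∫ w in ball 0 1, ‖Q (φ w)‖ ^ 2 := by
    have h6 := norm_integral_le_integral_norm (μ := volume.restrict (ball (0 : ℂ) 1))
      (fun w => Q (φ w) ^ 2)
    rw [hm] at h6
    simpa [hφ, abs_of_pos Real.pi_pos] using h6
  rw [hint]
  calc Real.pi * (d * ‖Q z‖) ^ 2 = d ^ 2 * (Real.pi * ‖Q z‖ ^ 2) := by ring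
    _ ≤ _ := by gcongr

/-- A square integrable holomorphic function on the disk is `o(1/(1-|z|))`. -/
theorem exists_forall_norm_mul_le {Q : ℂ → ℂ} (hQ : DifferentiableOn ℂ Q (ball 0 1))
    (hi : IntegrableOn (fun w => ‖Q w‖ ^ 2) (ball 0 1)) {ε : ℝ} (hε : 0 < ε) :
    ∃ ρ ∈ Ioo (0 : ℝ) 1, ∀ z : ℂ, ρ ≤ ‖z‖ → ‖z‖ < 1 → (1 - ‖z‖) * ‖Q z‖ ≤ ε := by
  set S : ℕ → Set ℂ := fun n => {w | 1 - 1 / ((n : ℝ) + 1) ≤ ‖w‖} ∩ ball 0 1 with hS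
  have hSm : ∀ n, MeasurableSet (S n) := fun n =>
    (measurableSet_le measurable_const measurable_norm).inter measurableSet_ball
  have hSa : Antitone S := fun m n hmn w hw => by
    have h1 : 1 - 1 / ((n : ℝ) + 1) ≤ ‖w‖ := hw.1
    have : (1 : ℝ) / (n + 1) ≤ 1 / (m + 1) := by gcongr
    exact ⟨show 1 - 1 / ((m : ℝ) + 1) ≤ ‖w‖ by linarith, hw.2⟩
  have hS0 : ⋂ n, S n = ∅ := by
    rw [eq_empty_iff_forall_notMem]
    intro w hw
    rw [mem_iInter] at hw
    have h1 : ‖w‖ < 1 := by simpa using (hw 0).2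
    obtain ⟨n, hn⟩ := exists_nat_one_div_lt (sub_pos.2 h1)
    have : 1 - 1 / ((n : ℝ) + 1) ≤ ‖w‖ := (hw n).1
    linarith
  have ht := tendsto_setIntegral_of_antitone (μ := volume) hSm hSa
    ⟨0, hi.mono_set inter_subset_right⟩
  rw [hS0, setIntegral_empty] at ht
  obtain ⟨n, hn⟩ := (ht.eventually (gt_mem_nhds (show 0 < Real.pi * ε ^ 2 by positivity))).exists
  have hn0 : (0 : ℝ) < 1 / ((n : ℝ) + 1) := by positivity
  have hn1 : (1 : ℝ) / ((n : ℝ) + 1) ≤ 1 := by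
    rw [div_le_one (by positivity)]; linarith [n.cast_nonneg (α := ℝ)]
  -- Half the width of the annulus `S n`: the disk of radius `1 - |z|` about `z` reaches inwards
  -- only to `2|z| - 1 ≥ 1 - 1/(n+1)`, hence stays in `S n`.
  refine ⟨1 - 1 / ((n : ℝ) + 1) / 2, ⟨by linarith, by linarith⟩, fun z hz hz1 => ?_⟩
  have hd : 0 < 1 - ‖z‖ := sub_pos.2 hz1
  have hsub : ball z (1 - ‖z‖) ⊆ S n := fun w hw => by
    rw [mem_ball_iff_norm] at hw
    have h2 := norm_sub_norm_le z w
    have h3 := norm_sub_norm_le w z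
    rw [norm_sub_rev] at h2
    refine ⟨?_, ?_⟩
    · show 1 - 1 / ((n : ℝ) + 1) ≤ ‖w‖
      linarith
    · rw [mem_ball_zero_iff]; linarith
  have hsub' : ball z (1 - ‖z‖) ⊆ ball 0 1 := hsub.trans inter_subset_right
  have h4 := sq_norm_le_setIntegral_ball hd (hQ.mono hsub') (hi.mono_set hsub')
  have h5 : ∫ w in ball z (1 - ‖z‖), ‖Q w‖ ^ 2 ≤ ∫ w in S n, ‖Q w‖ ^ 2 :=
    setIntegral_mono_set (hi.mono_set inter_subset_right) (ae_of_all _ fun w => by positivity)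
      hsub.eventuallyLE
  have h6 : ((1 - ‖z‖) * ‖Q z‖) ^ 2 ≤ ε ^ 2 :=
    le_of_mul_le_mul_left ((h4.trans h5).trans hn.le) Real.pi_pos
  exact le_of_sq_le_sq h6 hε.le

/-! ### Boundary values of a conformal map -/

section Boundary

variable {f p Q : ℂ → ℂ}

/-- First order approximation of a conformal map near the boundary. -/
theorem norm_sub_affine_le (hf : ∀ z ∈ ball (0 : ℂ) 1, HasDerivAt f (exp (p z)) z)
    (hp : ∀ z ∈ ball (0 : ℂ) 1, HasDerivAt p (Q z) z) {ε ρ : ℝ} (hε : 0 ≤ ε) (hε4 : ε ≤ 1 / 4)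
    (hρ : ∀ z : ℂ, ρ ≤ ‖z‖ → ‖z‖ < 1 → (1 - ‖z‖) * ‖Q z‖ ≤ ε)
    {ζ : ℂ} (hζ : ‖ζ‖ = 1) {d : ℝ} (hd : 0 < d) (hd1 : d ≤ 1 - ρ) (hd2 : d ≤ 1)
    {z : ℂ} (hz : ‖z‖ < 1) (hzd : ‖z - ζ‖ ≤ d) :
    ‖f z - f ((1 - d) * ζ) - exp (p ((1 - d) * ζ)) * (z - (1 - d) * ζ)‖ ≤
      8 * ε * d * ‖exp (p ((1 - d) * ζ))‖ := by
  obtain ⟨c, hc⟩ : ∃ c : ℂ, c = (1 - d) * ζ := ⟨_, rfl⟩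
  rw [← hc]
  -- The segment from `c` to `z`, run at exponential speed. Then `1 - |w(t)| ≥ e^{-t} d` and
  -- `|w'(t)| ≤ 2d e^{-t}`, so the bound on `Q` gives `|p(w(t)) - p(c)| ≤ 2εt`. The growth `e^{2εt}`
  -- of `f'` is beaten by the decay `e^{-t}` of the speed.
  set w : ℝ → ℂ := fun t => c + (1 - Real.exp (-t)) * (z - c) with hw
  have hcn : ‖c‖ = 1 - d := by
    rw [hc, norm_mul, hζ, mul_one, ← ofReal_one, ← ofReal_sub, norm_real, Real.norm_of_nonneg]
    linarith
  have hcζ : c - ζ = -d * ζ := by rw [hc]; ring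
  have hcζn : ‖c - ζ‖ = d := by rw [hcζ]; simp [hζ, abs_of_pos hd]
  have hzc : ‖z - c‖ ≤ 2 * d := by
    have : z - c = (z - ζ) - (c - ζ) := by ring
    rw [this]
    exact (norm_sub_le _ _).trans (by linarith)
  have hw' : ∀ t, HasDerivAt w (Real.exp (-t) * (z - c)) t := fun t => by
    have h1 : HasDerivAt (fun t : ℝ => ((Real.exp (-t) : ℝ) : ℂ)) (-(Real.exp (-t) : ℝ) : ℂ) t := by
      have h2 : HasDerivAt (fun t : ℝ => Real.exp (-t)) (-Real.exp (-t)) t := by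
        simpa using (hasDerivAt_neg t).exp
      simpa using h2.ofReal_comp
    refine (((h1.const_sub 1).mul_const (z - c)).const_add c).congr_deriv ?_
    ring
  have hwn : ∀ t, 0 ≤ t → ρ ≤ ‖w t‖ ∧ ‖w t‖ < 1 ∧ Real.exp (-t) * d ≤ 1 - ‖w t‖ := fun t ht => by
    have he0 : 0 < Real.exp (-t) := Real.exp_pos _
    have he1 : Real.exp (-t) ≤ 1 := Real.exp_le_one_iff.2 (by linarith)
    have hwe : w t = ((Real.exp (-t) : ℝ) : ℂ) * c + ((1 - Real.exp (-t) : ℝ) : ℂ) * z := by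
      simp only [hw]; push_cast; ring
    have h3 : ‖w t‖ ≤ Real.exp (-t) * (1 - d) + (1 - Real.exp (-t)) * ‖z‖ := by
      rw [hwe]
      refine (norm_add_le _ _).trans ?_
      rw [norm_mul, norm_mul, norm_real, norm_real, Real.norm_of_nonneg he0.le,
        Real.norm_of_nonneg (by linarith), hcn]
    have h4 : ‖w t - ζ‖ ≤ d := by
      have : w t - ζ = ((Real.exp (-t) : ℝ) : ℂ) * (c - ζ) +
        ((1 - Real.exp (-t) : ℝ) : ℂ) * (z - ζ) := by rw [hwe]; push_cast; ring
      rw [this]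
      refine (norm_add_le _ _).trans ?_
      rw [norm_mul, norm_mul, norm_real, norm_real, Real.norm_of_nonneg he0.le,
        Real.norm_of_nonneg (by linarith), hcζn]
      nlinarith
    have h5 := norm_sub_norm_le ζ (w t)
    rw [norm_sub_rev, hζ] at h5
    refine ⟨by linarith, ?_, ?_⟩ <;> nlinarith [norm_nonneg z]
  have hwb : ∀ t, 0 ≤ t → w t ∈ ball (0 : ℂ) 1 := fun t ht => by simpa using (hwn t ht).2.1
  have hw0 : w 0 = c := by simp [hw]
  have hpt : ∀ t, 0 ≤ t → ‖p (w t) - p c‖ ≤ 2 * ε * t := fun t ht => by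
    have h6 : ∀ s ∈ Icc 0 t, HasDerivWithinAt (p ∘ w) (Q (w s) * (Real.exp (-s) * (z - c)))
        (Icc 0 t) s := fun s hs => ((hp _ (hwb s hs.1)).comp s (hw' s)).hasDerivWithinAt
    have h7 := norm_image_sub_le_of_norm_deriv_le_segment' (C := 2 * ε) h6 (fun s hs => by
      obtain ⟨a1, a2, a3⟩ := hwn s hs.1
      have a4 := hρ _ a1 a2
      rw [norm_mul, norm_mul, norm_real, Real.norm_of_nonneg (Real.exp_pos _).le]
      have a5 : ‖Q (w s)‖ * (Real.exp (-s) * d) ≤ ε := by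
        refine le_trans ?_ a4
        rw [mul_comm]
        gcongr
      have a6 : ‖Q (w s)‖ * (Real.exp (-s) * ‖z - c‖) ≤ ‖Q (w s)‖ * (Real.exp (-s) * (2 * d)) := by
        gcongr
      linarith) t ⟨ht, le_rfl⟩
    simpa [hw0] using h7
  have hcb : c ∈ ball (0 : ℂ) 1 := by rw [← hw0]; exact hwb 0 le_rfl
  set A : ℝ := ‖exp (p c)‖ with hA
  have hlt : 0 < 1 - 2 * ε := by linarith
  have hbound : ∀ t, 0 ≤ t → ‖f (w t) - f c - exp (p c) * (w t - c)‖ ≤ 8 * ε * d * A := by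
    intro t ht
    -- The primitive, vanishing at `0`, of `2dA (e^{2εs} - 1) e^{-s}`, which bounds the derivative
    -- of the error.
    set B : ℝ → ℝ := fun s => A * (2 * d) *
      ((1 - Real.exp (-(1 - 2 * ε) * s)) / (1 - 2 * ε) - (1 - Real.exp (-s))) with hB
    have hBd : ∀ s, HasDerivAt B (A * (2 * d) * (Real.exp (-(1 - 2 * ε) * s) - Real.exp (-s))) s := by
      intro s
      have b1 : HasDerivAt (fun s => Real.exp (-(1 - 2 * ε) * s))
          (Real.exp (-(1 - 2 * ε) * s) * (-(1 - 2 * ε))) s := by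
        simpa using ((hasDerivAt_id s).const_mul (-(1 - 2 * ε))).exp
      have b2 : HasDerivAt (fun s => Real.exp (-s)) (Real.exp (-s) * (-1)) s :=
        (hasDerivAt_neg s).exp
      refine ((((b1.const_sub 1).div_const (1 - 2 * ε)).sub (b2.const_sub 1)).const_mul
        (A * (2 * d))).congr_deriv ?_
      field_simp
    have hfd : ∀ s, 0 ≤ s → HasDerivAt (fun s => f (w s) - f c - exp (p c) * (w s - c))
        ((exp (p (w s)) - exp (p c)) * (Real.exp (-s) * (z - c))) s := fun s hs => by
      refine ((((hf _ (hwb s hs)).comp s (hw' s)).sub_const (f c)).sub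
        (((hw' s).sub_const c).const_mul (exp (p c)))).congr_deriv ?_
      ring
    have h8 := image_norm_le_of_norm_deriv_right_le_deriv_boundary
      (f := fun s => f (w s) - f c - exp (p c) * (w s - c)) (a := 0) (b := t)
      (fun s hs => (hfd s hs.1).continuousAt.continuousWithinAt)
      (fun s hs => (hfd s hs.1).hasDerivWithinAt) (B := B) (by simp [hw0, hB]) hBd
      (fun s hs => by
        have c1 : exp (p (w s)) - exp (p c) = exp (p c) * (exp (p (w s) - p c) - 1) := by
          rw [mul_sub, ← exp_add]; simp
        have c2 : ‖exp (p (w s) - p c) - 1‖ ≤ Real.exp (2 * ε * s) - 1 := by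
          have h1 := norm_exp_sub_sum_le_exp_norm_sub_sum (p (w s) - p c) 1
          have := Real.exp_le_exp.2 (hpt s hs.1)
          simp only [Finset.range_one, Finset.sum_singleton, pow_zero, Nat.factorial_zero,
            Nat.cast_one, div_one] at h1
          linarith
        rw [norm_mul, c1, norm_mul, norm_mul, norm_real, Real.norm_of_nonneg (Real.exp_pos _).le]
        have c3 : Real.exp (-(1 - 2 * ε) * s) = Real.exp (2 * ε * s) * Real.exp (-s) := by
          rw [← Real.exp_add]; ring_nf
        rw [c3]
        have c4 : 0 ≤ A * (Real.exp (2 * ε * s) - 1) :=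
          mul_nonneg (norm_nonneg _) ((norm_nonneg _).trans c2)
        calc A * ‖exp (p (w s) - p c) - 1‖ * (Real.exp (-s) * ‖z - c‖)
            ≤ A * (Real.exp (2 * ε * s) - 1) * (Real.exp (-s) * (2 * d)) := by gcongr
          _ = _ := by ring) ⟨ht, le_rfl⟩
    refine h8.trans ?_
    have hA0 : 0 ≤ A := norm_nonneg _
    have d1 : Real.exp (-t) ≤ Real.exp (-(1 - 2 * ε) * t) / (1 - 2 * ε) := by
      rw [le_div_iff₀ hlt]
      have : Real.exp (-t) ≤ Real.exp (-(1 - 2 * ε) * t) := Real.exp_le_exp.2 (by nlinarith)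
      nlinarith [Real.exp_pos (-t)]
    -- Here `ε ≤ 1/4` is needed. Multiplied by `2dA`, this is the origin of the constant `8`.
    have d2 : 1 / (1 - 2 * ε) - 1 ≤ 4 * ε := by
      rw [sub_le_iff_le_add, div_le_iff₀ hlt]; nlinarith
    have d3 : (1 - Real.exp (-(1 - 2 * ε) * t)) / (1 - 2 * ε) - (1 - Real.exp (-t)) ≤ 4 * ε := by
      rw [sub_div]; linarith
    calc B t ≤ A * (2 * d) * (4 * ε) := by simp only [hB]; gcongr
      _ = _ := by ring
  have hwt : Tendsto w atTop (𝓝 z) := by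
    have e1 : Tendsto (fun t : ℝ => ((Real.exp (-t) : ℝ) : ℂ)) atTop (𝓝 ((0 : ℝ) : ℂ)) :=
      (continuous_ofReal.tendsto 0).comp (Real.tendsto_exp_neg_atTop_nhds_zero)
    have e2 := ((tendsto_const_nhds (x := (1 : ℂ))).sub e1).mul_const (z - c) |>.const_add c
    rwa [ofReal_zero, sub_zero, one_mul, add_sub_cancel] at e2
  have hfz : ContinuousAt f z := (hf z (by simpa using hz)).continuousAt
  have hlim : Tendsto (fun t => ‖f (w t) - f c - exp (p c) * (w t - c)‖) atTop
      (𝓝 ‖f z - f c - exp (p c) * (z - c)‖) :=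
    (((hfz.tendsto.comp hwt).sub_const (f c)).sub ((hwt.sub_const c).const_mul (exp (p c)))).norm
  exact le_of_tendsto hlim (by filter_upwards [eventually_ge_atTop 0] with t ht using hbound t ht)

end Boundary

end

/-! ### Continuous extension to the closed disk and boundary derivatives -/

section
open Metric Set
open scoped ComplexConjugate

/-- `f` is a conformal map of the disk, of finite area, with `f' = exp p` and `p' = Q ∈ L²`. -/
structure IsDirichletConformal (f p Q : ℂ → ℂ) : Prop where
  hasDerivAt : ∀ z ∈ ball (0 : ℂ) 1, HasDerivAt f (exp (p z)) z
  hasDerivAt_log : ∀ z ∈ ball (0 : ℂ) 1, HasDerivAt p (Q z) z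
  injOn : InjOn f (ball 0 1)
  integrableOn_sq : IntegrableOn (fun z => ‖Q z‖ ^ 2) (ball 0 1)
  integrableOn_deriv_sq : IntegrableOn (fun z => ‖exp (p z)‖ ^ 2) (ball 0 1)

/-- The extension of a function to the closed disk by limits. -/
noncomputable abbrev diskExtend (f : ℂ → ℂ) : ℂ → ℂ := extendFrom (ball 0 1) f

namespace IsDirichletConformal

variable {f p Q : ℂ → ℂ}

theorem differentiableOn_log (h : IsDirichletConformal f p Q) : DifferentiableOn ℂ p (ball 0 1) :=
  fun z hz => (h.hasDerivAt_log z hz).differentiableAt.differentiableWithinAt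

theorem differentiableOn (h : IsDirichletConformal f p Q) : DifferentiableOn ℂ f (ball 0 1) :=
  fun z hz => (h.hasDerivAt z hz).differentiableAt.differentiableWithinAt

theorem differentiableOn_deriv_log (h : IsDirichletConformal f p Q) :
    DifferentiableOn ℂ Q (ball 0 1) :=
  (h.differentiableOn_log.deriv isOpen_ball).congr fun z hz => (h.hasDerivAt_log z hz).deriv.symm

theorem norm_sub_affine_le_mul (h : IsDirichletConformal f p Q) {ε : ℝ} (hε : 0 < ε) :
    ∃ d₀ ∈ Ioo (0 : ℝ) 1, ∀ ζ : ℂ, ‖ζ‖ = 1 → ∀ d ∈ Ioc 0 d₀, ∀ z : ℂ, ‖z‖ < 1 → ‖z - ζ‖ ≤ d →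
      ‖f z - f ((1 - d) * ζ) - exp (p ((1 - d) * ζ)) * (z - (1 - d) * ζ)‖ ≤
        ε * d * ‖exp (p ((1 - d) * ζ))‖ := by
  obtain ⟨ρ, hρ, hb⟩ := exists_forall_norm_mul_le h.differentiableOn_deriv_log h.integrableOn_sq
    (show 0 < min (ε / 8) (1 / 4) by positivity)
  refine ⟨1 - ρ, ⟨by linarith [hρ.2], by linarith [hρ.1]⟩, fun ζ hζ d hd z hz hzd => ?_⟩
  refine (norm_sub_affine_le h.hasDerivAt h.hasDerivAt_log (by positivity) (min_le_right _ _) hb hζ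
    hd.1 hd.2 (hd.2.trans (by linarith [hρ.1])) hz hzd).trans ?_
  gcongr
  · exact hd.1.le
  · linarith [min_le_left (ε / 8) (1 / 4)]

theorem norm_center {ζ : ℂ} (hζ : ‖ζ‖ = 1) {d : ℝ} (hd : d ≤ 1) : ‖(1 - (d : ℂ)) * ζ‖ = 1 - d := by
  rw [norm_mul, hζ, mul_one, ← ofReal_one, ← ofReal_sub, norm_real, Real.norm_of_nonneg]
  linarith

theorem norm_center_sub {ζ : ℂ} (hζ : ‖ζ‖ = 1) {d : ℝ} (hd : 0 ≤ d) :
    ‖(1 - (d : ℂ)) * ζ - ζ‖ = d := by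
  have : (1 - (d : ℂ)) * ζ - ζ = -d * ζ := by ring
  rw [this]; simp [hζ, abs_of_nonneg hd]

/-- Since the image has finite area, `f' = e^p` is itself holomorphic and square integrable, so the
growth bound applied to `Q` applies to it too. -/
theorem mul_norm_deriv_le (h : IsDirichletConformal f p Q) {η : ℝ} (hη : 0 < η) :
    ∃ d₀ ∈ Ioo (0 : ℝ) 1, ∀ ζ : ℂ, ‖ζ‖ = 1 → ∀ d ∈ Ioc 0 d₀,
      d * ‖exp (p ((1 - d) * ζ))‖ ≤ η := by
  obtain ⟨ρ, hρ, hb⟩ := exists_forall_norm_mul_le (Q := fun z => exp (p z))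
    (h.differentiableOn_log.cexp) h.integrableOn_deriv_sq hη
  refine ⟨1 - ρ, ⟨by linarith [hρ.2], by linarith [hρ.1]⟩, fun ζ hζ d hd => ?_⟩
  have hn := norm_center hζ (hd.2.trans (by linarith [hρ.1]))
  have := hb ((1 - d) * ζ) (by rw [hn]; linarith [hd.2]) (by rw [hn]; linarith [hd.1])
  rwa [hn, sub_sub_cancel] at this

theorem nhdsWithin_ball_neBot {ζ : ℂ} (hζ : ‖ζ‖ ≤ 1) : (𝓝[ball 0 1] ζ).NeBot := by
  rw [← mem_closure_iff_nhdsWithin_neBot, closure_ball _ one_ne_zero]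
  simpa using hζ

/-- Cauchy criterion: by the affine approximation, the oscillation of `f` within distance `d` of `ζ`
is of order `d |f'((1-d)ζ)|`, which tends to zero. -/
theorem exists_tendsto (h : IsDirichletConformal f p Q) {ζ : ℂ} (hζ : ‖ζ‖ ≤ 1) :
    ∃ y, Tendsto f (𝓝[ball 0 1] ζ) (𝓝 y) := by
  rcases hζ.lt_or_eq with hlt | hζ
  · exact ⟨f ζ, (h.differentiableOn.continuousOn ζ (by simpa using hlt)).tendsto⟩
  have := nhdsWithin_ball_neBot hζ.le
  rw [← cauchy_map_iff_exists_tendsto, Metric.cauchy_iff]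
  refine ⟨inferInstance, fun ε hε => ?_⟩
  obtain ⟨d₁, hd₁, h1⟩ := h.norm_sub_affine_le_mul one_pos
  -- All values lie within `3 · ε/7` of `f c`, so two of them differ by at most `6ε/7 < ε`.
  obtain ⟨d₂, hd₂, h2⟩ := h.mul_norm_deriv_le (show 0 < ε / 7 by positivity)
  set d := min d₁ d₂ with hd
  have hd0 : 0 < d := lt_min hd₁.1 hd₂.1
  have hda := h1 ζ hζ d ⟨hd0, min_le_left _ _⟩
  have hdb := h2 ζ hζ d ⟨hd0, min_le_right _ _⟩
  set c : ℂ := (1 - d) * ζ with hc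
  have hcζ : ‖c - ζ‖ = d := norm_center_sub hζ hd0.le
  have key : ∀ z : ℂ, ‖z‖ < 1 → ‖z - ζ‖ ≤ d → ‖f z - f c‖ ≤ 3 * (d * ‖exp (p c)‖) := by
    intro z hz hzd
    have e1 := hda z hz hzd
    have e2 : ‖z - c‖ ≤ 2 * d := by
      have : z - c = (z - ζ) - (c - ζ) := by ring
      rw [this]
      exact (norm_sub_le _ _).trans (by linarith)
    have e3 : f z - f c = (f z - f c - exp (p c) * (z - c)) + exp (p c) * (z - c) := by ring
    rw [e3]
    refine (norm_add_le _ _).trans ?_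
    rw [norm_mul]
    nlinarith [mul_le_mul_of_nonneg_left e2 (norm_nonneg (exp (p c)))]
  refine ⟨f '' (closedBall ζ d ∩ ball 0 1), image_mem_map ?_, ?_⟩
  · exact inter_mem (mem_nhdsWithin_of_mem_nhds (closedBall_mem_nhds ζ hd0)) self_mem_nhdsWithin
  · rintro _ ⟨x, ⟨hx, hx1⟩, rfl⟩ _ ⟨y, ⟨hy, hy1⟩, rfl⟩
    rw [mem_closedBall_iff_norm] at hx hy
    rw [mem_ball_zero_iff] at hx1 hy1
    have e1 := key x hx1 hx
    have e2 := key y hy1 hy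
    rw [dist_eq_norm]
    have e3 : f x - f y = (f x - f c) - (f y - f c) := by ring
    rw [e3]
    refine (norm_sub_le _ _).trans_lt ?_
    linarith

theorem continuousOn_diskExtend (h : IsDirichletConformal f p Q) :
    ContinuousOn (diskExtend f) (closedBall 0 1) :=
  continuousOn_extendFrom (by rw [closure_ball _ one_ne_zero])
    fun x hx => h.exists_tendsto (by simpa using hx)

theorem diskExtend_eq (h : IsDirichletConformal f p Q) {z : ℂ} (hz : z ∈ ball (0 : ℂ) 1) :
    diskExtend f z = f z :=
  extendFrom_extends h.differentiableOn.continuousOn z hz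

/-- With `d = |z - ζ|`, both `z` and `ζ` lie in the range of the affine approximation centred at
`(1-d)ζ`. Using it at each of them with error `ε/2` and subtracting eliminates the centre value. -/
theorem norm_diskExtend_sub_affine_le (h : IsDirichletConformal f p Q) {ε : ℝ} (hε : 0 < ε) :
    ∃ d₀ ∈ Ioo (0 : ℝ) 1, ∀ ζ : ℂ, ‖ζ‖ = 1 → ∀ z : ℂ, ‖z‖ ≤ 1 → z ≠ ζ → ‖z - ζ‖ ≤ d₀ →
      ‖diskExtend f z - diskExtend f ζ -
        exp (p ((1 - (‖z - ζ‖ : ℝ)) * ζ)) * (z - ζ)‖ ≤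
        ε * ‖z - ζ‖ * ‖exp (p ((1 - (‖z - ζ‖ : ℝ)) * ζ))‖ := by
  obtain ⟨d₀, hd₀, h1⟩ := h.norm_sub_affine_le_mul (half_pos hε)
  refine ⟨d₀, hd₀, fun ζ hζ z hz hne hzd => ?_⟩
  obtain ⟨d, hd⟩ : ∃ d, d = ‖z - ζ‖ := ⟨_, rfl⟩
  have hd0 : 0 < d := by rw [hd]; exact norm_pos_iff.2 (sub_ne_zero.2 hne)
  rw [← hd] at hzd ⊢
  have hda := h1 ζ hζ d ⟨hd0, hzd⟩
  obtain ⟨c, hc⟩ : ∃ c : ℂ, c = (1 - d) * ζ := ⟨_, rfl⟩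
  rw [← hc] at hda ⊢
  have hcζ : ‖c - ζ‖ = d := hc ▸ norm_center_sub hζ hd0.le
  have hcn : ‖c‖ = 1 - d := hc ▸ norm_center hζ (hzd.trans hd₀.2.le)
  have key : ∀ x : ℂ, ‖x‖ ≤ 1 → ‖x - ζ‖ ≤ d →
      ‖diskExtend f x - f c - exp (p c) * (x - c)‖ ≤ ε / 2 * d * ‖exp (p c)‖ := by
    intro x hx hxd
    -- Moving `x` slightly towards `c` brings it inside the open disk without leaving the ball of
    -- radius `d` about `ζ`; the estimate then passes to the limit.
    set w : ℝ → ℂ := fun s => (1 - s) * x + s * c with hw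
    have hwm : ∀ s ∈ Ioo (0 : ℝ) 1, ‖w s‖ < 1 ∧ ‖w s - ζ‖ ≤ d := fun s hs => by
      have n1 : ‖(1 - s : ℂ)‖ = 1 - s := by
        rw [← ofReal_one, ← ofReal_sub, norm_real, Real.norm_of_nonneg]; linarith [hs.2]
      have n2 : ‖(s : ℂ)‖ = s := by rw [norm_real, Real.norm_of_nonneg hs.1.le]
      constructor
      · refine (norm_add_le _ _).trans_lt ?_
        rw [norm_mul, norm_mul, n1, n2, hcn]
        nlinarith [hs.1, hs.2, mul_pos hs.1 hd0]
      · have : w s - ζ = (1 - s) * (x - ζ) + s * (c - ζ) := by simp only [hw]; ring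
        rw [this]
        refine (norm_add_le _ _).trans ?_
        rw [norm_mul, norm_mul, n1, n2, hcζ]
        nlinarith [hs.1, hs.2]
    have hwc : Continuous w := by fun_prop
    have hw0 : w 0 = x := by simp [hw]
    have ht : Tendsto w (𝓝[>] 0) (𝓝[closedBall 0 1] x) := by
      refine tendsto_nhdsWithin_iff.2 ⟨?_, ?_⟩
      · have := hwc.tendsto 0
        rw [hw0] at this
        exact this.mono_left nhdsWithin_le_nhds
      · filter_upwards [Ioo_mem_nhdsGT one_pos] with s hs
        simpa using (hwm s hs).1.le
    have hF := (h.continuousOn_diskExtend x (by simpa using hx)).tendsto.comp ht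
    have hlim : Tendsto (fun s => ‖diskExtend f (w s) - f c - exp (p c) * (w s - c)‖) (𝓝[>] 0)
        (𝓝 ‖diskExtend f x - f c - exp (p c) * (x - c)‖) :=
      ((hF.sub_const (f c)).sub (((ht.mono_right nhdsWithin_le_nhds).sub_const c).const_mul
        (exp (p c)))).norm
    refine le_of_tendsto hlim ?_
    filter_upwards [Ioo_mem_nhdsGT one_pos] with s hs
    rw [h.diskExtend_eq (by simpa using (hwm s hs).1)]
    exact hda _ (hwm s hs).1 (hwm s hs).2
  have e1 := key z hz hd.ge
  have e2 := key ζ hζ.le (by simpa using hd0.le)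
  have e3 : diskExtend f z - diskExtend f ζ - exp (p c) * (z - ζ) =
    (diskExtend f z - f c - exp (p c) * (z - c)) - (diskExtend f ζ - f c - exp (p c) * (ζ - c)) := by
      ring
  rw [e3]
  refine (norm_sub_le _ _).trans ?_
  linarith

/-- With relative error `1/2` the linear part dominates. The scale `d₀` is uniform in `ζ`, which the
passage to global injectivity requires. -/
theorem diskExtend_locally_ne (h : IsDirichletConformal f p Q) :
    ∃ d₀ > 0, ∀ ζ : ℂ, ‖ζ‖ = 1 → ∀ z : ℂ, ‖z‖ ≤ 1 → z ≠ ζ → ‖z - ζ‖ ≤ d₀ →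
      diskExtend f z ≠ diskExtend f ζ := by
  obtain ⟨d₀, hd₀, h1⟩ := h.norm_diskExtend_sub_affine_le one_half_pos
  refine ⟨d₀, hd₀.1, fun ζ hζ z hz hne hzd heq => ?_⟩
  have h2 := h1 ζ hζ z hz hne hzd
  rw [heq, sub_self, zero_sub, norm_neg, norm_mul] at h2
  have h3 : 0 < ‖z - ζ‖ := norm_pos_iff.2 (sub_ne_zero.2 hne)
  have h4 : 0 < ‖exp (p ((1 - (‖z - ζ‖ : ℝ)) * ζ))‖ := norm_pos_iff.2 (exp_ne_zero _)
  nlinarith [mul_pos h3 h4]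

/-- The slope of the affine approximation at scale `d` is `e^p` at the radial point `(1-d)ζ`. If `p`
converges along the radius, the slopes converge to `e^P`, and the relative error tends to zero. -/
theorem hasDerivWithinAt_diskExtend (h : IsDirichletConformal f p Q) {ζ P : ℂ} (hζ : ‖ζ‖ = 1)
    (hP : Tendsto (fun r : ℝ => p (r * ζ)) (𝓝[<] 1) (𝓝 P)) :
    HasDerivWithinAt (diskExtend f) (exp P) (closedBall 0 1) ζ := by
  rw [hasDerivWithinAt_iff_isLittleO, Asymptotics.isLittleO_iff]
  intro η hη
  set A := ‖exp P‖ with hA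
  have hA0 : 0 < A := norm_pos_iff.2 (exp_ne_zero _)
  have hE : Tendsto (fun r : ℝ => exp (p (r * ζ))) (𝓝[<] 1) (𝓝 (exp P)) :=
    (continuous_exp.tendsto P).comp hP
  obtain ⟨d₁, hd₁, h1⟩ := h.norm_diskExtend_sub_affine_le (show 0 < η / (4 * A) by positivity)
  have hev := hE.eventually (Metric.ball_mem_nhds (exp P) (show 0 < min (η / 2) A by positivity))
  have hd : Tendsto (fun z : ℂ => 1 - ‖z - ζ‖) (𝓝[≠] ζ) (𝓝[<] 1) := by
    refine tendsto_nhdsWithin_iff.2 ⟨?_, ?_⟩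
    · have : Tendsto (fun z : ℂ => 1 - ‖z - ζ‖) (𝓝 ζ) (𝓝 (1 - ‖ζ - ζ‖)) := by
        have : Continuous fun z : ℂ => 1 - ‖z - ζ‖ := by fun_prop
        exact this.tendsto ζ
      simp only [sub_self, norm_zero, sub_zero] at this
      exact this.mono_left nhdsWithin_le_nhds
    · filter_upwards [self_mem_nhdsWithin] with z hz
      have : 0 < ‖z - ζ‖ := norm_pos_iff.2 (sub_ne_zero.2 hz)
      simpa using sub_ne_zero.2 hz
  have hev2 := eventually_nhdsWithin_iff.1 (hd.eventually hev)
  filter_upwards [mem_nhdsWithin_of_mem_nhds hev2, self_mem_nhdsWithin,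
    mem_nhdsWithin_of_mem_nhds (closedBall_mem_nhds ζ hd₁.1)] with z hz1 hz2 hz3
  rcases eq_or_ne z ζ with rfl | hne
  · simp
  have hz4 := h1 ζ hζ z (by simpa using hz2) hne (by simpa [dist_eq_norm] using hz3)
  have hz5 := hz1 hne
  push_cast at hz4 hz5
  obtain ⟨B, hB⟩ : ∃ B : ℂ, B = exp (p ((1 - (‖z - ζ‖ : ℝ)) * ζ)) := ⟨_, rfl⟩
  rw [← hB] at hz4
  rw [← hB, dist_eq_norm, lt_min_iff] at hz5
  have hBn : ‖B‖ ≤ 2 * A := by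
    have : B = (B - exp P) + exp P := by ring
    rw [this]
    exact (norm_add_le _ _).trans (by linarith [hz5.2])
  have e1 : diskExtend f z - diskExtend f ζ - (z - ζ) • exp P =
    (diskExtend f z - diskExtend f ζ - B * (z - ζ)) + (B - exp P) * (z - ζ) := by
      rw [smul_eq_mul]; ring
  rw [e1]
  refine (norm_add_le _ _).trans ?_
  rw [norm_mul]
  have e2 : η / (4 * A) * ‖z - ζ‖ * ‖B‖ ≤ η / (4 * A) * ‖z - ζ‖ * (2 * A) := by gcongr
  have e3 : η / (4 * A) * ‖z - ζ‖ * (2 * A) = η / 2 * ‖z - ζ‖ := by field_simp; ring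
  nlinarith [mul_le_mul_of_nonneg_right hz5.1.le (norm_nonneg (z - ζ))]

end IsDirichletConformal

end

/-! ### Injectivity of the extension on the closed disk -/

section
open Metric Set

theorem exists_continuous_log {X : Type*} [TopologicalSpace X] [LocallyPathConnectedSpace X]
    [ContractibleSpace X] {g : X → ℂ} (hg : Continuous g) (h0 : ∀ x, g x ≠ 0) :
    ∃ ℓ : X → ℂ, Continuous ℓ ∧ ∀ x, exp (ℓ x) = g x := by
  have hs : IsSimplyConnected (univ : Set X) :=
    (Homeomorph.Set.univ X).toHomotopyEquiv.simplyConnectedSpace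
  obtain ⟨ℓ, h1, h2⟩ := exists_continuousOn_eqOn_exp_comp hs isOpen_univ hg.continuousOn
    (by rintro ⟨x, -, hx⟩; exact h0 x hx)
  exact ⟨ℓ, continuousOn_univ.1 h1, fun x => h2 (mem_univ x)⟩

theorem eq_of_exp_eq_one {D : ℝ → ℂ} (hD : Continuous D) (h1 : ∀ t, exp (D t) = 1) (s t : ℝ) :
    D s = D t := by
  choose n hn using fun t => Complex.exp_eq_one_iff.1 (h1 t)
  have hc : Continuous n := by
    rw [Int.isClosedEmbedding_coe_real.isInducing.continuous_iff]
    have : ((Int.cast : ℤ → ℝ) ∘ n) = fun t => (D t).im / (2 * Real.pi) := by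
      ext t
      have h3 := congrArg Complex.im (hn t)
      have h4 : ((n t : ℂ) * (2 * Real.pi * I)).im = n t * (2 * Real.pi) := by
        have : ((n t : ℂ) * (2 * Real.pi * I)) = ((n t * (2 * Real.pi) : ℝ) : ℂ) * I := by
          push_cast; ring
        rw [this, im_ofReal_mul]; simp
      rw [h3, h4]
      have := Real.pi_pos
      simp only [Function.comp]
      field_simp
    rw [this]
    fun_prop
  rw [hn s, hn t, PreconnectedSpace.constant inferInstance hc]

theorem exists_int_of_exp_add_two_pi {ℓ : ℝ → ℂ} (hℓ : Continuous ℓ)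
    (h : ∀ t, exp (ℓ (t + 2 * Real.pi)) = exp (ℓ t)) :
    ∃ n : ℤ, ∀ t, ℓ (t + 2 * Real.pi) = ℓ t + n * (2 * Real.pi * I) := by
  have h1 : ∀ t, exp (ℓ (t + 2 * Real.pi) - ℓ t) = 1 := fun t => by
    rw [Complex.exp_sub, h, div_self (exp_ne_zero _)]
  obtain ⟨n, hn⟩ := Complex.exp_eq_one_iff.1 (h1 0)
  refine ⟨n, fun t => ?_⟩
  have := eq_of_exp_eq_one (D := fun t => ℓ (t + 2 * Real.pi) - ℓ t) (by fun_prop) h1 t 0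
  simp only [hn] at this
  linear_combination this

theorem circlePt_eq_iff {s t : ℝ} :
    circlePt s = circlePt t ↔ ∃ n : ℤ, s = t + n * (2 * Real.pi) := by
  rw [circlePt, circlePt, Complex.exp_eq_exp_iff_exists_int]
  refine exists_congr fun n => ?_
  have : (t * I + n * (2 * Real.pi * I) : ℂ) = ((t + n * (2 * Real.pi) : ℝ) : ℂ) * I := by
    push_cast; ring
  rw [this, mul_left_inj' I_ne_zero, ofReal_inj]

theorem circlePt_ne_of_abs_lt {s t : ℝ} (hne : s ≠ t) (hlt : |s - t| < 2 * Real.pi) :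
    circlePt s ≠ circlePt t := by
  rw [Ne, circlePt_eq_iff]
  rintro ⟨n, hn⟩
  have h1 : s - t = n * (2 * Real.pi) := by linarith
  rw [h1, abs_mul, abs_of_pos Real.two_pi_pos] at hlt
  have h2 : |(n : ℝ)| < 1 := by
    by_contra! hc
    nlinarith [Real.two_pi_pos]
  have h3 : n = 0 := by
    have : |n| < 1 := by exact_mod_cast h2
    exact Int.abs_lt_one_iff.1 this
  exact hne (by simpa [h3] using hn)

theorem norm_circlePt_sub_le (s t : ℝ) : ‖circlePt s - circlePt t‖ ≤ |s - t| := by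
  have h1 : circlePt s - circlePt t = circlePt t * (exp (I * ((s - t : ℝ) : ℂ)) - 1) := by
    have : circlePt s = circlePt t * exp (I * ((s - t : ℝ) : ℂ)) := by
      rw [circlePt, circlePt, ← Complex.exp_add]
      congr 1; push_cast; ring
    rw [this]; ring
  rw [h1, norm_mul, norm_circlePt, one_mul]
  exact Real.norm_exp_I_mul_ofReal_sub_one_le

theorem exists_circlePt_eq {ζ : ℂ} (hζ : ‖ζ‖ = 1) : ∃ t, circlePt t = ζ :=
  ⟨arg ζ, by have := norm_mul_exp_arg_mul_I ζ; rwa [hζ, ofReal_one, one_mul] at this⟩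

/-- If `G a = G b` there is an interior local extremum, but around it `G` is continuous and
injective, hence strictly monotone. -/
theorem injective_of_locally_ne {G : ℝ → ℝ} (hG : Continuous G) {d : ℝ} (hd : 0 < d)
    (h : ∀ s t, s ≠ t → |s - t| ≤ d → G s ≠ G t) : Function.Injective G := by
  have key : ∀ a b, a < b → G a ≠ G b := by
    intro a b hab heq
    obtain ⟨c, -, hc⟩ := exists_isLocalExtr_Ioo hab hG.continuousOn heq
    have hi : InjOn G (Icc (c - d / 2) (c + d / 2)) := by
      intro s hs t ht hst
      by_contra hne
      exact h s t hne (abs_le.2 ⟨by linarith [hs.1, ht.2], by linarith [hs.2, ht.1]⟩) hst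
    have hm := hG.continuousOn.strictMonoOn_of_injOn_Icc' (by linarith : c - d / 2 ≤ c + d / 2) hi
    have hcm : c ∈ Icc (c - d / 2) (c + d / 2) := ⟨by linarith, by linarith⟩
    have hr : ∀ᶠ x in 𝓝[>] c, x ∈ Ioo c (c + d / 2) := Ioo_mem_nhdsGT (by linarith)
    have hl : ∀ᶠ x in 𝓝[<] c, x ∈ Ioo (c - d / 2) c := Ioo_mem_nhdsLT (by linarith)
    rcases hc with hc | hc
    · obtain ⟨x, hx, hx'⟩ := (hr.and (hc.filter_mono nhdsWithin_le_nhds)).exists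
      obtain ⟨y, hy, hy'⟩ := (hl.and (hc.filter_mono nhdsWithin_le_nhds)).exists
      have hxm : x ∈ Icc (c - d / 2) (c + d / 2) := ⟨by linarith [hx.1], hx.2.le⟩
      have hym : y ∈ Icc (c - d / 2) (c + d / 2) := ⟨hy.1.le, by linarith [hy.2]⟩
      rcases hm with hm | hm
      · exact absurd (hm hym hcm hy.2) (not_lt.2 hy')
      · exact absurd (hm hcm hxm hx.1) (not_lt.2 hx')
    · obtain ⟨x, hx, hx'⟩ := (hr.and (hc.filter_mono nhdsWithin_le_nhds)).exists
      obtain ⟨y, hy, hy'⟩ := (hl.and (hc.filter_mono nhdsWithin_le_nhds)).exists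
      have hxm : x ∈ Icc (c - d / 2) (c + d / 2) := ⟨by linarith [hx.1], hx.2.le⟩
      have hym : y ∈ Icc (c - d / 2) (c + d / 2) := ⟨hy.1.le, by linarith [hy.2]⟩
      rcases hm with hm | hm
      · exact absurd (hm hcm hxm hx.1) (not_lt.2 hx')
      · exact absurd (hm hym hcm hy.2) (not_lt.2 hy')
  intro s t hst
  rcases lt_trichotomy s t with h1 | h1 | h1
  · exact absurd hst (key s t h1)
  · exact h1
  · exact absurd hst.symm (key t s h1)

/-- The retraction of the plane onto the closed unit disk. -/
theorem exists_retraction_closedBall : ∃ R : ℂ → ℂ, Continuous R ∧ (∀ z, ‖R z‖ ≤ 1) ∧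
    ∀ z, ‖z‖ ≤ 1 → R z = z := by
  refine ⟨fun z => z / (max 1 ‖z‖ : ℝ), ?_, fun z => ?_, fun z hz => ?_⟩
  · refine continuous_id.div (by fun_prop) fun z => ?_
    exact ofReal_ne_zero.2 (by positivity)
  · rw [norm_div, norm_real, Real.norm_of_nonneg (by positivity)]
    exact div_le_one_of_le₀ (le_max_right _ _) (by positivity)
  · simp [max_eq_left hz]

/-- A continuous map of the closed disk which is holomorphic and univalent at the centre, maps the
circle into a Jordan curve and is locally injective there, is injective on the circle. -/
theorem injOn_sphere_of_locally_ne {F : ℂ → ℂ} (h : ℂ ≃ₜ ℂ)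
    (hF : ContinuousOn F (closedBall 0 1)) (hd : DifferentiableAt ℂ F 0) (hd0 : deriv F 0 ≠ 0)
    (hF0 : ∀ z, ‖z‖ ≤ 1 → z ≠ 0 → F z ≠ F 0)
    (hh : ∀ ζ, ‖ζ‖ = 1 → h ζ ≠ F 0)
    (hm : ∀ ζ, ‖ζ‖ = 1 → ‖h.symm (F ζ)‖ = 1)
    {d₀ : ℝ} (hd₀ : 0 < d₀)
    (hl : ∀ ζ, ‖ζ‖ = 1 → ∀ z, ‖z‖ = 1 → z ≠ ζ → ‖z - ζ‖ ≤ d₀ → F z ≠ F ζ) :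
    InjOn F (sphere 0 1) := by
  have hcl : ∀ t, circlePt t ∈ closedBall (0 : ℂ) 1 := fun t => by simp
  have hFc : Continuous fun t => F (circlePt t) :=
    hF.comp_continuous continuous_circlePt hcl
  -- A lift `G` of the circle map `h⁻¹ ∘ F`; the integer `n` obtained below is its degree.
  obtain ⟨ℓ₁, hℓ₁, hℓ₁e⟩ := exists_continuous_log (g := fun t : ℝ => h.symm (F (circlePt t)))
    (h.symm.continuous.comp hFc) fun t h0 => by
      have := hm _ (norm_circlePt t)
      simp [h0] at this
  have hre : ∀ t, (ℓ₁ t).re = 0 := fun t => by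
    have h1 := hm _ (norm_circlePt t)
    have h2 := congrArg norm (hℓ₁e t)
    simp only [h1, norm_exp] at h2
    simpa using h2
  set G : ℝ → ℝ := fun t => (ℓ₁ t).im with hGdef
  have hG : Continuous G := by fun_prop
  have hℓG : ∀ t, ℓ₁ t = G t * I := fun t => by
    apply Complex.ext <;> simp [hre, G]
  have hGe : ∀ t, h.symm (F (circlePt t)) = circlePt (G t) := fun t => by
    rw [← hℓ₁e t, hℓG, circlePt]
  have hGh : ∀ t, F (circlePt t) = h (circlePt (G t)) := fun t => by
    rw [← hGe, h.apply_symm_apply]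
  obtain ⟨n, hn⟩ := exists_int_of_exp_add_two_pi hℓ₁ fun t => by
    simp only [hℓ₁e, circlePt_add_two_pi]
  have hGn : ∀ t, G (t + 2 * Real.pi) = G t + n * (2 * Real.pi) := fun t => by
    have := hn t
    rw [hℓG, hℓG] at this
    have h2 : ((G (t + 2 * Real.pi) : ℂ)) * I = ((G t + n * (2 * Real.pi) : ℝ) : ℂ) * I := by
      rw [this]; push_cast; ring
    exact_mod_cast mul_right_cancel₀ I_ne_zero h2
  -- A logarithm along the Jordan curve `h(e^{is})`, centred at `F 0`; the integer `m` below is the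
  -- winding number of that curve about `F 0`.
  obtain ⟨ℓ, hℓ, hℓe⟩ := exists_continuous_log (g := fun s : ℝ => h (circlePt s) - F 0)
    ((h.continuous.comp continuous_circlePt).sub continuous_const)
    fun s => sub_ne_zero.2 (hh _ (norm_circlePt s))
  obtain ⟨m, hm'⟩ := exists_int_of_exp_add_two_pi hℓ fun t => by
    simp only [hℓe, circlePt_add_two_pi]
  obtain ⟨R, hR, hR1, hR2⟩ := exists_retraction_closedBall
  have hds : ContinuousOn (dslope F 0) (closedBall 0 1) :=
    (continuousOn_dslope (closedBall_mem_nhds 0 one_pos)).2 ⟨hF, hd⟩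
  -- The quotient `(F z - F 0)/z` has no zero on the closed disk, so it has a logarithm there (the
  -- retraction extends it to the plane). Hence `F` of the circle winds exactly once about `F 0`.
  obtain ⟨K, hK, hKe⟩ := exists_continuous_log (g := fun z => dslope F 0 (R z))
    (hds.comp_continuous hR fun z => by simpa using hR1 z) fun z => by
      by_cases hz : R z = 0
      · rw [hz, dslope_same]; exact hd0
      · rw [dslope_of_ne _ hz, slope_def_field]
        exact div_ne_zero (sub_ne_zero.2 (hF0 _ (hR1 z) hz)) (by simpa using hz)
  have hKF : ∀ t, F (circlePt t) - F 0 = circlePt t * exp (K (circlePt t)) := fun t => by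
    rw [hKe, hR2 _ (by simp), dslope_of_ne _ (circlePt_ne_zero t), slope_def_field, sub_zero]
    field_simp [circlePt_ne_zero t]
  have hE : ∀ t, exp (ℓ (G t) - (t * I + K (circlePt t))) = 1 := fun t => by
    rw [Complex.exp_sub, hℓe, ← hGh, hKF, Complex.exp_add, ← circlePt]
    exact div_self (mul_ne_zero (circlePt_ne_zero _) (exp_ne_zero _))
  have hEc : Continuous fun t : ℝ => ℓ (G t) - (t * I + K (circlePt t)) := by
    have := continuous_circlePt
    fun_prop
  have hE2 := eq_of_exp_eq_one hEc hE (0 + 2 * Real.pi) 0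
  have hper : Function.Periodic (fun s : ℝ => ℓ s - m * I * s) (2 * Real.pi) := fun s => by
    simp only [hm']; push_cast; ring
  have hper2 := hper.int_mul n (G 0)
  -- The same winding number is `n m`, by factoring `F` on the circle through `h`. So `n = ±1`, and
  -- the strict monotonicity of the lift will make the circle map injective.
  have hnm : n * m = 1 := by
    simp only [circlePt_add_two_pi, hGn] at hE2
    push_cast at hE2 hper2
    have h3 : ((n * m : ℤ) : ℂ) * (2 * Real.pi * I) = ((1 : ℤ) : ℂ) * (2 * Real.pi * I) := by
      push_cast
      linear_combination (-1 : ℂ) * hper2 + hE2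
    have := mul_right_cancel₀ two_pi_I_ne_zero h3
    exact_mod_cast this
  have hGi : Function.Injective G := by
    refine injective_of_locally_ne hG (show 0 < min d₀ 1 by positivity) fun s t hne hst heq => ?_
    have hlt : |s - t| < 2 * Real.pi :=
      (hst.trans (min_le_right _ _)).trans_lt (by linarith [Real.pi_gt_three])
    refine hl _ (norm_circlePt t) _ (norm_circlePt s) (circlePt_ne_of_abs_lt hne hlt)
      ((norm_circlePt_sub_le s t).trans (hst.trans (min_le_left _ _))) ?_
    rw [hGh, hGh, heq]
  have hperG : Function.Periodic (fun s : ℝ => G s - n * s) (2 * Real.pi) := fun s => by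
    simp only [hGn]; ring
  intro x hx y hy hxy
  obtain ⟨s, rfl⟩ := exists_circlePt_eq (by simpa using hx)
  obtain ⟨t, rfl⟩ := exists_circlePt_eq (by simpa using hy)
  rw [hGh, hGh, h.injective.eq_iff, circlePt_eq_iff] at hxy
  obtain ⟨k, hk⟩ := hxy
  have hn2 : (n : ℝ) * n = 1 := by
    rcases Int.eq_one_or_neg_one_of_mul_eq_one hnm with h1 | h1 <;> simp [h1]
  have h5 := hperG.int_mul (k * n) t
  push_cast at h5
  -- As `n² = 1`, a shift of `G` by `k` periods is a shift of its argument by `k n` periods.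
  have h6 : G s = G (t + k * n * (2 * Real.pi)) := by
    linear_combination hk - h5 - k * (2 * Real.pi) * hn2
  rw [circlePt_eq_iff]
  exact ⟨k * n, by push_cast; exact hGi h6⟩

namespace IsDirichletConformal

variable {f p Q : ℂ → ℂ} {Ω : Set ℂ}

theorem deriv_diskExtend (h : IsDirichletConformal f p Q) {z : ℂ} (hz : z ∈ ball (0 : ℂ) 1) :
    HasDerivAt (diskExtend f) (exp (p z)) z := by
  refine (h.hasDerivAt z hz).congr_of_eventuallyEq ?_
  filter_upwards [isOpen_ball.mem_nhds hz] with w hw using h.diskExtend_eq hw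

/-- If a boundary value lay in `Ω`, continuity of the inverse there would give `z = f⁻¹(f(z))` a
limit in the open disk, while `z → ζ`. -/
theorem diskExtend_notMem (h : IsDirichletConformal f p Q) (hf : IsUniformization f Ω) {ζ : ℂ}
    (hζ : ‖ζ‖ = 1) : diskExtend f ζ ∉ Ω := by
  intro hmem
  have := nhdsWithin_ball_neBot hζ.le
  have h1 : Tendsto f (𝓝[ball 0 1] ζ) (𝓝 (diskExtend f ζ)) :=
    tendsto_extendFrom (h.exists_tendsto hζ.le)
  have h2 : Tendsto (fun z => IsUniformization.inv f (f z)) (𝓝[ball 0 1] ζ)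
      (𝓝 (IsUniformization.inv f (diskExtend f ζ))) :=
    (hf.hasDerivAt_inv hmem).continuousAt.tendsto.comp h1
  have h3 : Tendsto (fun z => IsUniformization.inv f (f z)) (𝓝[ball 0 1] ζ) (𝓝 ζ) := by
    refine Tendsto.congr' ?_ (tendsto_id.mono_left nhdsWithin_le_nhds)
    filter_upwards [self_mem_nhdsWithin] with z hz using (hf.inv_apply hz).symm
  have h4 := hf.inv_mem hmem
  rw [tendsto_nhds_unique h2 h3] at h4
  simp [hζ] at h4

theorem image_diskExtend (h : IsDirichletConformal f p Q) (hf : IsUniformization f Ω) :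
    diskExtend f '' closedBall 0 1 = closure Ω := by
  apply Subset.antisymm
  · rintro _ ⟨z, hz, rfl⟩
    have := nhdsWithin_ball_neBot (ζ := z) (by simpa using hz)
    refine mem_closure_of_tendsto (tendsto_extendFrom (h.exists_tendsto (by simpa using hz))) ?_
    filter_upwards [self_mem_nhdsWithin] with w hw using hf.mapsTo hw
  · refine closure_minimal ?_
      ((isCompact_closedBall 0 1).image_of_continuousOn h.continuousOn_diskExtend).isClosed
    rw [← hf.image_eq]
    rintro _ ⟨z, hz, rfl⟩
    exact ⟨z, ball_subset_closedBall hz, h.diskExtend_eq hz⟩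

/-- What is used of the quasidisk is topological: a homeomorphism of the plane takes the unit disk
to `Ω`, hence the unit circle to its boundary. Interior and boundary values are disjoint, so it
remains to treat the circle. -/
theorem injOn_diskExtend (h : IsDirichletConformal f p Q) (hf : IsUniformization f Ω)
    (g : ℂ ≃ₜ ℂ) (hg : g '' ball 0 1 = Ω) : InjOn (diskExtend f) (closedBall 0 1) := by
  have h0 : (0 : ℂ) ∈ ball (0 : ℂ) 1 := by simp
  have hnm : ∀ ζ, ‖ζ‖ = 1 → diskExtend f ζ ∉ Ω := fun ζ hζ => h.diskExtend_notMem hf hζ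
  have hin : ∀ z ∈ ball (0 : ℂ) 1, diskExtend f z ∈ Ω := fun z hz => by
    rw [h.diskExtend_eq hz]; exact hf.mapsTo hz
  have hcl : closure Ω = g '' closedBall 0 1 := by
    rw [← hg, ← g.image_closure, closure_ball _ one_ne_zero]
  obtain ⟨d₀, hd₀, hl⟩ := h.diskExtend_locally_ne
  have hball : InjOn (diskExtend f) (ball 0 1) := fun x hx y hy hxy =>
    h.injOn hx hy (by rwa [h.diskExtend_eq hx, h.diskExtend_eq hy] at hxy)
  have hs := injOn_sphere_of_locally_ne (F := diskExtend f) g h.continuousOn_diskExtend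
    (h.deriv_diskExtend h0).differentiableAt
    (by rw [(h.deriv_diskExtend h0).deriv]; exact exp_ne_zero _)
    (fun z hz hz0 heq => by
      rcases hz.lt_or_eq with h1 | h1
      · exact hz0 (hball (by simpa using h1) h0 heq)
      · exact hnm z h1 (heq ▸ hin 0 h0))
    (fun ζ hζ heq => by
      have h1 := hin 0 h0
      rw [← heq, ← hg] at h1
      obtain ⟨w, hw, hwe⟩ := h1
      rw [g.injective hwe] at hw
      simp [hζ] at hw)
    (fun ζ hζ => by
      have h1 : diskExtend f ζ ∈ closure Ω := by
        rw [← h.image_diskExtend hf]; exact ⟨ζ, by simp [hζ], rfl⟩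
      rw [hcl] at h1
      obtain ⟨w, hw, hwe⟩ := h1
      rw [← hwe, g.symm_apply_apply]
      refine le_antisymm (by simpa using hw) (not_lt.1 fun hlt => hnm ζ hζ ?_)
      rw [← hwe, ← hg]
      exact ⟨w, by simpa using hlt, rfl⟩)
    hd₀ (fun ζ hζ z hz => hl ζ hζ z hz.le)
  intro x hx y hy hxy
  have hx' : ‖x‖ ≤ 1 := by simpa using hx
  have hy' : ‖y‖ ≤ 1 := by simpa using hy
  rcases hx'.lt_or_eq with h1 | h1 <;> rcases hy'.lt_or_eq with h2 | h2
  · exact hball (by simpa using h1) (by simpa using h2) hxy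
  · exact absurd (hxy ▸ hin x (by simpa using h1)) (hnm y h2)
  · exact absurd (hxy ▸ hin y (by simpa using h2)) (hnm x h1)
  · exact hs (by simpa using h1) (by simpa using h2) hxy

end IsDirichletConformal

end

/-! ### Normal and tangent of the boundary curve -/

section
open Metric Set
open scoped ComplexConjugate

theorem dot_eq_re (z w : ℂ) : dot z w = (z * conj w).re := by
  simp [dot]

theorem abs_dot_le (z w : ℂ) : |dot z w| ≤ ‖z‖ * ‖w‖ := by
  rw [dot_eq_re]
  exact (abs_re_le_norm _).trans (by simp)

theorem dot_sub_left (z z' w : ℂ) : dot (z - z') w = dot z w - dot z' w := by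
  simp only [dot, sub_re, sub_im]; ring

theorem dot_self (z : ℂ) : dot z z = ‖z‖ ^ 2 := by
  rw [Complex.sq_norm, normSq_apply, dot]

theorem dot_mul_left_cancel (a z w : ℂ) : dot (a * z) (a * w) = ‖a‖ ^ 2 * dot z w := by
  rw [Complex.sq_norm, normSq_apply]
  simp only [dot, mul_re, mul_im]; ring

theorem norm_add_sq_dot (z w : ℂ) : ‖z + w‖ ^ 2 = ‖z‖ ^ 2 + 2 * dot z w + ‖w‖ ^ 2 := by
  simp only [Complex.sq_norm, normSq_apply, dot, add_re, add_im]; ring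

theorem dot_comm (z w : ℂ) : dot z w = dot w z := by
  simp only [dot]; ring

theorem dot_div_real (z w : ℂ) (r : ℝ) : dot z (w / r) = dot z w / r := by
  simp only [dot, div_ofReal_re, div_ofReal_im]; ring

namespace IsDirichletConformal

variable {f p Q : ℂ → ℂ} {Ω : Set ℂ}

/-- Compactness: the inverse of the injective extension is continuous at boundary points. -/
theorem exists_ball_of_diskExtend (h : IsDirichletConformal f p Q)
    (hi : InjOn (diskExtend f) (closedBall 0 1)) {ζ : ℂ} (hζ : ‖ζ‖ = 1) {η : ℝ} (hη : 0 < η) :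
    ∀ᶠ w in 𝓝 (0 : ℂ), ∀ z, ‖z‖ ≤ 1 → diskExtend f z = diskExtend f ζ + w → ‖z - ζ‖ < η := by
  have hK : IsCompact (closedBall (0 : ℂ) 1 \ ball ζ η) :=
    (isCompact_closedBall 0 1).diff isOpen_ball
  have hc := (hK.image_of_continuousOn (h.continuousOn_diskExtend.mono sdiff_subset)).isClosed
  have hn : diskExtend f ζ + 0 ∈ (diskExtend f '' (closedBall (0 : ℂ) 1 \ ball ζ η))ᶜ := by
    rw [add_zero]
    rintro ⟨z, ⟨hz, hz'⟩, hze⟩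
    rw [hi hz (by simp [hζ]) hze] at hz'
    exact hz' (mem_ball_self hη)
  have hcont : Continuous fun w : ℂ => diskExtend f ζ + w := by fun_prop
  filter_upwards [hcont.continuousAt.preimage_mem_nhds (hc.isOpen_compl.mem_nhds hn)]
    with w hw z hz hze
  by_contra hlt
  exact hw ⟨z, ⟨by simpa using hz, by rwa [mem_ball, dist_eq_norm]⟩, hze⟩

/-- The extension is tangent to `z ↦ A(z - ζ)` with `A = e^P`, a similarity that carries the half
plane `⟨z - ζ, ζ⟩ < 0` to the one opposite to `Aζ`. For the outer cone it is enough to estimate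
points of the image. For the inner cone, points must be shown to belong to the image, which needs a
quantitative open mapping theorem. -/
theorem isOutwardNormal (h : IsDirichletConformal f p Q) (hf : IsUniformization f Ω)
    (hi : InjOn (diskExtend f) (closedBall 0 1)) {ζ P : ℂ} (hζ : ‖ζ‖ = 1)
    (hP : Tendsto (fun r : ℝ => p (r * ζ)) (𝓝[<] 1) (𝓝 P)) :
    IsOutwardNormal Ω (diskExtend f ζ) (exp P * ζ / ‖exp P‖) := by
  have hD := h.hasDerivWithinAt_diskExtend hζ hP
  obtain ⟨A, hA⟩ : ∃ A, A = exp P := ⟨_, rfl⟩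
  rw [← hA] at hD ⊢
  have hA0 : A ≠ 0 := hA ▸ exp_ne_zero _
  obtain ⟨α, hα⟩ : ∃ α, α = ‖A‖ := ⟨_, rfl⟩
  rw [← hα]
  have hα0 : 0 < α := hα ▸ norm_pos_iff.2 hA0
  have hD' : ∀ ε > 0, ∃ η > 0, ∀ z, ‖z‖ ≤ 1 → ‖z - ζ‖ < η →
      ‖diskExtend f z - diskExtend f ζ - A * (z - ζ)‖ ≤ ε * ‖z - ζ‖ := fun ε hε => by
    rw [hasDerivWithinAt_iff_isLittleO, Asymptotics.isLittleO_iff] at hD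
    obtain ⟨η, hη, hb⟩ := Metric.mem_nhdsWithin_iff.1 (hD hε)
    refine ⟨η, hη, fun z hz hzη => ?_⟩
    have h1 : z ∈ ball ζ η ∩ closedBall 0 1 :=
      ⟨by rwa [mem_ball, dist_eq_norm], by simpa using hz⟩
    have h2 : ‖diskExtend f z - diskExtend f ζ - (z - ζ) • A‖ ≤ ε * ‖z - ζ‖ := hb h1
    rwa [smul_eq_mul, mul_comm] at h2
  refine ⟨?_, fun c hc => ?_, fun c hc => ?_⟩
  · rw [norm_div, norm_mul, hζ, norm_real, Real.norm_of_nonneg hα0.le, ← hα, mul_one,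
      div_self hα0.ne']
  · set c' := min c 1 with hc'
    have hc'0 : 0 < c' := by positivity
    have hc'1 : c' ≤ 1 := min_le_right _ _
    -- The candidate preimage is `ζ + w/A`, at distance `s = |w|/α` from `ζ`. The ball of radius
    -- `c's/2` about it stays in the disk and within `2s` of `ζ`, so the error there is at most
    -- `αc's/16`.
    have hε : 0 < α * c' / 32 := by positivity
    obtain ⟨η, hη, hb⟩ := hD' _ hε
    have hr : 0 < min (α * c') (α * η / 2) := by positivity
    filter_upwards [mem_nhdsWithin_of_mem_nhds (ball_mem_nhds (0 : ℂ) hr),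
      self_mem_nhdsWithin] with w hw hw0 hdw
    rw [mem_ball_zero_iff, lt_min_iff] at hw
    have hw0 : w ≠ 0 := hw0
    have hwn : 0 < ‖w‖ := norm_pos_iff.2 hw0
    obtain ⟨s, hs⟩ : ∃ s, s = ‖w‖ / α := ⟨_, rfl⟩
    have hs0 : 0 < s := hs ▸ by positivity
    have hws : ‖w‖ = s * α := by rw [hs]; field_simp
    have hsc : s < c' := by rw [hs, div_lt_iff₀ hα0]; linarith [hw.1]
    have hsη : 2 * s < η := by
      have : s < η / 2 := by rw [hs, div_lt_iff₀ hα0]; linarith [hw.2]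
      linarith
    obtain ⟨z₀, hz₀⟩ : ∃ z₀, z₀ = ζ + w / A := ⟨_, rfl⟩
    have hz₀ζ : z₀ - ζ = w / A := by rw [hz₀]; ring
    have hwA : ‖w / A‖ = s := by rw [norm_div, ← hα, hs]
    have hdot : dot ζ (w / A) ≤ -(c' * s) := by
      have e1 : dot (A * (w / A)) (A * ζ) = α ^ 2 * dot (w / A) ζ := by
        rw [dot_mul_left_cancel, hα]
      rw [mul_div_cancel₀ _ hA0] at e1
      have e2 : dot w (A * ζ) ≤ -(c' * ‖w‖) * α := by
        rw [dot_div_real, div_le_iff₀ hα0] at hdw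
        refine hdw.trans ?_
        have : c' * ‖w‖ ≤ c * ‖w‖ := by gcongr; exact min_le_left _ _
        nlinarith
      rw [dot_comm]
      rw [e1, hws] at e2
      have : α ^ 2 * dot (w / A) ζ ≤ α ^ 2 * -(c' * s) := by linarith
      exact le_of_mul_le_mul_left this (by positivity)
    have hnz₀ : ‖z₀‖ ≤ 1 - c' * s + s ^ 2 / 2 := by
      have e1 : ‖z₀‖ ^ 2 ≤ 1 - 2 * (c' * s) + s ^ 2 := by
        rw [hz₀, norm_add_sq_dot, hζ, hwA]; linarith
      have e2 : (‖z₀‖ - 1) ^ 2 ≥ 0 := sq_nonneg _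
      linarith
    have hin : ∀ z ∈ closedBall z₀ (c' * s / 2), ‖z‖ < 1 ∧ ‖z - ζ‖ ≤ 2 * s := by
      intro z hz
      rw [mem_closedBall, dist_eq_norm] at hz
      constructor
      · have : ‖z‖ ≤ ‖z - z₀‖ + ‖z₀‖ := by
          simpa using norm_add_le (z - z₀) z₀
        nlinarith
      · have : z - ζ = (z - z₀) + (z₀ - ζ) := by ring
        rw [this]
        refine (norm_add_le _ _).trans ?_
        rw [hz₀ζ, hwA]
        nlinarith
    have hb' : ∀ z ∈ closedBall z₀ (c' * s / 2),
        ‖f z - diskExtend f ζ - A * (z - ζ)‖ ≤ α * c' / 16 * s := by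
      intro z hz
      have h1 := hin z hz
      have h2 := hb z h1.1.le (by linarith [h1.2])
      rw [h.diskExtend_eq (by simpa using h1.1)] at h2
      refine h2.trans ?_
      nlinarith [mul_le_mul_of_nonneg_left h1.2 hε.le]
    have hz₀m : z₀ ∈ closedBall z₀ (c' * s / 2) := mem_closedBall_self (by positivity)
    have hsub : closedBall z₀ (c' * s / 2) ⊆ ball 0 1 := fun z hz => by
      simpa using (hin z hz).1
    have hcenter := hb' z₀ hz₀m
    rw [hz₀ζ, mul_div_cancel₀ _ hA0] at hcenter
    -- On the sphere `f` differs from its central value by at least `αc's/2 - 2αc's/16 = 3αc's/8`.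
    -- The image therefore contains the ball of half that radius, and `3/16` exceeds the central
    -- error `1/16`.
    have hbs := DiffContOnCl.ball_subset_image_closedBall (f := f) (z₀ := z₀) (r := c' * s / 2)
      (ε := 3 / 8 * (α * c' * s))
      ((h.differentiableOn.mono hsub).diffContOnCl_ball (le_refl _)) (by positivity)
      (fun z hz => ?_) ?_
    · have hmem : diskExtend f ζ + w ∈ ball (f z₀) (3 / 8 * (α * c' * s) / 2) := by
        rw [mem_ball, dist_comm, dist_eq_norm, ← sub_sub]
        refine hcenter.trans_lt ?_
        have : 0 < α * c' * s := by positivity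
        linarith
      obtain ⟨z, hz, hze⟩ := hbs hmem
      rw [← hze]
      exact hf.mapsTo (hsub hz)
    · have h1 := hb' z (sphere_subset_closedBall hz)
      have h2 : f z - f z₀ = A * (z - z₀) + ((f z - diskExtend f ζ - A * (z - ζ)) -
        (f z₀ - diskExtend f ζ - w)) := by
          have : A * (z₀ - ζ) = w := by rw [hz₀ζ, mul_div_cancel₀ _ hA0]
          linear_combination this
      have h3 : ‖A * (z - z₀)‖ = α * (c' * s / 2) := by
        rw [norm_mul, ← hα, mem_sphere_iff_norm.1 hz]
      have h4 := norm_sub_le (f z - diskExtend f ζ - A * (z - ζ)) (f z₀ - diskExtend f ζ - w)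
      have h5 := norm_sub_le_norm_add (A * (z - z₀)) ((f z - diskExtend f ζ - A * (z - ζ)) -
        (f z₀ - diskExtend f ζ - w))
      rw [← h2, h3] at h5
      linarith
    · have : ∀ᶠ z in 𝓝[≠] z₀, f z ≠ f z₀ := by
        filter_upwards [self_mem_nhdsWithin, mem_nhdsWithin_of_mem_nhds
          (isOpen_ball.mem_nhds (hsub hz₀m))] with z hz hz1 heq
        exact hz (h.injOn hz1 (hsub hz₀m) heq)
      exact this.frequently.filter_mono nhdsWithin_le_nhds
  -- A point of the closure near the boundary value comes from some `z` near `ζ`. Its linear part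
  -- has nonpositive component along `Aζ`, so `c|w|` is bounded by the error `cα|z - ζ|/4`, although
  -- `|w| ≥ α|z - ζ|/2`.
  · have hε : 0 < min (α / 2) (c * α / 4) := by positivity
    obtain ⟨η, hη, hb⟩ := hD' _ hε
    filter_upwards [mem_nhdsWithin_of_mem_nhds (h.exists_ball_of_diskExtend hi hζ hη),
      self_mem_nhdsWithin] with w hw hw0 hdw hmem
    rw [← h.image_diskExtend hf] at hmem
    obtain ⟨z, hz, hze⟩ := hmem
    have hz' : ‖z‖ ≤ 1 := by simpa using hz
    have h1 := hb z hz' (hw z hz' hze)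
    rw [hze, add_sub_cancel_left] at h1
    have hne : 0 < ‖z - ζ‖ := by
      refine norm_pos_iff.2 (sub_ne_zero.2 ?_)
      rintro rfl
      exact hw0 (by simpa using hze)
    rw [dot_div_real, le_div_iff₀ hα0] at hdw
    have e1 : dot (A * (z - ζ)) (A * ζ) ≤ 0 := by
      rw [dot_mul_left_cancel, dot_sub_left, dot_self, hζ]
      have : dot z ζ ≤ 1 := by
        refine (le_abs_self _).trans ((abs_dot_le _ _).trans ?_)
        rwa [hζ, mul_one]
      nlinarith [sq_nonneg ‖A‖]
    have e2 : dot (w - A * (z - ζ)) (A * ζ) ≤ min (α / 2) (c * α / 4) * ‖z - ζ‖ * α := by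
      refine (le_abs_self _).trans ((abs_dot_le _ _).trans ?_)
      rw [norm_mul, hζ, mul_one, ← hα]
      gcongr
    rw [dot_sub_left] at e2
    have e3 : α * ‖z - ζ‖ ≤ ‖w‖ + min (α / 2) (c * α / 4) * ‖z - ζ‖ := by
      have : A * (z - ζ) = w - (w - A * (z - ζ)) := by ring
      rw [hα, ← norm_mul, this]
      refine (norm_sub_le _ _).trans ?_
      rw [← hα]
      linarith
    have e4 : min (α / 2) (c * α / 4) * ‖z - ζ‖ ≤ α / 2 * ‖z - ζ‖ := by
      gcongr; exact min_le_left _ _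
    have e5 : min (α / 2) (c * α / 4) * ‖z - ζ‖ ≤ c * α / 4 * ‖z - ζ‖ := by
      gcongr; exact min_le_right _ _
    have e6 : c * ‖w‖ * α ≤ c * α / 4 * ‖z - ζ‖ * α := by
      nlinarith
    have e7 : c * ‖w‖ ≤ c * α / 4 * ‖z - ζ‖ := le_of_mul_le_mul_right e6 hα0
    have e8 : c * (α / 2 * ‖z - ζ‖) ≤ c * ‖w‖ := by gcongr; linarith
    nlinarith [mul_pos (mul_pos hc hα0) hne]

theorem unitTangent_diskExtend (h : IsDirichletConformal f p Q) (hf : IsUniformization f Ω)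
    (hi : InjOn (diskExtend f) (closedBall 0 1)) {ζ P : ℂ} (hζ : ‖ζ‖ = 1)
    (hP : Tendsto (fun r : ℝ => p (r * ζ)) (𝓝[<] 1) (𝓝 P)) :
    unitTangent Ω (diskExtend f ζ) = ζ * exp ((Real.pi / 2 + P.im : ℝ) * I) := by
  have hn := h.isOutwardNormal hf hi hζ hP
  have he : ∃ ν, IsOutwardNormal Ω (diskExtend f ζ) ν := ⟨_, hn⟩
  rw [unitTangent, dif_pos he, he.choose_spec.unique hn]
  have h1 : exp P = ‖exp P‖ * exp (P.im * I) := by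
    rw [norm_exp, ofReal_exp, ← Complex.exp_add, re_add_im]
  have h2 : (‖exp P‖ : ℂ) ≠ 0 := ofReal_ne_zero.2 (norm_ne_zero_iff.2 (exp_ne_zero _))
  have h3 : exp P * ζ / ‖exp P‖ = exp (P.im * I) * ζ := by
    nth_rewrite 1 [h1]
    field_simp
  rw [h3, ofReal_add, add_mul, Complex.exp_add]
  push_cast
  rw [exp_pi_div_two_mul_I]
  ring

end IsDirichletConformal

end

/-! ### Radial limits and the radial maximal function -/

section
open Metric Set

/-- The variance is nonnegative: `2m` is the mean of `g` over an interval of length `1/2`. -/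
theorem sq_integral_le_half_mul {g : ℝ → ℝ} (hg : IntegrableOn g (Ioo (1 / 2) 1))
    (hg2 : IntegrableOn (fun r => g r ^ 2) (Ioo (1 / 2) 1)) :
    (∫ r in Ioo (1 / 2 : ℝ) 1, g r) ^ 2 ≤ 1 / 2 * ∫ r in Ioo (1 / 2 : ℝ) 1, g r ^ 2 := by
  obtain ⟨m, hm⟩ : ∃ m, m = ∫ r in Ioo (1 / 2 : ℝ) 1, g r := ⟨_, rfl⟩
  have h0 : 0 ≤ ∫ r in Ioo (1 / 2 : ℝ) 1, (g r - 2 * m) ^ 2 := integral_nonneg fun _ => sq_nonneg _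
  have h1 : ∫ r in Ioo (1 / 2 : ℝ) 1, (g r - 2 * m) ^ 2 =
      (∫ r in Ioo (1 / 2 : ℝ) 1, g r ^ 2) - 4 * m * m + 4 * m ^ 2 * (1 / 2) := by
    have e : ∀ r, (g r - 2 * m) ^ 2 = g r ^ 2 - 4 * m * g r + 4 * m ^ 2 := fun r => by ring
    have hc : IntegrableOn (fun _ : ℝ => 4 * m ^ 2) (Ioo (1 / 2 : ℝ) 1) := integrableOn_const (by simp)
    simp_rw [e]
    have hl : IntegrableOn (fun r => 4 * m * g r) (Ioo (1 / 2 : ℝ) 1) := hg.const_mul _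
    have hs : IntegrableOn (fun r => g r ^ 2 - 4 * m * g r) (Ioo (1 / 2 : ℝ) 1) := hg2.sub hl
    rw [integral_add hs hc, integral_sub hg2 hl, integral_const_mul, ← hm, setIntegral_const]
    simp [Measure.real]
    norm_num
    ring
  rw [← hm]
  nlinarith

/-- The radial boundary values `e^{iθ} ↦ lim_{r → 1} p(r e^{iθ})`. -/
noncomputable def radialLimit (p : ℂ → ℂ) (θ : ℝ) : ℂ :=
  limUnder (𝓝[<] (1 : ℝ)) fun r : ℝ => p (r * circlePt θ)

variable {p Q : ℂ → ℂ}

theorem hasDerivAt_radial (hp : ∀ z ∈ ball (0 : ℂ) 1, HasDerivAt p (Q z) z) {r : ℝ}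
    (hr : r ∈ Ioo (-1 : ℝ) 1) (θ : ℝ) :
    HasDerivAt (fun r : ℝ => p (r * circlePt θ)) (Q (r * circlePt θ) * circlePt θ) r := by
  have h1 : (r : ℂ) * circlePt θ ∈ ball (0 : ℂ) 1 := by
    simpa [abs_lt] using hr
  have h2 : HasDerivAt (fun r : ℝ => (r : ℂ) * circlePt θ) (1 * circlePt θ) r :=
    (Complex.ofRealCLM.hasDerivAt (x := r)).mul_const _
  rw [one_mul] at h2
  exact (hp _ h1).comp_of_eq r h2 rfl

/-- Along the radius, `p` is a primitive of an integrable function, hence continuous up to the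
endpoint and of bounded variation. -/
theorem tendsto_radialLimit_of_integrableOn (hp : ∀ z ∈ ball (0 : ℂ) 1, HasDerivAt p (Q z) z)
    {θ : ℝ} (hi : IntegrableOn (fun r : ℝ => Q (r * circlePt θ) * circlePt θ) (Ioo (1 / 2) 1)) :
    Tendsto (fun r : ℝ => p (r * circlePt θ)) (𝓝[<] 1) (𝓝 (radialLimit p θ)) ∧
    ∀ r ∈ Ioo (1 / 2 : ℝ) 1, ‖p (r * circlePt θ) - p ((1 / 2 : ℝ) * circlePt θ)‖ ≤
      ∫ r in Ioo (1 / 2 : ℝ) 1, ‖Q (r * circlePt θ)‖ := by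
  have hii : IntervalIntegrable (fun r : ℝ => Q (r * circlePt θ) * circlePt θ) volume (1 / 2) 1 := by
    rw [intervalIntegrable_iff_integrableOn_Ioo_of_le (by norm_num)]
    exact hi
  have hftc : ∀ r ∈ Ioo (1 / 2 : ℝ) 1, ∫ s in (1 / 2 : ℝ)..r, Q (s * circlePt θ) * circlePt θ =
      p (r * circlePt θ) - p ((1 / 2 : ℝ) * circlePt θ) := fun r hr =>
    intervalIntegral.integral_eq_sub_of_hasDerivAt (fun s hs => by
      rw [uIcc_of_le hr.1.le] at hs
      exact hasDerivAt_radial hp ⟨by linarith [hs.1], by linarith [hs.2, hr.2]⟩ θ)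
      (hii.mono_set (by
        rw [uIcc_of_le hr.1.le, uIcc_of_le (by norm_num)]
        exact Icc_subset_Icc_right hr.2.le))
  constructor
  · refine tendsto_nhds_limUnder ?_
    have hc := intervalIntegral.continuousOn_primitive_interval' hii (by simp : (1 / 2 : ℝ) ∈ uIcc (1 / 2 : ℝ) 1)
    rw [uIcc_of_le (by norm_num)] at hc
    have h1 := (hc 1 ⟨by norm_num, le_rfl⟩).tendsto
    have h2 : Ioo (1 / 2 : ℝ) 1 ∈ 𝓝[<] (1 : ℝ) := Ioo_mem_nhdsLT (by norm_num)
    have h3 : 𝓝[<] (1 : ℝ) ≤ 𝓝[Icc (1 / 2) 1] 1 := by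
      rw [nhdsWithin_le_iff]
      exact mem_of_superset h2 Ioo_subset_Icc_self
    refine ⟨_, ((h1.mono_left h3).add_const (p ((1 / 2 : ℝ) * circlePt θ))).congr' ?_⟩
    filter_upwards [h2] with r hr
    rw [hftc r hr, sub_add_cancel]
  · intro r hr
    rw [← hftc r hr]
    refine (intervalIntegral.norm_integral_le_integral_norm hr.1.le).trans ?_
    have e : ∀ s : ℝ, ‖Q (s * circlePt θ) * circlePt θ‖ = ‖Q (s * circlePt θ)‖ := fun s => by simp
    have hi' := hi.norm
    simp only [e] at hi' ⊢
    rw [intervalIntegral.integral_of_le hr.1.le, integral_Ioc_eq_integral_Ioo]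
    exact setIntegral_mono_set hi' (ae_of_all _ fun _ => norm_nonneg _)
      (Ioo_subset_Ioo_right hr.2.le).eventuallyLE

/-- A holomorphic function with finite Dirichlet integral has radial limits almost everywhere, and
a square integrable radial maximal function. -/
theorem exists_radial_dominated (hp : ∀ z ∈ ball (0 : ℂ) 1, HasDerivAt p (Q z) z)
    (hQ : DifferentiableOn ℂ Q (ball 0 1)) (hi : IntegrableOn (fun z => ‖Q z‖ ^ 2) (ball 0 1)) :
    ∃ D : ℝ → ℝ, IntegrableOn D (Ioc 0 (2 * Real.pi)) ∧
      ∀ᵐ θ ∂(volume.restrict (Ioc 0 (2 * Real.pi))),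
        Tendsto (fun r : ℝ => p (r * circlePt θ)) (𝓝[<] 1) (𝓝 (radialLimit p θ)) ∧
        ∀ r ∈ Ioo (0 : ℝ) 1, ‖p (r * circlePt θ)‖ ^ 2 ≤ D θ := by
  have hA : MeasurableSet (Ioo (1 / 2 : ℝ) 1) := measurableSet_Ioo
  have hA0 : Ioo (1 / 2 : ℝ) 1 ⊆ Ioi 0 := Ioo_subset_Ioi_zero (by norm_num)
  have hsub : {z : ℂ | ‖z‖ ∈ Ioo (1 / 2 : ℝ) 1} ⊆ ball 0 1 := fun z hz => by
    have : ‖z‖ ∈ Ioo (1 / 2 : ℝ) 1 := hz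
    simpa using this.2
  have hint := integrable_polar hA hA0 (hi.mono_set hsub)
  have hpc : ContinuousOn p (closedBall 0 (1 / 2)) := fun z hz =>
    (hp z (closedBall_subset_ball (by norm_num) hz)).continuousAt.continuousWithinAt
  obtain ⟨M, hM⟩ := (isCompact_closedBall (0 : ℂ) (1 / 2)).exists_bound_of_continuousOn hpc
  have hM0 : 0 ≤ M := (norm_nonneg _).trans (hM 0 (by simp))
  -- `M` bounds `p` on the disk of radius `1/2`. Beyond it `r ≥ 1/2`, so `∫|Q|² dr ≤ 2 ∫|Q|² r dr`,
  -- and Cauchy–Schwarz on an interval of length `1/2` absorbs this factor `2`.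
  refine ⟨fun θ => 2 * M ^ 2 + 2 * ∫ r, ‖Q (r * circlePt θ)‖ ^ 2 ∂radialMeasure (Ioo (1 / 2) 1),
    ?_, ?_⟩
  · exact (integrableOn_const measure_Ioc_lt_top.ne).add ((hint.integral_prod_right).const_mul 2)
  filter_upwards [hint.prod_left_ae] with θ hθ
  have hw := (integrableOn_radialMeasure hA hA0).1 hθ
  have hQc : ContinuousOn (fun r : ℝ => Q (r * circlePt θ)) (Ioo (1 / 2) 1) :=
    hQ.continuousOn.comp (by fun_prop) fun r hr => by
      simpa [abs_lt] using And.intro (by linarith [hr.1] : -1 < r) hr.2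
  have hsq : IntegrableOn (fun r : ℝ => ‖Q (r * circlePt θ)‖ ^ 2) (Ioo (1 / 2) 1) := by
    refine (hw.const_mul 2).mono' ((hQc.norm.pow 2).aestronglyMeasurable hA) ?_
    filter_upwards [ae_restrict_mem hA] with r hr
    rw [Real.norm_of_nonneg (by positivity), smul_eq_mul]
    nlinarith [hr.1, sq_nonneg ‖Q (r * circlePt θ)‖]
  have h1 : IntegrableOn (fun r : ℝ => ‖Q (r * circlePt θ)‖) (Ioo (1 / 2) 1) := by
    have hone : IntegrableOn (fun _ : ℝ => (1 : ℝ)) (Ioo (1 / 2 : ℝ) 1) := integrableOn_const (by simp)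
    refine (hone.add hsq).mono' (hQc.norm.aestronglyMeasurable hA) (ae_of_all _ fun r => ?_)
    simp only [Pi.add_apply, norm_norm]
    nlinarith [sq_nonneg (‖Q (r * circlePt θ)‖ - 1), sq_nonneg ‖Q (r * circlePt θ)‖]
  have hle : ∫ r in Ioo (1 / 2 : ℝ) 1, ‖Q (r * circlePt θ)‖ ^ 2 ≤
      2 * ∫ r, ‖Q (r * circlePt θ)‖ ^ 2 ∂radialMeasure (Ioo (1 / 2) 1) := by
    rw [integral_radialMeasure hA hA0, ← integral_const_mul]
    refine setIntegral_mono_on hsq (hw.const_mul 2) hA fun r hr => ?_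
    rw [smul_eq_mul]
    nlinarith [hr.1, sq_nonneg ‖Q (r * circlePt θ)‖]
  have hnn : 0 ≤ ∫ r, ‖Q (r * circlePt θ)‖ ^ 2 ∂radialMeasure (Ioo (1 / 2) 1) :=
    integral_nonneg fun _ => by positivity
  have hQi : IntegrableOn (fun r : ℝ => Q (r * circlePt θ) * circlePt θ) (Ioo (1 / 2) 1) := by
    refine h1.mono' ((hQc.mul continuousOn_const).aestronglyMeasurable hA) (ae_of_all _ fun r => ?_)
    simp
  obtain ⟨hlim, hb⟩ := tendsto_radialLimit_of_integrableOn hp hQi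
  refine ⟨hlim, fun r hr => ?_⟩
  rcases le_or_gt r (1 / 2) with hr2 | hr2
  · have := hM (r * circlePt θ) (by simpa [abs_of_pos hr.1] using hr2)
    have : ‖p (r * circlePt θ)‖ ^ 2 ≤ M ^ 2 := by gcongr
    nlinarith [sq_nonneg M]
  · have h3 := hb r ⟨hr2, hr.2⟩
    have h4 := hM ((1 / 2 : ℝ) * circlePt θ) (by
      rw [mem_closedBall_zero_iff, norm_mul, norm_circlePt, norm_real]; norm_num)
    have h5 := sq_integral_le_half_mul h1 hsq
    have h6 : ‖p (r * circlePt θ)‖ ≤ M + ∫ r in Ioo (1 / 2 : ℝ) 1, ‖Q (r * circlePt θ)‖ := by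
      have := norm_add_le (p (r * circlePt θ) - p ((1 / 2 : ℝ) * circlePt θ))
        (p ((1 / 2 : ℝ) * circlePt θ))
      rw [sub_add_cancel] at this
      linarith
    have h7 : ‖p (r * circlePt θ)‖ ^ 2 ≤
      (M + ∫ r in Ioo (1 / 2 : ℝ) 1, ‖Q (r * circlePt θ)‖) ^ 2 := by gcongr
    nlinarith [sq_nonneg (M - ∫ r in Ioo (1 / 2 : ℝ) 1, ‖Q (r * circlePt θ)‖)]

end

/-! ### Parseval's identity and the Fejér kernel on the circle -/

section
open Metric Set
open scoped ComplexConjugate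

theorem integral_circlePt_pow_mul_conj_pow (n m : ℕ) :
    ∫ θ in (0 : ℝ)..(2 * Real.pi), circlePt θ ^ n * conj (circlePt θ) ^ m =
      if n = m then 2 * Real.pi else 0 := by
  have hc : ∀ θ : ℝ, circlePt θ ^ n * conj (circlePt θ) ^ m = exp (((n : ℂ) - m) * I * θ) := by
    intro θ
    have : conj (circlePt θ) = exp (-(θ * I)) := by
      rw [circlePt, ← exp_conj]; simp
    rw [this, circlePt, ← exp_nat_mul, ← exp_nat_mul, ← Complex.exp_add]
    congr 1; ring
  simp_rw [hc]
  split_ifs with h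
  · subst h; simp
  · have h0 : ((n : ℂ) - m) * I ≠ 0 :=
      mul_ne_zero (sub_ne_zero.2 (by exact_mod_cast h)) I_ne_zero
    rw [integral_exp_mul_complex h0]
    have : ((n : ℂ) - m) * I * ((2 * Real.pi : ℝ) : ℂ) = ((n - m : ℤ) : ℂ) * (2 * Real.pi * I) := by
      push_cast; ring
    rw [this, exp_int_mul_two_pi_mul_I]; simp

theorem hasSum_integral_circle {c : ℕ → ℂ} (hc : Summable fun n => ‖c n‖) {H : ℝ → ℂ}
    (hH : Continuous H) {B : ℝ} (hB : ∀ θ, ‖H θ‖ ≤ B) :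
    HasSum (fun n => ∫ θ in (0 : ℝ)..(2 * Real.pi), c n * circlePt θ ^ n * H θ)
      (∫ θ in (0 : ℝ)..(2 * Real.pi), (∑' n, c n * circlePt θ ^ n) * H θ) := by
  have hs : Summable fun n => ‖c n‖ * B := hc.mul_right B
  refine intervalIntegral.hasSum_integral_of_dominated_convergence (fun n _ => ‖c n‖ * B)
    (fun n => ?_) (fun n => ae_of_all _ fun t _ => ?_) (ae_of_all _ fun t _ => hs) (by simp)
    (ae_of_all _ fun t _ => ?_)
  · have := continuous_circlePt
    exact (by fun_prop : Continuous fun θ => c n * circlePt θ ^ n * H θ).aestronglyMeasurable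
  · rw [norm_mul, norm_mul, norm_pow, norm_circlePt, one_pow, mul_one]
    gcongr; exact hB t
  · have : Summable fun n => c n * circlePt t ^ n :=
      Summable.of_norm (hc.congr fun n => by simp)
    exact this.hasSum.mul_right _

theorem continuous_tsum_circlePt {c : ℕ → ℂ} (hc : Summable fun n => ‖c n‖) :
    Continuous fun θ => ∑' n, c n * circlePt θ ^ n := by
  have := continuous_circlePt
  exact continuous_tsum (fun n => by fun_prop) hc fun n θ => by simp

theorem norm_tsum_circlePt_le {c : ℕ → ℂ} (hc : Summable fun n => ‖c n‖) (θ : ℝ) :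
    ‖∑' n, c n * circlePt θ ^ n‖ ≤ ∑' n, ‖c n‖ := by
  refine (norm_tsum_le_tsum_norm (hc.congr fun n => by simp)).trans (le_of_eq ?_)
  simp

/-- Parseval's identity for absolutely convergent power series on the circle. -/
theorem hasSum_sq_circle {c : ℕ → ℂ} (hc : Summable fun n => ‖c n‖) :
    HasSum (fun n => 2 * Real.pi * ‖c n‖ ^ 2)
      (∫ θ in (0 : ℝ)..(2 * Real.pi), ‖∑' n, c n * circlePt θ ^ n‖ ^ 2) := by
  have hG := continuous_tsum_circlePt hc
  have hcc := continuous_circlePt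
  have hcoef : ∀ m, ∫ θ in (0 : ℝ)..(2 * Real.pi), (∑' n, c n * circlePt θ ^ n) *
      conj (circlePt θ) ^ m = 2 * Real.pi * c m := by
    intro m
    have h1 := hasSum_integral_circle hc (H := fun θ => conj (circlePt θ) ^ m) (by fun_prop)
      (B := 1) (by simp)
    have h2 : (fun n => ∫ θ in (0 : ℝ)..(2 * Real.pi), c n * circlePt θ ^ n * conj (circlePt θ) ^ m)
        = fun n => if n = m then 2 * Real.pi * c m else 0 := by
      ext n
      simp_rw [mul_assoc]
      rw [intervalIntegral.integral_const_mul, integral_circlePt_pow_mul_conj_pow]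
      split_ifs with h
      · rw [h]; push_cast; ring
      · simp
    rw [h2] at h1
    exact h1.unique (hasSum_ite_eq m _)
  have h1 := hasSum_integral_circle hc (H := fun θ => conj (∑' n, c n * circlePt θ ^ n))
    (by fun_prop) (B := ∑' n, ‖c n‖) (fun θ => by
      rw [RCLike.norm_conj]; exact norm_tsum_circlePt_le hc θ)
  have h2 : (fun n => ∫ θ in (0 : ℝ)..(2 * Real.pi), c n * circlePt θ ^ n *
      conj (∑' n, c n * circlePt θ ^ n)) = fun n => ((2 * Real.pi * ‖c n‖ ^ 2 : ℝ) : ℂ) := by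
    ext n
    have e : ∀ θ, c n * circlePt θ ^ n * conj (∑' n, c n * circlePt θ ^ n) =
        c n * conj ((∑' n, c n * circlePt θ ^ n) * conj (circlePt θ) ^ n) := fun θ => by
      simp only [map_mul, map_pow, conj_conj]; ring
    simp_rw [e]
    rw [intervalIntegral.integral_const_mul]
    rw [intervalIntegral.integral_of_le Real.two_pi_pos.le, integral_conj,
      ← intervalIntegral.integral_of_le Real.two_pi_pos.le, hcoef n]
    simp only [map_mul, conj_ofReal, map_ofNat]
    push_cast
    rw [← conj_mul']
    ring
  have h3 : ∫ θ in (0 : ℝ)..(2 * Real.pi), (∑' n, c n * circlePt θ ^ n) *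
      conj (∑' n, c n * circlePt θ ^ n) =
      ((∫ θ in (0 : ℝ)..(2 * Real.pi), ‖∑' n, c n * circlePt θ ^ n‖ ^ 2 : ℝ) : ℂ) := by
    rw [← intervalIntegral.integral_ofReal]
    congr 1 with θ
    rw [mul_conj, normSq_eq_norm_sq]
  rw [h2, h3] at h1
  exact_mod_cast h1

theorem lintegral_sq_circle {c : ℕ → ℂ} (hc : Summable fun n => ‖c n‖) :
    ∫⁻ θ in Ioc 0 (2 * Real.pi), ENNReal.ofReal (‖∑' n, c n * circlePt θ ^ n‖ ^ 2) =
      ∑' n, ENNReal.ofReal (2 * Real.pi * ‖c n‖ ^ 2) := by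
  have h := hasSum_sq_circle hc
  rw [← ENNReal.ofReal_tsum_of_nonneg (fun n => by positivity) h.summable, h.tsum_eq,
    intervalIntegral.integral_of_le Real.two_pi_pos.le, ofReal_integral_eq_lintegral_ofReal]
  · exact ((continuous_tsum_circlePt hc).norm.pow 2).integrableOn_Ioc
  · exact ae_of_all _ fun θ => by positivity

theorem circlePt_ne_one {h : ℝ} (hh : h ∈ Ioo 0 (2 * Real.pi)) : circlePt h ≠ 1 := by
  have : (1 : ℂ) = circlePt 0 := by simp [circlePt]
  rw [this]
  refine circlePt_ne_of_abs_lt hh.1.ne' ?_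
  rw [sub_zero, abs_of_pos hh.1]; exact hh.2

/-- The integral of the Fejér kernel. -/
theorem lintegral_fejer (n : ℕ) :
    ∫⁻ h in Ioc 0 (2 * Real.pi), ENNReal.ofReal ((‖circlePt h ^ n - 1‖ / ‖circlePt h - 1‖) ^ 2) =
      ENNReal.ofReal (2 * Real.pi * n) := by
  -- The quotient `(ζ^n - 1)/(ζ - 1)` is the polynomial with `n` coefficients equal to `1`, so
  -- Parseval's identity gives `2πn`.
  set c : ℕ → ℂ := fun k => if k < n then 1 else 0 with hcdef
  have hfin : ∀ k ∉ Finset.range n, c k = 0 := fun k hk => by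
    simpa [hcdef] using hk
  have hc : Summable fun k => ‖c k‖ :=
    summable_of_ne_finset_zero (s := Finset.range n) fun k hk => by rw [hfin k hk, norm_zero]
  have h1 := lintegral_sq_circle hc
  rw [tsum_eq_sum (s := Finset.range n) fun k hk => by simp [hfin k hk]] at h1
  have h2 : ∑ k ∈ Finset.range n, ENNReal.ofReal (2 * Real.pi * ‖c k‖ ^ 2) =
      ENNReal.ofReal (2 * Real.pi * n) := by
    rw [← ENNReal.ofReal_sum_of_nonneg (fun k _ => by positivity)]
    congr 1
    rw [Finset.sum_congr rfl (g := fun _ => 2 * Real.pi)]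
    · simp; ring
    · intro k hk
      simp [hcdef, Finset.mem_range.1 hk]
  rw [← h2, ← h1, ← restrict_Ioo_eq_restrict_Ioc]
  refine setLIntegral_congr_fun measurableSet_Ioo fun h hh => ?_
  have hne := circlePt_ne_one hh
  have h3 : ∑' k, c k * circlePt h ^ k = (circlePt h ^ n - 1) / (circlePt h - 1) := by
    rw [tsum_eq_sum (s := Finset.range n) fun k hk => by rw [hfin k hk, zero_mul],
      ← geom_sum_eq hne]
    refine Finset.sum_congr rfl fun k hk => ?_
    simp [hcdef, Finset.mem_range.1 hk]
  simp only [h3, norm_div]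

theorem lintegral_periodic_shift {g : ℝ → ENNReal} (hg : Function.Periodic g (2 * Real.pi))
    (t : ℝ) : ∫⁻ s in Ioc 0 (2 * Real.pi), g (t + s) = ∫⁻ s in Ioc 0 (2 * Real.pi), g s := by
  have h1 : ∫⁻ s in Ioc 0 (2 * Real.pi), g (t + s) = ∫⁻ s in Ioc t (t + 2 * Real.pi), g s := by
    have := (measurePreserving_add_left volume t).setLIntegral_comp_preimage_emb
      (measurableEmbedding_addLeft t) g (Ioc t (t + 2 * Real.pi))
    rw [← this]
    congr 2
    ext s; simp
  rw [h1]
  have h2 := (isAddFundamentalDomain_Ioc Real.two_pi_pos t).setLIntegral_eq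
    (isAddFundamentalDomain_Ioc Real.two_pi_pos 0) g (fun x y => by
      obtain ⟨n, hn⟩ := AddSubgroup.mem_zmultiples_iff.1 x.2
      have : x +ᵥ y = y + n • (2 * Real.pi) := by
        rw [AddSubgroup.vadd_def, vadd_eq_add, ← hn, add_comm]
      rw [this, hg.zsmul n y])
  rwa [zero_add] at h2

end

/-! ### Boundary values in `H^{1/2}` -/

section
open Metric Set
open scoped ComplexConjugate

variable {p Q : ℂ → ℂ}

/-- The Taylor coefficients at the centre of the disk. -/
noncomputable def taylorCoeff (p : ℂ → ℂ) (n : ℕ) : ℂ := (n.factorial : ℂ)⁻¹ * iteratedDeriv n p 0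

theorem hasSum_taylorCoeff (hp : DifferentiableOn ℂ p (ball 0 1)) {z : ℂ} (hz : ‖z‖ < 1) :
    HasSum (fun n => taylorCoeff p n * z ^ n) (p z) := by
  have h1 := Complex.hasSum_taylorSeries_on_ball (c := 0) (r := 1) hp (z := z) (by simpa using hz)
  refine h1.congr_fun fun n => ?_
  simp [taylorCoeff]; ring

theorem summable_norm_taylorCoeff (hp : DifferentiableOn ℂ p (ball 0 1)) {ρ : ℝ}
    (hρ : ρ ∈ Ioo (0 : ℝ) 1) : Summable fun n => ‖taylorCoeff p n‖ * ρ ^ n := by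
  have h1 := (hasSum_taylorCoeff hp (z := ρ) (by
    rw [norm_real, Real.norm_of_nonneg hρ.1.le]; exact hρ.2)).summable.norm
  refine h1.congr fun n => ?_
  simp [abs_of_pos hρ.1]

theorem taylorCoeff_deriv (hp : ∀ z ∈ ball (0 : ℂ) 1, HasDerivAt p (Q z) z) (n : ℕ) :
    taylorCoeff Q n = (n + 1) * taylorCoeff p (n + 1) := by
  have h1 : Q =ᶠ[𝓝 0] deriv p := by
    filter_upwards [isOpen_ball.mem_nhds (mem_ball_self one_pos)] with z hz
    exact (hp z hz).deriv.symm
  rw [taylorCoeff, taylorCoeff, iteratedDeriv_succ', h1.iteratedDeriv_eq, Nat.factorial_succ]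
  have : (n.factorial : ℂ) ≠ 0 := by exact_mod_cast n.factorial_ne_zero
  have h2 : (n : ℂ) + 1 ≠ 0 := by exact_mod_cast n.succ_ne_zero
  push_cast
  field_simp

theorem lintegral_pow_unit (n : ℕ) :
    ∫⁻ ρ in Ioo (0 : ℝ) 1, ENNReal.ofReal (ρ ^ (2 * n + 1)) = ENNReal.ofReal (1 / (2 * n + 2)) := by
  rw [← ofReal_integral_eq_lintegral_ofReal, ← integral_Ioc_eq_integral_Ioo,
    ← intervalIntegral.integral_of_le zero_le_one, integral_pow]
  · congr 1; push_cast; norm_num; ring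
  · exact (Continuous.integrableOn_Ioc (by fun_prop)).mono_set Ioo_subset_Ioc_self
  · filter_upwards [ae_restrict_mem measurableSet_Ioo] with ρ hρ
    exact pow_nonneg hρ.1.le _

theorem lintegral_circle_sq_of_differentiableOn (hQ : DifferentiableOn ℂ Q (ball 0 1)) {ρ : ℝ}
    (hρ : ρ ∈ Ioo (0 : ℝ) 1) :
    ∫⁻ θ in Ioc 0 (2 * Real.pi), ENNReal.ofReal (‖Q (ρ * circlePt θ)‖ ^ 2) =
      ∑' n, ENNReal.ofReal (2 * Real.pi * ‖taylorCoeff Q n‖ ^ 2 * ρ ^ (2 * n)) := by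
  have hs : Summable fun n => ‖taylorCoeff Q n * (ρ : ℂ) ^ n‖ :=
    (summable_norm_taylorCoeff hQ hρ).congr fun n => by simp [abs_of_pos hρ.1]
  have h1 := lintegral_sq_circle hs
  have h2 : ∀ θ, Q (ρ * circlePt θ) = ∑' n, taylorCoeff Q n * (ρ : ℂ) ^ n * circlePt θ ^ n := by
    intro θ
    rw [← (hasSum_taylorCoeff hQ (z := ρ * circlePt θ) (by simp [abs_of_pos hρ.1, hρ.2])).tsum_eq]
    congr 1 with n
    rw [mul_pow, mul_assoc]
  simp_rw [h2, h1]
  congr 1 with n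
  congr 1
  rw [norm_mul, norm_pow, norm_real, Real.norm_of_nonneg hρ.1.le, mul_pow, ← pow_mul, mul_comm n 2]
  ring

/-- Parseval's identity on each circle followed by integration in `ρ dρ` identifies the Dirichlet
integral with `π Σ n |a_n|²`. -/
theorem tsum_dirichlet_lt_top (hp : ∀ z ∈ ball (0 : ℂ) 1, HasDerivAt p (Q z) z)
    (hQ : DifferentiableOn ℂ Q (ball 0 1)) (hi : IntegrableOn (fun z => ‖Q z‖ ^ 2) (ball 0 1)) :
    ∑' n : ℕ, ENNReal.ofReal (n * ‖taylorCoeff p n‖ ^ 2) < ⊤ := by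
  have hA : MeasurableSet (Ioo (0 : ℝ) 1) := measurableSet_Ioo
  have hA0 : Ioo (0 : ℝ) 1 ⊆ Ioi 0 := Ioo_subset_Ioi_zero le_rfl
  have hfin : ∫⁻ z in ball (0 : ℂ) 1, ENNReal.ofReal (‖Q z‖ ^ 2) < ⊤ := hi.lintegral_lt_top
  rw [restrict_ball_eq, lintegral_polar hA hA0 (by
    rw [← restrict_ball_eq]
    exact hi.aestronglyMeasurable.aemeasurable.ennreal_ofReal)] at hfin
  have h1 : ∀ ρ ∈ Ioo (0 : ℝ) 1, ENNReal.ofReal ρ *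
      ∫⁻ θ in Ioc 0 (2 * Real.pi), ENNReal.ofReal (‖Q (ρ * circlePt θ)‖ ^ 2) =
      ∑' n, ENNReal.ofReal (2 * Real.pi * ‖taylorCoeff Q n‖ ^ 2) *
        ENNReal.ofReal (ρ ^ (2 * n + 1)) := by
    intro ρ hρ
    rw [lintegral_circle_sq_of_differentiableOn hQ hρ, ← ENNReal.tsum_mul_left]
    congr 1 with n
    rw [← ENNReal.ofReal_mul hρ.1.le, ← ENNReal.ofReal_mul (by positivity)]
    congr 1; ring
  rw [setLIntegral_congr_fun hA h1, lintegral_tsum (fun n => by fun_prop)] at hfin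
  have h2 : ∀ n : ℕ, ∫⁻ ρ in Ioo (0 : ℝ) 1, ENNReal.ofReal (2 * Real.pi * ‖taylorCoeff Q n‖ ^ 2) *
        ENNReal.ofReal (ρ ^ (2 * n + 1)) =
      ENNReal.ofReal Real.pi * ENNReal.ofReal (((n + 1 : ℕ) : ℝ) * ‖taylorCoeff p (n + 1)‖ ^ 2) := by
    intro n
    rw [lintegral_const_mul _ (by fun_prop), lintegral_pow_unit, taylorCoeff_deriv hp,
      ← ENNReal.ofReal_mul (by positivity), ← ENNReal.ofReal_mul Real.pi_pos.le]
    congr 1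
    have : ‖((n : ℂ) + 1)‖ = n + 1 := by
      rw [← Nat.cast_succ, Complex.norm_natCast]; push_cast; ring
    rw [norm_mul, this]
    push_cast
    field_simp
  simp_rw [h2, ENNReal.tsum_mul_left] at hfin
  rw [tsum_eq_zero_add' ENNReal.summable]
  simp only [Nat.cast_zero, zero_mul, ENNReal.ofReal_zero, zero_add]
  refine lt_of_not_ge fun hc => hfin.ne ?_
  rw [top_le_iff.1 hc, ENNReal.mul_top]
  simpa using Real.pi_pos

theorem norm_circlePt_sub_circlePt_add (s h : ℝ) :
    ‖circlePt s - circlePt (s + h)‖ = ‖circlePt h - 1‖ := by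
  rw [circlePt_add, show circlePt s - circlePt s * circlePt h = -(circlePt s * (circlePt h - 1)) by
    ring, norm_neg, norm_mul, norm_circlePt, one_mul]

/-- Douglas's computation on the circle of radius `ρ`. Put `t = s + h`; Parseval in `s` leaves
`2π|a_n|² ρ^{2n} |e^{inh} - 1|²/|e^{ih} - 1|²`, and the Fejér integral in `h` contributes `2πn`. The
bound is uniform in `ρ`. -/
theorem lintegral_hHalf_le (hp : DifferentiableOn ℂ p (ball 0 1)) {ρ : ℝ}
    (hρ : ρ ∈ Ioo (0 : ℝ) 1) :
    ∫⁻ s in Ioc 0 (2 * Real.pi), ∫⁻ t in Ioc 0 (2 * Real.pi), ENNReal.ofReal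
      ((‖p (ρ * circlePt s) - p (ρ * circlePt t)‖ / ‖circlePt s - circlePt t‖) ^ 2) ≤
    ENNReal.ofReal ((2 * Real.pi) ^ 2) * ∑' n : ℕ, ENNReal.ofReal (n * ‖taylorCoeff p n‖ ^ 2) := by
  have hcc := continuous_circlePt
  have hpc : Continuous fun s => p (ρ * circlePt s) :=
    hp.continuousOn.comp_continuous (by fun_prop) fun s => by simp [abs_of_pos hρ.1, hρ.2]
  have h1 : ∀ s, ∫⁻ t in Ioc 0 (2 * Real.pi), ENNReal.ofReal
      ((‖p (ρ * circlePt s) - p (ρ * circlePt t)‖ / ‖circlePt s - circlePt t‖) ^ 2) =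
      ∫⁻ h in Ioc 0 (2 * Real.pi), ENNReal.ofReal
      ((‖p (ρ * circlePt s) - p (ρ * circlePt (s + h))‖ / ‖circlePt h - 1‖) ^ 2) := by
    intro s
    rw [← lintegral_periodic_shift _ s]
    · simp_rw [norm_circlePt_sub_circlePt_add]
    · intro t; simp only [circlePt_add_two_pi]
  simp_rw [h1]
  rw [lintegral_lintegral_swap (by
    have m1 : Measurable fun q : ℝ × ℝ => ‖p (ρ * circlePt q.1) - p (ρ * circlePt (q.1 + q.2))‖ :=
      ((hpc.comp continuous_fst).sub
        (hpc.comp (continuous_fst.add continuous_snd))).norm.measurable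
    have m2 : Measurable fun q : ℝ × ℝ => ‖circlePt q.2 - 1‖ := by
      have : Continuous fun q : ℝ × ℝ => ‖circlePt q.2 - 1‖ := by fun_prop
      exact this.measurable
    exact ((m1.div m2).pow_const 2).ennreal_ofReal.aemeasurable)]
  have h2 : ∀ h ∈ Ioc 0 (2 * Real.pi), ∫⁻ s in Ioc 0 (2 * Real.pi), ENNReal.ofReal
      ((‖p (ρ * circlePt s) - p (ρ * circlePt (s + h))‖ / ‖circlePt h - 1‖) ^ 2) =
      ∑' n, ENNReal.ofReal (2 * Real.pi * ‖taylorCoeff p n‖ ^ 2 * ρ ^ (2 * n)) *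
        ENNReal.ofReal ((‖circlePt h ^ n - 1‖ / ‖circlePt h - 1‖) ^ 2) := by
    intro h _
    set c : ℕ → ℂ := fun n => taylorCoeff p n * (ρ : ℂ) ^ n * (1 - circlePt h ^ n) with hc
    have hs : Summable fun n => ‖c n‖ := by
      refine Summable.of_nonneg_of_le (fun _ => norm_nonneg _) (fun n => ?_)
        ((summable_norm_taylorCoeff hp hρ).mul_right 2)
      rw [hc, norm_mul, norm_mul, norm_pow, norm_real, Real.norm_of_nonneg hρ.1.le]
      have h0 : 0 ≤ ‖taylorCoeff p n‖ * ρ ^ n := mul_nonneg (norm_nonneg _) (pow_nonneg hρ.1.le _)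
      gcongr
      refine (norm_sub_le _ _).trans ?_
      rw [norm_pow, norm_circlePt]; norm_num
    have h3 : ∀ s, p (ρ * circlePt s) - p (ρ * circlePt (s + h)) = ∑' n, c n * circlePt s ^ n := by
      intro s
      have e1 := hasSum_taylorCoeff hp (z := ρ * circlePt s) (by simp [abs_of_pos hρ.1, hρ.2])
      have e2 := hasSum_taylorCoeff hp (z := ρ * circlePt (s + h)) (by simp [abs_of_pos hρ.1, hρ.2])
      rw [← (e1.sub e2).tsum_eq]
      congr 1 with n
      rw [hc, circlePt_add]; ring
    have h4 : ∀ s, ENNReal.ofReal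
      ((‖p (ρ * circlePt s) - p (ρ * circlePt (s + h))‖ / ‖circlePt h - 1‖) ^ 2) =
        ENNReal.ofReal (‖∑' n, c n * circlePt s ^ n‖ ^ 2) * ENNReal.ofReal (1 / ‖circlePt h - 1‖ ^ 2) := by
      intro s
      rw [h3, ← ENNReal.ofReal_mul (by positivity)]
      congr 1; ring
    simp_rw [h4]
    rw [lintegral_mul_const _ (by
      exact ((continuous_tsum_circlePt hs).norm.pow 2).measurable.ennreal_ofReal),
      lintegral_sq_circle hs, ← ENNReal.tsum_mul_right]
    congr 1 with n
    rw [← ENNReal.ofReal_mul (by positivity), ← ENNReal.ofReal_mul (by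
      have := pow_nonneg hρ.1.le (2 * n); positivity)]
    congr 1
    rw [hc, norm_mul, norm_mul, norm_pow, norm_real, Real.norm_of_nonneg hρ.1.le, norm_sub_rev,
      pow_mul']
    ring
  rw [setLIntegral_congr_fun measurableSet_Ioc h2, lintegral_tsum (fun n => by
    have m2 : Measurable fun h : ℝ => ‖circlePt h - 1‖ := by
      have : Continuous fun h : ℝ => ‖circlePt h - 1‖ := by fun_prop
      exact this.measurable
    have m1 : Measurable fun h : ℝ => ‖circlePt h ^ n - 1‖ := by
      have : Continuous fun h : ℝ => ‖circlePt h ^ n - 1‖ := by fun_prop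
      exact this.measurable
    exact (((m1.div m2).pow_const 2).ennreal_ofReal.const_mul _).aemeasurable),
    ← ENNReal.tsum_mul_left]
  refine ENNReal.tsum_le_tsum fun n => ?_
  rw [lintegral_const_mul' _ _ ENNReal.ofReal_ne_top, lintegral_fejer,
    ← ENNReal.ofReal_mul (by have := pow_nonneg hρ.1.le (2 * n); positivity),
    ← ENNReal.ofReal_mul (by positivity)]
  refine ENNReal.ofReal_le_ofReal ?_
  have hρn : ρ ^ (2 * n) ≤ 1 := pow_le_one₀ hρ.1.le hρ.2.le
  have h5 : 0 ≤ (2 * Real.pi) ^ 2 * (n * ‖taylorCoeff p n‖ ^ 2) := by positivity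
  calc _ = (2 * Real.pi) ^ 2 * (n * ‖taylorCoeff p n‖ ^ 2) * ρ ^ (2 * n) := by ring
    _ ≤ _ := mul_le_of_le_one_right h5 hρn

theorem aestronglyMeasurable_radialLimit (hp : DifferentiableOn ℂ p (ball 0 1))
    (hlim : ∀ᵐ θ ∂(volume.restrict (Ioc 0 (2 * Real.pi))),
      Tendsto (fun r : ℝ => p (r * circlePt θ)) (𝓝[<] 1) (𝓝 (radialLimit p θ))) :
    AEStronglyMeasurable (radialLimit p) (volume.restrict (Ioc 0 (2 * Real.pi))) := by
  have hcc := continuous_circlePt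
  have hne : (𝓝[<] (1 : ℝ)).NeBot := inferInstance
  -- Replacing irrelevant radii by `0` makes every approximant continuous in the angle.
  set r : ℝ → ℝ := fun r => if r ∈ Ioo (0 : ℝ) 1 then r else 0
  refine aestronglyMeasurable_of_tendsto_ae (𝓝[<] (1 : ℝ))
    (f := fun s θ => p ((r s : ℝ) * circlePt θ)) (fun s => ?_) ?_
  · refine (hp.continuousOn.comp_continuous (by fun_prop) fun θ => ?_).aestronglyMeasurable
    simp only [r]
    split_ifs with hs
    · simp [abs_of_pos hs.1, hs.2]
    · simp
  · filter_upwards [hlim] with θ hθ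
    refine hθ.congr' ?_
    filter_upwards [Ioo_mem_nhdsLT (zero_lt_one' ℝ)] with s hs
    simp only [r, if_pos hs]

theorem memLp_radialLimit (hp : ∀ z ∈ ball (0 : ℂ) 1, HasDerivAt p (Q z) z)
    (hQ : DifferentiableOn ℂ Q (ball 0 1)) (hi : IntegrableOn (fun z => ‖Q z‖ ^ 2) (ball 0 1)) :
    MemLp (radialLimit p) 2 (volume.restrict (Ioc 0 (2 * Real.pi))) := by
  have hpd : DifferentiableOn ℂ p (ball 0 1) := fun z hz =>
    (hp z hz).differentiableAt.differentiableWithinAt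
  obtain ⟨D, hD, hlim⟩ := exists_radial_dominated hp hQ hi
  have hm := aestronglyMeasurable_radialLimit hpd (hlim.mono fun θ h => h.1)
  rw [memLp_two_iff_integrable_sq_norm hm]
  refine hD.mono' (hm.norm.pow 2) ?_
  filter_upwards [hlim] with θ hθ
  rw [Real.norm_of_nonneg (by positivity)]
  refine le_of_tendsto (hθ.1.norm.pow 2) ?_
  filter_upwards [Ioo_mem_nhdsLT (zero_lt_one' ℝ)] with r hr using hθ.2 r hr

theorem measurable_hHalf {g : ℝ → ℂ} (hg : Continuous g) :
    Measurable fun q : ℝ × ℝ =>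
      ENNReal.ofReal ((‖g q.1 - g q.2‖ / ‖circlePt q.1 - circlePt q.2‖) ^ 2) := by
  have hcc := continuous_circlePt
  have m1 : Measurable fun q : ℝ × ℝ => ‖g q.1 - g q.2‖ :=
    ((hg.comp continuous_fst).sub (hg.comp continuous_snd)).norm.measurable
  have m2 : Measurable fun q : ℝ × ℝ => ‖circlePt q.1 - circlePt q.2‖ := by
    have : Continuous fun q : ℝ × ℝ => ‖circlePt q.1 - circlePt q.2‖ := by fun_prop
    exact this.measurable
  exact ((m1.div m2).pow_const 2).ennreal_ofReal

/-- Fatou's lemma in each variable separately, so that joint measurability of the limit is not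
required. -/
theorem lintegral_prod_liminf_le {μ : Measure ℝ} [SFinite μ] {K : ℕ → ℝ × ℝ → ENNReal}
    {L : ℝ → ℝ → ENNReal} (hK : ∀ k, Measurable (K k))
    (hlim : ∀ᵐ s ∂μ, ∀ᵐ t ∂μ, Tendsto (fun k => K k (s, t)) atTop (𝓝 (L s t))) {C : ENNReal}
    (hC : ∀ k, ∫⁻ s, ∫⁻ t, K k (s, t) ∂μ ∂μ ≤ C) : ∫⁻ s, ∫⁻ t, L s t ∂μ ∂μ ≤ C := by
  calc ∫⁻ s, ∫⁻ t, L s t ∂μ ∂μ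
      ≤ ∫⁻ s, liminf (fun k => ∫⁻ t, K k (s, t) ∂μ) atTop ∂μ := by
        refine lintegral_mono_ae ?_
        filter_upwards [hlim] with s hs
        refine le_trans (lintegral_mono_ae ?_)
          (lintegral_liminf_le fun k => (hK k).comp measurable_prodMk_left)
        filter_upwards [hs] with t ht using ht.liminf_eq.ge
    _ ≤ liminf (fun k => ∫⁻ s, ∫⁻ t, K k (s, t) ∂μ ∂μ) atTop :=
        lintegral_liminf_le fun k => (hK k).lintegral_prod_right'
    _ ≤ C := by
        refine liminf_le_of_le (by isBoundedDefault) fun b hb => ?_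
        obtain ⟨k, hk⟩ := hb.exists
        exact hk.trans (hC k)

/-- The boundary values of a holomorphic function with finite Dirichlet integral are in
`H^{1/2}`. -/
theorem memHHalf_radialLimit (hp : ∀ z ∈ ball (0 : ℂ) 1, HasDerivAt p (Q z) z)
    (hQ : DifferentiableOn ℂ Q (ball 0 1)) (hi : IntegrableOn (fun z => ‖Q z‖ ^ 2) (ball 0 1)) :
    MemHHalf (radialLimit p) := by
  refine ⟨memLp_radialLimit hp hQ hi, ?_⟩
  have hpd : DifferentiableOn ℂ p (ball 0 1) := fun z hz =>
    (hp z hz).differentiableAt.differentiableWithinAt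
  obtain ⟨D, hD, hlim⟩ := exists_radial_dominated hp hQ hi
  obtain ⟨r, hrm, hr01, hrt⟩ := exists_seq_strictMono_tendsto' (show (0 : ℝ) < 1 by norm_num)
  have hrt' : Tendsto r atTop (𝓝[<] 1) :=
    tendsto_nhdsWithin_iff.2 ⟨hrt, Eventually.of_forall fun k => (hr01 k).2⟩
  have hcc := continuous_circlePt
  have hpc : ∀ k, Continuous fun s => p (r k * circlePt s) := fun k =>
    hpd.continuousOn.comp_continuous (by fun_prop) fun s => by
      simp [abs_of_pos (hr01 k).1, (hr01 k).2]
  refine lt_of_le_of_lt (lintegral_prod_liminf_le (fun k => measurable_hHalf (hpc k)) ?_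
    fun k => lintegral_hHalf_le hpd (hr01 k))
    (ENNReal.mul_lt_top ENNReal.ofReal_lt_top (tsum_dirichlet_lt_top hp hQ hi))
  filter_upwards [hlim] with s hs
  filter_upwards [hlim] with t ht
  exact (ENNReal.continuous_ofReal.tendsto _).comp
    ((((hs.1.comp hrt').sub (ht.1.comp hrt')).norm.div_const _).pow 2)

end

/-! ### Stability of `H^{1/2}` and rigidity of integer-valued functions -/

section
open Metric Set

variable {E F : Type*} [NormedAddCommGroup E] [NormedAddCommGroup F]

/-- The integrand of the `H^{1/2}` seminorm. -/
noncomputable def hHalfKernel (h : ℝ → E) (q : ℝ × ℝ) : ENNReal :=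
  ENNReal.ofReal ((‖h q.1 - h q.2‖ / ‖circlePt q.1 - circlePt q.2‖) ^ 2)

theorem aemeasurable_hHalfKernel {h : ℝ → E} (hh : AEStronglyMeasurable h angularMeasure) :
    AEMeasurable (hHalfKernel h) (angularMeasure.prod angularMeasure) := by
  have hcc := continuous_circlePt
  have m1 : AEMeasurable (fun q : ℝ × ℝ => ‖h q.1 - h q.2‖) (angularMeasure.prod angularMeasure) :=
    (hh.comp_fst.sub hh.comp_snd).norm.aemeasurable
  have m2 : Measurable fun q : ℝ × ℝ => ‖circlePt q.1 - circlePt q.2‖ := by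
    have : Continuous fun q : ℝ × ℝ => ‖circlePt q.1 - circlePt q.2‖ := by fun_prop
    exact this.measurable
  exact ((m1.div m2.aemeasurable).pow_const 2).ennreal_ofReal

theorem memHHalf_iff {h : ℝ → E} : MemHHalf h ↔ MemLp h 2 angularMeasure ∧
    ∫⁻ q, hHalfKernel h q ∂(angularMeasure.prod angularMeasure) < ⊤ := by
  refine and_congr_right fun hh => ?_
  rw [lintegral_prod _ (aemeasurable_hHalfKernel hh.aestronglyMeasurable)]
  rfl

/-- An additional Lipschitz increment contributes a bounded kernel. The case `C = 0` covers
contractions of `h`; `C = 1` covers the product of `e^{iθ}` with a function of the phase. -/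
theorem MemHHalf.mono_add {h : ℝ → E} {g : ℝ → F} {C : ℝ} (hh : MemHHalf h)
    (hg : MemLp g 2 angularMeasure)
    (hle : ∀ᵐ q ∂(angularMeasure.prod angularMeasure),
      ‖g q.1 - g q.2‖ ≤ ‖h q.1 - h q.2‖ + C * ‖circlePt q.1 - circlePt q.2‖) : MemHHalf g := by
  rw [memHHalf_iff] at hh ⊢
  refine ⟨hg, ?_⟩
  calc ∫⁻ q, hHalfKernel g q ∂(angularMeasure.prod angularMeasure)
      ≤ ∫⁻ q, (ENNReal.ofReal 2 * hHalfKernel h q + ENNReal.ofReal (2 * C ^ 2))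
        ∂(angularMeasure.prod angularMeasure) := by
        refine lintegral_mono_ae ?_
        filter_upwards [hle] with q hq
        unfold hHalfKernel
        rw [← ENNReal.ofReal_mul (by norm_num), ← ENNReal.ofReal_add (by positivity) (by positivity)]
        refine ENNReal.ofReal_le_ofReal ?_
        rcases eq_or_lt_of_le (norm_nonneg (circlePt q.1 - circlePt q.2)) with h0 | h0
        · rw [← h0]; simp; positivity
        · have : ‖g q.1 - g q.2‖ / ‖circlePt q.1 - circlePt q.2‖ ≤
            ‖h q.1 - h q.2‖ / ‖circlePt q.1 - circlePt q.2‖ + C := by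
            rw [div_add' _ _ _ h0.ne']; gcongr
          have h2 : 0 ≤ ‖g q.1 - g q.2‖ / ‖circlePt q.1 - circlePt q.2‖ := by positivity
          nlinarith [sq_nonneg (‖h q.1 - h q.2‖ / ‖circlePt q.1 - circlePt q.2‖ - C)]
    _ < ⊤ := by
        rw [lintegral_add_right _ measurable_const,
          lintegral_const_mul' _ _ ENNReal.ofReal_ne_top, lintegral_const]
        exact ENNReal.add_lt_top.2 ⟨ENNReal.mul_lt_top ENNReal.ofReal_lt_top hh.2,
          ENNReal.mul_lt_top ENNReal.ofReal_lt_top (measure_lt_top _ _)⟩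

theorem MemHHalf.sub {h g : ℝ → E} (hh : MemHHalf h) (hg : MemHHalf g) :
    MemHHalf fun θ => h θ - g θ := by
  rw [memHHalf_iff] at hh hg ⊢
  refine ⟨hh.1.sub hg.1, ?_⟩
  calc ∫⁻ q, hHalfKernel (fun θ => h θ - g θ) q ∂(angularMeasure.prod angularMeasure)
      ≤ ∫⁻ q, (ENNReal.ofReal 2 * hHalfKernel h q + ENNReal.ofReal 2 * hHalfKernel g q)
        ∂(angularMeasure.prod angularMeasure) := by
        refine lintegral_mono fun q => ?_
        unfold hHalfKernel
        rw [← ENNReal.ofReal_mul (by norm_num), ← ENNReal.ofReal_mul (by norm_num),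
          ← ENNReal.ofReal_add (by positivity) (by positivity)]
        refine ENNReal.ofReal_le_ofReal ?_
        obtain ⟨c, hc⟩ : ∃ c, c = ‖circlePt q.1 - circlePt q.2‖ := ⟨_, rfl⟩
        have h1 : ‖h q.1 - g q.1 - (h q.2 - g q.2)‖ ≤ ‖h q.1 - h q.2‖ + ‖g q.1 - g q.2‖ := by
          rw [sub_sub_sub_comm]; exact norm_sub_le _ _
        have hc0 : 0 ≤ c := hc ▸ norm_nonneg _
        rw [← hc]
        have h2 := div_le_div_of_nonneg_right h1 hc0
        rw [add_div] at h2
        have h3 : 0 ≤ ‖h q.1 - g q.1 - (h q.2 - g q.2)‖ / c := by positivity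
        nlinarith [sq_nonneg (‖h q.1 - h q.2‖ / c - ‖g q.1 - g q.2‖ / c)]
    _ < ⊤ := by
        rw [lintegral_add_left' ((aemeasurable_hHalfKernel hh.1.aestronglyMeasurable).const_mul _),
          lintegral_const_mul' _ _ ENNReal.ofReal_ne_top,
          lintegral_const_mul' _ _ ENNReal.ofReal_ne_top]
        exact ENNReal.add_lt_top.2 ⟨ENNReal.mul_lt_top ENNReal.ofReal_lt_top hh.2,
          ENNReal.mul_lt_top ENNReal.ofReal_lt_top hg.2⟩

theorem ae_prod_of_ae {μ : Measure ℝ} [SFinite μ] {p : ℝ → Prop} (hp : ∀ᵐ θ ∂μ, p θ) :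
    ∀ᵐ q ∂(μ.prod μ), p q.1 ∧ p q.2 :=
  (Measure.quasiMeasurePreserving_fst.ae hp).and (Measure.quasiMeasurePreserving_snd.ae hp)

/-- The `L¹` modulus of continuity of a periodic function. -/
noncomputable def periodicModulus (K : ℝ → ℝ) (h : ℝ) : ENNReal :=
  ∫⁻ s in Ioc 0 (2 * Real.pi), ENNReal.ofReal |K (s + h) - K s|

theorem measurable_abs_shift_sub {K : ℝ → ℝ} (hK : Measurable K) :
    Measurable fun q : ℝ × ℝ => ENNReal.ofReal |K (q.1 + q.2) - K q.1| :=
  ((hK.comp (measurable_fst.add measurable_snd)).sub (hK.comp measurable_fst)).abs.ennreal_ofReal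

theorem measurable_periodicModulus {K : ℝ → ℝ} (hK : Measurable K) :
    Measurable (periodicModulus K) :=
  (measurable_abs_shift_sub hK).lintegral_prod_left'

theorem periodicModulus_two_mul_le {K : ℝ → ℝ} (hK : Measurable K)
    (hp : Function.Periodic K (2 * Real.pi)) (h : ℝ) :
    periodicModulus K (2 * h) ≤ 2 * periodicModulus K h := by
  have e1 : ∫⁻ s in Ioc 0 (2 * Real.pi), ENNReal.ofReal |K (h + s + h) - K (h + s)| =
      periodicModulus K h :=
    lintegral_periodic_shift (g := fun s => ENNReal.ofReal |K (s + h) - K s|) (fun s => by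
      simp only [add_right_comm s _ h, hp _]) h
  have hm : Measurable fun s => ENNReal.ofReal |K (s + h) - K s| :=
    (measurable_abs_shift_sub hK).comp measurable_prodMk_right
  calc periodicModulus K (2 * h)
      ≤ ∫⁻ s in Ioc 0 (2 * Real.pi), (ENNReal.ofReal |K (h + s + h) - K (h + s)| +
        ENNReal.ofReal |K (s + h) - K s|) := by
        refine lintegral_mono fun s => ?_
        rw [← ENNReal.ofReal_add (abs_nonneg _) (abs_nonneg _)]
        refine ENNReal.ofReal_le_ofReal ?_
        have := abs_add_le (K (h + s + h) - K (h + s)) (K (s + h) - K s)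
        rw [add_comm h s, sub_add_sub_cancel] at this
        rw [two_mul, ← add_assoc, add_comm h s]
        exact this
    _ = 2 * periodicModulus K h := by
        rw [lintegral_add_right _ hm, e1]; exact (two_mul _).symm

/-- A scaling argument. Since `ω(2h) ≤ 2ω(h)`, the substitution `h ↦ 2h` bounds `∫ ω/h²` over `(0,
4π]` by the same integral over `(0, 2π]`, with constant exactly one. That integral is finite, so `ω`
has integral zero over `(2π, 4π]`, and periodicity transfers this to the first period. -/
theorem lintegral_periodicModulus_eq_zero {K : ℝ → ℝ} (hK : Measurable K)
    (hp : Function.Periodic K (2 * Real.pi))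
    (hfin : ∫⁻ h in Ioc 0 (2 * Real.pi), periodicModulus K h * ENNReal.ofReal (1 / h ^ 2) < ⊤) :
    ∫⁻ h in Ioc 0 (2 * Real.pi), periodicModulus K h = 0 := by
  have hm := measurable_periodicModulus hK
  have hm2 : Measurable fun h : ℝ => periodicModulus K h * ENNReal.ofReal (1 / h ^ 2) :=
    hm.mul (by fun_prop)
  have hpi := Real.pi_pos
  have himg : (fun h : ℝ => 2 * h) '' Ioc 0 (2 * Real.pi) = Ioc 0 (4 * Real.pi) := by
    rw [image_mul_left_Ioc two_pos]
    congr 1 <;> ring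
  have h1 : ∫⁻ h in Ioc 0 (4 * Real.pi), periodicModulus K h * ENNReal.ofReal (1 / h ^ 2) ≤
      ∫⁻ h in Ioc 0 (2 * Real.pi), periodicModulus K h * ENNReal.ofReal (1 / h ^ 2) := by
    rw [← himg, lintegral_image_eq_lintegral_abs_deriv_mul (f' := fun _ => 2) measurableSet_Ioc
      (fun x _ => by simpa using (hasDerivAt_id x).const_mul (2 : ℝ) |>.hasDerivWithinAt)
      (fun x _ y _ hxy => by simpa using hxy)]
    refine lintegral_mono fun h => ?_
    calc _ ≤ ENNReal.ofReal |2| * (2 * periodicModulus K h * ENNReal.ofReal (1 / (2 * h) ^ 2)) := by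
          gcongr; exact periodicModulus_two_mul_le hK hp h
      _ = periodicModulus K h * (ENNReal.ofReal |2| * (ENNReal.ofReal 2 *
            ENNReal.ofReal (1 / (2 * h) ^ 2))) := by
          rw [ENNReal.ofReal_ofNat]; ring
      _ = _ := by
          rw [← ENNReal.ofReal_mul (by norm_num), ← ENNReal.ofReal_mul (by norm_num)]
          congr 2
          rw [abs_two, mul_pow]
          field_simp
  have hsplit : Ioc 0 (4 * Real.pi) = Ioc 0 (2 * Real.pi) ∪ Ioc (2 * Real.pi) (4 * Real.pi) :=
    (Ioc_union_Ioc_eq_Ioc (by positivity) (by linarith)).symm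
  rw [hsplit, lintegral_union measurableSet_Ioc (by
    rw [Set.disjoint_left]; intro x hx hx'; exact absurd hx.2 (not_le.2 hx'.1))] at h1
  have h2 : ∫⁻ h in Ioc (2 * Real.pi) (4 * Real.pi),
      periodicModulus K h * ENNReal.ofReal (1 / h ^ 2) = 0 := by
    by_contra h0
    have := ENNReal.lt_add_right hfin.ne h0
    exact absurd h1 (not_le.2 this)
  rw [lintegral_eq_zero_iff hm2] at h2
  have h3 : ∫⁻ h in Ioc (2 * Real.pi) (4 * Real.pi), periodicModulus K h = 0 := by
    rw [lintegral_eq_zero_iff hm]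
    filter_upwards [h2, ae_restrict_mem measurableSet_Ioc] with h hh hm
    have hpos : 0 < h := lt_trans (by positivity) hm.1
    have : ENNReal.ofReal (1 / h ^ 2) ≠ 0 := by
      rw [Ne, ENNReal.ofReal_eq_zero, not_le]; positivity
    exact (mul_eq_zero.1 hh).resolve_right this
  have hmp : Function.Periodic (periodicModulus K) (2 * Real.pi) := fun h => by
    unfold periodicModulus
    simp only [← add_assoc, hp _]
  have h4 := (measurePreserving_add_left volume (2 * Real.pi)).setLIntegral_comp_preimage_emb
      (measurableEmbedding_addLeft (2 * Real.pi)) (periodicModulus K)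
      (Ioc (2 * Real.pi) (4 * Real.pi))
  rw [h3] at h4
  rw [← h4]
  have h5 : (fun x => 2 * Real.pi + x) ⁻¹' Ioc (2 * Real.pi) (4 * Real.pi) = Ioc 0 (2 * Real.pi) := by
    ext x; simp only [mem_preimage, mem_Ioc]; constructor <;> rintro ⟨a, b⟩ <;> constructor <;> linarith
  rw [h5]
  refine lintegral_congr fun x => ?_
  rw [add_comm, hmp]

/-- An integer-valued function in `H^{1/2}` of the circle is constant. -/
theorem MemHHalf.ae_eq_const_of_int {k : ℝ → ℝ} (hk : MemHHalf k)
    (hint : ∀ᵐ θ ∂angularMeasure, ∃ n : ℤ, k θ = n) :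
    ∃ n : ℤ, ∀ᵐ θ ∂angularMeasure, k θ = n := by
  have hpi := Real.two_pi_pos
  have hcc := continuous_circlePt
  obtain ⟨k₁, hk₁, hkk⟩ := hk.1.aestronglyMeasurable.aemeasurable
  -- A representative that is measurable, periodic and integer-valued everywhere, as translations
  -- will be used.
  set K : ℝ → ℝ := fun x => (round (k₁ (2 * Real.pi * Int.fract (x / (2 * Real.pi)))) : ℝ) with hKdef
  have hround : Measurable fun x : ℝ => ((round x : ℤ) : ℝ) := by
    have : (fun x : ℝ => ((round x : ℤ) : ℝ)) = fun x => ((⌊x + 1 / 2⌋ : ℤ) : ℝ) := by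
      ext x; rw [round_eq]
    rw [this]
    exact measurable_from_top.comp (Int.measurable_floor.comp (measurable_id.add_const _))
  have hK : Measurable K := hround.comp (hk₁.comp ((measurable_fract.comp
    (measurable_id.div_const _)).const_mul _))
  have hKp : Function.Periodic K (2 * Real.pi) := fun x => by
    simp only [hKdef]
    rw [add_div, div_self hpi.ne', Int.fract_add_one]
  have hKint : ∀ x, ∃ n : ℤ, K x = n := fun x => ⟨_, rfl⟩
  have hkK : ∀ᵐ θ ∂angularMeasure, k θ = K θ := by
    have hIoo : ∀ᵐ θ ∂angularMeasure, θ ∈ Ioo 0 (2 * Real.pi) := by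
      unfold angularMeasure
      rw [← restrict_Ioo_eq_restrict_Ioc]
      exact ae_restrict_mem measurableSet_Ioo
    filter_upwards [hkk, hint, hIoo] with θ h1 ⟨n, hn⟩ h3
    have hfr : Int.fract (θ / (2 * Real.pi)) = θ / (2 * Real.pi) :=
      Int.fract_eq_self.2 ⟨div_nonneg h3.1.le hpi.le, (div_lt_one hpi).2 h3.2⟩
    simp only [hKdef, hfr, mul_div_cancel₀ _ hpi.ne']
    rw [← h1, hn, round_intCast]
  have hKH := (memHHalf_iff.1 (hk.mono_add (C := 0) (g := K) ((memLp_congr_ae hkK).1 hk.1) (by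
    filter_upwards [ae_prod_of_ae hkK] with q hq
    rw [hq.1, hq.2, zero_mul, add_zero]))).2
  rw [lintegral_prod _ (aemeasurable_hHalfKernel hK.aestronglyMeasurable)] at hKH
  have hfin : ∫⁻ h in Ioc 0 (2 * Real.pi), periodicModulus K h * ENNReal.ofReal (1 / h ^ 2) < ⊤ := by
    refine lt_of_le_of_lt ?_ hKH
    have e1 : ∀ h, periodicModulus K h * ENNReal.ofReal (1 / h ^ 2) =
        ∫⁻ s in Ioc 0 (2 * Real.pi), ENNReal.ofReal |K (s + h) - K s| * ENNReal.ofReal (1 / h ^ 2) :=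
      fun h => (lintegral_mul_const' _ _ ENNReal.ofReal_ne_top).symm
    simp_rw [e1]
    rw [lintegral_lintegral_swap (by
      refine Measurable.aemeasurable ?_
      exact ((measurable_abs_shift_sub hK).comp measurable_swap).mul
        (by fun_prop : Measurable fun q : ℝ × ℝ => ENNReal.ofReal (1 / q.1 ^ 2)))]
    refine lintegral_mono fun s => ?_
    have e2 : ∫⁻ t, hHalfKernel K (s, t) ∂angularMeasure =
        ∫⁻ h in Ioc 0 (2 * Real.pi), hHalfKernel K (s, s + h) :=
      (lintegral_periodic_shift (g := fun t => hHalfKernel K (s, t)) (fun t => by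
        simp only [hHalfKernel, hKp _, circlePt_add_two_pi]) s).symm
    rw [e2, ← restrict_Ioo_eq_restrict_Ioc]
    refine setLIntegral_mono' measurableSet_Ioo fun h hh => ?_
    rw [← ENNReal.ofReal_mul (abs_nonneg _)]
    unfold hHalfKernel
    refine ENNReal.ofReal_le_ofReal ?_
    simp only [norm_circlePt_sub_circlePt_add]
    have hc0 : 0 < ‖circlePt h - 1‖ := norm_pos_iff.2 (sub_ne_zero.2 (circlePt_ne_one hh))
    have hc1 : ‖circlePt h - 1‖ ≤ h := by
      have := norm_circlePt_sub_le h 0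
      rwa [show circlePt 0 = 1 by simp [circlePt], sub_zero, abs_of_pos hh.1] at this
    obtain ⟨n, hn⟩ := hKint (s + h)
    obtain ⟨m, hm⟩ := hKint s
    -- For integers `|n| ≤ n²`. This turns the quadratic seminorm into a bound on the `L¹` modulus
    -- with weight `1/h²`, the chord being at most the arc `h`.
    have hi : |K (s + h) - K s| ≤ ‖K s - K (s + h)‖ ^ 2 := by
      rw [norm_sub_rev, Real.norm_eq_abs, hn, hm]
      have : |n - m| ≤ |n - m| ^ 2 := by
        rcases eq_or_lt_of_le (abs_nonneg (n - m)) with h0 | h0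
        · rw [← h0]; simp
        · nlinarith
      exact_mod_cast this
    rw [div_pow, mul_one_div]
    gcongr
  have h0 := lintegral_periodicModulus_eq_zero hK hKp hfin
  unfold periodicModulus at h0
  rw [lintegral_lintegral_swap (by
      exact ((measurable_abs_shift_sub hK).comp measurable_swap).aemeasurable)] at h0
  have e3 : ∀ s, ∫⁻ h in Ioc 0 (2 * Real.pi), ENNReal.ofReal |K (s + h) - K s| =
      ∫⁻ t in Ioc 0 (2 * Real.pi), ENNReal.ofReal |K t - K s| := fun s =>
    lintegral_periodic_shift (g := fun t => ENNReal.ofReal |K t - K s|)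
      (fun t => by simp only [hKp _]) s
  simp_rw [e3] at h0
  have hm3 : Measurable fun q : ℝ × ℝ => ENNReal.ofReal |K q.2 - K q.1| :=
    ((hK.comp measurable_snd).sub (hK.comp measurable_fst)).abs.ennreal_ofReal
  rw [lintegral_eq_zero_iff hm3.lintegral_prod_right'] at h0
  have hne : (ae angularMeasure).NeBot := by
    rw [ae_neBot, angularMeasure, Ne, Measure.restrict_eq_zero, Real.volume_Ioc]
    simpa using Real.pi_pos
  obtain ⟨s, hs⟩ := Eventually.exists (f := ae angularMeasure) h0
  have hs' : ∫⁻ t, ENNReal.ofReal |K t - K s| ∂angularMeasure = 0 := hs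
  rw [lintegral_eq_zero_iff ((hK.sub_const _).abs.ennreal_ofReal)] at hs'
  obtain ⟨n, hn⟩ := hKint s
  refine ⟨n, ?_⟩
  filter_upwards [hkK, hs'] with t h1 h2
  have h3 : |K t - K s| ≤ 0 := ENNReal.ofReal_eq_zero.1 h2
  rw [h1, ← hn]
  exact sub_eq_zero.1 (abs_eq_zero.1 (le_antisymm h3 (abs_nonneg _)))

end

/-! ### Mollification and a weak chain rule -/

section
open Metric Set ContinuousLinearMap
open scoped Convolution

theorem LocallyIntegrableOn.integrable_test_smul {E : Type*} [NormedAddCommGroup E]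
    [NormedSpace ℝ E] {U : Set ℂ} {a : ℂ → E} (ha : LocallyIntegrableOn a U) {φ : ℂ → ℝ}
    (hφ : Continuous φ) (hc : HasCompactSupport φ) (hs : tsupport φ ⊆ U) :
    Integrable fun z => φ z • a z := by
  rw [← integrableOn_iff_integrable_of_support_subset (s := tsupport φ)]
  · exact (ha.integrableOn_compact_subset hs hc).continuousOn_smul hφ.continuousOn hc
  · intro z hz
    exact subset_tsupport φ fun h0 => hz (by simp [h0])

theorem continuous_fderiv_apply_of_contDiff {φ : ℂ → ℝ} (hφ : ContDiff ℝ ∞ φ) (v : ℂ) :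
    Continuous fun z => fderiv ℝ φ z v :=
  (hφ.continuous_fderiv (by simp)).clm_apply continuous_const

theorem integral_mul_convolution {k b c : ℂ → ℝ} (hk : Continuous k) (hkc : HasCompactSupport k)
    (hb : Integrable b) (hc : Integrable c) :
    ∫ z, c z * (k ⋆[lsmul ℝ ℝ] b) z = ∫ w, b w * ((fun x => k (-x)) ⋆[lsmul ℝ ℝ] c) w := by
  obtain ⟨M, hM⟩ := hkc.exists_bound_of_continuous hk
  have hint : Integrable (fun q : ℂ × ℂ => k (q.1 - q.2) * (c q.1 * b q.2))
      (volume.prod volume) :=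
    (hc.mul_prod hb).bdd_mul (c := M) (hk.comp (continuous_fst.sub continuous_snd)).aestronglyMeasurable
      (ae_of_all _ fun q => hM _)
  have h1 : ∀ z, c z * (k ⋆[lsmul ℝ ℝ] b) z = ∫ w, k (z - w) * (c z * b w) := fun z => by
    rw [convolution_lsmul_swap, ← integral_const_mul]
    congr 1 with w
    rw [smul_eq_mul]; ring
  have h2 : ∀ w, b w * ((fun x => k (-x)) ⋆[lsmul ℝ ℝ] c) w = ∫ z, k (z - w) * (c z * b w) :=
    fun w => by
    rw [convolution_lsmul_swap, ← integral_const_mul]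
    congr 1 with z
    rw [smul_eq_mul, neg_sub]; ring
  simp_rw [h1, h2]
  exact integral_integral_swap hint

theorem fderiv_convolution_apply {k b : ℂ → ℝ} (hk : ContDiff ℝ ∞ k) (hkc : HasCompactSupport k)
    (hb : LocallyIntegrable b) (z v : ℂ) :
    fderiv ℝ (k ⋆[lsmul ℝ ℝ] b) z v = ((fun x => fderiv ℝ k x v) ⋆[lsmul ℝ ℝ] b) z := by
  have h1 := hkc.hasFDerivAt_convolution_left (lsmul ℝ ℝ) (μ := volume) (hk.of_le (by simp)) hb z
  rw [h1.fderiv, convolution, convolution]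
  have h2 : ConvolutionExistsAt (fderiv ℝ k) b z ((lsmul ℝ ℝ).precompL ℂ) volume :=
    HasCompactSupport.convolutionExists_left _ (hkc.fderiv (𝕜 := ℝ))
      (hk.continuous_fderiv (by simp)) hb z
  rw [ContinuousLinearMap.integral_apply h2.integrable]
  rfl

/-- Fubini moves the convolution to the other factor; the minus sign appears because the derivative
of an even kernel is odd. -/
theorem integral_mul_fderiv_convolution {k b c : ℂ → ℝ} (hk : ContDiff ℝ ∞ k)
    (hkc : HasCompactSupport k) (he : ∀ x, k (-x) = k x) (hb : Integrable b) (hc : Integrable c)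
    (v : ℂ) : ∫ z, c z * fderiv ℝ (k ⋆[lsmul ℝ ℝ] b) z v =
      - ∫ z, b z * fderiv ℝ (k ⋆[lsmul ℝ ℝ] c) z v := by
  simp_rw [fderiv_convolution_apply hk hkc hb.locallyIntegrable,
    fderiv_convolution_apply hk hkc hc.locallyIntegrable]
  rw [integral_mul_convolution (continuous_fderiv_apply_of_contDiff hk v)
    (hkc.fderiv_apply (𝕜 := ℝ) v) hb hc, ← integral_neg]
  have h1 : (fun x => fderiv ℝ k (-x) v) = -(fun x => fderiv ℝ k x v) := by
    ext x
    have h2 : HasFDerivAt (fun x => k (-x)) ((fderiv ℝ k (-x)).comp (-ContinuousLinearMap.id ℝ ℂ)) x :=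
      ((hk.differentiable (by simp) (-x)).hasFDerivAt).comp x (hasFDerivAt_id x).neg
    simp_rw [he] at h2
    rw [Pi.neg_apply, h2.fderiv]
    simp
  rw [h1]
  congr 1 with w
  have h3 : ((-(fun x => fderiv ℝ k x v)) ⋆[lsmul ℝ ℝ] c) w =
      -((fun x => fderiv ℝ k x v) ⋆[lsmul ℝ ℝ] c) w := by
    simp only [convolution, Pi.neg_apply, map_neg, neg_apply, integral_neg]
  rw [h3]; ring

theorem norm_convolution_le {k b : ℂ → ℝ} (hk0 : ∀ x, 0 ≤ k x) (hki : Integrable k)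
    (hk1 : ∫ x, k x = 1) {M : ℝ} (hM : ∀ᵐ z, |b z| ≤ M) (z : ℂ) :
    |(k ⋆[lsmul ℝ ℝ] b) z| ≤ M := by
  have h1 : ∀ᵐ w, |b (z - w)| ≤ M := (Measure.measurePreserving_sub_left volume z).quasiMeasurePreserving.ae hM
  have h2 := norm_integral_le_of_norm_le (f := fun w => k w * b (z - w)) (g := fun w => k w * M)
    (hki.mul_const M) (by
      filter_upwards [h1] with w hw
      rw [norm_mul, Real.norm_of_nonneg (hk0 w)]
      exact mul_le_mul_of_nonneg_left hw (hk0 w))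
  rw [integral_mul_const, hk1, one_mul] at h2
  exact h2

theorem tsupport_convolution_subset {k c : ℂ → ℝ} {K : Set ℂ} {δ : ℝ}
    (hk : Function.support k ⊆ closedBall 0 δ) (hc : Function.support c ⊆ K) :
    tsupport (k ⋆[lsmul ℝ ℝ] c) ⊆ cthickening δ K := by
  refine closure_minimal ?_ isClosed_cthickening
  refine (support_convolution_subset (lsmul ℝ ℝ)).trans ?_
  rintro _ ⟨x, hx, y, hy, rfl⟩
  refine mem_cthickening_of_dist_le _ y δ K (hc hy) ?_
  have := hk hx
  rw [mem_closedBall_zero_iff] at this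
  simpa [dist_eq_norm] using this

/-- The chain rule for the square of a bounded weakly differentiable function. -/
theorem integral_fderiv_mul_sq {U : Set ℂ} (hU : IsOpen U) {a g : ℂ → ℝ}
    (ha : LocallyIntegrableOn a U) (hg : LocallyIntegrableOn g U)
    (hb : ∀ᵐ z ∂(volume.restrict U), |a z| ≤ 1) {v : ℂ}
    (hw : ∀ φ : ℂ → ℝ, ContDiff ℝ ∞ φ → HasCompactSupport φ → tsupport φ ⊆ U →
      ∫ z, fderiv ℝ φ z v * a z = - ∫ z, φ z * g z)
    {φ : ℂ → ℝ} (hφ : ContDiff ℝ ∞ φ) (hφc : HasCompactSupport φ) (hφU : tsupport φ ⊆ U) :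
    ∫ z, fderiv ℝ φ z v * a z ^ 2 = - 2 * ∫ z, φ z * (a z * g z) := by
  obtain ⟨K, hK⟩ : ∃ K, K = tsupport φ := ⟨_, rfl⟩
  have hKc : IsCompact K := hK ▸ hφc
  obtain ⟨δ, hδ, hδU⟩ := hKc.exists_cthickening_subset_open hU (hK ▸ hφU)
  obtain ⟨K', hK'⟩ : ∃ K', K' = cthickening δ K := ⟨_, rfl⟩
  have hK'c : IsCompact K' := hK' ▸ hKc.cthickening
  have hK'm : MeasurableSet K' := hK'c.isClosed.measurableSet
  have hKK' : K ⊆ K' := hK' ▸ self_subset_cthickening K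
  rw [← hK'] at hδU
  have hb' : ∀ᵐ z, z ∈ U → |a z| ≤ 1 := (ae_restrict_iff' hU.measurableSet).1 hb
  -- Truncation to a compact neighbourhood of the support of `φ`, so that convolutions are defined
  -- on the whole plane and only see points of `U`.
  set b : ℂ → ℝ := K'.indicator a with hbdef
  have hbi : Integrable b := (integrable_indicator_iff hK'm).2 (ha.integrableOn_compact_subset hδU hK'c)
  have hba : ∀ z ∈ K', b z = a z := fun z hz => indicator_of_mem hz a
  have hb1 : ∀ᵐ z, |b z| ≤ 1 := by
    filter_upwards [hb'] with z hz
    by_cases hzK : z ∈ K'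
    · rw [hba z hzK]; exact hz (hδU hzK)
    · rw [hbdef, indicator_of_notMem hzK]; simp
  set c : ℂ → ℝ := fun z => φ z * a z with hcdef
  have hci : Integrable c := LocallyIntegrableOn.integrable_test_smul ha hφ.continuous hφc hφU
  have hφ0 : ∀ z, z ∉ K → φ z = 0 := fun z hz => image_eq_zero_of_notMem_tsupport (hK ▸ hz)
  have hcs : Function.support c ⊆ K := fun z hz => by
    by_contra h0
    exact hz (by simp [hcdef, hφ0 z h0])
  obtain ⟨M, hM⟩ := hφc.exists_bound_of_continuous hφ.continuous
  have hM0 : 0 ≤ M := (norm_nonneg _).trans (hM 0)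
  have hcM : ∀ᵐ z, |c z| ≤ M := by
    filter_upwards [hb'] with z hz
    by_cases hzK : z ∈ K
    · rw [hcdef, abs_mul]
      have := hz (hδU (hKK' hzK))
      have h2 : |φ z| ≤ M := hM z
      nlinarith [abs_nonneg (φ z), abs_nonneg (a z)]
    · rw [hcdef]; simpa [hφ0 z hzK] using hM0
  have hdφ0 : ∀ z, z ∉ K → fderiv ℝ φ z v = 0 := fun z hz => by
    rw [fderiv_of_notMem_tsupport ℝ (hK ▸ hz)]; rfl
  have hδn : ∀ n : ℕ, 0 < δ / (n + 1) := fun n => by positivity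
  let β : ℕ → ContDiffBump (0 : ℂ) := fun n =>
    ⟨δ / (n + 1) / 2, δ / (n + 1), half_pos (hδn n), half_lt_self (hδn n)⟩
  have hβ0 : Tendsto (fun n => (β n).rOut) atTop (𝓝 0) :=
    tendsto_const_div_atTop_nhds_zero_nat δ |>.comp (tendsto_add_atTop_nat 1) |>.congr fun n => by
      simp [β]
  have hβK : ∀ᶠ n in atTop, (β n).rOut ≤ 2 * (β n).rIn := Eventually.of_forall fun n => by
    simp only [β]; linarith
  let k : ℕ → ℂ → ℝ := fun n => (β n).normed volume
  have hk : ∀ n, ContDiff ℝ ∞ (k n) := fun n => (β n).contDiff_normed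
  have hkc : ∀ n, HasCompactSupport (k n) := fun n => (β n).hasCompactSupport_normed
  have hke : ∀ n x, k n (-x) = k n x := fun n x => (β n).normed_neg x
  have hks : ∀ n, Function.support (k n) ⊆ closedBall 0 δ := fun n => by
    rw [(β n).support_normed_eq]
    refine ball_subset_closedBall.trans (closedBall_subset_closedBall ?_)
    simp only [β]
    exact div_le_self hδ.le (by linarith [n.cast_nonneg (α := ℝ)])
  have hkn : ∀ n x, 0 ≤ k n x := fun n x => (β n).nonneg_normed x
  have hki : ∀ n, Integrable (k n) := fun n => (β n).integrable_normed
  have hk1 : ∀ n, ∫ x, k n x = 1 := fun n => (β n).integral_normed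
  let A : ℕ → ℂ → ℝ := fun n => k n ⋆[lsmul ℝ ℝ] b
  let S : ℕ → ℂ → ℝ := fun n => k n ⋆[lsmul ℝ ℝ] c
  have hA : ∀ n, ContDiff ℝ ∞ (A n) := fun n =>
    (hkc n).contDiff_convolution_left _ (hk n) hbi.locallyIntegrable
  have hS : ∀ n, ContDiff ℝ ∞ (S n) := fun n =>
    (hkc n).contDiff_convolution_left _ (hk n) hci.locallyIntegrable
  have hA1 : ∀ n z, |A n z| ≤ 1 := fun n z => norm_convolution_le (hkn n) (hki n) (hk1 n) hb1 z
  have hS1 : ∀ n z, |S n z| ≤ M := fun n z => norm_convolution_le (hkn n) (hki n) (hk1 n) hcM z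
  have hSs : ∀ n, tsupport (S n) ⊆ K' := fun n =>
    hK' ▸ tsupport_convolution_subset (hks n) hcs
  have hSc : ∀ n, HasCompactSupport (S n) := fun n => hK'c.of_isClosed_subset isClosed_closure (hSs n)
  have hAt := ContDiffBump.ae_convolution_tendsto_right_of_locallyIntegrable hβ0 hβK
    (μ := volume) hbi.locallyIntegrable
  have hSt := ContDiffBump.ae_convolution_tendsto_right_of_locallyIntegrable hβ0 hβK
    (μ := volume) hci.locallyIntegrable
  have hdφa : Integrable fun z => fderiv ℝ φ z v * a z :=
    LocallyIntegrableOn.integrable_test_smul ha (continuous_fderiv_apply_of_contDiff hφ v)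
      (hφc.fderiv_apply (𝕜 := ℝ) v) ((tsupport_fderiv_apply_subset ℝ v).trans hφU)
  have hφg : Integrable fun z => φ z * g z :=
    LocallyIntegrableOn.integrable_test_smul hg hφ.continuous hφc hφU
  have hI1 : ∀ n, Integrable fun z => A n z * (fderiv ℝ φ z v * a z) := fun n =>
    hdφa.bdd_mul (c := 1) (hA n).continuous.aestronglyMeasurable (ae_of_all _ (hA1 n))
  -- The weak equation is tested with `φ A_n`, where `A_n` mollifies `a`; in the term containing
  -- `∂_v A_n` the mollifier is moved onto `φ a`, which yields the admissible test function `S_n`.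
  -- In the limit this reads `∫ a² ∂_vφ + ∫ φ a g = -∫ φ a g`.
  have hid : ∀ n, (∫ z, A n z * (fderiv ℝ φ z v * a z)) + ∫ z, S n z * g z =
      - ∫ z, A n z * (φ z * g z) := by
    intro n
    have hψ : ContDiff ℝ ∞ fun z => φ z * A n z := hφ.mul (hA n)
    have hψc : HasCompactSupport fun z => φ z * A n z := hφc.mul_right
    have h1 := hw _ hψ hψc ((closure_mono (Function.support_mul_subset_left _ _)).trans hφU)
    have h2 : ∀ z, fderiv ℝ (fun z => φ z * A n z) z v =
        A n z * fderiv ℝ φ z v + φ z * fderiv ℝ (A n) z v := fun z => by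
      rw [fderiv_fun_mul (hφ.differentiable (by simp) z) ((hA n).differentiable (by simp) z)]
      simp; ring
    have h3 : Integrable fun z => c z * fderiv ℝ (A n) z v := by
      have := LocallyIntegrableOn.integrable_test_smul ha (φ := fun z => φ z * fderiv ℝ (A n) z v)
        (hφ.continuous.mul (continuous_fderiv_apply_of_contDiff (hA n) v)) hφc.mul_right
        ((closure_mono (Function.support_mul_subset_left _ _)).trans hφU)
      refine this.congr (ae_of_all _ fun z => ?_)
      simp only [hcdef, smul_eq_mul]; ring
    have h4 : ∫ z, c z * fderiv ℝ (A n) z v = ∫ z, S n z * g z := by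
      rw [integral_mul_fderiv_convolution (hk n) (hkc n) (hke n) hbi hci, neg_eq_iff_eq_neg,
        ← hw (S n) (hS n) (hSc n) ((hSs n).trans hδU)]
      refine integral_congr_ae (ae_of_all _ fun z => ?_)
      by_cases hz : z ∈ K'
      · simp only [hba z hz, mul_comm]; rfl
      · have h0 : fderiv ℝ (S n) z v = 0 := by
          rw [fderiv_of_notMem_tsupport ℝ fun h => hz (hSs n h)]; rfl
        simp only [h0, zero_mul]
        rw [show fderiv ℝ (k n ⋆[lsmul ℝ ℝ] c) z v = 0 from h0, mul_zero]
    rw [← h4, ← integral_add (hI1 n) h3]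
    have e1 : ∀ z, fderiv ℝ (fun z => φ z * A n z) z v * a z =
        A n z * (fderiv ℝ φ z v * a z) + c z * fderiv ℝ (A n) z v := fun z => by
      rw [h2]; simp only [hcdef]; ring
    simp_rw [e1] at h1
    rw [h1]
    congr 2 with z
    ring
  have hl1 : Tendsto (fun n => ∫ z, A n z * (fderiv ℝ φ z v * a z)) atTop
      (𝓝 (∫ z, fderiv ℝ φ z v * a z ^ 2)) := by
    have e : ∫ z, fderiv ℝ φ z v * a z ^ 2 = ∫ z, b z * (fderiv ℝ φ z v * a z) := by
      congr 1 with z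
      by_cases hz : z ∈ K
      · rw [hba z (hKK' hz)]; ring
      · simp [hdφ0 z hz]
    rw [e]
    refine tendsto_integral_of_dominated_convergence (fun z => ‖fderiv ℝ φ z v * a z‖)
      (fun n => (hI1 n).aestronglyMeasurable) hdφa.norm (fun n => ae_of_all _ fun z => ?_) ?_
    · rw [norm_mul]
      exact mul_le_of_le_one_left (norm_nonneg _) (hA1 n z)
    · filter_upwards [hAt] with z hz using hz.mul_const _
  have hl3 : Tendsto (fun n => ∫ z, A n z * (φ z * g z)) atTop
      (𝓝 (∫ z, φ z * (a z * g z))) := by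
    have e : ∫ z, φ z * (a z * g z) = ∫ z, b z * (φ z * g z) := by
      congr 1 with z
      by_cases hz : z ∈ K
      · rw [hba z (hKK' hz)]; ring
      · simp [hφ0 z hz]
    rw [e]
    refine tendsto_integral_of_dominated_convergence (fun z => ‖φ z * g z‖)
      (fun n => (hA n).continuous.aestronglyMeasurable.mul hφg.aestronglyMeasurable) hφg.norm
      (fun n => ae_of_all _ fun z => ?_) ?_
    · rw [norm_mul]
      exact mul_le_of_le_one_left (norm_nonneg _) (hA1 n z)
    · filter_upwards [hAt] with z hz using hz.mul_const _
  have hl2 : Tendsto (fun n => ∫ z, S n z * g z) atTop (𝓝 (∫ z, φ z * (a z * g z))) := by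
    have e : ∫ z, φ z * (a z * g z) = ∫ z, c z * g z := by
      congr 1 with z
      simp only [hcdef]; ring
    rw [e]
    have hgi : Integrable (K'.indicator g) :=
      (integrable_indicator_iff hK'm).2 (hg.integrableOn_compact_subset hδU hK'c)
    have hSg : ∀ n z, S n z * g z = S n z * K'.indicator g z := fun n z => by
      by_cases hz : z ∈ K'
      · rw [indicator_of_mem hz]
      · rw [image_eq_zero_of_notMem_tsupport fun h => hz (hSs n h)]; simp
    have hcg : ∀ z, c z * g z = c z * K'.indicator g z := fun z => by
      by_cases hz : z ∈ K'
      · rw [indicator_of_mem hz]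
      · simp [hcdef, hφ0 z fun h => hz (hKK' h)]
    simp_rw [hSg, hcg]
    refine tendsto_integral_of_dominated_convergence (fun z => M * ‖K'.indicator g z‖)
      (fun n => (hS n).continuous.aestronglyMeasurable.mul hgi.aestronglyMeasurable)
      (hgi.norm.const_mul M) (fun n => ae_of_all _ fun z => ?_) ?_
    · rw [norm_mul]
      exact mul_le_mul_of_nonneg_right (hS1 n z) (norm_nonneg _)
    · filter_upwards [hSt] with z hz using hz.mul_const _
  have hfin := tendsto_nhds_unique ((hl1.add hl2).congr hid) hl3.neg
  linarith

end

/-! ### Weak derivatives and circle-valued maps -/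

section
open Metric Set ContinuousLinearMap
open scoped ComplexConjugate

/-- Classical derivatives are weak derivatives. -/
theorem hasWeakDeriv_of_hasFDerivAt {E : Type*} [NormedAddCommGroup E] [NormedSpace ℝ E]
    {U : Set ℂ} (hU : IsOpen U) {u : ℂ → E} {Du : ℂ → ℂ →L[ℝ] E}
    (hd : ∀ z ∈ U, HasFDerivAt u (Du z) z) (hc : LocallyIntegrableOn Du U) :
    HasWeakDeriv U u Du where
  locallyIntegrableOn := ContinuousOn.locallyIntegrableOn
    (fun z hz => (hd z hz).continuousAt.continuousWithinAt) hU.measurableSet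
  locallyIntegrableOn_deriv := hc
  integral_eq φ hφ hφc hφU v := by
    have hu : LocallyIntegrableOn u U := ContinuousOn.locallyIntegrableOn
      (fun z hz => (hd z hz).continuousAt.continuousWithinAt) hU.measurableSet
    have h1 := LocallyIntegrableOn.integrable_test_smul hu
      (continuous_fderiv_apply_of_contDiff hφ v) (hφc.fderiv_apply (𝕜 := ℝ) v)
      ((tsupport_fderiv_apply_subset ℝ v).trans hφU)
    have h2 := LocallyIntegrableOn.integrable_test_smul
      ((ContinuousLinearMap.apply ℝ E v).locallyIntegrableOn_comp hc) hφ.continuous hφc hφU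
    have h3 := LocallyIntegrableOn.integrable_test_smul hu hφ.continuous hφc hφU
    have h4 := integral_bilinear_hasFDerivAt_right_eq_neg_left_of_integrable (μ := volume)
      (f := φ) (f' := fderiv ℝ φ) (g := u) (g' := Du) (v := v) (B := lsmul ℝ ℝ)
      h1 h2 h3 (fun z _ => (hφ.differentiable (by simp) z).hasFDerivAt) (fun z hz => hd z (hφU hz))
    simp only [lsmul_apply] at h4
    rw [h4, neg_neg]

theorem integral_fderiv_apply_eq_zero {φ : ℂ → ℝ} (hφ : ContDiff ℝ ∞ φ) (hφc : HasCompactSupport φ)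
    (v : ℂ) : ∫ z, fderiv ℝ φ z v = 0 := by
  have := (hasWeakDeriv_of_hasFDerivAt isOpen_univ (u := fun _ => (1 : ℝ)) (Du := fun _ => 0)
    (fun z _ => hasFDerivAt_const _ _) (continuous_const.locallyIntegrable.locallyIntegrableOn _)).integral_eq
    φ hφ hφc (subset_univ _) v
  simpa using this

theorem LocallyIntegrableOn.mul_of_ae_le_one {U : Set ℂ} {a b : ℂ → ℝ}
    (ha : LocallyIntegrableOn a U) (hb : LocallyIntegrableOn b U)
    (hb1 : ∀ᵐ z ∂(volume.restrict U), |b z| ≤ 1) : LocallyIntegrableOn (fun z => b z * a z) U := by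
  intro x hx
  obtain ⟨s, hs, hsi⟩ := ha x hx
  obtain ⟨t, ht, hti⟩ := hb x hx
  refine ⟨(s ∩ t) ∩ U, inter_mem (inter_mem hs ht) self_mem_nhdsWithin, ?_⟩
  exact Integrable.bdd_mul (c := 1) (hsi.mono_set (inter_subset_left.trans inter_subset_left))
    (hti.mono_set (inter_subset_left.trans inter_subset_right)).aestronglyMeasurable
    (ae_restrict_of_ae_restrict_of_subset inter_subset_right hb1)

namespace HasWeakDeriv

variable {U : Set ℂ}

theorem locallyIntegrableOn_apply {E : Type*} [NormedAddCommGroup E] [NormedSpace ℝ E]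
    {u : ℂ → E} {Du : ℂ → ℂ →L[ℝ] E} (h : HasWeakDeriv U u Du) (v : ℂ) :
    LocallyIntegrableOn (fun z => Du z v) U :=
  (ContinuousLinearMap.apply ℝ E v).locallyIntegrableOn_comp h.locallyIntegrableOn_deriv

theorem clm_comp {E F : Type*} [NormedAddCommGroup E] [NormedSpace ℝ E] [CompleteSpace E]
    [NormedAddCommGroup F] [NormedSpace ℝ F] [CompleteSpace F]
    {u : ℂ → E} {Du : ℂ → ℂ →L[ℝ] E} (h : HasWeakDeriv U u Du) (L : E →L[ℝ] F) :
    HasWeakDeriv U (fun z => L (u z)) (fun z => L.comp (Du z)) where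
  locallyIntegrableOn := L.locallyIntegrableOn_comp h.locallyIntegrableOn
  locallyIntegrableOn_deriv :=
    ((ContinuousLinearMap.compL ℝ ℂ E F) L).locallyIntegrableOn_comp h.locallyIntegrableOn_deriv
  integral_eq φ hφ hφc hφU v := by
    have h1 := LocallyIntegrableOn.integrable_test_smul h.locallyIntegrableOn
      (continuous_fderiv_apply_of_contDiff hφ v) (hφc.fderiv_apply (𝕜 := ℝ) v)
      ((tsupport_fderiv_apply_subset ℝ v).trans hφU)
    have h2 := LocallyIntegrableOn.integrable_test_smul (h.locallyIntegrableOn_apply v)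
      hφ.continuous hφc hφU
    have h3 := congrArg L (h.integral_eq φ hφ hφc hφU v)
    rw [map_neg, ← L.integral_comp_comm h1, ← L.integral_comp_comm h2] at h3
    simpa using h3

theorem sub {E : Type*} [NormedAddCommGroup E] [NormedSpace ℝ E]
    {u w : ℂ → E} {Du Dw : ℂ → ℂ →L[ℝ] E} (hu : HasWeakDeriv U u Du) (hw : HasWeakDeriv U w Dw) :
    HasWeakDeriv U (fun z => u z - w z) (fun z => Du z - Dw z) where
  locallyIntegrableOn := hu.locallyIntegrableOn.sub hw.locallyIntegrableOn
  locallyIntegrableOn_deriv := hu.locallyIntegrableOn_deriv.sub hw.locallyIntegrableOn_deriv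
  integral_eq φ hφ hφc hφU v := by
    have h1 : ∀ {a : ℂ → E}, LocallyIntegrableOn a U → Integrable fun z => fderiv ℝ φ z v • a z :=
      fun ha => LocallyIntegrableOn.integrable_test_smul ha
        (continuous_fderiv_apply_of_contDiff hφ v) (hφc.fderiv_apply (𝕜 := ℝ) v)
        ((tsupport_fderiv_apply_subset ℝ v).trans hφU)
    have h2 : ∀ {a : ℂ → E}, LocallyIntegrableOn a U → Integrable fun z => φ z • a z :=
      fun ha => LocallyIntegrableOn.integrable_test_smul ha hφ.continuous hφc hφU
    simp only [smul_sub, sub_apply]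
    rw [integral_sub (h1 hu.locallyIntegrableOn) (h1 hw.locallyIntegrableOn),
      integral_sub (h2 (hu.locallyIntegrableOn_apply v)) (h2 (hw.locallyIntegrableOn_apply v)),
      hu.integral_eq φ hφ hφc hφU v, hw.integral_eq φ hφ hφc hφU v]
    abel

/-- The differential of a circle-valued map is tangential. -/
theorem dot_eq_zero (hU : IsOpen U) {u : ℂ → ℂ} {Du : ℂ → ℂ →L[ℝ] ℂ} (h : HasWeakDeriv U u Du)
    (hn : ∀ᵐ z ∂(volume.restrict U), ‖u z‖ = 1) (v : ℂ) :
    ∀ᵐ z ∂(volume.restrict U), dot (Du z v) (u z) = 0 := by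
  have hre := h.clm_comp reCLM
  have him := h.clm_comp imCLM
  have hn' : ∀ᵐ z, z ∈ U → ‖u z‖ = 1 := (ae_restrict_iff' hU.measurableSet).1 hn
  have hb1 : ∀ᵐ z ∂(volume.restrict U), |(u z).re| ≤ 1 := by
    filter_upwards [hn] with z hz using hz ▸ abs_re_le_norm _
  have hb2 : ∀ᵐ z ∂(volume.restrict U), |(u z).im| ≤ 1 := by
    filter_upwards [hn] with z hz using hz ▸ abs_im_le_norm _
  have hloc1 : LocallyIntegrableOn (fun z => (u z).re * (Du z v).re) U :=
    LocallyIntegrableOn.mul_of_ae_le_one (hre.locallyIntegrableOn_apply v) hre.locallyIntegrableOn hb1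
  have hloc2 : LocallyIntegrableOn (fun z => (u z).im * (Du z v).im) U :=
    LocallyIntegrableOn.mul_of_ae_le_one (him.locallyIntegrableOn_apply v) him.locallyIntegrableOn hb2
  rw [ae_restrict_iff' hU.measurableSet]
  refine IsOpen.ae_eq_zero_of_integral_contDiff_smul_eq_zero hU ?_ fun φ hφ hφc hφU => ?_
  · refine (hloc1.add hloc2).congr (ae_of_all _ fun z => ?_)
    simp only [dot, Pi.add_apply]; ring
  have e1 := integral_fderiv_mul_sq hU hre.locallyIntegrableOn (hre.locallyIntegrableOn_apply v) hb1
    (fun φ h1 h2 h3 => by simpa using hre.integral_eq φ h1 h2 h3 v) hφ hφc hφU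
  have e2 := integral_fderiv_mul_sq hU him.locallyIntegrableOn (him.locallyIntegrableOn_apply v) hb2
    (fun φ h1 h2 h3 => by simpa using him.integral_eq φ h1 h2 h3 v) hφ hφc hφU
  have hdφ : ∀ {a : ℂ → ℝ}, LocallyIntegrableOn a U → Integrable fun z => fderiv ℝ φ z v * a z :=
    fun ha => LocallyIntegrableOn.integrable_test_smul ha
      (continuous_fderiv_apply_of_contDiff hφ v) (hφc.fderiv_apply (𝕜 := ℝ) v)
      ((tsupport_fderiv_apply_subset ℝ v).trans hφU)
  have hφi : ∀ {a : ℂ → ℝ}, LocallyIntegrableOn a U → Integrable fun z => φ z * a z :=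
    fun ha => LocallyIntegrableOn.integrable_test_smul ha hφ.continuous hφc hφU
  have hsq1 : LocallyIntegrableOn (fun z => (u z).re * (u z).re) U :=
    LocallyIntegrableOn.mul_of_ae_le_one hre.locallyIntegrableOn hre.locallyIntegrableOn hb1
  have hsq2 : LocallyIntegrableOn (fun z => (u z).im * (u z).im) U :=
    LocallyIntegrableOn.mul_of_ae_le_one him.locallyIntegrableOn him.locallyIntegrableOn hb2
  -- On the support of `φ` the squares of the two components add up to one, so the left sides of the
  -- two chain rules sum to `∫ ∂_vφ = 0`; the right sides sum to `-2 ∫ φ ⟨∂_v u, u⟩`.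
  have e3 : (∫ z, fderiv ℝ φ z v * (u z).re ^ 2) + ∫ z, fderiv ℝ φ z v * (u z).im ^ 2 = 0 := by
    simp only [sq]
    rw [← integral_add (hdφ hsq1) (hdφ hsq2), ← integral_fderiv_apply_eq_zero hφ hφc v]
    refine integral_congr_ae ?_
    filter_upwards [hn'] with z hz
    by_cases hzs : z ∈ tsupport φ
    · have h1 := hz (hφU hzs)
      have h2 : (u z).re * (u z).re + (u z).im * (u z).im = 1 := by
        rw [← normSq_apply, normSq_eq_norm_sq, h1, one_pow]
      linear_combination fderiv ℝ φ z v * h2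
    · rw [fderiv_of_notMem_tsupport ℝ hzs]; simp
  have e4 : ∫ z, φ z • dot (Du z v) (u z) =
      (∫ z, φ z * ((u z).re * (Du z v).re)) + ∫ z, φ z * ((u z).im * (Du z v).im) := by
    rw [← integral_add (hφi hloc1) (hφi hloc2)]
    congr 1 with z
    simp only [dot, smul_eq_mul]; ring
  rw [e4]
  simp only [reCLM_apply, imCLM_apply, coe_comp, Function.comp_apply] at e1 e2
  linarith

end HasWeakDeriv

end

/-! ### Vanishing moments and smooth truncations -/

section
open Metric Set ContinuousLinearMap
open scoped ComplexConjugate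

/-- A complex function on the disk with vanishing moments is zero. -/
theorem ae_eq_zero_of_moments_eq_zero {F : ℂ → ℂ} (hF : IntegrableOn F (ball 0 1))
    (hm : ∀ a b : ℕ, ∫ z in ball (0 : ℂ) 1, F z * (z ^ a * conj z ^ b) = 0) :
    ∀ᵐ z ∂(volume.restrict (ball (0 : ℂ) 1)), F z = 0 := by
  classical
  set K : Set ℂ := closedBall 0 1 with hK
  have : CompactSpace K := isCompact_iff_compactSpace.1 (isCompact_closedBall 0 1)
  have hsub : ball (0 : ℂ) 1 ⊆ K := ball_subset_closedBall
  -- the extension of a function on the closed disk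
  let ext : C(K, ℂ) → ℂ → ℂ := fun g z => if h : z ∈ K then g ⟨z, h⟩ else 0
  have hext : ∀ g z (hz : z ∈ K), ext g z = g ⟨z, hz⟩ := fun g z hz => dif_pos hz
  have hextm : ∀ g, AEStronglyMeasurable (ext g) (volume.restrict (ball (0 : ℂ) 1)) := fun g => by
    have : ContinuousOn (ext g) K := by
      rw [continuousOn_iff_continuous_domRestrict]
      convert g.continuous using 1
      ext z; exact hext g z z.2
    exact (this.mono hsub).aestronglyMeasurable measurableSet_ball
  have hbd : ∀ g z, z ∈ ball (0 : ℂ) 1 → ‖ext g z‖ ≤ ‖g‖ := fun g z hz => by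
    rw [hext g z (hsub hz)]; exact g.norm_coe_le_norm _
  have hint : ∀ g, IntegrableOn (fun z => F z * ext g z) (ball 0 1) := fun g =>
    Integrable.mul_bdd (c := ‖g‖) hF (hextm g)
      (by filter_upwards [ae_restrict_mem measurableSet_ball] with z hz using hbd g z hz)
  let T : C(K, ℂ) →ₗ[ℂ] ℂ :=
    { toFun := fun g => ∫ z in ball (0 : ℂ) 1, F z * ext g z
      map_add' := fun g h => by
        rw [← integral_add (hint g) (hint h)]
        refine setIntegral_congr_fun measurableSet_ball fun z hz => ?_
        simp only [hext _ z (hsub hz), ContinuousMap.add_apply]; ring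
      map_smul' := fun c g => by
        rw [RingHom.id_apply, smul_eq_mul, ← integral_const_mul]
        refine setIntegral_congr_fun measurableSet_ball fun z hz => ?_
        simp only [hext _ z (hsub hz), ContinuousMap.smul_apply, smul_eq_mul]; ring }
  have hTc : Continuous T := by
    refine (T.mkContinuous (∫ z in ball (0 : ℂ) 1, ‖F z‖) fun g => ?_).continuous
    rw [← integral_mul_const]
    refine norm_integral_le_of_norm_le (hF.norm.mul_const _) ?_
    filter_upwards [ae_restrict_mem measurableSet_ball] with z hz
    rw [norm_mul]
    exact mul_le_mul_of_nonneg_left (hbd g z hz) (norm_nonneg _)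
  -- Stone–Weierstrass: `T` is a continuous functional that vanishes on the monomials `z^a z̄^b`,
  -- whose span is dense.
  have hT0 : ∀ g, T g = 0 := by
    set X : C(K, ℂ) := Polynomial.toContinuousMapOnAlgHom K Polynomial.X with hX
    have hXz : ∀ z : K, X z = z := fun z => by simp [hX]
    have hmon : ∀ g ∈ Submonoid.closure ({X} ∪ star {X} : Set C(K, ℂ)), ∃ a b : ℕ, ∀ z : K,
        g z = (z : ℂ) ^ a * conj (z : ℂ) ^ b := by
      intro g hg
      induction hg using Submonoid.closure_induction with
      | mem x hx =>
        rcases hx with hx | hx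
        · rw [mem_singleton_iff] at hx
          exact ⟨1, 0, fun z => by rw [hx, hXz]; simp⟩
        · rw [Set.mem_star, mem_singleton_iff, star_eq_iff_star_eq] at hx
          exact ⟨0, 1, fun z => by rw [← hx, ContinuousMap.star_apply, hXz]; simp⟩
      | one => exact ⟨0, 0, fun z => by simp⟩
      | mul x y _ _ hx hy =>
        obtain ⟨a, b, h1⟩ := hx
        obtain ⟨a', b', h2⟩ := hy
        exact ⟨a + a', b + b', fun z => by rw [ContinuousMap.mul_apply, h1, h2]; ring⟩
    have hker : ∀ g ∈ Algebra.adjoin ℂ ({X} ∪ star {X} : Set C(K, ℂ)), T g = 0 := by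
      intro g hg
      rw [← Subalgebra.mem_toSubmodule, Algebra.adjoin_eq_span] at hg
      have : Submodule.span ℂ ((Submonoid.closure ({X} ∪ star {X} : Set C(K, ℂ)) : Set C(K, ℂ))) ≤
          LinearMap.ker T := by
        rw [Submodule.span_le]
        intro x hx
        obtain ⟨a, b, h⟩ := hmon x hx
        rw [SetLike.mem_coe, LinearMap.mem_ker, ← hm a b]
        refine setIntegral_congr_fun measurableSet_ball fun z hz => ?_
        simp only [hext _ z (hsub hz), h]
      exact this hg
    intro g
    have hg : g ∈ (polynomialFunctions K).starClosure.topologicalClosure := by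
      rw [polynomialFunctions.starClosure_topologicalClosure]; trivial
    rw [polynomialFunctions.starClosure_eq_adjoin_X] at hg
    have hcl : IsClosed {g | T g = 0} := isClosed_singleton.preimage hTc
    refine closure_minimal (s := (StarAlgebra.adjoin ℂ {X} : Set C(K, ℂ))) (fun x hx => ?_) hcl hg
    exact hker x hx
  rw [ae_restrict_iff' measurableSet_ball]
  refine isOpen_ball.ae_eq_zero_of_integral_contDiff_smul_eq_zero hF.locallyIntegrableOn
    fun φ hφ hφc hφs => ?_
  let g : C(K, ℂ) := ⟨fun z => (φ z : ℂ), by have := hφ.continuous; fun_prop⟩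
  rw [← setIntegral_eq_integral_of_forall_compl_eq_zero (s := ball 0 1)]
  · refine Eq.trans ?_ (hT0 g)
    refine setIntegral_congr_fun measurableSet_ball fun z hz => ?_
    simp only [hext _ z (hsub hz), real_smul]
    exact mul_comm _ _
  · intro z hz
    rw [image_eq_zero_of_notMem_tsupport fun h => hz (hφs h), zero_smul]

/-- Smooth truncations of the identity. -/
noncomputable def truncId (n : ℕ) (x : ℝ) : ℝ := ∫ t in (0 : ℝ)..x, Real.smoothTransition (n * t - 1)

theorem hasDerivAt_truncId (n : ℕ) (x : ℝ) :
    HasDerivAt (truncId n) (Real.smoothTransition (n * x - 1)) x := by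
  have hc : Continuous fun t : ℝ => Real.smoothTransition (n * t - 1) :=
    Real.smoothTransition.continuous.comp (by fun_prop)
  exact (hc.integral_hasStrictDerivAt 0 x).hasDerivAt

theorem contDiff_truncId (n : ℕ) : ContDiff ℝ ∞ (truncId n) := by
  rw [contDiff_infty_iff_deriv]
  refine ⟨fun x => (hasDerivAt_truncId n x).differentiableAt, ?_⟩
  rw [show deriv (truncId n) = fun x : ℝ => Real.smoothTransition (n * x - 1) from
    funext fun x => (hasDerivAt_truncId n x).deriv]
  exact Real.smoothTransition.contDiff.comp (by fun_prop)

theorem truncId_eq_zero {n : ℕ} {x : ℝ} (hx : n * x ≤ 1) : truncId n x = 0 := by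
  unfold truncId
  rw [intervalIntegral.integral_congr (g := fun _ => 0), intervalIntegral.integral_zero]
  intro t ht
  refine Real.smoothTransition.zero_of_nonpos ?_
  rcases le_total 0 x with h | h
  · rw [uIcc_of_le h] at ht
    nlinarith [ht.1, ht.2, n.cast_nonneg (α := ℝ)]
  · rw [uIcc_of_ge h] at ht
    nlinarith [ht.1, ht.2, n.cast_nonneg (α := ℝ)]

/-- The derivative of the truncation lies in `[0, 1]` and equals `1` beyond `2/n`, so the deviation
from the identity accumulates only on `[0, 2/n]`. -/
theorem abs_truncId_sub_le {n : ℕ} (hn : 0 < n) {x : ℝ} (hx : 0 ≤ x) :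
    |truncId n x - x| ≤ 2 / n := by
  have hn' : (0 : ℝ) < n := by exact_mod_cast hn
  have hc : Continuous fun t : ℝ => Real.smoothTransition (n * t - 1) :=
    Real.smoothTransition.continuous.comp (by fun_prop)
  have hD : ∀ t, HasDerivAt (fun x => truncId n x - x) (Real.smoothTransition (n * t - 1) - 1) t :=
    fun t => (hasDerivAt_truncId n t).sub (hasDerivAt_id t)
  have hbd : ∀ t, |Real.smoothTransition (n * t - 1) - 1| ≤ 1 := fun t => by
    rw [abs_le]
    constructor <;> linarith [Real.smoothTransition.nonneg (n * t - 1),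
      Real.smoothTransition.le_one (n * t - 1)]
  have h0 : truncId n 0 = 0 := by simp [truncId]
  have hlip : ∀ x y, |(truncId n y - y) - (truncId n x - x)| ≤ 1 * |y - x| := fun x y =>
    convex_univ.norm_image_sub_le_of_norm_hasDerivWithin_le (f := fun x => truncId n x - x)
      (fun t _ => (hD t).hasDerivWithinAt) (fun t _ => hbd t) (mem_univ x) (mem_univ y)
  rcases le_total x (2 / n) with h | h
  · have := hlip 0 x
    rw [h0, sub_zero, sub_zero, sub_zero, one_mul, abs_of_nonneg hx] at this
    exact this.trans h
  · have hconst : (truncId n x - x) = truncId n (2 / n) - 2 / n := by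
      have h1 : ∀ t ∈ Icc (2 / n : ℝ) x, Real.smoothTransition (n * t - 1) - 1 = 0 := fun t ht => by
        rw [Real.smoothTransition.one_of_one_le, sub_self]
        have := ht.1
        rw [div_le_iff₀ hn'] at this
        linarith
      have h2 := (convex_Icc (2 / n : ℝ) x).norm_image_sub_le_of_norm_hasDerivWithin_le
        (f := fun x => truncId n x - x) (C := 0)
        (fun t _ => (hD t).hasDerivWithinAt) (fun t ht => by rw [h1 t ht, norm_zero])
        (left_mem_Icc.2 h) (right_mem_Icc.2 h)
      rw [zero_mul] at h2
      exact sub_eq_zero.1 (norm_le_zero_iff.1 h2)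
    rw [hconst]
    have := hlip 0 (2 / n)
    rw [h0, sub_zero, sub_zero, sub_zero, one_mul, abs_of_nonneg (show (0 : ℝ) ≤ 2 / n by positivity)] at this
    exact this

end

/-! ### Uniqueness for the weak Neumann problem -/

section
open Metric Set ContinuousLinearMap
open scoped ComplexConjugate

theorem clm_apply_eq_re_im {E : Type*} [NormedAddCommGroup E] [NormedSpace ℝ E]
    (L : ℂ →L[ℝ] E) (v : ℂ) : L v = v.re • L 1 + v.im • L I := by
  have : v = v.re • (1 : ℂ) + v.im • I := by
    simp [re_add_im]
  conv_lhs => rw [this]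
  rw [map_add, map_smul, map_smul]

theorem IntegrableOn.clm_apply {E : Type*} [NormedAddCommGroup E] [NormedSpace ℝ E]
    {D : ℂ → ℂ →L[ℝ] E} {s : Set ℂ} (hD : IntegrableOn D s) (v : ℂ) :
    IntegrableOn (fun z => D z v) s :=
  (ContinuousLinearMap.apply ℝ E v).integrable_comp hD

theorem IntegrableOn.mul_of_continuousOn_closedBall {A : ℂ → ℝ} (hA : IntegrableOn A (ball 0 1))
    {g : ℂ → ℂ} (hg : ContinuousOn g (closedBall 0 1)) :
    IntegrableOn (fun z => (A z : ℂ) * g z) (ball 0 1) := by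
  obtain ⟨M, hM⟩ := (isCompact_closedBall (0 : ℂ) 1).exists_bound_of_continuousOn hg
  refine Integrable.mul_bdd (c := M) hA.ofReal
    ((hg.mono ball_subset_closedBall).aestronglyMeasurable measurableSet_ball) ?_
  filter_upwards [ae_restrict_mem measurableSet_ball] with z hz
  exact hM z (ball_subset_closedBall hz)

theorem integral_complex_of_real {A B : ℂ → ℝ} (hA : IntegrableOn A (ball 0 1))
    (hB : IntegrableOn B (ball 0 1)) {ψ : ℂ → ℂ} (hψ : ContDiff ℝ ∞ ψ)
    (hre : ∫ z in ball (0 : ℂ) 1, (A z * fderiv ℝ (fun z => (ψ z).re) z 1 +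
      B z * fderiv ℝ (fun z => (ψ z).re) z I) = 0)
    (him : ∫ z in ball (0 : ℂ) 1, (A z * fderiv ℝ (fun z => (ψ z).im) z 1 +
      B z * fderiv ℝ (fun z => (ψ z).im) z I) = 0) :
    ∫ z in ball (0 : ℂ) 1, ((A z : ℂ) * fderiv ℝ ψ z 1 + (B z : ℂ) * fderiv ℝ ψ z I) = 0 := by
  have hc : ∀ v, Continuous fun z => fderiv ℝ ψ z v := fun v =>
    (hψ.continuous_fderiv (by simp)).clm_apply continuous_const
  have hi : IntegrableOn (fun z => (A z : ℂ) * fderiv ℝ ψ z 1 + (B z : ℂ) * fderiv ℝ ψ z I)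
      (ball 0 1) :=
    (IntegrableOn.mul_of_continuousOn_closedBall hA (hc 1).continuousOn).add
      (IntegrableOn.mul_of_continuousOn_closedBall hB (hc I).continuousOn)
  have h1 : ∀ z v, fderiv ℝ (fun z => (ψ z).re) z v = (fderiv ℝ ψ z v).re := fun z v => by
    have := (reCLM.hasFDerivAt (x := ψ z)).comp z (hψ.differentiable (by simp) z).hasFDerivAt
    rw [show (fun z => (ψ z).re) = reCLM ∘ ψ from rfl, this.fderiv]; rfl
  have h2 : ∀ z v, fderiv ℝ (fun z => (ψ z).im) z v = (fderiv ℝ ψ z v).im := fun z v => by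
    have := (imCLM.hasFDerivAt (x := ψ z)).comp z (hψ.differentiable (by simp) z).hasFDerivAt
    rw [show (fun z => (ψ z).im) = imCLM ∘ ψ from rfl, this.fderiv]; rfl
  simp_rw [h1] at hre
  simp_rw [h2] at him
  apply Complex.ext
  · rw [zero_re, ← hre]
    refine (reCLM.integral_comp_comm hi).symm.trans ?_
    simp
  · rw [zero_im, ← him]
    refine (imCLM.integral_comp_comm hi).symm.trans ?_
    simp

theorem fderiv_fderiv_apply_comm {χ : ℂ → ℝ} (hχ : ContDiff ℝ ∞ χ) (z : ℂ) :
    fderiv ℝ (fun z => fderiv ℝ χ z I) z 1 = fderiv ℝ (fun z => fderiv ℝ χ z 1) z I := by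
  have hdd : DifferentiableAt ℝ (fderiv ℝ χ) z :=
    (hχ.fderiv_right (m := ∞) (by simp)).differentiable (by simp) z
  have e : ∀ v v', fderiv ℝ (fun z => fderiv ℝ χ z v) z v' = fderiv ℝ (fderiv ℝ χ) z v' v := by
    intro v v'
    rw [fderiv_clm_apply hdd (differentiableAt_const v)]
    simp
  rw [e, e]
  exact (hχ.contDiffAt.isSymmSndFDerivAt
    (by rw [minSmoothness_of_isRCLikeNormedField]; exact WithTop.coe_le_coe.2 le_top)).eq 1 I

/-- A weak gradient is curl-free, by symmetry of second derivatives. Unlike the divergence equation,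
which holds for tests up to the boundary, this requires compact support. -/
theorem integral_curl_eq_zero {w : ℂ → ℝ} {D : ℂ → ℂ →L[ℝ] ℝ}
    (hw : HasWeakDeriv (ball 0 1) w D) {χ : ℂ → ℝ} (hχ : ContDiff ℝ ∞ χ)
    (hχc : HasCompactSupport χ) (hχs : tsupport χ ⊆ ball 0 1) :
    ∫ z in ball (0 : ℂ) 1, (- D z I * fderiv ℝ χ z 1 + D z 1 * fderiv ℝ χ z I) = 0 := by
  have hd : ∀ v, ContDiff ℝ ∞ fun z => fderiv ℝ χ z v := fun v =>
    (hχ.fderiv_right (m := ∞) (by simp)).clm_apply contDiff_const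
  have hdc : ∀ v, HasCompactSupport fun z => fderiv ℝ χ z v := fun v => hχc.fderiv_apply (𝕜 := ℝ) v
  have hds : ∀ v, tsupport (fun z => fderiv ℝ χ z v) ⊆ ball 0 1 := fun v =>
    (tsupport_fderiv_apply_subset ℝ v).trans hχs
  have h1 := hw.integral_eq _ (hd I) (hdc I) (hds I) 1
  have h2 := hw.integral_eq _ (hd 1) (hdc 1) (hds 1) I
  have hsymm := fderiv_fderiv_apply_comm hχ
  simp_rw [hsymm] at h1
  rw [h1, neg_inj] at h2
  have i1 : Integrable fun z => fderiv ℝ χ z I • D z 1 :=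
    LocallyIntegrableOn.integrable_test_smul (hw.locallyIntegrableOn_apply 1) (hd I).continuous (hdc I) (hds I)
  have i2 : Integrable fun z => fderiv ℝ χ z 1 • D z I :=
    LocallyIntegrableOn.integrable_test_smul (hw.locallyIntegrableOn_apply I) (hd 1).continuous (hdc 1) (hds 1)
  rw [setIntegral_eq_integral_of_forall_compl_eq_zero]
  · have : ∀ z, - D z I * fderiv ℝ χ z 1 + D z 1 * fderiv ℝ χ z I =
      fderiv ℝ χ z I • D z 1 - fderiv ℝ χ z 1 • D z I := fun z => by
        simp only [smul_eq_mul]; ring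
    simp_rw [this]
    rw [integral_sub i1 i2, h2, sub_self]
  · intro z hz
    rw [fderiv_of_notMem_tsupport ℝ fun h => hz (hχs h)]
    simp

theorem hasFDerivAt_monomial (a b : ℕ) (z : ℂ) :
    HasFDerivAt (fun z : ℂ => z ^ a * conj z ^ b)
      ((a * z ^ (a - 1) * conj z ^ b) • ContinuousLinearMap.id ℝ ℂ +
        (b * z ^ a * conj z ^ (b - 1)) • (conjCLE : ℂ →L[ℝ] ℂ)) z := by
  have h1 : HasFDerivAt (fun z : ℂ => z ^ a) ((a * z ^ (a - 1)) • ContinuousLinearMap.id ℝ ℂ) z := by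
    refine ((hasFDerivAt_id (𝕜 := ℝ) z).pow a).congr_fderiv ?_
    simp [nsmul_eq_mul]
  have h2 : HasFDerivAt (fun z : ℂ => conj z ^ b)
      ((b * conj z ^ (b - 1)) • (conjCLE : ℂ →L[ℝ] ℂ)) z := by
    refine (((conjCLE : ℂ →L[ℝ] ℂ).hasFDerivAt (x := z)).pow b).congr_fderiv ?_
    simp [nsmul_eq_mul]
  refine (h1.mul h2).congr_fderiv ?_
  ext v
  simp
  ring

theorem contDiff_monomial (a b : ℕ) : ContDiff ℝ ∞ fun z : ℂ => z ^ a * conj z ^ b :=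
  (contDiff_id.pow a).mul ((conjCLE : ℂ →L[ℝ] ℂ).contDiff.pow b)

theorem hasFDerivAt_one_sub_normSq (z : ℂ) :
    HasFDerivAt (fun z : ℂ => 1 - normSq z) (-(2 * z.re) • reCLM - (2 * z.im) • imCLM) z := by
  have h1 := (reCLM.hasFDerivAt (x := z))
  have h2 := (imCLM.hasFDerivAt (x := z))
  have h3 := ((h1.mul h1).add (h2.mul h2)).const_sub 1
  refine (h3.congr_fderiv ?_).congr_of_eventuallyEq (Eventually.of_forall fun w => ?_)
  · ext v; simp; ring
  · simp [normSq_apply]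

/-- The truncated monomials. -/
noncomputable def truncMonomial (n a b : ℕ) (z : ℂ) : ℂ :=
  truncId n (1 - normSq z) • (z ^ a * conj z ^ b)

theorem contDiff_one_sub_normSq : ContDiff ℝ ∞ fun z : ℂ => 1 - normSq z := by
  simp only [normSq_apply]
  have h1 : ContDiff ℝ ∞ fun z : ℂ => z.re := reCLM.contDiff
  have h2 : ContDiff ℝ ∞ fun z : ℂ => z.im := imCLM.contDiff
  fun_prop

theorem contDiff_truncMonomial (n a b : ℕ) : ContDiff ℝ ∞ (truncMonomial n a b) :=
  ((contDiff_truncId n).comp contDiff_one_sub_normSq).smul (contDiff_monomial a b)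

theorem tsupport_truncMonomial_subset (n a b : ℕ) :
    tsupport (truncMonomial n a b) ⊆ {z | (1 : ℝ) ≤ n * (1 - normSq z)} := by
  refine closure_minimal (fun z hz => ?_) ?_
  · by_contra h
    have h' : ¬ (1 : ℝ) ≤ n * (1 - normSq z) := h
    exact hz (by rw [truncMonomial, truncId_eq_zero (not_le.1 h').le, zero_smul])
  · exact isClosed_le continuous_const (by fun_prop)

theorem tsupport_truncMonomial_subset_ball {n : ℕ} (hn : 0 < n) (a b : ℕ) :
    tsupport (truncMonomial n a b) ⊆ ball 0 1 := fun z hz => by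
  have h1 : (1 : ℝ) ≤ n * (1 - normSq z) := tsupport_truncMonomial_subset n a b hz
  have hn' : (0 : ℝ) < n := by exact_mod_cast hn
  rw [normSq_eq_norm_sq] at h1
  rw [mem_ball_zero_iff]
  by_contra! h
  nlinarith [norm_nonneg z, mul_nonneg hn'.le (show 0 ≤ ‖z‖ ^ 2 - 1 by nlinarith)]

theorem hasCompactSupport_truncMonomial {n : ℕ} (hn : 0 < n) (a b : ℕ) :
    HasCompactSupport (truncMonomial n a b) :=
  (isCompact_closedBall (0 : ℂ) 1).of_isClosed_subset isClosed_closure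
    ((tsupport_truncMonomial_subset_ball hn a b).trans ball_subset_closedBall)

/-- The left side is `2 ∂/∂z̄`, and `∂(1 - |z|²)/∂z̄ = -z`. -/
theorem fderiv_truncMonomial (n a b : ℕ) (z : ℂ) :
    fderiv ℝ (truncMonomial n a b) z 1 + I * fderiv ℝ (truncMonomial n a b) z I =
      2 * (-(Real.smoothTransition (n * (1 - normSq z) - 1) : ℝ) * (z ^ (a + 1) * conj z ^ b) +
        (truncId n (1 - normSq z) : ℝ) * (b * z ^ a * conj z ^ (b - 1))) := by
  have h1 : HasFDerivAt (fun z => truncId n (1 - normSq z))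
      (Real.smoothTransition (n * (1 - normSq z) - 1) •
        (-(2 * z.re) • reCLM - (2 * z.im) • imCLM)) z :=
    HasDerivAt.comp_hasFDerivAt (f := fun z : ℂ => 1 - normSq z) (h₂ := truncId n) z
      (hasDerivAt_truncId n (1 - normSq z)) (hasFDerivAt_one_sub_normSq z)
  have h2 : HasFDerivAt (truncMonomial n a b) _ z := h1.smul (hasFDerivAt_monomial a b z)
  rw [h2.fderiv]
  simp
  have hz : z ^ (a + 1) = (z.re + z.im * I) * z ^ a := by rw [re_add_im, pow_succ']
  rw [hz]
  generalize ((truncId n (1 - normSq z) : ℝ) : ℂ) = t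
  generalize ((Real.smoothTransition (n * (1 - normSq z) - 1) : ℝ) : ℂ) = s
  linear_combination (a * z ^ (a - 1) * conj z ^ b * t - b * z ^ a * conj z ^ (b - 1) * t) * I_sq

section
variable {w : ℂ → ℝ} {D : ℂ → ℂ →L[ℝ] ℝ}

/-- Vanishing divergence plus `i` times vanishing curl is the weak Cauchy–Riemann equation for `F =
∂_x w - i ∂_y w`. -/
theorem integral_wirtinger_eq_zero (hw : HasWeakDeriv (ball 0 1) w D)
    (hD : IntegrableOn D (ball 0 1))
    (h0 : ∀ ψ : ℂ → ℝ, ContDiff ℝ ∞ ψ →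
      ∫ z in ball (0 : ℂ) 1, (D z 1 * fderiv ℝ ψ z 1 + D z I * fderiv ℝ ψ z I) = 0)
    {χ : ℂ → ℂ} (hχ : ContDiff ℝ ∞ χ) (hχc : HasCompactSupport χ) (hχs : tsupport χ ⊆ ball 0 1) :
    ∫ z in ball (0 : ℂ) 1, ((D z 1 : ℂ) - I * D z I) * (fderiv ℝ χ z 1 + I * fderiv ℝ χ z I) = 0 := by
  have hD1 := IntegrableOn.clm_apply hD 1
  have hDI := IntegrableOn.clm_apply hD I
  have hre : ContDiff ℝ ∞ fun z => (χ z).re := reCLM.contDiff.comp hχ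
  have him : ContDiff ℝ ∞ fun z => (χ z).im := imCLM.contDiff.comp hχ
  have sre : tsupport (fun z => (χ z).re) ⊆ tsupport χ := tsupport_comp_subset (g := re) rfl χ
  have sim : tsupport (fun z => (χ z).im) ⊆ tsupport χ := tsupport_comp_subset (g := im) rfl χ
  have e1 := integral_complex_of_real hD1 hDI hχ (h0 _ hre) (h0 _ him)
  have e2 := integral_complex_of_real hDI.neg hD1 hχ
    (integral_curl_eq_zero hw hre (hχc.of_isClosed_subset isClosed_closure sre) (sre.trans hχs))
    (integral_curl_eq_zero hw him (hχc.of_isClosed_subset isClosed_closure sim) (sim.trans hχs))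
  have hc : ∀ v, ContinuousOn (fun z => fderiv ℝ χ z v) (closedBall 0 1) := fun v =>
    ((hχ.continuous_fderiv (by simp)).clm_apply continuous_const).continuousOn
  have i1 := (IntegrableOn.mul_of_continuousOn_closedBall hD1 (hc 1)).add
    (IntegrableOn.mul_of_continuousOn_closedBall hDI (hc I))
  have i2 := (IntegrableOn.mul_of_continuousOn_closedBall hDI.neg (hc 1)).add
    (IntegrableOn.mul_of_continuousOn_closedBall hD1 (hc I))
  have e3 := integral_add i1 (i2.const_mul I)
  simp only [Pi.add_apply] at e3
  rw [integral_const_mul] at e3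
  rw [e1, e2, mul_zero, add_zero] at e3
  refine Eq.trans ?_ e3
  refine integral_congr_ae (ae_of_all _ fun z => ?_)
  simp only [Pi.neg_apply]
  push_cast
  linear_combination (-(D z I : ℂ) * fderiv ℝ χ z I) * I_sq

/-- The Neumann condition allows tests that do not vanish on the circle. For `z̄^{b+1}` the pairing
with the gradient is exactly `(b+1) F z̄^b`. -/
theorem moment_zero_left (hD : IntegrableOn D (ball 0 1))
    (h0 : ∀ ψ : ℂ → ℝ, ContDiff ℝ ∞ ψ →
      ∫ z in ball (0 : ℂ) 1, (D z 1 * fderiv ℝ ψ z 1 + D z I * fderiv ℝ ψ z I) = 0) (b : ℕ) :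
    ∫ z in ball (0 : ℂ) 1, ((D z 1 : ℂ) - I * D z I) * (z ^ 0 * conj z ^ b) = 0 := by
  have hψ := contDiff_monomial 0 (b + 1)
  have e1 := integral_complex_of_real (IntegrableOn.clm_apply hD 1) (IntegrableOn.clm_apply hD I) hψ
    (h0 _ (reCLM.contDiff.comp hψ)) (h0 _ (imCLM.contDiff.comp hψ))
  have e2 : ∀ z, (D z 1 : ℂ) * fderiv ℝ (fun z : ℂ => z ^ 0 * conj z ^ (b + 1)) z 1 +
      (D z I : ℂ) * fderiv ℝ (fun z : ℂ => z ^ 0 * conj z ^ (b + 1)) z I =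
      ((b : ℂ) + 1) * (((D z 1 : ℂ) - I * D z I) * (z ^ 0 * conj z ^ b)) := fun z => by
    rw [(hasFDerivAt_monomial 0 (b + 1) z).fderiv]
    simp
    ring
  simp_rw [e2] at e1
  rw [integral_const_mul] at e1
  exact (mul_eq_zero.1 e1).resolve_left (by exact_mod_cast b.succ_ne_zero)

/-- The Cauchy–Riemann equation is tested with `(1 - |z|²) z^a z̄^b`, which vanishes on the circle.
The truncation of `1 - |z|²` gives it compact support, with derivatives bounded uniformly in `n`, so
the limit can be taken even for `F` merely integrable. -/
theorem moment_recursion (hw : HasWeakDeriv (ball 0 1) w D)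
    (hD : IntegrableOn D (ball 0 1))
    (h0 : ∀ ψ : ℂ → ℝ, ContDiff ℝ ∞ ψ →
      ∫ z in ball (0 : ℂ) 1, (D z 1 * fderiv ℝ ψ z 1 + D z I * fderiv ℝ ψ z I) = 0) (a b : ℕ) :
    ∫ z in ball (0 : ℂ) 1, ((D z 1 : ℂ) - I * D z I) *
      (2 * (- (z ^ (a + 1) * conj z ^ b) + (1 - normSq z : ℝ) * (b * z ^ a * conj z ^ (b - 1)))) = 0 := by
  have hF : IntegrableOn (fun z => (D z 1 : ℂ) - I * D z I) (ball 0 1) :=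
    (IntegrableOn.clm_apply hD 1).ofReal.sub ((IntegrableOn.clm_apply hD I).ofReal.const_mul I)
  have hlim : Tendsto (fun n : ℕ => ∫ z in ball (0 : ℂ) 1, ((D z 1 : ℂ) - I * D z I) *
      (2 * (-(Real.smoothTransition ((n + 1 : ℕ) * (1 - normSq z) - 1) : ℝ) * (z ^ (a + 1) * conj z ^ b) +
        (truncId (n + 1) (1 - normSq z) : ℝ) * (b * z ^ a * conj z ^ (b - 1))))) atTop
      (𝓝 (∫ z in ball (0 : ℂ) 1, ((D z 1 : ℂ) - I * D z I) *
      (2 * (-(1 : ℝ) * (z ^ (a + 1) * conj z ^ b) +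
        (1 - normSq z : ℝ) * (b * z ^ a * conj z ^ (b - 1)))))) := by
    refine tendsto_integral_of_dominated_convergence
      (fun z => ‖(D z 1 : ℂ) - I * D z I‖ * (2 * (1 + 3 * b))) (fun n => ?_) (hF.norm.mul_const _)
      (fun n => ?_) ?_
    · refine hF.aestronglyMeasurable.mul (Continuous.aestronglyMeasurable ?_)
      have h1 := (contDiff_truncId (n + 1)).continuous
      have h2 : Continuous fun z : ℂ => truncId (n + 1) (1 - normSq z) :=
        h1.comp contDiff_one_sub_normSq.continuous
      have h3 : Continuous fun z : ℂ => Real.smoothTransition ((n + 1 : ℕ) * (1 - normSq z) - 1) :=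
        Real.smoothTransition.continuous.comp
          ((continuous_const.mul contDiff_one_sub_normSq.continuous).sub continuous_const)
      fun_prop
    · filter_upwards [ae_restrict_mem measurableSet_ball] with z hz
      have hz1 : ‖z‖ ≤ 1 := by simpa using (mem_ball_zero_iff.1 hz).le
      have hp : ∀ k, ‖z‖ ^ k ≤ 1 := fun k => pow_le_one₀ (norm_nonneg z) hz1
      have hx0 : 0 ≤ 1 - normSq z := by rw [normSq_eq_norm_sq]; linarith [hp 2]
      have hx1 : 1 - normSq z ≤ 1 := by linarith [normSq_nonneg z]
      have ht : |truncId (n + 1) (1 - normSq z)| ≤ 3 := by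
        have h1 := abs_truncId_sub_le (Nat.succ_pos n) hx0
        have h2 : (2 : ℝ) / (n + 1 : ℕ) ≤ 2 := by
          refine div_le_self (by norm_num) ?_
          push_cast; linarith [n.cast_nonneg (α := ℝ)]
        have h3 := abs_le.1 (h1.trans h2)
        exact abs_le.2 ⟨by linarith [h3.1], by linarith [h3.2]⟩
      rw [norm_mul]
      gcongr
      rw [norm_mul]
      have hs : |Real.smoothTransition ((n + 1 : ℕ) * (1 - normSq z) - 1)| ≤ 1 := by
        rw [abs_of_nonneg (Real.smoothTransition.nonneg _)]
        exact Real.smoothTransition.le_one _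
      refine mul_le_mul (by simp) ((norm_add_le _ _).trans (add_le_add ?_ ?_)) (norm_nonneg _) (by simp)
      · rw [norm_mul, norm_neg, norm_real, norm_mul, norm_pow, norm_pow, RCLike.norm_conj, Real.norm_eq_abs]
        exact mul_le_one₀ hs (by positivity) (mul_le_one₀ (hp _) (by positivity) (hp _))
      · rw [norm_mul, norm_real, norm_mul, norm_mul, norm_pow, norm_pow, RCLike.norm_conj,
          Real.norm_eq_abs, norm_natCast]
        refine mul_le_mul ht ?_ (by positivity) (by norm_num)
        calc (b : ℝ) * ‖z‖ ^ a * ‖z‖ ^ (b - 1) ≤ b * 1 * 1 := by gcongr <;> exact hp _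
          _ = b := by ring
    · filter_upwards [ae_restrict_mem measurableSet_ball] with z hz
      have hz1 : ‖z‖ < 1 := mem_ball_zero_iff.1 hz
      have hx0 : 0 < 1 - normSq z := by rw [normSq_eq_norm_sq]; nlinarith [norm_nonneg z]
      have ht : Tendsto (fun n : ℕ => truncId (n + 1) (1 - normSq z)) atTop (𝓝 (1 - normSq z)) := by
        rw [tendsto_iff_dist_tendsto_zero]
        refine squeeze_zero (fun _ => dist_nonneg)
          (fun n => (abs_truncId_sub_le (Nat.succ_pos n) hx0.le)) ?_
        exact (tendsto_const_div_atTop_nhds_zero_nat 2).comp (tendsto_add_atTop_nat 1)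
      have hs : Tendsto (fun n : ℕ => Real.smoothTransition ((n + 1 : ℕ) * (1 - normSq z) - 1)) atTop
          (𝓝 1) := by
        refine tendsto_const_nhds.congr' ?_
        have h1 : Tendsto (fun n : ℕ => ((n + 1 : ℕ) : ℝ) * (1 - normSq z)) atTop atTop :=
          (tendsto_natCast_atTop_atTop.comp (tendsto_add_atTop_nat 1)).atTop_mul_const hx0
        filter_upwards [h1.eventually_ge_atTop 2] with n hn
        exact (Real.smoothTransition.one_of_one_le (by linarith)).symm
      exact (((((continuous_ofReal.tendsto _).comp hs).neg.mul_const _).add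
        (((continuous_ofReal.tendsto _).comp ht).mul_const _)).const_mul _).const_mul _
  have hz : ∀ n : ℕ, ∫ z in ball (0 : ℂ) 1, ((D z 1 : ℂ) - I * D z I) *
      (2 * (-(Real.smoothTransition ((n + 1 : ℕ) * (1 - normSq z) - 1) : ℝ) * (z ^ (a + 1) * conj z ^ b) +
        (truncId (n + 1) (1 - normSq z) : ℝ) * (b * z ^ a * conj z ^ (b - 1)))) = 0 := fun n => by
    have := integral_wirtinger_eq_zero hw hD h0 (contDiff_truncMonomial (n + 1) a b)
      (hasCompactSupport_truncMonomial n.succ_pos a b) (tsupport_truncMonomial_subset_ball n.succ_pos a b)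
    simp_rw [fderiv_truncMonomial] at this
    exact this
  simp_rw [hz] at hlim
  have := tendsto_nhds_unique hlim tendsto_const_nhds
  simpa using this

/-- Uniqueness for the weak Neumann problem in `W^{1,1}(𝔻)`. -/
theorem HasWeakDeriv.ae_eq_zero_of_neumann (hw : HasWeakDeriv (ball 0 1) w D)
    (hD : IntegrableOn D (ball 0 1))
    (h0 : ∀ ψ : ℂ → ℝ, ContDiff ℝ ∞ ψ →
      ∫ z in ball (0 : ℂ) 1, (D z 1 * fderiv ℝ ψ z 1 + D z I * fderiv ℝ ψ z I) = 0) :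
    ∀ᵐ z ∂(volume.restrict (ball (0 : ℂ) 1)), D z = 0 := by
  have hF : IntegrableOn (fun z => (D z 1 : ℂ) - I * D z I) (ball 0 1) :=
    (IntegrableOn.clm_apply hD 1).ofReal.sub ((IntegrableOn.clm_apply hD I).ofReal.const_mul I)
  have hint : ∀ a b : ℕ, IntegrableOn (fun z => ((D z 1 : ℂ) - I * D z I) * (z ^ a * conj z ^ b))
      (ball 0 1) := fun a b => by
    refine Integrable.mul_bdd (c := 1) hF ?_ ?_
    · exact (contDiff_monomial a b).continuous.aestronglyMeasurable
    · filter_upwards [ae_restrict_mem measurableSet_ball] with z hz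
      have hz1 : ‖z‖ ≤ 1 := by simpa using (mem_ball_zero_iff.1 hz).le
      rw [norm_mul, norm_pow, norm_pow, RCLike.norm_conj]
      exact mul_le_one₀ (pow_le_one₀ (norm_nonneg z) hz1) (by positivity)
        (pow_le_one₀ (norm_nonneg z) hz1)
  have hm : ∀ a b : ℕ, ∫ z in ball (0 : ℂ) 1, ((D z 1 : ℂ) - I * D z I) * (z ^ a * conj z ^ b) = 0 := by
    intro a
    -- With `m(a,b)` the moments, the recursion says `m(a+1,0) = 0` and `(b+2) m(a+1,b+1) = (b+1)
    -- m(a,b)`.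
    induction a with
    | zero => exact moment_zero_left hD h0
    | succ a ih =>
      intro b
      have h1 := moment_recursion hw hD h0 a b
      rcases b with _ | b
      · have e : ∀ z : ℂ, ((D z 1 : ℂ) - I * D z I) *
          (2 * (- (z ^ (a + 1) * conj z ^ 0) + (1 - normSq z : ℝ) *
            (((0 : ℕ) : ℂ) * z ^ a * conj z ^ (0 - 1)))) =
            (-2) * (((D z 1 : ℂ) - I * D z I) * (z ^ (a + 1) * conj z ^ 0)) := fun z => by
          simp; ring
        simp_rw [e] at h1
        rw [integral_const_mul] at h1
        simpa using h1
      · have e : ∀ z : ℂ, ((D z 1 : ℂ) - I * D z I) *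
          (2 * (- (z ^ (a + 1) * conj z ^ (b + 1)) + (1 - normSq z : ℝ) *
            (((b + 1 : ℕ) : ℂ) * z ^ a * conj z ^ (b + 1 - 1)))) =
            (2 * (b + 1)) * (((D z 1 : ℂ) - I * D z I) * (z ^ a * conj z ^ b)) -
            (2 * (b + 2)) * (((D z 1 : ℂ) - I * D z I) * (z ^ (a + 1) * conj z ^ (b + 1))) :=
          fun z => by
            rw [ofReal_sub, ← mul_conj]
            simp only [add_tsub_cancel_right]
            push_cast
            ring
        simp_rw [e] at h1
        rw [integral_sub ((hint a b).const_mul _) ((hint (a + 1) (b + 1)).const_mul _),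
          integral_const_mul, integral_const_mul, ih b, mul_zero, zero_sub, neg_eq_zero] at h1
        refine (mul_eq_zero.1 h1).resolve_left ?_
        have : (b : ℂ) + 2 ≠ 0 := by exact_mod_cast (b + 1).succ_ne_zero
        exact mul_ne_zero two_ne_zero this
  filter_upwards [ae_eq_zero_of_moments_eq_zero hF hm] with z hz
  have h1 : D z 1 = 0 := by simpa using congrArg re hz
  have h2 : D z I = 0 := by simpa using congrArg im hz
  ext v
  rw [clm_apply_eq_re_im, h1, h2]; simp

end

end

section
open Metric Set ContinuousLinearMap
open scoped ComplexConjugate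

/-! ### Green's formula in the punctured disk -/

/-- The real linear form `⟨v, ·⟩`. -/
noncomputable def dotCLM (v : ℂ) : ℂ →L[ℝ] ℝ := v.re • reCLM + v.im • imCLM

theorem dotCLM_apply (v w : ℂ) : dotCLM v w = dot v w := by simp [dotCLM, dot]

theorem eq_dot_smul_add (v : ℂ) {e : ℂ} (he : ‖e‖ = 1) :
    v = dot v e • e + dot v (I * e) • (I * e) := by
  have h : e.re ^ 2 + e.im ^ 2 = 1 := by
    have := Complex.sq_norm e
    rw [he, normSq_apply] at this
    linarith
  apply Complex.ext
  · simp [dot]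
    linear_combination (-v.re) * h
  · simp [dot]
    linear_combination (-v.im) * h

theorem hasFDerivAt_circlePt_snd (x : ℝ × ℝ) :
    HasFDerivAt (fun x : ℝ × ℝ => circlePt x.2)
      ((toSpanSingleton ℝ (I * circlePt x.2)).comp (snd ℝ ℝ ℝ)) x :=
  (hasDerivAt_circlePt x.2).hasFDerivAt.comp x hasFDerivAt_snd

theorem hasFDerivAt_polarMap (x : ℝ × ℝ) :
    HasFDerivAt polarMap ((x.1 : ℂ) • (toSpanSingleton ℝ (I * circlePt x.2)).comp (snd ℝ ℝ ℝ) +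
      (ofRealCLM.comp (fst ℝ ℝ ℝ)).smulRight (circlePt x.2)) x := by
  have h1 : HasFDerivAt (fun x : ℝ × ℝ => (x.1 : ℂ)) (ofRealCLM.comp (fst ℝ ℝ ℝ)) x :=
    ofRealCLM.hasFDerivAt.comp x hasFDerivAt_fst
  exact h1.mul' (hasFDerivAt_circlePt_snd x)

variable {E : Type*} [NormedAddCommGroup E] {G : ℂ → E}

theorem continuousOn_comp_circle (hG : ContinuousOn G (ball 0 1 \ {0})) {r : ℝ} (hr : r ∈ Ioo (0 : ℝ) 1) :
    Continuous fun θ : ℝ => G (r * circlePt θ) := by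
  have := continuous_circlePt
  refine hG.comp_continuous (by fun_prop) fun θ => ⟨?_, ?_⟩
  · simp [abs_of_pos hr.1, hr.2]
  · simp [hr.1.ne', circlePt_ne_zero]

variable [NormedSpace ℝ E] {DG : ℂ → ℂ →L[ℝ] E}

/-- Divergence theorem on the rectangle of polar coordinates: with `e = e^{iθ}`, `r ∂_v G =
∂_r(r⟨v,e⟩G) + ∂_θ(⟨v,ie⟩G)`. The sides `θ = 0` and `θ = 2π` cancel by periodicity. -/
theorem integral_annulus_fderiv (hG : ∀ z ∈ ball (0 : ℂ) 1 \ {0}, HasFDerivAt G (DG z) z) {v : ℂ}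
    (hc : ContinuousOn (fun z => DG z v) (ball 0 1 \ {0})) {ε R : ℝ} (hε : 0 < ε) (hεR : ε ≤ R)
    (hR : R < 1) :
    ∫ z in {z : ℂ | ‖z‖ ∈ Ioo ε R}, DG z v =
      R • (∫ θ in (0 : ℝ)..(2 * Real.pi), dot v (circlePt θ) • G (R * circlePt θ)) -
      ε • ∫ θ in (0 : ℝ)..(2 * Real.pi), dot v (circlePt θ) • G (ε * circlePt θ) := by
  have hmaps : ∀ x ∈ Icc ε R ×ˢ (univ : Set ℝ), polarMap x ∈ ball (0 : ℂ) 1 \ {0} := by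
    rintro ⟨r, θ⟩ ⟨hr, -⟩
    have h0 : 0 < r := hε.trans_le hr.1
    refine ⟨?_, ?_⟩
    · simp [polarMap, abs_of_pos h0, hr.2.trans_lt hR]
    · simp [polarMap, h0.ne', circlePt_ne_zero]
  have hGc : ContinuousOn G (ball 0 1 \ {0}) := fun z hz => (hG z hz).continuousAt.continuousWithinAt
  have hGp : ContinuousOn (fun x => G (polarMap x)) (Icc ε R ×ˢ (univ : Set ℝ)) :=
    hGc.comp continuous_polarMap.continuousOn hmaps
  have hDp : ContinuousOn (fun x => DG (polarMap x) v) (Icc ε R ×ˢ (univ : Set ℝ)) :=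
    hc.comp continuous_polarMap.continuousOn hmaps
  have hcirc := continuous_circlePt
  have hdot : ∀ w : ℂ, Continuous fun x : ℝ × ℝ => dot v (w * circlePt x.2) := fun w => by
    simp_rw [← dotCLM_apply]; fun_prop
  have hd : ∀ x : ℝ × ℝ, HasFDerivAt (fun x : ℝ × ℝ => dot v (circlePt x.2))
      ((dotCLM v).comp ((toSpanSingleton ℝ (I * circlePt x.2)).comp (snd ℝ ℝ ℝ))) x := fun x => by
    simp_rw [← dotCLM_apply]
    exact (dotCLM v).hasFDerivAt.comp x (hasFDerivAt_circlePt_snd x)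
  have hdI : ∀ x : ℝ × ℝ, HasFDerivAt (fun x : ℝ × ℝ => dot v (I * circlePt x.2))
      ((dotCLM v).comp (I • (toSpanSingleton ℝ (I * circlePt x.2)).comp (snd ℝ ℝ ℝ))) x := fun x => by
    simp_rw [← dotCLM_apply]
    exact (dotCLM v).hasFDerivAt.comp x ((hasFDerivAt_circlePt_snd x).const_mul I)
  have hsub : (uIcc ε R ×ˢ uIcc 0 (2 * Real.pi) : Set (ℝ × ℝ)) ⊆ Icc ε R ×ˢ univ := by
    rw [uIcc_of_le hεR]; exact prod_mono le_rfl (subset_univ _)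
  have hsub' : ∀ x ∈ Ioo (min ε R) (max ε R) ×ˢ Ioo (min 0 (2 * Real.pi)) (max 0 (2 * Real.pi)) \ ∅,
      polarMap x ∈ ball (0 : ℂ) 1 \ {0} := fun x hx => by
    rw [min_eq_left hεR, max_eq_right hεR] at hx
    exact hmaps x ⟨Ioo_subset_Icc_self hx.1.1, mem_univ _⟩
  have hF' : ∀ x ∈ Ioo (min ε R) (max ε R) ×ˢ Ioo (min 0 (2 * Real.pi)) (max 0 (2 * Real.pi)) \ ∅,
      HasFDerivAt (fun x : ℝ × ℝ => (x.1 * dot v (circlePt x.2)) • G (polarMap x)) _ x := fun x hx =>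
    (hasFDerivAt_fst.mul (hd x)).smul ((hG _ (hsub' x hx)).comp x (hasFDerivAt_polarMap x))
  have hG' : ∀ x ∈ Ioo (min ε R) (max ε R) ×ˢ Ioo (min 0 (2 * Real.pi)) (max 0 (2 * Real.pi)) \ ∅,
      HasFDerivAt (fun x : ℝ × ℝ => dot v (I * circlePt x.2) • G (polarMap x)) _ x := fun x hx =>
    (hdI x).smul ((hG _ (hsub' x hx)).comp x (hasFDerivAt_polarMap x))
  have hdiv : ∀ (r θ : ℝ), r • DG (polarMap (r, θ)) v =
      (dot v (circlePt θ) • G (polarMap (r, θ)) +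
        (r * dot v (circlePt θ)) • DG (polarMap (r, θ)) (circlePt θ)) +
      (dot v (-circlePt θ) • G (polarMap (r, θ)) +
        dot v (I * circlePt θ) • DG (polarMap (r, θ)) (r * (I * circlePt θ))) := fun r θ => by
    have e1 := eq_dot_smul_add v (norm_circlePt θ)
    have e2 : (r : ℂ) * (I * circlePt θ) = r • (I * circlePt θ) := by simp
    have e3 : dot v (-circlePt θ) = - dot v (circlePt θ) := by simp [dot]; ring
    conv_lhs => rw [e1]
    rw [e2, e3, map_add, map_smul, map_smul, map_smul, neg_smul, smul_add, smul_smul, smul_smul,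
      smul_smul, mul_comm r (dot v (I * circlePt θ))]
    abel
  have hval : ∀ x : ℝ × ℝ, x.1 • DG (polarMap x) v =
      ((x.1 * dot v (circlePt x.2)) • (DG (polarMap x)).comp
            ((x.1 : ℂ) • (toSpanSingleton ℝ (I * circlePt x.2)).comp (snd ℝ ℝ ℝ) +
              (ofRealCLM.comp (fst ℝ ℝ ℝ)).smulRight (circlePt x.2)) +
        (x.1 • (dotCLM v).comp ((toSpanSingleton ℝ (I * circlePt x.2)).comp (snd ℝ ℝ ℝ)) +
              dot v (circlePt x.2) • fst ℝ ℝ ℝ).smulRight (G (polarMap x))) (1, 0) +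
      (dot v (I * circlePt x.2) • (DG (polarMap x)).comp
            ((x.1 : ℂ) • (toSpanSingleton ℝ (I * circlePt x.2)).comp (snd ℝ ℝ ℝ) +
              (ofRealCLM.comp (fst ℝ ℝ ℝ)).smulRight (circlePt x.2)) +
        ((dotCLM v).comp (I • (toSpanSingleton ℝ (I * circlePt x.2)).comp (snd ℝ ℝ ℝ))).smulRight
          (G (polarMap x))) (0, 1) := by
    rintro ⟨r, θ⟩
    have e : I * (I * circlePt θ) = - circlePt θ := by
      rw [← mul_assoc, I_mul_I, neg_one_mul]
    have e0 : dot v 0 = 0 := by simp [dot]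
    rw [hdiv]
    simp [dotCLM_apply, e, e0]
    abel
  have key := integral2_divergence_prod_of_hasFDerivAt_off_countable _ _ _ _ ε 0 R (2 * Real.pi) ∅
    countable_empty (ContinuousOn.smul (by
      have := (continuous_fst.mul (hdot 1)).continuousOn (s := uIcc ε R ×ˢ uIcc 0 (2 * Real.pi))
      simp only [one_mul] at this
      exact this) (hGp.mono hsub))
    (ContinuousOn.smul (hdot I).continuousOn (hGp.mono hsub)) hF' hG' (by
      refine (integrableOn_congr_fun (fun x _ => hval x) (measurableSet_uIcc.prod measurableSet_uIcc)).1 ?_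
      exact (continuous_fst.continuousOn.smul (hDp.mono hsub)).integrableOn_compact
        (isCompact_uIcc.prod isCompact_uIcc))
  have key' : ∫ r in ε..R, ∫ θ in (0 : ℝ)..(2 * Real.pi), r • DG (polarMap (r, θ)) v = _ :=
    (intervalIntegral.integral_congr fun r _ => intervalIntegral.integral_congr
      fun θ _ => hval (r, θ)).trans key
  have hper : circlePt (2 * Real.pi) = circlePt 0 := by
    rw [← circlePt_add_two_pi 0, zero_add]
  have hi : IntegrableOn (fun z => DG z v) {z : ℂ | ‖z‖ ∈ Ioo ε R} := by
    refine (ContinuousOn.integrableOn_compact (K := closedBall 0 R \ ball 0 ε) ?_ ?_).mono_set ?_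
    · exact (isCompact_closedBall 0 R).diff isOpen_ball
    · refine hc.mono fun z hz => ⟨?_, ?_⟩
      · simpa using (mem_closedBall_zero_iff.1 hz.1).trans_lt hR
      · rintro rfl
        exact hz.2 (mem_ball_self hε)
    · intro z hz
      simpa using ⟨hz.2.le, hz.1.le⟩
  rw [integral_polar measurableSet_Ioo (Ioo_subset_Ioi_zero hε.le) hi,
    ← integral_Ioc_eq_integral_Ioo, ← intervalIntegral.integral_of_le hεR]
  simp only [Pi.smul_apply', polarMap, hper, sub_self, zero_add, intervalIntegral.integral_smul, mul_smul] at key'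
  exact key'

theorem tendsto_integral_small_circle {v : ℂ} (h0 : Tendsto (fun z => ‖z‖ * ‖G z‖) (𝓝[≠] 0) (𝓝 0)) :
    Tendsto (fun ε : ℝ => ε • ∫ θ in (0 : ℝ)..(2 * Real.pi), dot v (circlePt θ) • G (ε * circlePt θ))
      (𝓝[>] 0) (𝓝 0) := by
  rw [NormedAddGroup.tendsto_nhds_zero]
  intro η hη
  have hη' : 0 < η / (2 * (2 * Real.pi * (‖v‖ + 1))) := by positivity
  have h1 := (tendsto_order.1 h0).2 _ hη'
  obtain ⟨δ, hδ, h2⟩ := Metric.eventually_nhds_iff.1 (eventually_nhdsWithin_iff.1 h1)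
  filter_upwards [Ioo_mem_nhdsGT hδ] with ε hε
  have hb : ∀ θ : ℝ, ‖ε • (dot v (circlePt θ) • G (ε * circlePt θ))‖ ≤
      (‖v‖ + 1) * (η / (2 * (2 * Real.pi * (‖v‖ + 1)))) := fun θ => by
    have hn : ‖(ε : ℂ) * circlePt θ‖ = ε := by simp [abs_of_pos hε.1]
    have h3 := h2 (y := ε * circlePt θ) (by rw [dist_zero_right, hn]; exact hε.2)
      (by simp [hε.1.ne', circlePt_ne_zero])
    rw [hn] at h3
    have h4 : |dot v (circlePt θ)| ≤ ‖v‖ := by simpa using abs_dot_le v (circlePt θ)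
    rw [norm_smul, norm_smul, Real.norm_of_nonneg hε.1.le, Real.norm_eq_abs]
    calc ε * (|dot v (circlePt θ)| * ‖G (ε * circlePt θ)‖)
        = |dot v (circlePt θ)| * (ε * ‖G (ε * circlePt θ)‖) := by ring
      _ ≤ (‖v‖ + 1) * (η / (2 * (2 * Real.pi * (‖v‖ + 1)))) :=
        mul_le_mul (by linarith) h3.le (mul_nonneg hε.1.le (norm_nonneg _)) (by positivity)
  rw [← intervalIntegral.integral_smul]
  refine (intervalIntegral.norm_integral_le_of_norm_le_const fun θ _ => hb θ).trans_lt ?_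
  rw [sub_zero, abs_of_pos Real.two_pi_pos]
  have : (‖v‖ + 1) * (η / (2 * (2 * Real.pi * (‖v‖ + 1)))) * (2 * Real.pi) = η / 2 := by
    have : ‖v‖ + 1 ≠ 0 := by positivity
    have := Real.pi_ne_zero
    field_simp
  linarith

/-- Exhaustion of the punctured disk by annuli. The inner circles contribute nothing because
`|z||G(z)| → 0`, and the outer ones converge by domination along radii; continuity of `G` up to the
circle is not needed. -/
theorem integral_ball_fderiv {g : ℝ → E} {D : ℝ → ℝ}
    (hG : ∀ z ∈ ball (0 : ℂ) 1 \ {0}, HasFDerivAt G (DG z) z) {v : ℂ}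
    (hc : ContinuousOn (fun z => DG z v) (ball 0 1 \ {0}))
    (hi : IntegrableOn (fun z => DG z v) (ball 0 1))
    (h0 : Tendsto (fun z => ‖z‖ * ‖G z‖) (𝓝[≠] 0) (𝓝 0))
    (hD : IntegrableOn D (Ioc 0 (2 * Real.pi)))
    (hb : ∀ᵐ θ ∂(volume.restrict (Ioc 0 (2 * Real.pi))),
      Tendsto (fun r : ℝ => G (r * circlePt θ)) (𝓝[<] 1) (𝓝 (g θ)) ∧
      ∀ r ∈ Ioo (1 / 2 : ℝ) 1, ‖G (r * circlePt θ)‖ ≤ D θ) :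
    ∫ z in ball (0 : ℂ) 1, DG z v = ∫ θ in (0 : ℝ)..(2 * Real.pi), dot v (circlePt θ) • g θ := by
  -- The shift by `3` keeps the inner radius below the outer one, `1/3 < 2/3`, from the first term
  -- on.
  have hε : Tendsto (fun n : ℕ => 1 / ((n : ℝ) + 3)) atTop (𝓝[>] 0) := by
    refine tendsto_nhdsWithin_iff.2 ⟨?_, Eventually.of_forall fun n => mem_Ioi.2 (by positivity)⟩
    exact tendsto_const_nhds.div_atTop (tendsto_atTop_add_const_right _ _ tendsto_natCast_atTop_atTop)
  have hR : Tendsto (fun n : ℕ => 1 - 1 / ((n : ℝ) + 3)) atTop (𝓝[<] 1) := by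
    refine tendsto_nhdsWithin_iff.2 ⟨?_, Eventually.of_forall fun n => mem_Iio.2 ?_⟩
    · simpa using (tendsto_nhdsWithin_iff.1 hε).1.const_sub 1
    · have : 0 < 1 / ((n : ℝ) + 3) := by positivity
      linarith
  have hn3 : ∀ n : ℕ, 1 / ((n : ℝ) + 3) ≤ 1 / 3 := fun n => by gcongr; linarith [n.cast_nonneg (α := ℝ)]
  have hn0 : ∀ n : ℕ, 0 < 1 / ((n : ℝ) + 3) := fun n => by positivity
  have hann := fun n : ℕ => integral_annulus_fderiv hG hc (hn0 n) (R := 1 - 1 / ((n : ℝ) + 3))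
    (by linarith [hn3 n]) (by linarith [hn0 n])
  have hL : Tendsto (fun n : ℕ => ∫ z in {z : ℂ | ‖z‖ ∈ Ioo (1 / ((n : ℝ) + 3)) (1 - 1 / ((n : ℝ) + 3))},
      DG z v) atTop (𝓝 (∫ z in ball (0 : ℂ) 1, DG z v)) := by
    have hU : (⋃ n : ℕ, {z : ℂ | ‖z‖ ∈ Ioo (1 / ((n : ℝ) + 3)) (1 - 1 / ((n : ℝ) + 3))}) =
        {z : ℂ | ‖z‖ ∈ Ioo 0 1} := by
      ext z
      simp only [mem_iUnion, mem_ofPred, mem_Ioo]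
      constructor
      · rintro ⟨n, h1, h2⟩
        exact ⟨(hn0 n).trans h1, h2.trans (by linarith [hn0 n])⟩
      · rintro ⟨h1, h2⟩
        exact (((tendsto_order.1 (tendsto_nhdsWithin_iff.1 hε).1).2 _ h1).and
          ((tendsto_order.1 (tendsto_nhdsWithin_iff.1 hR).1).1 _ h2)).exists
    rw [restrict_ball_eq, ← hU]
    refine tendsto_setIntegral_of_monotone (fun n => measurable_norm measurableSet_Ioo) ?_ ?_
    · intro m n hmn z hz
      have : 1 / ((n : ℝ) + 3) ≤ 1 / ((m : ℝ) + 3) := by gcongr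
      exact ⟨this.trans_lt hz.1, hz.2.trans_le (by linarith)⟩
    · rw [hU]
      refine hi.mono_set fun z hz => ?_
      simpa using hz.2
  have hGc : ContinuousOn G (ball 0 1 \ {0}) := fun z hz => (hG z hz).continuousAt.continuousWithinAt
  have hdot : Continuous fun θ : ℝ => dot v (circlePt θ) := by
    have := continuous_circlePt
    simp_rw [← dotCLM_apply]; fun_prop
  have hM : Tendsto (fun r : ℝ => ∫ θ in (0 : ℝ)..(2 * Real.pi), dot v (circlePt θ) • G (r * circlePt θ))
      (𝓝[<] 1) (𝓝 (∫ θ in (0 : ℝ)..(2 * Real.pi), dot v (circlePt θ) • g θ)) := by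
    simp_rw [intervalIntegral.integral_of_le Real.two_pi_pos.le]
    have hnear : ∀ᶠ r : ℝ in 𝓝[<] 1, r ∈ Ioo (1 / 2 : ℝ) 1 := Ioo_mem_nhdsLT (by norm_num)
    refine tendsto_integral_filter_of_dominated_convergence (fun θ => ‖v‖ * D θ) ?_ ?_
      (hD.const_mul _) ?_
    · filter_upwards [hnear] with r hr
      exact (hdot.smul (continuousOn_comp_circle hGc ⟨by linarith [hr.1], hr.2⟩)).aestronglyMeasurable
    · filter_upwards [hnear] with r hr
      filter_upwards [hb] with θ hθ
      rw [norm_smul, Real.norm_eq_abs]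
      exact mul_le_mul (by simpa using abs_dot_le v (circlePt θ)) (hθ.2 r hr) (norm_nonneg _)
        (norm_nonneg _)
    · filter_upwards [hb] with θ hθ using hθ.1.const_smul _
  refine tendsto_nhds_unique hL ?_
  simp_rw [hann]
  have := ((tendsto_nhdsWithin_iff.1 hR).1.smul (hM.comp hR)).sub
    ((tendsto_integral_small_circle (v := v) h0).comp hε)
  simpa using this

end

section
open Metric Set ContinuousLinearMap
open scoped ComplexConjugate

section Test

variable {E : Type*} [NormedAddCommGroup E] [NormedSpace ℝ E] {w : ℂ → E} {Dw : ℂ → ℂ →L[ℝ] E}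

theorem IntegrableOn.smul_of_continuous {ψ : ℂ → ℝ} (hw : IntegrableOn w (ball 0 1)) (hψ : Continuous ψ) :
    IntegrableOn (fun z => ψ z • w z) (ball 0 1) := by
  obtain ⟨C, hC⟩ := (isCompact_closedBall (0 : ℂ) 1).exists_bound_of_continuousOn hψ.continuousOn
  exact hw.bdd_smul C hψ.aestronglyMeasurable
    ((ae_restrict_mem measurableSet_ball).mono fun z hz => hC z (ball_subset_closedBall hz))

theorem integral_ball_test_smul {g : ℝ → E} {D : ℝ → ℝ}
    (hw : ∀ z ∈ ball (0 : ℂ) 1 \ {0}, HasFDerivAt w (Dw z) z) {v : ℂ}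
    (hc : ContinuousOn (fun z => Dw z v) (ball 0 1 \ {0}))
    (hiw : IntegrableOn w (ball 0 1)) (hi : IntegrableOn (fun z => Dw z v) (ball 0 1))
    (h0 : Tendsto (fun z => ‖z‖ * ‖w z‖) (𝓝[≠] 0) (𝓝 0))
    (hD : IntegrableOn D (Ioc 0 (2 * Real.pi)))
    (hb : ∀ᵐ θ ∂(volume.restrict (Ioc 0 (2 * Real.pi))),
      Tendsto (fun r : ℝ => w (r * circlePt θ)) (𝓝[<] 1) (𝓝 (g θ)) ∧
      ∀ r ∈ Ioo (1 / 2 : ℝ) 1, ‖w (r * circlePt θ)‖ ≤ D θ) {ψ : ℂ → ℝ} (hψ : ContDiff ℝ ∞ ψ) :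
    ∫ z in ball (0 : ℂ) 1, ((fderiv ℝ ψ z v) • w z + ψ z • Dw z v) =
      ∫ θ in (0 : ℝ)..(2 * Real.pi), (ψ (circlePt θ) * dot v (circlePt θ)) • g θ := by
  have hψc := hψ.continuous
  have hdc : Continuous fun z => fderiv ℝ ψ z v := continuous_fderiv_apply_of_contDiff hψ v
  have hwc : ContinuousOn w (ball 0 1 \ {0}) := fun z hz => (hw z hz).continuousAt.continuousWithinAt
  obtain ⟨C, hC⟩ := (isCompact_closedBall (0 : ℂ) 1).exists_bound_of_continuousOn hψc.continuousOn
  have key := integral_ball_fderiv (G := fun z => ψ z • w z)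
    (DG := fun z => ψ z • Dw z + (fderiv ℝ ψ z).smulRight (w z)) (v := v)
    (g := fun θ => ψ (circlePt θ) • g θ) (D := fun θ => C * D θ)
    (fun z hz => (hψ.differentiable (by simp) z).hasFDerivAt.smul (hw z hz)) ?_ ?_ ?_ (hD.const_mul C) ?_
  · simp only [add_apply, smul_apply, smulRight_apply, smul_smul] at key
    simp_rw [mul_comm (ψ _) (dot _ _), add_comm (fderiv ℝ ψ _ v • w _)]
    exact key
  · exact (hψc.continuousOn.smul hc).add (hdc.continuousOn.smul hwc)
  · exact (IntegrableOn.smul_of_continuous hi hψc).add (IntegrableOn.smul_of_continuous hiw hdc)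
  · have := (hψc.norm.tendsto 0).mono_left (nhdsWithin_le_nhds (s := {0}ᶜ)) |>.mul h0
    rw [mul_zero] at this
    refine this.congr fun z => ?_
    rw [norm_smul]; ring
  · filter_upwards [hb] with θ hθ
    refine ⟨?_, fun r hr => ?_⟩
    · refine Tendsto.smul ?_ hθ.1
      have : Continuous fun r : ℝ => ψ (r * circlePt θ) := by fun_prop
      simpa using (this.tendsto 1).mono_left nhdsWithin_le_nhds
    · rw [norm_smul]
      have h1 : (r : ℂ) * circlePt θ ∈ closedBall (0 : ℂ) 1 := by
        simp [abs_of_pos (show 0 < r by linarith [hr.1]), hr.2.le]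
      exact mul_le_mul (hC _ h1) (hθ.2 r hr) (norm_nonneg _) ((norm_nonneg _).trans (hC _ h1))

end Test

/-! ### The fundamental solution -/

theorem integrableOn_ball_polar {A : ℂ → ℝ} (hA : AEStronglyMeasurable A (volume.restrict (ball 0 1)))
    {B : ℝ × ℝ → ℝ} (hB : Integrable B ((radialMeasure (Ioo 0 1)).prod angularMeasure))
    (hAB : ∀ᵐ x ∂((radialMeasure (Ioo 0 1)).prod angularMeasure), ‖A (polarMap x)‖ ≤ B x) :
    IntegrableOn A (ball 0 1) := by
  rw [restrict_ball_eq] at hA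
  rw [IntegrableOn, restrict_ball_eq]
  have hP := measurePreserving_polarMap (A := Ioo 0 1) measurableSet_Ioo (Ioo_subset_Ioi_zero le_rfl)
  rw [← hP.integrable_comp hA]
  exact hB.mono' (hA.comp_measurePreserving hP) hAB

theorem integrableOn_ball_norm {h : ℝ → ℝ} (hm : Measurable h)
    (hi : IntegrableOn (fun r => r * h r) (Ioo 0 1)) : IntegrableOn (fun z : ℂ => h ‖z‖) (ball 0 1) := by
  have h1 : Integrable h (radialMeasure (Ioo 0 1)) :=
    (integrableOn_radialMeasure measurableSet_Ioo (Ioo_subset_Ioi_zero le_rfl)).2 hi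
  refine integrableOn_ball_polar (hm.comp measurable_norm).aestronglyMeasurable
    (h1.norm.comp_fst angularMeasure) ?_
  have hfst : ∀ᵐ r ∂(radialMeasure (Ioo 0 1)), r ∈ Ioo (0 : ℝ) 1 :=
    (withDensity_absolutelyContinuous _ _).ae_le (ae_restrict_mem measurableSet_Ioo)
  filter_upwards [Measure.quasiMeasurePreserving_fst.ae hfst] with x hx
  simp [polarMap, abs_of_pos hx.1]

theorem integrableOn_inv_norm : IntegrableOn (fun z : ℂ => ‖z‖⁻¹) (ball 0 1) := by
  refine integrableOn_ball_norm measurable_inv ?_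
  refine (integrableOn_const (C := (1 : ℝ)) (by simp)).congr_fun (fun r hr => ?_) measurableSet_Ioo
  exact (mul_inv_cancel₀ hr.1.ne').symm

theorem integrableOn_log_norm : IntegrableOn (fun z : ℂ => Real.log ‖z‖) (ball 0 1) := by
  refine integrableOn_ball_norm Real.measurable_log ?_
  exact (Real.continuous_mul_log.integrableOn_Icc (a := 0) (b := 1)).mono_set Ioo_subset_Icc_self

/-- Near `z`, `ln|w|` is a constant plus the real part of `log(w/z)`, whose argument stays near `1`,
away from the branch cut. -/
theorem hasFDerivAt_log_norm {z : ℂ} (hz : z ≠ 0) :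
    HasFDerivAt (fun z : ℂ => Real.log ‖z‖) (reCLM.comp (mul ℝ ℂ z⁻¹)) z := by
  have h1 : HasDerivAt (fun w => Complex.log (w / z)) (z⁻¹) z := by
    have := ((hasDerivAt_id z).div_const z).clog (by simp [div_self hz])
    simpa [div_self hz] using this
  have h2 : HasFDerivAt (fun w => Real.log ‖z‖ + (Complex.log (w / z)).re) (reCLM.comp (mul ℝ ℂ z⁻¹)) z :=
    (reCLM.hasFDerivAt.comp z (hasFDerivAt_mul_real h1)).const_add _
  refine h2.congr_of_eventuallyEq ?_
  filter_upwards [isOpen_ne.mem_nhds hz] with w hw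
  rw [log_re, norm_div, Real.log_div (norm_ne_zero_iff.2 hw) (norm_ne_zero_iff.2 hz)]
  ring


/-- The solution `log |z| + Re p` of the Neumann problem. -/
noncomputable def neumannFun (p : ℂ → ℂ) (z : ℂ) : ℝ := Real.log ‖z‖ + (p z).re

/-- The differential `Re ((1/z + p') dz)` of `log |z| + Re p`. -/
noncomputable def neumannDeriv (Q : ℂ → ℂ) (z : ℂ) : ℂ →L[ℝ] ℝ := reCLM.comp (mul ℝ ℂ (z⁻¹ + Q z))

@[simp] theorem neumannDeriv_apply (Q : ℂ → ℂ) (z v : ℂ) :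
    neumannDeriv Q z v = ((z⁻¹ + Q z) * v).re := rfl

variable {p Q : ℂ → ℂ}

theorem ae_radial_mem : ∀ᵐ x ∂((radialMeasure (Ioo 0 1)).prod angularMeasure), x.1 ∈ Ioo (0 : ℝ) 1 :=
  Measure.quasiMeasurePreserving_fst.ae
    ((withDensity_absolutelyContinuous _ _).ae_le (ae_restrict_mem measurableSet_Ioo))

instance : IsFiniteMeasure (radialMeasure (Ioo 0 1)) := by
  have h : Integrable (fun _ : ℝ => (1 : ℝ)) (radialMeasure (Ioo 0 1)) := by
    rw [integrableOn_radialMeasure measurableSet_Ioo (Ioo_subset_Ioi_zero le_rfl)]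
    have : Continuous fun r : ℝ => r • (1 : ℝ) := by fun_prop
    exact (this.integrableOn_Icc (a := 0) (b := 1)).mono_set Ioo_subset_Icc_self
  simpa using (integrable_const_iff_isFiniteMeasure one_ne_zero).1 h

theorem integrableOn_log_deriv (hp : ∀ z ∈ ball (0 : ℂ) 1, HasDerivAt p (Q z) z)
    (hQ : DifferentiableOn ℂ Q (ball 0 1)) (hi : IntegrableOn (fun z => ‖Q z‖ ^ 2) (ball 0 1)) :
    IntegrableOn p (ball 0 1) := by
  obtain ⟨D, hD, hDb⟩ := exists_radial_dominated hp hQ hi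
  have hpc : ContinuousOn p (ball 0 1) := fun z hz => (hp z hz).continuousAt.continuousWithinAt
  have hpm := hpc.aestronglyMeasurable (μ := volume) measurableSet_ball
  rw [IntegrableOn, ← integrable_norm_iff hpm]
  refine integrableOn_ball_polar hpm.norm (B := fun x => 1 + D x.2)
    ((integrable_const 1).add (Integrable.comp_snd (ν := angularMeasure) hD _)) ?_
  filter_upwards [ae_radial_mem, Measure.quasiMeasurePreserving_snd.ae hDb] with x h1 h2
  have h3 := h2.2 x.1 h1
  rw [norm_norm]
  change ‖p (x.1 * circlePt x.2)‖ ≤ _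
  nlinarith [sq_nonneg (‖p (x.1 * circlePt x.2)‖ - 1), sq_nonneg ‖p (x.1 * circlePt x.2)‖]

theorem integrableOn_neumannFun (hp : IntegrableOn p (ball 0 1)) :
    IntegrableOn (neumannFun p) (ball 0 1) :=
  integrableOn_log_norm.add hp.re

theorem integrableOn_inv : IntegrableOn (fun z : ℂ => z⁻¹) (ball 0 1) := by
  have hm : AEStronglyMeasurable (fun z : ℂ => z⁻¹) (volume.restrict (ball 0 1)) :=
    measurable_inv.aestronglyMeasurable
  rw [IntegrableOn, ← integrable_norm_iff hm]
  simpa [IntegrableOn] using integrableOn_inv_norm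

theorem integrableOn_neumannDeriv (hQ : IntegrableOn Q (ball 0 1)) :
    IntegrableOn (neumannDeriv Q) (ball 0 1) :=
  ((compL ℝ ℂ ℂ ℝ reCLM).comp (mul ℝ ℂ)).integrable_comp (integrableOn_inv.add hQ)

theorem hasFDerivAt_neumannFun {z : ℂ} (hz : z ≠ 0) (hp : HasDerivAt p (Q z) z) :
    HasFDerivAt (neumannFun p) (neumannDeriv Q z) z := by
  refine ((hasFDerivAt_log_norm hz).add (reCLM.hasFDerivAt.comp z (hasFDerivAt_mul_real hp))).congr_fderiv ?_
  ext v
  simp [add_mul]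

theorem tendsto_norm_mul_neumannFun (hp : ContinuousAt p 0) :
    Tendsto (fun z => ‖z‖ * ‖neumannFun p z‖) (𝓝[≠] 0) (𝓝 0) := by
  have h1 : ContinuousAt (fun z : ℂ => ‖z‖ * Real.log ‖z‖ + ‖z‖ * (p z).re) 0 :=
    (Real.continuous_mul_log.comp continuous_norm).continuousAt.add
      (continuous_norm.continuousAt.mul (continuous_re.continuousAt.comp hp))
  have h2 := (h1.norm.tendsto).mono_left (nhdsWithin_le_nhds (s := {0}ᶜ))
  simp only [norm_zero, zero_mul, add_zero] at h2
  refine h2.congr fun z => ?_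
  rw [← mul_add, norm_mul, norm_norm]
  rfl

theorem continuousOn_neumannDeriv_apply (hQ : ContinuousOn Q (ball 0 1)) (v : ℂ) :
    ContinuousOn (fun z => neumannDeriv Q z v) (ball 0 1 \ {0}) := by
  simp only [neumannDeriv_apply]
  have : ContinuousOn (fun z : ℂ => z⁻¹) (ball 0 1 \ {0}) :=
    continuousOn_inv₀.mono fun z hz => hz.2
  exact continuous_re.comp_continuousOn ((this.add (hQ.mono sdiff_subset)).mul continuousOn_const)

theorem neumannFun_radial_bound {D : ℝ → ℝ} {θ r : ℝ} (hr : r ∈ Ioo (1 / 2 : ℝ) 1)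
    (hb : ‖p (r * circlePt θ)‖ ^ 2 ≤ D θ) : ‖neumannFun p (r * circlePt θ)‖ ≤ 3 + D θ := by
  have h0 : 0 < r := by linarith [hr.1]
  have h1 : ‖(r : ℂ) * circlePt θ‖ = r := by simp [abs_of_pos h0]
  have h2 : |Real.log r| ≤ 2 := by
    have h3 := Real.one_sub_inv_le_log_of_pos h0
    have h4 : r⁻¹ ≤ 2 := by rw [inv_le_comm₀ h0 two_pos]; linarith [hr.1]
    have h5 := Real.log_nonpos h0.le hr.2.le
    rw [abs_of_nonpos h5]; linarith
  have h3 := abs_re_le_norm (p (r * circlePt θ))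
  rw [neumannFun, h1, Real.norm_eq_abs]
  refine (abs_add_le _ _).trans ?_
  nlinarith [sq_nonneg (‖p (r * circlePt θ)‖ - 1), sq_nonneg ‖p (r * circlePt θ)‖]

/-- Green's formula with a test function that vanishes on the circle. The logarithmic singularity
adds no mass at first order since `|z| ln|z| → 0`. -/
theorem hasWeakDeriv_neumannFun (hp : ∀ z ∈ ball (0 : ℂ) 1, HasDerivAt p (Q z) z)
    (hQ : DifferentiableOn ℂ Q (ball 0 1)) (hi : IntegrableOn (fun z => ‖Q z‖ ^ 2) (ball 0 1)) :
    HasWeakDeriv (ball 0 1) (neumannFun p) (neumannDeriv Q) := by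
  obtain ⟨D, hD, hDb⟩ := exists_radial_dominated hp hQ hi
  have hQi : IntegrableOn Q (ball 0 1) := integrableOn_of_sq measure_ball_lt_top.ne
    (hQ.continuousOn.aestronglyMeasurable measurableSet_ball) hi
  have hΦ := integrableOn_neumannFun (integrableOn_log_deriv hp hQ hi)
  have hDΦ := integrableOn_neumannDeriv hQi
  refine ⟨hΦ.locallyIntegrableOn, hDΦ.locallyIntegrableOn, fun φ hφ hφc hφs v => ?_⟩
  have hcirc : ∀ θ, φ (circlePt θ) = 0 := fun θ =>
    image_eq_zero_of_notMem_tsupport fun h => by simpa using hφs h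
  have key := integral_ball_test_smul (v := v) (g := fun θ => (radialLimit p θ).re) (D := fun θ => 3 + D θ)
    (fun z hz => hasFDerivAt_neumannFun hz.2 (hp z hz.1)) (continuousOn_neumannDeriv_apply hQ.continuousOn v)
    hΦ (IntegrableOn.clm_apply hDΦ v)
    (tendsto_norm_mul_neumannFun (hp 0 (mem_ball_self one_pos)).continuousAt)
    ((integrableOn_const (by simp [ENNReal.mul_eq_top])).add hD) ?_ hφ
  · simp only [hcirc, zero_mul, zero_smul, intervalIntegral.integral_zero] at key
    rw [setIntegral_eq_integral_of_forall_compl_eq_zero, integral_add, ← eq_neg_iff_add_eq_zero] at key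
    · exact key
    · exact LocallyIntegrableOn.integrable_test_smul hΦ.locallyIntegrableOn
        (continuous_fderiv_apply_of_contDiff hφ v) (hφc.fderiv_apply (𝕜 := ℝ) v)
        ((tsupport_fderiv_apply_subset ℝ v).trans hφs)
    · exact LocallyIntegrableOn.integrable_test_smul
        (ContinuousLinearMap.apply ℝ ℝ v |>.locallyIntegrableOn_comp hDΦ.locallyIntegrableOn)
        hφ.continuous hφc hφs
    · intro z hz
      rw [fderiv_of_notMem_tsupport ℝ fun h => hz (hφs h),
        image_eq_zero_of_notMem_tsupport fun h => hz (hφs h)]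
      simp
  · filter_upwards [hDb] with θ hθ
    refine ⟨?_, fun r hr => neumannFun_radial_bound hr (hθ.2 r ⟨by linarith [hr.1], hr.2⟩)⟩
    have h1 : Tendsto (fun r : ℝ => Real.log r) (𝓝[<] 1) (𝓝 0) := by
      simpa using (Real.continuousAt_log one_ne_zero).tendsto.mono_left nhdsWithin_le_nhds
    have h2 := h1.add ((continuous_re.tendsto _).comp hθ.1)
    rw [zero_add] at h2
    refine h2.congr' ?_
    filter_upwards [Ioo_mem_nhdsLT zero_lt_one] with r hr
    simp [neumannFun, abs_of_pos hr.1]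

end

/-! ### The Neumann problem solved by `ln|z| + Re p` -/

section
open Metric Set ContinuousLinearMap
open scoped ComplexConjugate

theorem hasDerivAt_comp_circlePt {ψ : ℂ → ℝ} (hψ : ContDiff ℝ ∞ ψ) (θ : ℝ) :
    HasDerivAt (fun t : ℝ => ψ (circlePt t)) (fderiv ℝ ψ (circlePt θ) (I * circlePt θ)) θ :=
  (hψ.differentiable (by simp) (circlePt θ)).hasFDerivAt.comp_hasDerivAt θ (hasDerivAt_circlePt θ)

theorem hasDerivAt_comp_radial {ψ : ℂ → ℝ} (hψ : ContDiff ℝ ∞ ψ) (θ r : ℝ) :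
    HasDerivAt (fun r : ℝ => ψ (r * circlePt θ)) (fderiv ℝ ψ (r * circlePt θ) (circlePt θ)) r := by
  have h2 : HasDerivAt (fun r : ℝ => (r : ℂ) * circlePt θ) (1 * circlePt θ) r :=
    (Complex.ofRealCLM.hasDerivAt (x := r)).mul_const _
  rw [one_mul] at h2
  exact (hψ.differentiable (by simp) _).hasFDerivAt.comp_hasDerivAt r h2

theorem fderiv_eq_re_im (L : ℂ →L[ℝ] ℝ) (v : ℂ) : L v = v.re * L 1 + v.im * L I := by
  conv_lhs => rw [← re_add_im v]
  have h1 : ((v.re : ℂ) + v.im * I) = v.re • (1 : ℂ) + v.im • I := by simp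
  rw [h1, map_add, map_smul, map_smul, smul_eq_mul, smul_eq_mul]

/-- In polar coordinates `∇ln r · ∇ψ` times `r dr dθ` is `∂_rψ dr dθ`; integration along each radius
produces the circle term and the Dirac mass. -/
theorem integral_log_norm_gradient {ψ : ℂ → ℝ} (hψ : ContDiff ℝ ∞ ψ) :
    ∫ z in ball (0 : ℂ) 1, ((z⁻¹).re * fderiv ℝ ψ z 1 + (z⁻¹ * I).re * fderiv ℝ ψ z I) =
      (∫ θ in (0 : ℝ)..(2 * Real.pi), ψ (circlePt θ)) - 2 * Real.pi * ψ 0 := by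
  have hd : ∀ v, Continuous fun z => fderiv ℝ ψ z v := continuous_fderiv_apply_of_contDiff hψ
  have hcirc := continuous_circlePt
  have hi : IntegrableOn (fun z : ℂ => (z⁻¹).re * fderiv ℝ ψ z 1 + (z⁻¹ * I).re * fderiv ℝ ψ z I)
      {z : ℂ | ‖z‖ ∈ Ioo 0 1} := by
    have h1 := IntegrableOn.smul_of_continuous integrableOn_inv.re (hd 1)
    have h2 := IntegrableOn.smul_of_continuous (integrableOn_inv.mul_const I).re (hd I)
    rw [IntegrableOn, ← restrict_ball_eq]
    refine (h1.add h2).congr (ae_of_all _ fun z => ?_)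
    simp [mul_comm]
  rw [restrict_ball_eq, integral_polar measurableSet_Ioo (Ioo_subset_Ioi_zero le_rfl) hi]
  have hjoint : Continuous fun x : ℝ × ℝ => fderiv ℝ ψ (x.1 * circlePt x.2) (circlePt x.2) := by
    have := (hψ.continuous_fderiv (by simp))
    fun_prop
  have e1 : ∀ r ∈ Ioo (0 : ℝ) 1, r • ∫ θ in (0 : ℝ)..(2 * Real.pi),
      (((r * circlePt θ : ℂ)⁻¹).re * fderiv ℝ ψ (r * circlePt θ) 1 +
        ((r * circlePt θ : ℂ)⁻¹ * I).re * fderiv ℝ ψ (r * circlePt θ) I) =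
      ∫ θ in (0 : ℝ)..(2 * Real.pi), fderiv ℝ ψ (r * circlePt θ) (circlePt θ) := by
    intro r hr
    rw [← intervalIntegral.integral_smul]
    refine intervalIntegral.integral_congr fun θ _ => ?_
    have h1 : (r * circlePt θ : ℂ)⁻¹ = ((r⁻¹ : ℝ) : ℂ) * conj (circlePt θ) := by
      rw [mul_inv, Complex.inv_eq_conj (norm_circlePt θ), ofReal_inv]
    simp only [fderiv_eq_re_im _ (circlePt θ), h1]
    simp only [smul_eq_mul, re_ofReal_mul, mul_assoc]
    simp only [conj_re, mul_re, conj_im, I_re, I_im]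
    have := hr.1.ne'
    field_simp
    ring
  have hswap : ∫ r in Ioc (0 : ℝ) 1, ∫ θ in Ioc 0 (2 * Real.pi), fderiv ℝ ψ (r * circlePt θ) (circlePt θ) =
      ∫ θ in Ioc 0 (2 * Real.pi), ∫ r in Ioc (0 : ℝ) 1, fderiv ℝ ψ (r * circlePt θ) (circlePt θ) := by
    refine integral_integral_swap ?_
    rw [Measure.prod_restrict]
    exact (hjoint.continuousOn.integrableOn_compact (isCompact_Icc.prod isCompact_Icc)).mono_set
      (prod_mono Ioc_subset_Icc_self Ioc_subset_Icc_self)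
  rw [setIntegral_congr_fun measurableSet_Ioo e1, ← integral_Ioc_eq_integral_Ioo]
  simp_rw [intervalIntegral.integral_of_le Real.two_pi_pos.le] at hswap ⊢
  rw [hswap]
  have e2 : ∀ θ, ∫ r in Ioc (0 : ℝ) 1, fderiv ℝ ψ (r * circlePt θ) (circlePt θ) = ψ (circlePt θ) - ψ 0 := by
    intro θ
    rw [← intervalIntegral.integral_of_le zero_le_one,
      intervalIntegral.integral_eq_sub_of_hasDerivAt (fun r _ => hasDerivAt_comp_radial hψ θ r)]
    · simp
    · exact (hjoint.comp (Continuous.prodMk_left θ)).intervalIntegrable _ _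
  simp_rw [e2]
  rw [integral_sub, integral_const]
  · simp [Real.pi_pos.le]
  · exact ((hψ.continuous.comp hcirc).integrableOn_Icc).mono_set Ioc_subset_Icc_self
  · exact integrable_const _

variable {p Q : ℂ → ℂ}

/-- By Cauchy–Riemann, `∇Re p · ∇ψ = ∂_y(Im p) ∂_xψ - ∂_x(Im p) ∂_yψ`. Two Green formulas, with
tests `∂_xψ` and `∂_yψ`, are subtracted; the mixed second derivatives cancel and the boundary terms
combine into `-Im p ∂_θψ`. -/
theorem integral_re_deriv_gradient (hp : ∀ z ∈ ball (0 : ℂ) 1, HasDerivAt p (Q z) z)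
    (hQ : DifferentiableOn ℂ Q (ball 0 1)) (hi : IntegrableOn (fun z => ‖Q z‖ ^ 2) (ball 0 1))
    {ψ : ℂ → ℝ} (hψ : ContDiff ℝ ∞ ψ) :
    ∫ z in ball (0 : ℂ) 1, ((Q z).re * fderiv ℝ ψ z 1 + (Q z * I).re * fderiv ℝ ψ z I) =
      - ∫ θ in (0 : ℝ)..(2 * Real.pi), (radialLimit p θ).im * deriv (fun t : ℝ => ψ (circlePt t)) θ := by
  obtain ⟨D, hD, hDb⟩ := exists_radial_dominated hp hQ hi
  have hQi : IntegrableOn Q (ball 0 1) := integrableOn_of_sq measure_ball_lt_top.ne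
    (hQ.continuousOn.aestronglyMeasurable measurableSet_ball) hi
  have hpi := (integrableOn_log_deriv hp hQ hi)
  have hd : ∀ v, ContDiff ℝ ∞ fun z => fderiv ℝ ψ z v := fun v =>
    (hψ.fderiv_right (m := ∞) (by simp)).clm_apply contDiff_const
  have hw : ∀ z ∈ ball (0 : ℂ) 1 \ {0}, HasFDerivAt (fun z => (p z).im) (imCLM.comp (mul ℝ ℂ (Q z))) z :=
    fun z hz => imCLM.hasFDerivAt.comp z (hasFDerivAt_mul_real (hp z hz.1))
  have hc : ∀ v, ContinuousOn (fun z => imCLM.comp (mul ℝ ℂ (Q z)) v) (ball 0 1 \ {0}) := fun v =>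
    continuous_im.comp_continuousOn ((hQ.continuousOn.mono sdiff_subset).mul continuousOn_const)
  have hi' : ∀ v, IntegrableOn (fun z => imCLM.comp (mul ℝ ℂ (Q z)) v) (ball 0 1) := fun v =>
    (hQi.mul_const v).im
  have h0 : Tendsto (fun z => ‖z‖ * ‖(p z).im‖) (𝓝[≠] 0) (𝓝 0) := by
    have h1 : ContinuousAt (fun z : ℂ => ‖z‖ * ‖(p z).im‖) 0 :=
      continuous_norm.continuousAt.mul (continuous_im.continuousAt.comp
        (hp 0 (mem_ball_self one_pos)).continuousAt).norm
    simpa using h1.tendsto.mono_left nhdsWithin_le_nhds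
  have hb : ∀ᵐ θ ∂(volume.restrict (Ioc 0 (2 * Real.pi))),
      Tendsto (fun r : ℝ => (p (r * circlePt θ)).im) (𝓝[<] 1) (𝓝 (radialLimit p θ).im) ∧
      ∀ r ∈ Ioo (1 / 2 : ℝ) 1, ‖(p (r * circlePt θ)).im‖ ≤ 1 + D θ := by
    filter_upwards [hDb] with θ hθ
    refine ⟨(continuous_im.tendsto _).comp hθ.1, fun r hr => ?_⟩
    have h1 := hθ.2 r ⟨by linarith [hr.1], hr.2⟩
    refine (abs_im_le_norm _).trans ?_
    nlinarith [sq_nonneg (‖p (r * circlePt θ)‖ - 1), sq_nonneg ‖p (r * circlePt θ)‖]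
  have hD1 : IntegrableOn (fun θ => 1 + D θ) (Ioc 0 (2 * Real.pi)) :=
    (integrableOn_const (by simp [ENNReal.mul_eq_top])).add hD
  have g1 := integral_ball_test_smul hw (hc I) hpi.im (hi' I) h0 hD1 hb (hd 1)
  have g2 := integral_ball_test_smul hw (hc 1) hpi.im (hi' 1) h0 hD1 hb (hd I)
  have hint : ∀ v v', IntegrableOn (fun z => fderiv ℝ (fun z => fderiv ℝ ψ z v) z v' • (p z).im +
      fderiv ℝ ψ z v • imCLM.comp (mul ℝ ℂ (Q z)) v') (ball 0 1) := fun v v' =>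
    (IntegrableOn.smul_of_continuous hpi.im (continuous_fderiv_apply_of_contDiff (hd v) v')).add
      (IntegrableOn.smul_of_continuous (hi' v') (hd v).continuous)
  have hcirc := continuous_circlePt
  have him : IntervalIntegrable (fun θ => (radialLimit p θ).im) volume 0 (2 * Real.pi) := by
    rw [intervalIntegrable_iff_integrableOn_Ioc_of_le Real.two_pi_pos.le]
    exact ((memLp_radialLimit hp hQ hi).integrable one_le_two).im
  have hib : ∀ v v', IntervalIntegrable (fun θ => (fderiv ℝ ψ (circlePt θ) v * dot v' (circlePt θ)) •
      (radialLimit p θ).im) volume 0 (2 * Real.pi) := fun v v' => by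
    refine him.continuousOn_mul (Continuous.continuousOn ?_)
    have h1 : Continuous fun θ : ℝ => dot v' (circlePt θ) := by
      simp_rw [← dotCLM_apply]; fun_prop
    exact ((hd v).continuous.comp hcirc).mul h1
  have e1 := integral_sub (hint 1 I) (hint I 1)
  have e2 := intervalIntegral.integral_sub (hib 1 I) (hib I 1)
  rw [g1, g2, ← e2] at e1
  refine (Eq.trans ?_ e1).trans ?_
  · refine integral_congr_ae (ae_of_all _ fun z => ?_)
    simp only [fderiv_fderiv_apply_comm hψ z, coe_comp, Function.comp_apply, mul_apply', imCLM_apply,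
      smul_eq_mul, mul_one, mul_im, mul_re, I_re, I_im]
    ring
  · rw [← intervalIntegral.integral_neg]
    refine intervalIntegral.integral_congr fun θ _ => ?_
    simp only [(hasDerivAt_comp_circlePt hψ θ).deriv, fderiv_eq_re_im _ (I * circlePt θ), dot, smul_eq_mul,
      mul_re, mul_im, I_re, I_im, one_re, one_im]
    ring

/-- An additive constant in the phase is invisible because `∂_θψ` has zero integral over the circle.
This leaves room for the normalization `π/2` and for multiples of `2π`. -/
theorem isNeumannSolution_neumannFun (hp : ∀ z ∈ ball (0 : ℂ) 1, HasDerivAt p (Q z) z)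
    (hQ : DifferentiableOn ℂ Q (ball 0 1)) (hi : IntegrableOn (fun z => ‖Q z‖ ^ 2) (ball 0 1)) {φ : ℝ → ℝ}
    {c : ℝ} (hφ : ∀ᵐ θ ∂(volume.restrict (Ioc 0 (2 * Real.pi))), φ θ = c + (radialLimit p θ).im) :
    IsNeumannSolution φ (neumannFun p) (neumannDeriv Q) := by
  have hQi : IntegrableOn Q (ball 0 1) := integrableOn_of_sq measure_ball_lt_top.ne
    (hQ.continuousOn.aestronglyMeasurable measurableSet_ball) hi
  refine ⟨hasWeakDeriv_neumannFun hp hQ hi, integrableOn_neumannFun (integrableOn_log_deriv hp hQ hi),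
    integrableOn_neumannDeriv hQi, fun ψ hψ => ?_⟩
  have hd : ∀ v, Continuous fun z => fderiv ℝ ψ z v := continuous_fderiv_apply_of_contDiff hψ
  have hint : ∀ {A : ℂ → ℂ}, IntegrableOn A (ball 0 1) → IntegrableOn (fun z =>
      (A z).re * fderiv ℝ ψ z 1 + (A z * I).re * fderiv ℝ ψ z I) (ball 0 1) := fun {A} hA => by
    refine ((IntegrableOn.smul_of_continuous hA.re (hd 1)).add
      (IntegrableOn.smul_of_continuous (hA.mul_const I).re (hd I))).congr (ae_of_all _ fun z => ?_)
    simp [mul_comm]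
  have e1 := integral_add (hint integrableOn_inv) (hint hQi)
  rw [integral_log_norm_gradient hψ, integral_re_deriv_gradient hp hQ hi hψ] at e1
  have hcirc := continuous_circlePt
  have hder : Continuous (deriv fun t : ℝ => ψ (circlePt t)) := by
    have : (deriv fun t : ℝ => ψ (circlePt t)) = fun θ => fderiv ℝ ψ (circlePt θ) (I * circlePt θ) :=
      funext fun θ => (hasDerivAt_comp_circlePt hψ θ).deriv
    rw [this]
    have := hψ.continuous_fderiv (by simp)
    fun_prop
  have him : IntervalIntegrable (fun θ => (radialLimit p θ).im) volume 0 (2 * Real.pi) := by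
    rw [intervalIntegrable_iff_integrableOn_Ioc_of_le Real.two_pi_pos.le]
    exact ((memLp_radialLimit hp hQ hi).integrable one_le_two).im
  have e2 : ∫ θ in (0 : ℝ)..(2 * Real.pi), φ θ * deriv (fun t : ℝ => ψ (circlePt t)) θ =
      ∫ θ in (0 : ℝ)..(2 * Real.pi), (radialLimit p θ).im * deriv (fun t : ℝ => ψ (circlePt t)) θ := by
    have e3 : ∫ θ in (0 : ℝ)..(2 * Real.pi), φ θ * deriv (fun t : ℝ => ψ (circlePt t)) θ =
        ∫ θ in (0 : ℝ)..(2 * Real.pi), (c * deriv (fun t : ℝ => ψ (circlePt t)) θ +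
          (radialLimit p θ).im * deriv (fun t : ℝ => ψ (circlePt t)) θ) := by
      rw [intervalIntegral.integral_of_le Real.two_pi_pos.le,
        intervalIntegral.integral_of_le Real.two_pi_pos.le]
      refine integral_congr_ae ?_
      filter_upwards [hφ] with θ hθ
      rw [hθ, add_mul]
    rw [e3, intervalIntegral.integral_add ((hder.const_mul c).intervalIntegrable _ _)
      (him.mul_continuousOn hder.continuousOn), intervalIntegral.integral_const_mul,
      intervalIntegral.integral_eq_sub_of_hasDerivAt
        (fun θ _ => (hasDerivAt_comp_circlePt hψ θ).differentiableAt.hasDerivAt)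
        (hder.intervalIntegrable _ _)]
    rw [← circlePt_add_two_pi 0]
    simp
  rw [e2]
  refine Eq.trans ?_ (e1.trans (by ring))
  refine integral_congr_ae (ae_of_all _ fun z => ?_)
  simp only [neumannDeriv_apply, mul_one, add_mul, add_re]
  ring

end

section
open Metric Set ContinuousLinearMap
open scoped ComplexConjugate

/-! ### The canonical harmonic map of the disk -/

/-- The circle-valued map `i z e^p / |z e^p|`. -/
noncomputable def canonicalMap (p : ℂ → ℂ) (z : ℂ) : ℂ := I * (z / ‖z‖) * exp ((p z).im * I)

/-- The differential of `canonicalMap`. -/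
noncomputable def canonicalDeriv (p Q : ℂ → ℂ) (z : ℂ) : ℂ →L[ℝ] ℂ :=
  (imCLM.comp (mul ℝ ℂ (z⁻¹ + Q z))).smulRight (I * canonicalMap p z)

variable {p Q : ℂ → ℂ}

theorem canonicalDeriv_apply (z v : ℂ) :
    canonicalDeriv p Q z v = (((z⁻¹ + Q z) * v).im : ℂ) * (I * canonicalMap p z) := by
  rw [canonicalDeriv, smulRight_apply, real_smul]
  rfl

theorem norm_canonicalMap {z : ℂ} (hz : z ≠ 0) : ‖canonicalMap p z‖ = 1 := by
  rw [canonicalMap, norm_mul, norm_mul, norm_div, norm_I, norm_exp_ofReal_mul_I]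
  simp [hz]

theorem canonicalMap_polar {r : ℝ} (hr : 0 < r) (θ : ℝ) :
    canonicalMap p (r * circlePt θ) = I * circlePt θ * exp ((p (r * circlePt θ)).im * I) := by
  have : (r : ℂ) ≠ 0 := ofReal_ne_zero.2 hr.ne'
  simp only [canonicalMap, norm_mul, norm_circlePt, norm_real, Real.norm_of_nonneg hr.le, mul_one]
  rw [mul_div_cancel_left₀ _ this]

/-- Near `z` the map is a unimodular constant times `exp(i Im(log(w/z) + p(w)))`, the exponential of
a harmonic phase. -/
theorem hasFDerivAt_canonicalMap {z : ℂ} (hz : z ≠ 0) (hp : HasDerivAt p (Q z) z) :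
    HasFDerivAt (canonicalMap p) (canonicalDeriv p Q z) z := by
  have h1 : HasDerivAt (fun w => Complex.log (w / z) + p w) (z⁻¹ + Q z) z := by
    have h0 : HasDerivAt (fun w => Complex.log (w / z)) z⁻¹ z := by
      simpa [div_self hz] using ((hasDerivAt_id z).div_const z).clog (by simp [div_self hz])
    exact h0.add hp
  have h2 : HasFDerivAt (fun w => (Complex.log (w / z) + p w).im) (imCLM.comp (mul ℝ ℂ (z⁻¹ + Q z))) z :=
    imCLM.hasFDerivAt.comp z (hasFDerivAt_mul_real h1)
  have h3 : HasDerivAt (fun t : ℝ => I * (z / ‖z‖) * circlePt t)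
      (I * (z / ‖z‖) * (I * circlePt (Complex.log (z / z) + p z).im)) (Complex.log (z / z) + p z).im :=
    (hasDerivAt_circlePt _).const_mul _
  have h4 := HasFDerivAt.comp (g := fun t : ℝ => I * (z / ‖z‖) * circlePt t)
    (f := fun w => (Complex.log (w / z) + p w).im) z h3.hasFDerivAt h2
  have he : canonicalMap p =ᶠ[𝓝 z] fun w => I * (z / ‖z‖) * circlePt (Complex.log (w / z) + p w).im := by
    filter_upwards [isOpen_ne.mem_nhds hz] with w hw
    have hwz : w / z ≠ 0 := div_ne_zero hw hz
    have e1 : (w / z) / ‖w / z‖ = exp ((Complex.log (w / z)).im * I) := by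
      rw [log_im, div_eq_iff (by simpa using hwz), mul_comm, norm_mul_exp_arg_mul_I]
    have e2 : w / ‖w‖ = z / ‖z‖ * exp ((Complex.log (w / z)).im * I) := by
      have a1 : (‖w‖ : ℂ) ≠ 0 := by simpa using hw
      have a2 : (‖z‖ : ℂ) ≠ 0 := by simpa using hz
      rw [← e1, norm_div]
      push_cast
      field_simp
    rw [canonicalMap, e2, circlePt, add_im, ofReal_add, add_mul, exp_add]
    ring
  refine (h4.congr_of_eventuallyEq he).congr_fderiv ?_
  ext v
  rw [canonicalDeriv_apply, he.eq_of_nhds]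
  simp
  ring

theorem continuousOn_canonicalMap (hp : ContinuousOn p (ball 0 1)) :
    ContinuousOn (canonicalMap p) (ball 0 1 \ {0}) := by
  have h1 : ContinuousOn (fun z : ℂ => z / ‖z‖) (ball 0 1 \ {0}) :=
    continuousOn_id.div (by fun_prop) fun z hz => by simpa using hz.2
  have h2 : ContinuousOn (fun z => exp ((p z).im * I)) (ball 0 1 \ {0}) :=
    ((continuous_ofReal.comp_continuousOn (continuous_im.comp_continuousOn
      (hp.mono sdiff_subset))).mul continuousOn_const).cexp
  exact (continuousOn_const.mul h1).mul h2

theorem continuousOn_canonicalDeriv (hp : ContinuousOn p (ball 0 1)) (hQ : ContinuousOn Q (ball 0 1)) :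
    ContinuousOn (canonicalDeriv p Q) (ball 0 1 \ {0}) := by
  have h1 : ContinuousOn (fun z : ℂ => z⁻¹ + Q z) (ball 0 1 \ {0}) :=
    (continuousOn_inv₀.mono fun z hz => hz.2).add (hQ.mono sdiff_subset)
  have h2 := ((compL ℝ ℂ ℂ ℝ imCLM).comp (mul ℝ ℂ)).continuous.comp_continuousOn h1
  exact ((smulRightL ℝ ℂ ℂ).continuous.comp_continuousOn h2).clm_apply
    (continuousOn_const.mul (continuousOn_canonicalMap hp))

theorem dot_real_mul (t : ℝ) (w : ℂ) (hw : ‖w‖ = 1) : dot (t * w) w = t := by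
  have := dot_self w
  rw [hw] at this
  simp only [dot, re_ofReal_mul, im_ofReal_mul] at this ⊢
  linear_combination t * this

theorem angularPart_canonicalDeriv {z : ℂ} (hz : z ≠ 0) (v : ℂ) :
    angularPart (canonicalMap p z) (canonicalDeriv p Q z v) = ((z⁻¹ + Q z) * v).im := by
  rw [angularPart, canonicalDeriv_apply, dot_real_mul]
  simp [norm_canonicalMap hz]

/-- The directional derivatives along `1` and `i` have lengths `|Im k|` and `|Re k|`, where `k =
(1/z + Q) c`. The factor `c` accounts for a conformal change of variable. -/
theorem gradSq_canonicalDeriv {z : ℂ} (hz : z ≠ 0) (c : ℂ) :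
    gradSq ((canonicalDeriv p Q z).comp (mul ℝ ℂ c)) = ‖z⁻¹ + Q z‖ ^ 2 * ‖c‖ ^ 2 := by
  have hn := norm_canonicalMap (p := p) hz
  simp only [gradSq, comp_apply, mul_apply', canonicalDeriv_apply, norm_mul, hn, norm_I, mul_one,
    norm_real, Real.norm_eq_abs, sq_abs]
  rw [← mul_pow, ← norm_mul, Complex.sq_norm, normSq_apply]
  simp only [← mul_assoc, mul_I_im]
  ring

theorem hasCircleTrace_canonicalMap (hp : ∀ z ∈ ball (0 : ℂ) 1, HasDerivAt p (Q z) z)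
    (hQ : DifferentiableOn ℂ Q (ball 0 1)) (hi : IntegrableOn (fun z => ‖Q z‖ ^ 2) (ball 0 1)) {u : ℂ → ℂ}
    {Du : ℂ → ℂ →L[ℝ] ℂ} (hu : EqOn u (canonicalMap p) (ball 0 1 \ {0}))
    (hDu : EqOn Du (canonicalDeriv p Q) (ball 0 1 \ {0})) {h : ℝ → ℂ}
    (hh : ∀ᵐ θ ∂(volume.restrict (Ioc 0 (2 * Real.pi))),
      h θ = I * circlePt θ * exp ((radialLimit p θ).im * I)) :
    HasCircleTrace u Du h := by
  intro ψ hψ _ v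
  obtain ⟨D, hD, hDb⟩ := exists_radial_dominated hp hQ hi
  have hpc : ContinuousOn p (ball 0 1) := fun z hz => (hp z hz).continuousAt.continuousWithinAt
  have hQi : IntegrableOn Q (ball 0 1) := integrableOn_of_sq measure_ball_lt_top.ne
    (hQ.continuousOn.aestronglyMeasurable measurableSet_ball) hi
  have hnull : (ball (0 : ℂ) 1 \ {0} : Set ℂ) =ᵐ[volume] ball 0 1 := sdiff_null_ae_eq_self (measure_singleton 0)
  have hm : MeasurableSet (ball (0 : ℂ) 1 \ {0}) := measurableSet_ball.diff (measurableSet_singleton 0)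
  have hi1 : IntegrableOn (canonicalMap p) (ball 0 1) := by
    rw [← integrableOn_congr_set_ae hnull]
    refine (integrableOn_const (C := (1 : ℝ)) ((measure_mono sdiff_subset).trans_lt measure_ball_lt_top).ne).mono'
      ((continuousOn_canonicalMap hpc).aestronglyMeasurable hm) ?_
    filter_upwards [ae_restrict_mem hm] with z hz using (norm_canonicalMap hz.2).le
  have hcd := continuousOn_canonicalDeriv hpc hQ.continuousOn
  have hi2 : IntegrableOn (fun z => canonicalDeriv p Q z v) (ball 0 1) := by
    rw [← integrableOn_congr_set_ae hnull]
    have hb : IntegrableOn (fun z => ‖(z⁻¹ + Q z) * v‖) (ball 0 1) :=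
      ((integrableOn_inv.add hQi).mul_const v).norm
    refine (hb.mono_set sdiff_subset).mono'
      ((hcd.clm_apply continuousOn_const).aestronglyMeasurable hm) ?_
    filter_upwards [ae_restrict_mem hm] with z hz
    rw [canonicalDeriv_apply, norm_mul, norm_mul, norm_I, norm_canonicalMap hz.2, mul_one, mul_one, norm_real]
    exact abs_im_le_norm _
  have key := integral_ball_test_smul (D := fun _ => 1)
    (g := fun θ => I * circlePt θ * exp ((radialLimit p θ).im * I))
    (fun z hz => hasFDerivAt_canonicalMap hz.2 (hp z hz.1)) (hcd.clm_apply continuousOn_const)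
    hi1 hi2 ?_ (integrableOn_const (by simp [ENNReal.mul_eq_top])) ?_ hψ
  · refine (Eq.trans ?_ key).trans ?_
    · refine integral_congr_ae ?_
      rw [← Measure.restrict_congr_set hnull]
      filter_upwards [ae_restrict_mem hm] with z hz
      rw [hu hz, hDu hz]
    · rw [intervalIntegral.integral_of_le Real.two_pi_pos.le,
        intervalIntegral.integral_of_le Real.two_pi_pos.le]
      refine integral_congr_ae ?_
      filter_upwards [hh] with θ hθ
      rw [hθ]
  · have h1 : Tendsto (fun z : ℂ => ‖z‖) (𝓝[≠] 0) (𝓝 0) := by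
      simpa using (continuous_norm.tendsto (0 : ℂ)).mono_left nhdsWithin_le_nhds
    refine h1.congr' ?_
    filter_upwards [self_mem_nhdsWithin] with z hz
    rw [norm_canonicalMap hz, mul_one]
  · filter_upwards [hDb] with θ hθ
    refine ⟨?_, fun r hr => ?_⟩
    · have h1 : Continuous fun w : ℂ => I * circlePt θ * exp (w.im * I) := by fun_prop
      refine ((h1.tendsto _).comp hθ.1).congr' ?_
      filter_upwards [Ioo_mem_nhdsLT zero_lt_one] with r hr
      rw [canonicalMap_polar hr.1]
      rfl
    · have h0 : 0 < r := by linarith [hr.1]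
      exact (norm_canonicalMap (by simp [h0.ne', circlePt_ne_zero])).le

end

/-! ### The canonical harmonic map on `Ω` -/

section
open Metric Set ContinuousLinearMap IsUniformization
open scoped ComplexConjugate

namespace IsDirichletConformal

variable {f p Q : ℂ → ℂ} {Ω : Set ℂ}

theorem ae_boundaryPullback (h : IsDirichletConformal f p Q) (hf : IsUniformization f Ω)
    (hi : InjOn (diskExtend f) (closedBall 0 1)) :
    ∀ᵐ θ ∂(volume.restrict (Ioc 0 (2 * Real.pi))), boundaryPullback f (unitTangent Ω) θ =
      I * circlePt θ * exp ((radialLimit p θ).im * I) := by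
  obtain ⟨D, hD, hDb⟩ := exists_radial_dominated h.hasDerivAt_log h.differentiableOn_deriv_log
    h.integrableOn_sq
  filter_upwards [hDb] with θ hθ
  rw [boundaryPullback, h.unitTangent_diskExtend hf hi (norm_circlePt θ) hθ.1]
  have : ((Real.pi / 2 + (radialLimit p θ).im : ℝ) : ℂ) * I = Real.pi / 2 * I + (radialLimit p θ).im * I := by
    push_cast; ring
  rw [this, exp_add, exp_pi_div_two_mul_I]
  ring

theorem memHHalf_phase (h : IsDirichletConformal f p Q) (c : ℝ) :
    MemHHalf fun θ => c + (radialLimit p θ).im := by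
  have hP := memHHalf_radialLimit h.hasDerivAt_log h.differentiableOn_deriv_log h.integrableOn_sq
  have hm : MemLp (fun θ => c + (radialLimit p θ).im) 2 angularMeasure :=
    (memLp_const c).add hP.1.im
  refine hP.mono_add (C := 0) hm (ae_of_all _ fun q => ?_)
  rw [add_sub_add_left_eq_sub, ← sub_im, zero_mul, add_zero]
  exact abs_im_le_norm _

/-- The map `t ↦ e^{it}` is 1-Lipschitz, so the increments are at most those of the phase plus the
chord, the latter coming from the factor `e^{iθ}`. -/
theorem memHHalf_boundaryPullback (h : IsDirichletConformal f p Q) (hf : IsUniformization f Ω)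
    (hi : InjOn (diskExtend f) (closedBall 0 1)) : MemHHalf (boundaryPullback f (unitTangent Ω)) := by
  have hb := h.ae_boundaryPullback hf hi
  have hP := memHHalf_radialLimit h.hasDerivAt_log h.differentiableOn_deriv_log h.integrableOn_sq
  have hcirc := continuous_circlePt
  have hmeas : AEStronglyMeasurable (fun θ => I * circlePt θ * exp ((radialLimit p θ).im * I)) angularMeasure := by
    have h1 : Continuous fun w : ℂ => exp (w.im * I) := by fun_prop
    exact (by fun_prop : Continuous fun θ => I * circlePt θ).aestronglyMeasurable.mul
      (h1.comp_aestronglyMeasurable hP.1.aestronglyMeasurable)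
  have hm : MemLp (boundaryPullback f (unitTangent Ω)) 2 angularMeasure := by
    refine MemLp.of_bound (hmeas.congr (hb.mono fun θ hθ => hθ.symm)) 1 ?_
    filter_upwards [hb] with θ hθ
    rw [hθ, norm_mul, norm_mul, norm_I, norm_circlePt, norm_exp_ofReal_mul_I, one_mul, one_mul]
  refine hP.mono_add (C := 1) hm ?_
  filter_upwards [ae_prod_of_ae hb] with q hq
  rw [hq.1, hq.2]
  have e : I * circlePt q.1 * exp ((radialLimit p q.1).im * I) -
      I * circlePt q.2 * exp ((radialLimit p q.2).im * I) =
      I * circlePt q.1 * (circlePt (radialLimit p q.1).im - circlePt (radialLimit p q.2).im) +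
      I * (circlePt q.1 - circlePt q.2) * circlePt (radialLimit p q.2).im := by
    simp only [circlePt]; ring
  rw [e]
  refine (norm_add_le _ _).trans ?_
  simp only [norm_mul, norm_I, norm_circlePt, one_mul, mul_one]
  gcongr
  refine (norm_circlePt_sub_le _ _).trans ?_
  rw [← sub_im]
  exact abs_im_le_norm _

theorem isPhase_boundaryPullback (h : IsDirichletConformal f p Q) (hf : IsUniformization f Ω)
    (hi : InjOn (diskExtend f) (closedBall 0 1)) :
    IsPhase 1 (boundaryPullback f (unitTangent Ω)) fun θ => Real.pi / 2 + (radialLimit p θ).im := by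
  refine ⟨h.memHHalf_phase _, ?_⟩
  filter_upwards [h.ae_boundaryPullback hf hi] with θ hθ
  have : ((Real.pi / 2 + (radialLimit p θ).im : ℝ) : ℂ) * I = Real.pi / 2 * I + (radialLimit p θ).im * I := by
    push_cast; ring
  rw [hθ, this, exp_add, exp_pi_div_two_mul_I, zpow_one]
  ring

/-- The canonical harmonic map of `Ω` in terms of a uniformization. -/
noncomputable def domainMap (f p : ℂ → ℂ) (w : ℂ) : ℂ := canonicalMap p (inv f w)

/-- The differential of `domainMap`. -/
noncomputable def domainDeriv (f p Q : ℂ → ℂ) (w : ℂ) : ℂ →L[ℝ] ℂ :=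
  (canonicalDeriv p Q (inv f w)).comp (mul ℝ ℂ (exp (p (inv f w)))⁻¹)

theorem invFunOn_ne_zero (hf : IsUniformization f Ω) {w : ℂ} (hw : w ∈ Ω \ {f 0}) : inv f w ≠ 0 := fun h0 =>
  hw.2 (by rw [mem_singleton_iff, ← h0, hf.apply_inv hw.1])

theorem hasFDerivAt_domainMap (h : IsDirichletConformal f p Q) (hf : IsUniformization f Ω) {w : ℂ}
    (hw : w ∈ Ω \ {f 0}) : HasFDerivAt (domainMap f p) (domainDeriv f p Q w) w := by
  have h1 := hasFDerivAt_mul_real (hf.hasDerivAt_inv hw.1)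
  rw [(h.hasDerivAt _ (hf.inv_mem hw.1)).deriv] at h1
  exact (hasFDerivAt_canonicalMap (invFunOn_ne_zero hf hw)
    (h.hasDerivAt_log _ (hf.inv_mem hw.1))).comp w h1

theorem continuousOn_domainDeriv (h : IsDirichletConformal f p Q) (hf : IsUniformization f Ω) :
    ContinuousOn (domainDeriv f p Q) (Ω \ {f 0}) := by
  have hinv : ContinuousOn (inv f) (Ω \ {f 0}) := fun w hw =>
    (hf.hasDerivAt_inv hw.1).continuousAt.continuousWithinAt
  have hmaps : MapsTo (inv f) (Ω \ {f 0}) (ball 0 1 \ {0}) := fun w hw =>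
    ⟨hf.inv_mem hw.1, invFunOn_ne_zero hf hw⟩
  have h1 : ContinuousOn (fun w => canonicalDeriv p Q (inv f w)) (Ω \ {f 0}) :=
    (continuousOn_canonicalDeriv h.differentiableOn_log.continuousOn
      h.differentiableOn_deriv_log.continuousOn).comp hinv hmaps
  have h2 : ContinuousOn (fun w => p (inv f w)) (Ω \ {f 0}) :=
    h.differentiableOn_log.continuousOn.comp hinv fun w hw => hf.inv_mem hw.1
  have h3 : ContinuousOn (fun w => (exp (p (inv f w)))⁻¹) (Ω \ {f 0}) :=
    h2.cexp.inv₀ fun w _ => exp_ne_zero _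
  have h4 : ContinuousOn (fun w => mul ℝ ℂ (exp (p (inv f w)))⁻¹) (Ω \ {f 0}) :=
    (mul ℝ ℂ).continuous.comp_continuousOn h3
  exact h1.clm_comp h4

theorem angularPart_domainDeriv (hf : IsUniformization f Ω) {w : ℂ} (hw : w ∈ Ω \ {f 0}) (v : ℂ) :
    angularPart (domainMap f p w) (domainDeriv f p Q w v) =
      (((inv f w)⁻¹ + Q (inv f w)) * ((exp (p (inv f w)))⁻¹ * v)).im := by
  rw [domainMap, domainDeriv, comp_apply, angularPart_canonicalDeriv (invFunOn_ne_zero hf hw), mul_apply']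

/-- The form `⟨du, iu⟩` is the imaginary part of a logarithmic differential. Writing `f⁻¹(w) = (w -
a) k(w)` with `k` zero-free isolates the pole `1/(w - a)`, which contributes `2π`; the rest is
holomorphic and disappears by Cauchy's theorem. -/
theorem integral_angularPart_circle (h : IsDirichletConformal f p Q) (hf : IsUniformization f Ω) {r : ℝ}
    (hr : 0 < r) (hrΩ : closedBall (f 0) r ⊆ Ω) :
    ∫ θ in (0 : ℝ)..(2 * Real.pi), angularPart (domainMap f p (f 0 + r * circlePt θ))
      (domainDeriv f p Q (f 0 + r * circlePt θ) (I * (r * circlePt θ))) = 2 * Real.pi := by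
  have h0 : (0 : ℂ) ∈ ball (0 : ℂ) 1 := mem_ball_self one_pos
  have hΩ := hf.isOpen
  have ha : f 0 ∈ Ω := hf.mapsTo h0
  have hg : DifferentiableOn ℂ (inv f) Ω := fun w hw =>
    (hf.hasDerivAt_inv hw).differentiableAt.differentiableWithinAt
  obtain ⟨k, hk⟩ : ∃ k, k = dslope (inv f) (f 0) := ⟨_, rfl⟩
  have hkd : DifferentiableOn ℂ k Ω := by
    rw [hk]; exact (differentiableOn_dslope (hΩ.mem_nhds ha)).2 hg
  have hgk : ∀ w, inv f w = (w - f 0) * k w := fun w => by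
    have := sub_smul_dslope (inv f) (f 0) w
    rw [hf.inv_apply h0, sub_zero, smul_eq_mul, ← hk] at this
    exact this.symm
  have hk0 : ∀ w ∈ Ω, k w ≠ 0 := fun w hw hkw => by
    by_cases hwa : w = f 0
    · rw [hwa, hk, dslope_same, (hf.hasDerivAt_inv ha).deriv, hf.inv_apply h0] at hkw
      exact inv_ne_zero (hf.deriv_ne_zero h0) hkw
    · exact invFunOn_ne_zero hf ⟨hw, hwa⟩ (by rw [hgk, hkw, mul_zero])
  obtain ⟨H, hH⟩ : ∃ H : ℂ → ℂ, H = fun w => deriv k w / k w + Q (inv f w) * (exp (p (inv f w)))⁻¹ := ⟨_, rfl⟩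
  have hmaps : MapsTo (inv f) Ω (ball 0 1) := fun w hw => hf.inv_mem hw
  have hHd : DifferentiableOn ℂ H Ω := by
    rw [hH]
    exact ((hkd.deriv hΩ).div hkd hk0).add ((h.differentiableOn_deriv_log.comp hg hmaps).mul
      (((h.differentiableOn_log.comp hg hmaps).cexp).inv fun w _ => exp_ne_zero _))
  have hsum : ∀ w ∈ Ω \ {f 0}, ((inv f w)⁻¹ + Q (inv f w)) * (exp (p (inv f w)))⁻¹ = (w - f 0)⁻¹ + H w := by
    intro w hw
    have hwa : w - f 0 ≠ 0 := sub_ne_zero.2 hw.2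
    have hd1 := hf.hasDerivAt_inv hw.1
    rw [(h.hasDerivAt _ (hf.inv_mem hw.1)).deriv] at hd1
    have hd2 : HasDerivAt (inv f) (1 * k w + (w - f 0) * deriv k w) w := by
      have h3 := ((hasDerivAt_id w).sub_const (f 0)).mul
        (hkd.differentiableAt (hΩ.mem_nhds hw.1)).hasDerivAt
      refine h3.congr_of_eventuallyEq (Eventually.of_forall fun w => ?_)
      exact hgk w
    have hkw := hk0 w hw.1
    have e : (inv f w)⁻¹ = ((w - f 0) * k w)⁻¹ := by rw [hgk w]
    simp only [hH]
    rw [add_mul, hd1.unique hd2, e]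
    field_simp
    ring
  have hcont : ContinuousOn H (closedBall (f 0) r) := hHd.continuousOn.mono hrΩ
  have hzero : ∮ z in C(f 0, r), H z = 0 :=
    circleIntegral_eq_zero_of_differentiable_on_off_countable hr.le countable_empty hcont fun z hz =>
      hHd.differentiableAt (hΩ.mem_nhds (hrΩ (ball_subset_closedBall hz.1)))
  have hcirc := continuous_circlePt
  have hmem : ∀ θ, f 0 + r * circlePt θ ∈ closedBall (f 0) r := fun θ => by
    simp [abs_of_pos hr]
  have hHc : Continuous fun θ => H (f 0 + r * circlePt θ) :=
    hcont.comp_continuous (by fun_prop) hmem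
  have hval : ∀ θ, angularPart (domainMap f p (f 0 + r * circlePt θ))
      (domainDeriv f p Q (f 0 + r * circlePt θ) (I * (r * circlePt θ))) =
      1 + (r * circlePt θ * I * H (f 0 + r * circlePt θ)).im := fun θ => by
    have hne : (r : ℂ) * circlePt θ ≠ 0 := mul_ne_zero (ofReal_ne_zero.2 hr.ne') (circlePt_ne_zero θ)
    have hmm : f 0 + r * circlePt θ ∈ Ω \ {f 0} := ⟨hrΩ (hmem θ), by simpa using hne⟩
    rw [angularPart_domainDeriv hf hmm, ← mul_assoc, hsum _ hmm, add_sub_cancel_left, add_mul,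
      ← mul_assoc, mul_comm _ I, mul_assoc I, inv_mul_cancel₀ hne, mul_one, add_im, I_im]
    congr 2
    ring
  simp_rw [hval]
  have hc2 : Continuous fun θ : ℝ => r * circlePt θ * I * H (f 0 + r * circlePt θ) :=
    (by fun_prop : Continuous fun θ : ℝ => r * circlePt θ * I).mul hHc
  have hc3 : Continuous fun θ : ℝ => (r * circlePt θ * I * H (f 0 + r * circlePt θ)).im :=
    continuous_im.comp hc2
  rw [intervalIntegral.integral_add (by simp) (hc3.intervalIntegrable _ _)]
  have hz2 : ∫ θ in (0 : ℝ)..(2 * Real.pi), (r * circlePt θ * I * H (f 0 + r * circlePt θ)).im = 0 := by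
    have e := imCLM.intervalIntegral_comp_comm (hc2.intervalIntegrable (μ := volume) 0 (2 * Real.pi))
    have e' : ∫ θ in (0 : ℝ)..(2 * Real.pi), r * circlePt θ * I * H (f 0 + r * circlePt θ) = 0 := by
      simpa [circleIntegral, deriv_circleMap, circleMap, circlePt] using hzero
    rw [e', map_zero] at e
    exact e
  rw [hz2]
  simp

end IsDirichletConformal

end

section
open Metric Set ContinuousLinearMap IsUniformization
open scoped ComplexConjugate

/-! ### The energy of the canonical map outside a small disk -/

variable {Q : ℂ → ℂ}

theorem annulus_eq (ρ : ℝ) : {z : ℂ | ‖z‖ ∈ Ico ρ 1} = ball 0 1 \ ball 0 ρ := by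
  ext z
  simp [and_comm]

theorem norm_inv_add_sq_le {ρ : ℝ} (hρ : 0 < ρ) {z q : ℂ} (hz : ρ ≤ ‖z‖) :
    ‖z⁻¹ + q‖ ^ 2 ≤ 2 * (ρ⁻¹) ^ 2 + 2 * ‖q‖ ^ 2 := by
  have h1 : ‖z⁻¹‖ ≤ ρ⁻¹ := by
    rw [norm_inv]; exact inv_anti₀ hρ hz
  have h2 := norm_add_le z⁻¹ q
  have h3 := norm_nonneg (z⁻¹ + q)
  nlinarith [sq_nonneg (ρ⁻¹ - ‖q‖), norm_nonneg z⁻¹]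

theorem integrableOn_norm_inv_add_sq (hQ : DifferentiableOn ℂ Q (ball 0 1))
    (hi : IntegrableOn (fun z => ‖Q z‖ ^ 2) (ball 0 1)) {ρ : ℝ} (hρ : 0 < ρ) {S : Set ℂ}
    (hS : MeasurableSet S) (hS1 : S ⊆ ball 0 1) (hSρ : ∀ z ∈ S, ρ ≤ ‖z‖) :
    IntegrableOn (fun z => ‖z⁻¹ + Q z‖ ^ 2) S := by
  have hb : IntegrableOn (fun z => 2 * (ρ⁻¹) ^ 2 + 2 * ‖Q z‖ ^ 2) S :=
    (integrableOn_const ((measure_mono hS1).trans_lt measure_ball_lt_top).ne).add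
      ((hi.mono_set hS1).const_mul 2)
  have hm : AEStronglyMeasurable (fun z => z⁻¹ + Q z) (volume.restrict S) :=
    measurable_inv.aestronglyMeasurable.add ((hQ.continuousOn.mono hS1).aestronglyMeasurable hS)
  refine hb.mono' (hm.norm.pow 2) ?_
  filter_upwards [ae_restrict_mem hS] with z hz
  rw [Real.norm_of_nonneg (sq_nonneg _)]
  exact norm_inv_add_sq_le hρ (hSρ z hz)

theorem integral_annulus_inv_norm_sq {ρ : ℝ} (hρ : ρ ∈ Ioo (0 : ℝ) 1) :
    ∫ z in {z : ℂ | ‖z‖ ∈ Ico ρ 1}, (‖z‖ ^ 2)⁻¹ = - (2 * Real.pi * Real.log ρ) := by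
  have h0 : Ico ρ 1 ⊆ Ioi 0 := fun r hr => hρ.1.trans_le hr.1
  have hS : MeasurableSet {z : ℂ | ‖z‖ ∈ Ico ρ 1} := measurable_norm measurableSet_Ico
  have hi : IntegrableOn (fun z : ℂ => (‖z‖ ^ 2)⁻¹) {z : ℂ | ‖z‖ ∈ Ico ρ 1} := by
    have hQ0 : DifferentiableOn ℂ (fun _ : ℂ => (0 : ℂ)) (ball 0 1) := differentiableOn_const 0
    have := integrableOn_norm_inv_add_sq (Q := fun _ => 0) hQ0 (by simp) hρ.1 hS
      (by rw [annulus_eq]; exact sdiff_subset) (fun z hz => hz.1)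
    simpa using this
  rw [integral_polar measurableSet_Ico h0 hi]
  have e : ∀ r ∈ Ico ρ 1, r • ∫ θ in (0 : ℝ)..(2 * Real.pi), (‖(r : ℂ) * circlePt θ‖ ^ 2)⁻¹ =
      2 * Real.pi * r⁻¹ := fun r hr => by
    have hr0 : 0 < r := h0 hr
    simp [abs_of_pos hr0]
    field_simp
  rw [setIntegral_congr_fun measurableSet_Ico e, integral_const_mul, integral_Ico_eq_integral_Ioo,
    ← integral_Ioc_eq_integral_Ioo, ← intervalIntegral.integral_of_le hρ.2.le,
    integral_inv_of_pos hρ.1 one_pos, one_div, Real.log_inv]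
  ring

/-- The mean of `z Q(z)` on each circle is its value at the origin, which is zero. -/
theorem integral_annulus_cross (hQ : DifferentiableOn ℂ Q (ball 0 1)) {ρ : ℝ} (hρ : ρ ∈ Ioo (0 : ℝ) 1)
    (hi : IntegrableOn (fun z => (z * Q z).re * (‖z‖ ^ 2)⁻¹) {z : ℂ | ‖z‖ ∈ Ico ρ 1}) :
    ∫ z in {z : ℂ | ‖z‖ ∈ Ico ρ 1}, (z * Q z).re * (‖z‖ ^ 2)⁻¹ = 0 := by
  have h0 : Ico ρ 1 ⊆ Ioi 0 := fun r hr => hρ.1.trans_le hr.1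
  rw [integral_polar measurableSet_Ico h0 hi]
  refine setIntegral_eq_zero_of_forall_eq_zero fun r hr => ?_
  have hr0 : 0 < r := h0 hr
  have hcirc := continuous_circlePt
  have hc : Continuous fun θ : ℝ => (r * circlePt θ) * Q (r * circlePt θ) :=
    (by fun_prop : Continuous fun θ : ℝ => (r : ℂ) * circlePt θ).mul
      (hQ.continuousOn.comp_continuous (by fun_prop) fun θ => by simp [abs_of_pos hr0, hr.2])
  have e1 : ∫ θ in (0 : ℝ)..(2 * Real.pi), (r * circlePt θ) * Q (r * circlePt θ) = 0 := by
    have hd : DifferentiableOn ℂ (fun z => z * Q z) (ball 0 1) := differentiableOn_id.mul hQ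
    simpa using integral_circle_mean hd ⟨hr0, hr.2⟩
  have e2 := reCLM.intervalIntegral_comp_comm (hc.intervalIntegrable (μ := volume) 0 (2 * Real.pi))
  rw [e1, map_zero] at e2
  simp only [reCLM_apply] at e2
  simp only [norm_mul, norm_circlePt, norm_real, Real.norm_of_nonneg hr0.le, mul_one]
  rw [intervalIntegral.integral_mul_const, e2, zero_mul, smul_zero]

theorem integral_annulus_energy (hQ : DifferentiableOn ℂ Q (ball 0 1))
    (hi : IntegrableOn (fun z => ‖Q z‖ ^ 2) (ball 0 1)) {ρ : ℝ} (hρ : ρ ∈ Ioo (0 : ℝ) 1) :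
    ∫ z in {z : ℂ | ‖z‖ ∈ Ico ρ 1}, ‖z⁻¹ + Q z‖ ^ 2 =
      - (2 * Real.pi * Real.log ρ) + ∫ z in {z : ℂ | ‖z‖ ∈ Ico ρ 1}, ‖Q z‖ ^ 2 := by
  have hS : MeasurableSet {z : ℂ | ‖z‖ ∈ Ico ρ 1} := measurable_norm measurableSet_Ico
  have hS1 : {z : ℂ | ‖z‖ ∈ Ico ρ 1} ⊆ ball 0 1 := by rw [annulus_eq]; exact sdiff_subset
  have i1 : IntegrableOn (fun z : ℂ => (‖z‖ ^ 2)⁻¹) {z : ℂ | ‖z‖ ∈ Ico ρ 1} := by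
    have := integrableOn_norm_inv_add_sq (Q := fun _ => 0) (differentiableOn_const 0) (by simp) hρ.1 hS
      hS1 (fun z hz => hz.1)
    simpa using this
  have i2 := integrableOn_norm_inv_add_sq hQ hi hρ.1 hS hS1 (fun z hz => hz.1)
  have i3 := hi.mono_set hS1
  have e : ∀ z : ℂ, z ≠ 0 → ‖z⁻¹ + Q z‖ ^ 2 = (‖z‖ ^ 2)⁻¹ + ‖Q z‖ ^ 2 + 2 * ((z * Q z).re * (‖z‖ ^ 2)⁻¹) := by
    intro z hz
    have hn : normSq z ≠ 0 := by simpa using hz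
    simp only [Complex.sq_norm, normSq_add, inv_re, inv_im, map_inv₀, mul_re, conj_re, conj_im]
    field_simp
  have hae : ∀ z ∈ {z : ℂ | ‖z‖ ∈ Ico ρ 1}, z ≠ 0 := fun z hz => norm_pos_iff.1 (hρ.1.trans_le hz.1)
  have i4 : IntegrableOn (fun z => (z * Q z).re * (‖z‖ ^ 2)⁻¹) {z : ℂ | ‖z‖ ∈ Ico ρ 1} := by
    refine (((i2.sub i1).sub i3).const_mul (1 / 2)).congr ?_
    filter_upwards [ae_restrict_mem hS] with z hz
    simp only [Pi.sub_apply, e z (hae z hz)]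
    ring
  have i5 : IntegrableOn (fun z : ℂ => (‖z‖ ^ 2)⁻¹ + ‖Q z‖ ^ 2) {z : ℂ | ‖z‖ ∈ Ico ρ 1} := i1.add i3
  rw [setIntegral_congr_fun hS fun z hz => e z (hae z hz), integral_add i5 (i4.const_mul 2),
    integral_add i1 i3, integral_const_mul, integral_annulus_cross hQ hρ i4,
    integral_annulus_inv_norm_sq hρ]
  ring

theorem eventually_norm_sub_le {g : ℂ → ℂ} {d x : ℂ} (hg : HasDerivAt g d x) (hd : d ≠ 0) {η : ℝ}
    (hη : 0 < η) : ∀ᶠ z in 𝓝 x, ‖g z - g x‖ ≤ (1 + η) * ‖d‖ * ‖z - x‖ := by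
  have h1 := hg.isLittleO.bound (mul_pos hη (norm_pos_iff.2 hd))
  filter_upwards [h1] with z hz
  have h2 : g z - g x = (g z - g x - (z - x) • d) + (z - x) • d := by ring
  rw [h2]
  refine (norm_add_le _ _).trans ?_
  rw [norm_smul]
  linarith

theorem tendsto_annulus_energy (hQ : DifferentiableOn ℂ Q (ball 0 1))
    (hi : IntegrableOn (fun z => ‖Q z‖ ^ 2) (ball 0 1)) :
    Tendsto (fun ρ : ℝ => (∫ z in {z : ℂ | ‖z‖ ∈ Ico ρ 1}, ‖z⁻¹ + Q z‖ ^ 2) + 2 * Real.pi * Real.log ρ)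
      (𝓝[>] 0) (𝓝 (∫ z in ball (0 : ℂ) 1, ‖Q z‖ ^ 2)) := by
  have hS : ∀ ρ : ℝ, MeasurableSet {z : ℂ | ‖z‖ ∈ Ico ρ 1} := fun ρ => measurable_norm measurableSet_Ico
  have hS1 : ∀ ρ : ℝ, {z : ℂ | ‖z‖ ∈ Ico ρ 1} ⊆ ball 0 1 := fun ρ => by rw [annulus_eq]; exact sdiff_subset
  have h1 : Tendsto (fun ρ : ℝ => ∫ z in ball (0 : ℂ) 1,
      {z : ℂ | ‖z‖ ∈ Ico ρ 1}.indicator (fun z => ‖Q z‖ ^ 2) z) (𝓝[>] 0)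
      (𝓝 (∫ z in ball (0 : ℂ) 1, ‖Q z‖ ^ 2)) := by
    refine tendsto_integral_filter_of_dominated_convergence (fun z => ‖Q z‖ ^ 2)
      (Eventually.of_forall fun ρ => hi.aestronglyMeasurable.indicator (hS ρ))
      (Eventually.of_forall fun ρ => ae_of_all _ fun z => ?_) hi ?_
    · refine (norm_indicator_le_norm_self _ _).trans ?_
      rw [Real.norm_of_nonneg (sq_nonneg _)]
    · have hne : ∀ᵐ z ∂(volume.restrict (ball (0 : ℂ) 1)), z ≠ 0 := ae_restrict_of_ae (by
        simp [ae_iff])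
      filter_upwards [ae_restrict_mem measurableSet_ball, hne] with z hz hz0
      refine tendsto_const_nhds.congr' ?_
      filter_upwards [Ioo_mem_nhdsGT (norm_pos_iff.2 hz0)] with ρ hρ
      rw [indicator_of_mem]
      exact ⟨hρ.2.le, by simpa using hz⟩
  refine h1.congr' ?_
  filter_upwards [Ioo_mem_nhdsGT zero_lt_one] with ρ hρ
  rw [integral_annulus_energy hQ hi hρ, setIntegral_indicator (hS ρ), inter_eq_right.2 (hS1 ρ)]
  ring

variable {f p : ℂ → ℂ} {Ω : Set ℂ}

/-- The first inclusion linearizes `f` at `0`. The second linearizes the inverse at `f 0`, which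
also excludes points far from `0` whose image is close to `f 0`. -/
theorem eventually_sublevel_subset (hf : IsUniformization f Ω) {η : ℝ} (hη : η ∈ Ioo (0 : ℝ) 1) :
    ∀ᶠ δ : ℝ in 𝓝[>] 0,
      {z : ℂ | z ∈ ball 0 1 ∧ δ ≤ ‖f z - f 0‖} ⊆ {z : ℂ | ‖z‖ ∈ Ico ((1 - η) / ‖deriv f 0‖ * δ) 1} ∧
      {z : ℂ | ‖z‖ ∈ Ico ((1 + η) / ‖deriv f 0‖ * δ) 1} ⊆ {z : ℂ | z ∈ ball 0 1 ∧ δ ≤ ‖f z - f 0‖} := by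
  have h0 : (0 : ℂ) ∈ ball (0 : ℂ) 1 := mem_ball_self one_pos
  have hd := hf.deriv_ne_zero h0
  have hc : 0 < ‖deriv f 0‖ := norm_pos_iff.2 hd
  have h1 := eventually_norm_sub_le (hf.hasDerivAt h0) hd hη.1
  have hinv := hf.hasDerivAt_inv (hf.mapsTo h0)
  rw [hf.inv_apply h0] at hinv
  have h2 := eventually_norm_sub_le hinv (inv_ne_zero hd) hη.1
  rw [hf.inv_apply h0] at h2
  obtain ⟨d₁, hd₁, h1⟩ := Metric.eventually_nhds_iff.1 h1
  obtain ⟨d₂, hd₂, h2⟩ := Metric.eventually_nhds_iff.1 h2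
  have hk : 0 < (1 - η) / ‖deriv f 0‖ := div_pos (by linarith [hη.2]) hc
  have hsmall : ∀ᶠ δ : ℝ in 𝓝[>] 0, (1 - η) / ‖deriv f 0‖ * δ < d₁ := by
    have : Tendsto (fun δ : ℝ => (1 - η) / ‖deriv f 0‖ * δ) (𝓝[>] 0) (𝓝 0) := by
      simpa using ((continuous_const_mul ((1 - η) / ‖deriv f 0‖)).tendsto 0).mono_left nhdsWithin_le_nhds
    exact (tendsto_order.1 this).2 _ hd₁
  filter_upwards [hsmall, Ioo_mem_nhdsGT hd₂] with δ hδ₁ hδ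
  constructor
  · rintro z ⟨hz, hδz⟩
    refine ⟨not_lt.1 fun hlt => ?_, by simpa using hz⟩
    have h3 := h1 (y := z) (by rw [dist_zero_right]; exact hlt.trans hδ₁)
    rw [sub_zero] at h3
    -- The product `(1 + η)(1 - η) = 1 - η²` is less than one, contradicting `δ ≤ |f(z) - f(0)|`.
    have h4 : (1 + η) * ‖deriv f 0‖ * ‖z‖ ≤ (1 + η) * ‖deriv f 0‖ * ((1 - η) / ‖deriv f 0‖ * δ) := by
      have := hη.1
      gcongr
    have h5 : (1 + η) * ‖deriv f 0‖ * ((1 - η) / ‖deriv f 0‖ * δ) = (1 - η ^ 2) * δ := by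
      field_simp; ring
    nlinarith [hη.1, hδ.1, mul_pos (pow_pos hη.1 2) hδ.1]
  · rintro z ⟨hz, hz1⟩
    have hzb : z ∈ ball (0 : ℂ) 1 := by simpa using hz1
    refine ⟨hzb, not_lt.1 fun hlt => ?_⟩
    have h3 := h2 (y := f z) (by rw [dist_eq_norm]; exact hlt.trans hδ.2)
    rw [hf.inv_apply hzb, sub_zero, norm_inv] at h3
    have h4 : (1 + η) * ‖deriv f 0‖⁻¹ * ‖f z - f 0‖ < (1 + η) * ‖deriv f 0‖⁻¹ * δ := by
      have := hη.1
      gcongr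
    rw [← div_eq_mul_inv] at h3 h4
    linarith

theorem measurableSet_sublevel (hf : IsUniformization f Ω) (δ : ℝ) :
    MeasurableSet {z : ℂ | z ∈ ball 0 1 ∧ δ ≤ ‖f z - f 0‖} := by
  have hcont : ContinuousOn (fun z => ‖f z - f 0‖) (ball 0 1) :=
    (hf.differentiableOn.continuousOn.sub continuousOn_const).norm
  have h1 : {z : ℂ | z ∈ ball 0 1 ∧ δ ≤ ‖f z - f 0‖} =
      ball 0 1 \ (ball 0 1 ∩ (fun z => ‖f z - f 0‖) ⁻¹' Iio δ) := by
    ext z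
    constructor
    · rintro ⟨h1, h2⟩
      exact ⟨h1, fun h3 => (not_lt.2 h2) h3.2⟩
    · rintro ⟨h1, h2⟩
      exact ⟨h1, not_lt.1 fun h3 => h2 ⟨h1, h3⟩⟩
  rw [h1]
  exact measurableSet_ball.diff (hcont.isOpen_inter_preimage isOpen_ball isOpen_Iio).measurableSet

/-- The density is nonnegative, so the energy is squeezed between those of the annuli of inner radii
`(1 ± η)δ/|f'(0)|`. Their renormalized limits differ from the claim by `-2π ln(1 ± η)`, and `η` is
arbitrary. -/
theorem tendsto_sublevel_energy (hf : IsUniformization f Ω) (hQ : DifferentiableOn ℂ Q (ball 0 1))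
    (hi : IntegrableOn (fun z => ‖Q z‖ ^ 2) (ball 0 1)) :
    Tendsto (fun δ : ℝ => (∫ z in {z : ℂ | z ∈ ball 0 1 ∧ δ ≤ ‖f z - f 0‖}, ‖z⁻¹ + Q z‖ ^ 2)
      - 2 * Real.pi * Real.log (1 / δ)) (𝓝[>] 0)
      (𝓝 ((∫ z in ball (0 : ℂ) 1, ‖Q z‖ ^ 2) + 2 * Real.pi * Real.log ‖deriv f 0‖)) := by
  have h0 : (0 : ℂ) ∈ ball (0 : ℂ) 1 := mem_ball_self one_pos
  have hc : 0 < ‖deriv f 0‖ := norm_pos_iff.2 (hf.deriv_ne_zero h0)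
  obtain ⟨L, hL⟩ : ∃ L, L = ∫ z in ball (0 : ℂ) 1, ‖Q z‖ ^ 2 := ⟨_, rfl⟩
  have hA := tendsto_annulus_energy hQ hi
  rw [← hL] at hA ⊢
  obtain ⟨A, hAdef⟩ : ∃ A : ℝ → ℝ, A = fun ρ => ∫ z in {z : ℂ | ‖z‖ ∈ Ico ρ 1}, ‖z⁻¹ + Q z‖ ^ 2 := ⟨_, rfl⟩
  have hscale : ∀ κ : ℝ, 0 < κ → Tendsto (fun δ : ℝ => A (κ / ‖deriv f 0‖ * δ) - 2 * Real.pi * Real.log (1 / δ))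
      (𝓝[>] 0) (𝓝 (L + 2 * Real.pi * Real.log ‖deriv f 0‖ - 2 * Real.pi * Real.log κ)) := by
    intro κ hκ
    have hk : 0 < κ / ‖deriv f 0‖ := div_pos hκ hc
    have h1 : Tendsto (fun δ : ℝ => κ / ‖deriv f 0‖ * δ) (𝓝[>] 0) (𝓝[>] 0) := by
      refine tendsto_nhdsWithin_iff.2 ⟨?_, ?_⟩
      · simpa using ((continuous_const_mul (κ / ‖deriv f 0‖)).tendsto 0).mono_left nhdsWithin_le_nhds
      · filter_upwards [self_mem_nhdsWithin] with δ hδ using mul_pos hk hδ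
    have h2 := (hA.comp h1).sub_const (2 * Real.pi * Real.log (κ / ‖deriv f 0‖))
    have e : L - 2 * Real.pi * Real.log (κ / ‖deriv f 0‖) =
        L + 2 * Real.pi * Real.log ‖deriv f 0‖ - 2 * Real.pi * Real.log κ := by
      rw [Real.log_div hκ.ne' hc.ne']; ring
    rw [e] at h2
    refine h2.congr' ?_
    filter_upwards [self_mem_nhdsWithin] with δ hδ
    have hδ : 0 < δ := hδ
    simp only [Function.comp_apply, hAdef]
    rw [Real.log_mul hk.ne' hδ.ne', one_div, Real.log_inv]
    ring
  have hlog : ∀ s : ℝ, Tendsto (fun η : ℝ => L + 2 * Real.pi * Real.log ‖deriv f 0‖ -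
      2 * Real.pi * Real.log (1 + s * η)) (𝓝[>] 0) (𝓝 (L + 2 * Real.pi * Real.log ‖deriv f 0‖)) := by
    intro s
    have h1 : ContinuousAt (fun η : ℝ => L + 2 * Real.pi * Real.log ‖deriv f 0‖ -
        2 * Real.pi * Real.log (1 + s * η)) 0 :=
      continuousAt_const.sub (continuousAt_const.mul (ContinuousAt.log (by fun_prop) (by simp)))
    simpa using h1.tendsto.mono_left nhdsWithin_le_nhds
  have hS : ∀ ρ : ℝ, MeasurableSet {z : ℂ | ‖z‖ ∈ Ico ρ 1} := fun ρ => measurable_norm measurableSet_Ico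
  have hS1 : ∀ ρ : ℝ, {z : ℂ | ‖z‖ ∈ Ico ρ 1} ⊆ ball 0 1 := fun ρ => by rw [annulus_eq]; exact sdiff_subset
  have hmono : ∀ {ρ : ℝ} {S T : Set ℂ}, 0 < ρ → MeasurableSet T → S ⊆ T → T ⊆ {z : ℂ | ‖z‖ ∈ Ico ρ 1} →
      ∫ z in S, ‖z⁻¹ + Q z‖ ^ 2 ≤ ∫ z in T, ‖z⁻¹ + Q z‖ ^ 2 := fun {ρ S T} hρ hT hST hTρ =>
    setIntegral_mono_set (integrableOn_norm_inv_add_sq hQ hi hρ hT (hTρ.trans (hS1 ρ)) fun z hz => (hTρ hz).1)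
      (ae_of_all _ fun z => sq_nonneg _) hST.eventuallyLE
  have hT := measurableSet_sublevel hf
  have h01 : Ioo (0 : ℝ) 1 ∈ 𝓝[>] (0 : ℝ) := Ioo_mem_nhdsGT zero_lt_one
  refine tendsto_order.2 ⟨fun b hb => ?_, fun b hb => ?_⟩
  · obtain ⟨η, h1, hη⟩ := (((tendsto_order.1 (hlog 1)).1 b hb).and h01).exists
    rw [one_mul] at h1
    filter_upwards [(tendsto_order.1 (hscale (1 + η) (by linarith [hη.1]))).1 b h1,
      eventually_sublevel_subset hf hη, self_mem_nhdsWithin] with δ h2 h3 hδ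
    have hδ : 0 < δ := hδ
    have hk : 0 < (1 - η) / ‖deriv f 0‖ * δ := mul_pos (div_pos (by linarith [hη.2]) hc) hδ
    have := hmono hk (hT δ) h3.2 h3.1
    rw [hAdef] at h2
    linarith
  · obtain ⟨η, h1, hη⟩ := (((tendsto_order.1 (hlog (-1))).2 b hb).and h01).exists
    rw [neg_one_mul, ← sub_eq_add_neg] at h1
    filter_upwards [(tendsto_order.1 (hscale (1 - η) (by linarith [hη.2]))).2 b h1,
      eventually_sublevel_subset hf hη, self_mem_nhdsWithin] with δ h2 h3 hδ
    have hδ : 0 < δ := hδ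
    have hk : 0 < (1 - η) / ‖deriv f 0‖ * δ := mul_pos (div_pos (by linarith [hη.2]) hc) hδ
    have := hmono hk (hS _) h3.1 le_rfl
    rw [hAdef] at h2
    linarith

end

/-! ### Transport of the energy by `f`, and existence of the canonical map -/

section
open Metric Set ContinuousLinearMap IsUniformization
open scoped ComplexConjugate

variable {f p Q : ℂ → ℂ} {Ω : Set ℂ}

namespace IsUniformization

theorem image_sublevel (hf : IsUniformization f Ω) (δ : ℝ) :
    f '' {z : ℂ | z ∈ ball 0 1 ∧ δ ≤ ‖f z - f 0‖} = Ω \ ball (f 0) δ := by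
  ext w
  constructor
  · rintro ⟨z, ⟨hz, hδ⟩, rfl⟩
    exact ⟨hf.mapsTo hz, by rw [mem_ball, dist_eq_norm]; exact not_lt.2 hδ⟩
  · rintro ⟨hw, hδ⟩
    refine ⟨inv f w, ⟨hf.inv_mem hw, ?_⟩, hf.apply_inv hw⟩
    rw [hf.apply_inv hw]
    rw [mem_ball, dist_eq_norm] at hδ
    exact not_lt.1 hδ

/-- The inverse is differentiable, hence maps null sets to null sets. -/
theorem ae_comp (hf : IsUniformization f Ω) {P : ℂ → Prop} (hP : ∀ᵐ w ∂(volume.restrict Ω), P w) :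
    ∀ᵐ z ∂(volume.restrict (ball (0 : ℂ) 1)), P (f z) := by
  rw [ae_restrict_iff' hf.isOpen.measurableSet, ae_iff] at hP
  rw [ae_restrict_iff' measurableSet_ball, ae_iff]
  have hd : DifferentiableOn ℝ (inv f) {w | ¬ (w ∈ Ω → P w)} := fun w hw => by
    have hw' : w ∈ Ω := by by_contra h; exact hw fun h' => absurd h' h
    exact (hasFDerivAt_mul_real (hf.hasDerivAt_inv hw')).differentiableAt.differentiableWithinAt
  refine measure_mono_null ?_ (addHaar_image_eq_zero_of_differentiableOn_of_addHaar_eq_zero volume hd hP)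
  intro z hz
  have hzb : z ∈ ball (0 : ℂ) 1 := by by_contra h; exact hz fun h' => absurd h' h
  exact ⟨f z, fun h => hz fun _ => h (hf.mapsTo hzb), hf.inv_apply hzb⟩

end IsUniformization

theorem gradSq_eq_angularPart {u : ℂ} (hu : ‖u‖ = 1) {L : ℂ →L[ℝ] ℂ} (h1 : dot (L 1) u = 0)
    (hI : dot (L I) u = 0) : gradSq L = angularPart u (L 1) ^ 2 + angularPart u (L I) ^ 2 := by
  have key : ∀ w : ℂ, dot w u = 0 → ‖w‖ ^ 2 = angularPart u w ^ 2 := fun w hw => by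
    have h2 : u.re ^ 2 + u.im ^ 2 = 1 := by
      have := Complex.sq_norm u
      rw [hu, normSq_apply] at this
      linarith
    simp only [Complex.sq_norm, normSq_apply, angularPart, dot, mul_re, mul_im, I_re, I_im] at hw ⊢
    linear_combination (-(w.re ^ 2 + w.im ^ 2)) * h2 + (w.re * u.re + w.im * u.im) * hw
  rw [gradSq, key _ h1, key _ hI]

namespace IsDirichletConformal

theorem integrableOn_gradSq_iff (hf : IsUniformization f Ω) {Du : ℂ → ℂ →L[ℝ] ℂ}
    (hDu : ∀ᵐ z ∂(volume.restrict (ball (0 : ℂ) 1)), ‖deriv f z‖ ^ 2 * gradSq (Du (f z)) = ‖z⁻¹ + Q z‖ ^ 2)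
    (δ : ℝ) : IntegrableOn (fun w => gradSq (Du w)) (Ω \ ball (f 0) δ) ↔
      IntegrableOn (fun z => ‖z⁻¹ + Q z‖ ^ 2) {z : ℂ | z ∈ ball 0 1 ∧ δ ≤ ‖f z - f 0‖} := by
  have hsub : {z : ℂ | z ∈ ball 0 1 ∧ δ ≤ ‖f z - f 0‖} ⊆ ball 0 1 := fun z hz => hz.1
  rw [← hf.image_sublevel, integrableOn_image_holomorphic isOpen_ball hf.differentiableOn hf.injOn
    (measurableSet_sublevel hf δ) hsub]
  exact integrable_congr (ae_restrict_of_ae_restrict_of_subset hsub hDu)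

/-- Conformal invariance. Only the almost everywhere value of the energy density is prescribed, so
the formula applies to arbitrary canonical maps as well as to the explicit one. -/
theorem integral_gradSq_eq (hf : IsUniformization f Ω) {Du : ℂ → ℂ →L[ℝ] ℂ}
    (hDu : ∀ᵐ z ∂(volume.restrict (ball (0 : ℂ) 1)), ‖deriv f z‖ ^ 2 * gradSq (Du (f z)) = ‖z⁻¹ + Q z‖ ^ 2)
    (δ : ℝ) : ∫ w in Ω \ ball (f 0) δ, gradSq (Du w) =
      ∫ z in {z : ℂ | z ∈ ball 0 1 ∧ δ ≤ ‖f z - f 0‖}, ‖z⁻¹ + Q z‖ ^ 2 := by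
  have hsub : {z : ℂ | z ∈ ball 0 1 ∧ δ ≤ ‖f z - f 0‖} ⊆ ball 0 1 := fun z hz => hz.1
  rw [← hf.image_sublevel, setIntegral_image_holomorphic isOpen_ball hf.differentiableOn hf.injOn
    (measurableSet_sublevel hf δ) hsub]
  exact integral_congr_ae (ae_restrict_of_ae_restrict_of_subset hsub hDu)

theorem isCanonicalHarmonicMap (h : IsDirichletConformal f p Q) (hf : IsUniformization f Ω)
    (hi : InjOn (diskExtend f) (closedBall 0 1)) :
    IsCanonicalHarmonicMap Ω (f 0) (unitTangent Ω) (domainMap f p) (domainDeriv f p Q) := by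
  have hΩ : IsOpen (Ω \ {f 0}) := hf.isOpen.sdiff isClosed_singleton
  have hball : ∀ᵐ z ∂(volume.restrict (ball (0 : ℂ) 1)), z ∈ ball (0 : ℂ) 1 ∧ z ≠ 0 :=
    (ae_restrict_mem measurableSet_ball).and (ae_restrict_of_ae (by simp [ae_iff]))
  have hcomp : ∀ z ∈ ball (0 : ℂ) 1, domainMap f p (f z) = canonicalMap p z := fun z hz => by
    rw [domainMap, hf.inv_apply hz]
  have hpull : ∀ z ∈ ball (0 : ℂ) 1, pullbackDeriv f (domainDeriv f p Q) z = canonicalDeriv p Q z :=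
    fun z hz => by
      ext v
      rw [pullbackDeriv, domainDeriv, hf.inv_apply hz, (h.hasDerivAt z hz).deriv]
      simp only [comp_apply, mul_apply']
      rw [inv_mul_cancel_left₀ (exp_ne_zero _)]
  refine ⟨?_, ?_, fun δ hδ => ?_, ?_, f, hf, rfl, h.memHHalf_boundaryPullback hf hi, ?_, _, _, _,
    h.isPhase_boundaryPullback hf hi, isNeumannSolution_neumannFun h.hasDerivAt_log
      h.differentiableOn_deriv_log h.integrableOn_sq (ae_of_all _ fun θ => rfl), ?_⟩
  · have hne : ∀ᵐ w ∂(volume.restrict Ω), w ≠ f 0 := ae_restrict_of_ae (by simp [ae_iff])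
    filter_upwards [ae_restrict_mem hf.isOpen.measurableSet, hne] with w hw hw0
    exact norm_canonicalMap (invFunOn_ne_zero hf ⟨hw, hw0⟩)
  · exact hasWeakDeriv_of_hasFDerivAt hΩ (fun w hw => h.hasFDerivAt_domainMap hf hw)
      ((h.continuousOn_domainDeriv hf).locallyIntegrableOn hΩ.measurableSet)
  · have hg : ∀ᵐ z ∂(volume.restrict (ball (0 : ℂ) 1)),
        ‖deriv f z‖ ^ 2 * gradSq (domainDeriv f p Q (f z)) = ‖z⁻¹ + Q z‖ ^ 2 := by
      filter_upwards [hball] with z hz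
      rw [domainDeriv, hf.inv_apply hz.1, gradSq_canonicalDeriv hz.2, (h.hasDerivAt z hz.1).deriv, norm_inv]
      have : ‖exp (p z)‖ ≠ 0 := norm_ne_zero_iff.2 (exp_ne_zero _)
      field_simp
    rw [integrableOn_gradSq_iff hf hg]
    have h0 : (0 : ℂ) ∈ ball (0 : ℂ) 1 := mem_ball_self one_pos
    -- By continuity of `f` at `0`, the region lies outside a disk about the origin, where `1/z` is
    -- bounded.
    obtain ⟨ρ, hρ, hρf⟩ := Metric.continuousAt_iff.1 (hf.hasDerivAt h0).continuousAt δ hδ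
    refine integrableOn_norm_inv_add_sq h.differentiableOn_deriv_log h.integrableOn_sq hρ
      (measurableSet_sublevel hf δ) (fun z hz => hz.1) fun z hz => not_lt.1 fun hlt => ?_
    have := hρf (x := z) (by simpa using hlt)
    rw [dist_eq_norm] at this
    exact (not_lt.2 hz.2) this
  · exact ae_of_all _ fun r hr hrΩ => h.integral_angularPart_circle hf hr hrΩ
  · exact hasCircleTrace_canonicalMap h.hasDerivAt_log h.differentiableOn_deriv_log h.integrableOn_sq
      (fun z hz => hcomp z hz.1) (fun z hz => hpull z hz.1) (h.ae_boundaryPullback hf hi)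
  · filter_upwards [hball] with z hz v
    rw [hcomp z hz.1, hpull z hz.1, angularPart_canonicalDeriv hz.2, neumannDeriv_apply]
    simp only [mul_re, mul_im, neg_re, neg_im, I_re, I_im]
    ring

end IsDirichletConformal

end

/-! ### Uniqueness of the energy density and conclusion -/

section
open Metric Set ContinuousLinearMap IsUniformization
open scoped ComplexConjugate

variable {f p Q : ℂ → ℂ} {Ω : Set ℂ}

theorem IsNeumannSolution.ae_eq {φ : ℝ → ℝ} {Φ Ψ : ℂ → ℝ} {DΦ DΨ : ℂ → ℂ →L[ℝ] ℝ}
    (hΦ : IsNeumannSolution φ Φ DΦ) (hΨ : IsNeumannSolution φ Ψ DΨ) :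
    ∀ᵐ z ∂(volume.restrict (ball (0 : ℂ) 1)), DΦ z = DΨ z := by
  have hint : ∀ {D : ℂ → ℂ →L[ℝ] ℝ}, IntegrableOn D (ball 0 1) → ∀ {ψ : ℂ → ℝ}, ContDiff ℝ ∞ ψ →
      IntegrableOn (fun z => D z 1 * fderiv ℝ ψ z 1 + D z I * fderiv ℝ ψ z I) (ball 0 1) :=
    fun {D} hD {ψ} hψ => by
      refine ((IntegrableOn.smul_of_continuous (IntegrableOn.clm_apply hD 1)
        (continuous_fderiv_apply_of_contDiff hψ 1)).add
        (IntegrableOn.smul_of_continuous (IntegrableOn.clm_apply hD I)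
        (continuous_fderiv_apply_of_contDiff hψ I))).congr (ae_of_all _ fun z => ?_)
      simp [mul_comm]
  have h0 := (hΦ.weakDeriv.sub hΨ.weakDeriv).ae_eq_zero_of_neumann
    (hΦ.integrableOn_deriv.sub hΨ.integrableOn_deriv) fun ψ hψ => by
      have e := integral_sub (hint hΦ.integrableOn_deriv hψ) (hint hΨ.integrableOn_deriv hψ)
      rw [hΦ.integral_eq ψ hψ, hΨ.integral_eq ψ hψ, sub_self] at e
      refine Eq.trans (integral_congr_ae (ae_of_all _ fun z => ?_)) e
      simp only [sub_apply]
      ring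
  filter_upwards [h0] with z hz using sub_eq_zero.1 hz

namespace IsDirichletConformal

/-- Two phases of the same map differ by `2π` times an integer-valued function, which is in
`H^{1/2}` and hence constant. -/
theorem exists_phase_eq (h : IsDirichletConformal f p Q) (hf : IsUniformization f Ω)
    (hi : InjOn (diskExtend f) (closedBall 0 1)) {φ : ℝ → ℝ}
    (hφ : IsPhase 1 (boundaryPullback f (unitTangent Ω)) φ) :
    ∃ c : ℝ, ∀ᵐ θ ∂(volume.restrict (Ioc 0 (2 * Real.pi))), φ θ = c + (radialLimit p θ).im := by
  have h0 := h.isPhase_boundaryPullback hf hi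
  obtain ⟨k, hk⟩ : ∃ k : ℝ → ℝ, k = fun θ => (φ θ - (Real.pi / 2 + (radialLimit p θ).im)) / (2 * Real.pi) :=
    ⟨_, rfl⟩
  have hsub := hφ.1.sub h0.1
  have hkH : MemHHalf k := by
    have hm : MemLp k 2 angularMeasure := by
      rw [hk]
      simp_rw [div_eq_mul_inv]
      exact hsub.1.mul_const _
    refine hsub.mono_add (C := 0) hm (ae_of_all _ fun q => ?_)
    rw [zero_mul, add_zero, hk, ← sub_div, norm_div]
    refine div_le_self (norm_nonneg _) ?_
    rw [Real.norm_of_nonneg Real.two_pi_pos.le]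
    linarith [Real.two_le_pi]
  obtain ⟨n, hn⟩ := hkH.ae_eq_const_of_int (by
    have h1 : ∀ᵐ θ ∂angularMeasure, _ := hφ.2
    have h2 : ∀ᵐ θ ∂angularMeasure, _ := h0.2
    filter_upwards [h1, h2] with θ h1 h2
    rw [h1] at h2
    obtain ⟨n, hn⟩ := Complex.exp_eq_exp_iff_exists_int.1 (mul_left_cancel₀ (zpow_ne_zero _ (circlePt_ne_zero θ)) h2)
    refine ⟨n, ?_⟩
    have h3 : φ θ = (Real.pi / 2 + (radialLimit p θ).im) + n * (2 * Real.pi) := by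
      have := congrArg Complex.im hn
      simpa using this
    rw [hk]
    simp only [h3]
    have := Real.pi_ne_zero
    field_simp
    ring)
  refine ⟨Real.pi / 2 + n * (2 * Real.pi), ?_⟩
  have hn' : ∀ᵐ θ ∂(volume.restrict (Ioc 0 (2 * Real.pi))), k θ = n := hn
  filter_upwards [hn'] with θ hθ
  rw [hk, div_eq_iff Real.two_pi_pos.ne'] at hθ
  linarith

/-- Uniqueness of the phase and of the Neumann gradient identifies `⟨du, iu⟩`, pulled back, with the
form `Im((1/z + Q) dz)`. Since `du` is tangential, this determines `|∇u|` almost everywhere, without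
identifying `u` itself. -/
theorem tendsto_energy (h : IsDirichletConformal f p Q) (hf : IsUniformization f Ω)
    (hi : InjOn (diskExtend f) (closedBall 0 1)) {u : ℂ → ℂ} {Du : ℂ → ℂ →L[ℝ] ℂ}
    (hn : ∀ᵐ z ∂(volume.restrict Ω), ‖u z‖ = 1) (hu : HasWeakDeriv (Ω \ {f 0}) u Du)
    {φ : ℝ → ℝ} {Φ : ℂ → ℝ} {DΦ : ℂ → ℂ →L[ℝ] ℝ}
    (hφ : IsPhase 1 (boundaryPullback f (unitTangent Ω)) φ) (hΦ : IsNeumannSolution φ Φ DΦ)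
    (hstar : ∀ᵐ z ∂(volume.restrict (ball 0 1)), ∀ v : ℂ,
      angularPart (u (f z)) (pullbackDeriv f Du z v) = DΦ z (-I * v)) :
    Tendsto (fun δ : ℝ => (∫ z in Ω \ ball (f 0) δ, gradSq (Du z)) - 2 * Real.pi * Real.log (1 / δ))
      (𝓝[>] 0) (𝓝 ((∫ z in ball (0 : ℂ) 1, ‖Q z‖ ^ 2) + 2 * Real.pi * Real.log ‖deriv f 0‖)) := by
  obtain ⟨c, hc⟩ := h.exists_phase_eq hf hi hφ
  have hD := hΦ.ae_eq (isNeumannSolution_neumannFun h.hasDerivAt_log h.differentiableOn_deriv_log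
    h.integrableOn_sq hc)
  have hΩ : IsOpen (Ω \ {f 0}) := hf.isOpen.sdiff isClosed_singleton
  have hset : (Ω \ {f 0} : Set ℂ) =ᵐ[volume] Ω := sdiff_null_ae_eq_self (measure_singleton _)
  have hn' : ∀ᵐ z ∂(volume.restrict (Ω \ {f 0})), ‖u z‖ = 1 := by rwa [Measure.restrict_congr_set hset]
  have h1 := hu.dot_eq_zero hΩ hn' 1
  have hI := hu.dot_eq_zero hΩ hn' I
  rw [Measure.restrict_congr_set hset] at h1 hI
  have hg : ∀ᵐ z ∂(volume.restrict (ball (0 : ℂ) 1)),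
      ‖deriv f z‖ ^ 2 * gradSq (Du (f z)) = ‖z⁻¹ + Q z‖ ^ 2 := by
    filter_upwards [hf.ae_comp hn, hf.ae_comp h1, hf.ae_comp hI, hD, hstar,
      ae_restrict_mem measurableSet_ball] with z hnz h1z hIz hDz hsz hz
    have hd := hf.deriv_ne_zero hz
    have key : ∀ w : ℂ, angularPart (u (f z)) (Du (f z) w) = ((z⁻¹ + Q z) * ((deriv f z)⁻¹ * w)).im := by
      intro w
      have := hsz ((deriv f z)⁻¹ * w)
      rw [pullbackDeriv, comp_apply, mul_apply', mul_inv_cancel_left₀ hd, hDz, neumannDeriv_apply] at this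
      rw [this]
      simp only [mul_re, mul_im, neg_re, neg_im, I_re, I_im]
      ring
    rw [gradSq_eq_angularPart hnz h1z hIz, key, key]
    have e : z⁻¹ + Q z = deriv f z * ((z⁻¹ + Q z) * (deriv f z)⁻¹) := by field_simp
    rw [e, norm_mul, mul_pow]
    rw [← e, Complex.sq_norm ((z⁻¹ + Q z) * (deriv f z)⁻¹), normSq_apply]
    congr 1
    rw [mul_one, ← mul_assoc, mul_I_im]
    ring
  simp_rw [integral_gradSq_eq hf hg]
  exact tendsto_sublevel_energy hf h.differentiableOn_deriv_log h.integrableOn_sq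

end IsDirichletConformal

/-- `Ω` lies in the homeomorphic image of a compact disk, so its area `∫|f'|²` is finite. -/
theorem IsQuasidisk.exists_isDirichletConformal (hq : IsQuasidisk Ω) (hf : IsUniformization f Ω)
    (hi : IntegrableOn (preSchwarzianSq f) (ball 0 1)) :
    ∃ p, IsDirichletConformal f p (fun z => deriv (deriv f) z / deriv f z) ∧
      InjOn (diskExtend f) (closedBall 0 1) := by
  obtain ⟨K, g, -, hg⟩ := hq
  obtain ⟨p, hp, hfp⟩ := hf.exists_log_deriv
  have hfin : volume Ω < ⊤ := by
    have hb : Ω ⊆ g '' closedBall 0 1 := hg ▸ image_mono ball_subset_closedBall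
    exact (measure_mono hb).trans_lt ((isCompact_closedBall 0 1).image g.continuous).measure_lt_top
  have h : IsDirichletConformal f p (fun z => deriv (deriv f) z / deriv f z) := by
    refine ⟨fun z hz => hfp z hz ▸ hf.hasDerivAt hz, hp, hf.injOn, hi, ?_⟩
    have h1 : IntegrableOn (fun _ : ℂ => (1 : ℝ)) (f '' ball 0 1) := by
      rw [hf.image_eq]; exact integrableOn_const hfin.ne
    rw [integrableOn_image_holomorphic isOpen_ball hf.differentiableOn hf.injOn measurableSet_ball le_rfl] at h1
    refine h1.congr_fun (fun z hz => ?_) measurableSet_ball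
    simp only [smul_eq_mul, mul_one, hfp z hz]
  exact ⟨p, h, h.injOn_diskExtend hf g hg⟩

end

/-- Let `Ω` be a domain enclosed by a Weil–Petersson curve. There is a constant `W₀`, depending only
on `Ω`, such that every uniformization `f : 𝔻 → Ω` satisfies
`W₀ = ∫_𝔻 |f''/f'|² + 4π ln |f'(0)|` (a convergent integral), and the renormalized energy of the
canonical harmonic map with tangential boundary data and singularity `a = f(0)` is
`W(a) = W₀ - 2π ln |f'(0)|`. -/
theorem mainTheorem6 (Ω : Set ℂ) (hΩ : IsWeilPeterssonDomain Ω) :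
    ∃ W₀ : ℝ, ∀ (a : ℂ) (f : ℂ → ℂ), IsUniformization f Ω → f 0 = a →
      IntegrableOn (preSchwarzianSq f) (Metric.ball 0 1) ∧
      W₀ = (∫ z in Metric.ball 0 1, preSchwarzianSq f z) + 4 * Real.pi * Real.log ‖deriv f 0‖ ∧
      IsRenormalizedEnergy Ω (unitTangent Ω) a (W₀ - 2 * Real.pi * Real.log ‖deriv f 0‖) := by
  obtain ⟨hq, f₀, hf₀, hi₀⟩ := hΩ
  refine ⟨(∫ z in Metric.ball 0 1, preSchwarzianSq f₀ z) + 4 * Real.pi * Real.log ‖deriv f₀ 0‖,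
    fun a f hf ha => ?_⟩
  subst ha
  obtain ⟨hi, hW, -⟩ := hf₀.weilPetersson_invariant hf hi₀
  refine ⟨hi, hW.symm, ?_, fun u Du hu => ?_⟩
  · obtain ⟨p, h, hinj⟩ := hq.exists_isDirichletConformal hf hi
    exact ⟨_, _, h.isCanonicalHarmonicMap hf hinj⟩
  -- The uniformization `f₁` attached to a canonical map need not be `f`. Both send `0` to `a`, so
  -- `|f₁'(0)| = |f'(0)|`, and the invariance of the constant equates the two values of the limit.
  · obtain ⟨f₁, hf₁, h₁, -, -, φ, Φ, DΦ, hφ, hΦ, hstar⟩ := hu.exists_uniformization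
    obtain ⟨hi₁, hW₁, hd⟩ := hf.weilPetersson_invariant hf₁ hi
    obtain ⟨p, h, hinj⟩ := hq.exists_isDirichletConformal hf₁ hi₁
    have hwd := hu.weakDeriv
    rw [← h₁] at hwd
    have := h.tendsto_energy hf₁ hinj hu.norm_eq hwd hφ hΦ hstar
    rw [h₁] at this
    convert this using 2
    have e : (∫ z in Metric.ball 0 1, preSchwarzianSq f₁ z) =
      ∫ z in Metric.ball 0 1, ‖deriv (deriv f₁) z / deriv f₁ z‖ ^ 2 := rfl
    rw [← e, hd h₁.symm]
    rw [hd h₁.symm] at hW₁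
    linarith
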